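/- **Crease perestroikas.** Let $(M,g)$ be a smooth time-oriented four-dimensional Lorentzian manifold (signature $-+++$) with a smooth time function $\tau$ ($d\tau>0$ on future-directed causal vectors), and write $\Sigma_s=\{\tau=s\}$. Let $\mathcal N_1=\{f_1=0\}$, $\mathcal N_2=\{f_2=0\}$ be smooth null hypersurfaces near $p$, with $\nabla f_A$ future-directed and null on $\mathcal N_A$, which intersect transversally at $p$; the crease submanifold is $\mathcal N_1\cap\mathcal N_2$. Suppose that $p$ is a pinch point with $\tau(p)=0$: $\Sigma_0$ is tangent to $\mathcal N_1\cap\mathcal N_2$ at $p$. In a neighbourhood of $p$ let $\mathcal H$ (the horizon) be the set of the points of $\mathcal N_1\cup\mathcal N_2$ that lie on the crease or to its future along a null generator of $\mathcal N_1$ or $\mathcal N_2$, and let the black hole region be the chronological future of $\mathcal H$ in that neighbourhood. Take Riemannian normal coordinates $X=(t,x^i)$ centred at $p$ such that $t=0$ is the tangent plane of $\Sigma_0$ at $p$ and $\partial_t$ is future-directed. Then, after a rotation of $x^i=(x,y,z)$, and with $x^A=(x,y)$: 1. *Normal forms.* There are $a>0$, a diagonal matrix $b_{AB}$ and a symmetric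 matrix $\hat b_{AB}$ such that near $p$, with $K_{ij}$ the extrinsic curvature of $\Sigma_0$ at $p$, all remainders being smooth, $$\mathcal N_1:\ t=z+b_{AB}x^Ax^B+O(|x^i|^3),\qquad \mathcal N_2:\ t=-z+\hat b_{AB}x^Ax^B+O(|x^i|^3),$$ $$\Sigma_\tau:\ t=a\tau+c\tau^2+d_i\tau x^i+\tfrac12K_{ij}x^ix^j+O(|(\tau,x^i)|^3)\quad(c,d_i\ \text{constants}).$$ On $\Sigma_\tau$ the sheets are $a\tau=z+(b_{AB}-\tfrac12K_{AB})x^Ax^B+\dots$ and $a\tau=-z+(\hat b_{AB}-\tfrac12K_{AB})x^Ax^B+\dots$, the dots being $O(|x^A|^3+|\tau||x^A|+\tau^2)$. The crease submanifold is $2t=(b_{AB}+\hat b_{AB})x^Ax^B+O(|x^A|^3)$, $2z=(\hat b_{AB}-b_{AB})x^Ax^B+O(|x^A|^3)$, and on $\Sigma_\tau$ the first equation becomes $2a\tau=Q_{AB}x^Ax^B+O(|x^A|^3)$ with $Q_{AB}=b_{AB}+\hat b_{AB}-K_{AB}$. 2. *Shape of the crease.* Suppose from now on the generic condition $\det Q\neq0$.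 After a smooth change of the coordinates $x^A$ that is tangent to the identity at the origin, the crease on $\Sigma_\tau$ is exactly the conic $Q_{AB}\xi^A\xi^B=2a\tau$: an ellipse (or empty, or a point) if $Q$ is definite, a hyperbola with two branches (a pair of lines for $\tau=0$) if $Q$ is indefinite. 3. *Classification.* In a suitable (arbitrarily small) neighbourhood of $p$ and for small $|\tau|$, $\mathcal H\cap\Sigma_\tau$ consists of the points of the two sheets over the region of the $x^A$-plane where the value of the time function at the crease point over $x^A$ is at most $\tau$, the black hole region lies between the two sheets, and exactly one of the following occurs. * $Q$ negative definite: *collapse of a hole*. For $\tau<0$ the black hole region in $\Sigma_\tau$, with its boundary $\mathcal H\cap\Sigma_\tau$, is homeomorphic to a circle times a wedge, whose edge is the crease, a closed curve around a hole; at $\tau=0$ the horizon consists of two discs that touch at $p$; for $\tau>0$ it consists of two disjoint discs with the black hole region between them and there is no crease. * $Q$ positive definite: *nucleation of a flying saucer*. The horizon is locally empty for $\tau<0$ and equals $\{p\}$ for $\tau=0$; for $\tau>0$ it is a sphere bounding a ball of black hole region, with the crease as its equator. Its width is $O(\sqrt\tau)$, its height is of exact order $\tau$, and its area is of exact order $\tau$.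 * $Q$ indefinite: *merger by a bridge*. For $\tau<0$ there are two disjoint pieces (each a line times a wedge, with a crease as its edge); at $\tau=0$ the two pieces touch at $p$; for $\tau>0$ the region is a solid tube, whose boundary is a connected piece of horizon with two creases running along it. 4. *Scaling.* In the two definite cases, whenever the crease on $\Sigma_\tau$ ($\tau\ne0$) is non-empty it is a smooth closed curve; its length, $|x^A|$ on it, and the angle $\Omega$ at which the two smooth sections of the horizon meet along it are bounded above and below by positive constants times $\sqrt{|\tau|}$, and $|z|=O(|\tau|)$ on it. In the indefinite case, for $\tau\neq0$, the separation of the two branches of the crease where they are closest, and the angle $\Omega$ at these points, are bounded above and below by positive constants times $\sqrt{|\tau|}$, and $|z|=O(|\tau|)$ there. Here $\cos(\pi-\Omega)=h(n,n')$, where $h$ is the induced metric of $\Sigma_\tau$ and $n,n'$ are the unit normals of $\Sigma_\tau\cap\mathcal N_1$, $\Sigma_\tau\cap\mathcal N_2$ in $\Sigma_\tau$, on the sides to which these wavefronts move. -/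

import Mathlib

open Set Filter Topology Asymptotics MeasureTheory
open scoped Manifold ContDiff

noncomputable section

namespace Crease

/-- Coordinate space of a four-dimensional spacetime; the coordinates are `(t, x, y, z)`. -/
abbrev E4 : Type := EuclideanSpace ℝ (Fin 4)

/-- The space of spatial coordinates `(x, y, z)`. -/
abbrev Space : Type := EuclideanSpace ℝ (Fin 3)

/-- The plane of transverse coordinates `x^A = (x, y)`. -/
abbrev Plane : Type := EuclideanSpace ℝ (Fin 2)

/-- The `μ`-th coordinate vector. -/
def e4 (μ : Fin 4) : E4 := EuclideanSpace.single μ 1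

def spatial (X : E4) : Space := !₂[X 1, X 2, X 3]

def transverse (X : E4) : Plane := !₂[X 1, X 2]

/-- The quadratic form `B_{ij} x^i x^j`. -/
def quad {n : ℕ} (B : Matrix (Fin n) (Fin n) ℝ) (x : EuclideanSpace ℝ (Fin n)) : ℝ :=
  ∑ i, ∑ j, B i j * x i * x j

/-- The Minkowski form `η`, of signature `(-,+,+,+)`. -/
def minkowski (v w : E4) : ℝ := -(v 0 * w 0) + v 1 * w 1 + v 2 * w 2 + v 3 * w 3

/-- `F` is smooth on a neighbourhood of the origin. -/
def SmoothNearZero {E : Type*} [NormedAddCommGroup E] [NormedSpace ℝ E] (F : E → ℝ) : Prop :=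
  ∃ O : Set E, IsOpen O ∧ (0 : E) ∈ O ∧ ContDiffOn ℝ ∞ F O

section Manifold

variable {M : Type*} [TopologicalSpace M] [ChartedSpace E4 M] [IsManifold (𝓡 4) ∞ M]

/-- A smooth Lorentzian metric together with a time orientation, given by a continuous timelike
vector field. -/
structure Spacetime (M : Type*) [TopologicalSpace M] [ChartedSpace E4 M]
    [IsManifold (𝓡 4) ∞ M] where
  metric (x : M) : TangentSpace (𝓡 4) x →L[ℝ] TangentSpace (𝓡 4) x →L[ℝ] ℝ
  symm (x : M) (v w : TangentSpace (𝓡 4) x) : metric x v w = metric x w v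
  signature (x : M) : ∃ e : Module.Basis (Fin 4) ℝ (TangentSpace (𝓡 4) x),
    ∀ i j, metric x (e i) (e j) = minkowski (e4 i) (e4 j)
  contMDiff : ContMDiff (𝓡 4) ((𝓡 4).prod 𝓘(ℝ, E4 →L[ℝ] E4 →L[ℝ] ℝ)) ∞
    (fun x ↦ Bundle.TotalSpace.mk' (E4 →L[ℝ] E4 →L[ℝ] ℝ)
      (E := fun x : M ↦ (TangentSpace (𝓡 4) x →L[ℝ] TangentSpace (𝓡 4) x →L[ℝ] ℝ)) x (metric x))
  timeDir (x : M) : TangentSpace (𝓡 4) x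
  timeDir_timelike (x : M) : metric x (timeDir x) (timeDir x) < 0
  timeDir_continuous : Continuous (fun x ↦ (⟨x, timeDir x⟩ : TangentBundle (𝓡 4) M))

variable (𝓢 : Spacetime M)

def Spacetime.FutureTimelike (x : M) (v : TangentSpace (𝓡 4) x) : Prop :=
  𝓢.metric x v v < 0 ∧ 𝓢.metric x (𝓢.timeDir x) v < 0

def Spacetime.FutureNull (x : M) (v : TangentSpace (𝓡 4) x) : Prop :=
  𝓢.metric x v v = 0 ∧ 𝓢.metric x (𝓢.timeDir x) v < 0

/-- The differential of a real function. -/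
def diff (f : M → ℝ) (x : M) : TangentSpace (𝓡 4) x →L[ℝ] ℝ := mfderiv (𝓡 4) 𝓘(ℝ, ℝ) f x

/-- A smooth time function: its differential is positive on future-directed causal vectors
(so that its level sets are spacelike hypersurfaces). -/
structure IsTimeFunction (τ : M → ℝ) : Prop where
  smooth : ContMDiff (𝓡 4) 𝓘(ℝ, ℝ) ∞ τ
  pos_of_timelike : ∀ x v, 𝓢.FutureTimelike x v → 0 < diff τ x v
  pos_of_null : ∀ x v, 𝓢.FutureNull x v → 0 < diff τ x v

/-- `f = 0` is a smooth null hypersurface in `U`: at each of its points the gradient of `f` is a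
(nonzero) future-directed null vector. -/
structure IsNullSheet (U : Set M) (f : M → ℝ) : Prop where
  smooth : ContMDiffOn (𝓡 4) 𝓘(ℝ, ℝ) ∞ f U
  null : ∀ q ∈ U, f q = 0 → ∃ l : TangentSpace (𝓡 4) q, 𝓢.FutureNull q l ∧
    ∀ v, 𝓢.metric q l v = diff f q v

/-- `p` is a pinch point at time `τ = 0`: the null hypersurfaces `f 0 = 0` and `f 1 = 0`
intersect transversally at `p`, and the level set `τ = 0` is tangent at `p` to their
intersection, the crease submanifold. -/
structure IsPinchPoint (τ : M → ℝ) (U : Set M) (f : Fin 2 → M → ℝ) (p : M) : Prop where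
  time : IsTimeFunction 𝓢 τ
  time_zero : τ p = 0
  isOpen : IsOpen U
  mem : p ∈ U
  sheet : ∀ A, IsNullSheet 𝓢 U (f A)
  mem_sheet : ∀ A, f A p = 0
  transverse : LinearIndependent ℝ ![diff (f 0) p, diff (f 1) p]
  tangent : ∀ v, diff (f 0) p v = 0 → diff (f 1) p v = 0 → diff τ p v = 0

/-- There is a nonconstant differentiable curve in `S` from `r` to `q`, all of whose velocities
satisfy `P`. -/
def JoinedBy (P : (x : M) → TangentSpace (𝓡 4) x → Prop) (S : Set M) (r q : M) : Prop :=
  ∃ (c : ℝ → M) (l : ℝ), 0 < l ∧ c 0 = r ∧ c l = q ∧ ∀ s ∈ Icc 0 l, c s ∈ S ∧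
    ∃ v : TangentSpace (𝓡 4) (c s), P (c s) v ∧
      HasMFDerivWithinAt 𝓘(ℝ, ℝ) (𝓡 4) c (Icc 0 l) s ((1 : ℝ →L[ℝ] ℝ).smulRight v)

/-- The part of the crease submanifold in `V`. -/
def crease (f : Fin 2 → M → ℝ) (V : Set M) : Set M := {q ∈ V | f 0 q = 0 ∧ f 1 q = 0}

/-- The horizon in `V`: the points that lie on the crease or to its future along a generator of
one of the two null hypersurfaces. (A curve with future-directed null velocity inside a null
hypersurface is a segment of a null geodesic generator, up to its parametrization.) -/
def horizon (f : Fin 2 → M → ℝ) (V : Set M) : Set M :=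
  {q | q ∈ crease f V ∨
    ∃ A, ∃ r ∈ crease f V, JoinedBy 𝓢.FutureNull {x ∈ V | f A x = 0} r q}

/-- The black hole region in `V`: the chronological future of the horizon in `V`. -/
def blackHole (f : Fin 2 → M → ℝ) (V : Set M) : Set M :=
  {q | ∃ r ∈ horizon 𝓢 f V, JoinedBy 𝓢.FutureTimelike V r q}

/-! ### Normal coordinates -/

/-- The components `g_{μν}` of the metric in a chart, as a bilinear form in `v`, `w`. -/
def coordMetric (φ : OpenPartialHomeomorph M E4) (X v w : E4) : ℝ :=
  𝓢.metric (φ.symm X) (mfderiv (𝓡 4) (𝓡 4) φ.symm X v) (mfderiv (𝓡 4) (𝓡 4) φ.symm X w)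

/-- Christoffel symbols of the first kind:
`(∂_u g(v,w) + ∂_v g(u,w) - ∂_w g(u,v)) / 2` for constant `u`, `v`, `w`. -/
def christoffel (G : E4 → E4 → E4 → ℝ) (X u v w : E4) : ℝ :=
  (fderiv ℝ (fun Y ↦ G Y v w) X u + fderiv ℝ (fun Y ↦ G Y u w) X v
    - fderiv ℝ (fun Y ↦ G Y u v) X w) / 2

/-- The geodesic equation at parameter `s`, with its free index lowered. -/
def GeodesicEquation (G : E4 → E4 → E4 → ℝ) (c : ℝ → E4) (s : ℝ) : Prop :=
  ∀ w, G (c s) (deriv (deriv c) s) w + christoffel G (c s) (deriv c s) (deriv c s) w = 0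

/-- A Riemannian normal coordinate system centred at `p`: the metric at `p` is the Minkowski
metric and the straight lines through the origin are geodesics. -/
structure IsNormalChart (p : M) (φ : OpenPartialHomeomorph M E4) : Prop where
  mem_atlas : φ ∈ IsManifold.maximalAtlas (𝓡 4) ∞ M
  mem_source : p ∈ φ.source
  map_zero : φ p = 0
  starConvex : StarConvex ℝ 0 φ.target
  metric_zero : ∀ v w, coordMetric 𝓢 φ 0 v w = minkowski v w
  geodesic : ∀ (v : E4) (s : ℝ), s • v ∈ φ.target →
    GeodesicEquation (coordMetric 𝓢 φ) (fun r ↦ r • v) s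

/-- Normal coordinates for which `t = 0` is the tangent plane at `p` of the level set of `τ`
through `p` and `∂/∂t` is future-directed at `p`. -/
structure IsAdaptedNormalChart (τ : M → ℝ) (p : M) (φ : OpenPartialHomeomorph M E4) : Prop
    extends IsNormalChart 𝓢 p φ where
  tangent : ∀ v : E4, v 0 = 0 → fderiv ℝ (τ ∘ φ.symm) 0 v = 0
  future : 0 < fderiv ℝ (τ ∘ φ.symm) 0 (e4 0)

/-- `ψ` arises from `φ` by a rotation of the spatial coordinates. -/
def IsSpatialRotation (φ ψ : OpenPartialHomeomorph M E4) : Prop :=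
  ψ.source = φ.source ∧ ∃ R ∈ Matrix.specialOrthogonalGroup (Fin 3) ℝ, ∀ q ∈ φ.source,
    ψ q 0 = φ q 0 ∧ ∀ i : Fin 3, ψ q i.succ = ∑ j : Fin 3, R i j * φ q j.succ

/-- `K_{ij} = g(∇_i n, ∂_j)` at the origin, where `n` is the future-directed unit normal field of
the level sets of `h`: the extrinsic curvature at the origin, when the spatial coordinate vectors
`∂_i` are tangent there to the level set of `h`. -/
def IsExtrinsicCurvature (G : E4 → E4 → E4 → ℝ) (h : E4 → ℝ)
    (K : Matrix (Fin 3) (Fin 3) ℝ) : Prop :=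
  ∃ n : E4 → E4, DifferentiableAt ℝ n 0 ∧
    (∀ᶠ X in 𝓝 (0 : E4), G X (n X) (n X) = -1 ∧ 0 < fderiv ℝ h X (n X) ∧
      ∀ w, fderiv ℝ h X w = 0 → G X (n X) w = 0) ∧
    ∀ i j : Fin 3, K i j = G 0 (fderiv ℝ n 0 (e4 i.succ)) (e4 j.succ)
      + christoffel G 0 (e4 i.succ) (n 0) (e4 j.succ)

/-! ### The local description of sheets, slices and crease -/

/-- The constants and functions in the local description near a pinch point. -/
structure LocalData where
  /-- lapse at the pinch point -/
  a : ℝ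
  /-- quadratic coefficients of the sheet moving in the positive `z` direction -/
  b : Matrix (Fin 2) (Fin 2) ℝ
  /-- quadratic coefficients of the sheet moving in the negative `z` direction -/
  b' : Matrix (Fin 2) (Fin 2) ℝ
  /-- extrinsic curvature of the slice at the pinch point -/
  K : Matrix (Fin 3) (Fin 3) ℝ
  c : ℝ
  d : Fin 3 → ℝ
  /-- the sheets are `t = F A (x, y, z)` -/
  F : Fin 2 → Space → ℝ
  /-- the slice at time `s` is `t = T (s, (x, y, z))` -/
  T : ℝ × Space → ℝ
  /-- within the slice at time `s` the sheets are `z = Z A (s, (x, y))` -/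
  Z : Fin 2 → ℝ × Plane → ℝ
  /-- the crease is `t = θ (x, y)`, `z = ζ (x, y)` -/
  θ : Plane → ℝ
  ζ : Plane → ℝ
  /-- the value of the time function at the crease point above `(x, y)` -/
  S : Plane → ℝ

namespace LocalData

/-- The transverse components `K_{AB}`. -/
def KT (D : LocalData) : Matrix (Fin 2) (Fin 2) ℝ := D.K.submatrix Fin.castSucc Fin.castSucc

/-- `Q_{AB} = b_{AB} + b'_{AB} - K_{AB}`. -/
def Q (D : LocalData) : Matrix (Fin 2) (Fin 2) ℝ := D.b + D.b' - D.KT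

/-- The normal forms of the sheets, slices and crease at the pinch point `p`, in the
coordinates `ψ`. -/
structure Describes (D : LocalData) (τ : M → ℝ) (f : Fin 2 → M → ℝ) (p : M)
    (ψ : OpenPartialHomeomorph M E4) : Prop where
  a_pos : 0 < D.a
  b_diag : D.b.IsDiag
  b'_symm : D.b'.IsSymm
  K_symm : D.K.IsSymm
  K_extrinsic : IsExtrinsicCurvature (coordMetric 𝓢 ψ) (τ ∘ ψ.symm) D.K
  /- the null sheets in spacetime -/
  F_smooth : ∀ A, SmoothNearZero (D.F A)
  sheet_iff : ∀ A, ∀ᶠ q in 𝓝 p, f A q = 0 ↔ ψ q 0 = D.F A (spatial (ψ q))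
  F_zero : (fun y : Space ↦ D.F 0 y - (y 2 + quad D.b !₂[y 0, y 1]))
    =O[𝓝 0] fun y ↦ ‖y‖ ^ 3
  F_one : (fun y : Space ↦ D.F 1 y - (-y 2 + quad D.b' !₂[y 0, y 1]))
    =O[𝓝 0] fun y ↦ ‖y‖ ^ 3
  /- the slices -/
  T_smooth : SmoothNearZero D.T
  slice_iff : ∀ᶠ u in 𝓝 ((0 : ℝ), p), τ u.2 = u.1 ↔ ψ u.2 0 = D.T (u.1, spatial (ψ u.2))
  T_expansion : (fun u : ℝ × Space ↦ D.T u - (D.a * u.1 + D.c * u.1 ^ 2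
      + u.1 * ∑ i, D.d i * u.2 i + quad D.K u.2 / 2)) =O[𝓝 0] fun u ↦ ‖u‖ ^ 3
  /- the sheets within the slices -/
  Z_smooth : ∀ A, SmoothNearZero (D.Z A)
  sheet_slice_iff : ∀ A, ∀ᶠ q in 𝓝 p, f A q = 0 ↔ ψ q 3 = D.Z A (τ q, transverse (ψ q))
  Z_zero : (fun u : ℝ × Plane ↦ D.a * u.1
      - (D.Z 0 u + quad (D.b - (1 / 2 : ℝ) • D.KT) u.2))
    =O[𝓝 0] fun u ↦ ‖u.2‖ ^ 3 + |u.1| * ‖u.2‖ + u.1 ^ 2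
  Z_one : (fun u : ℝ × Plane ↦ D.a * u.1
      - (-D.Z 1 u + quad (D.b' - (1 / 2 : ℝ) • D.KT) u.2))
    =O[𝓝 0] fun u ↦ ‖u.2‖ ^ 3 + |u.1| * ‖u.2‖ + u.1 ^ 2
  /- the crease, in spacetime and on the slices -/
  θ_smooth : SmoothNearZero D.θ
  ζ_smooth : SmoothNearZero D.ζ
  S_smooth : SmoothNearZero D.S
  crease_iff : ∀ᶠ q in 𝓝 p, (f 0 q = 0 ∧ f 1 q = 0) ↔
    (ψ q 0 = D.θ (transverse (ψ q)) ∧ ψ q 3 = D.ζ (transverse (ψ q)))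
  crease_slice_iff : ∀ᶠ q in 𝓝 p, (f 0 q = 0 ∧ f 1 q = 0) ↔
    (τ q = D.S (transverse (ψ q)) ∧ ψ q 3 = D.ζ (transverse (ψ q)))
  θ_expansion : (fun x : Plane ↦ 2 * D.θ x - quad (D.b + D.b') x) =O[𝓝 0] fun x ↦ ‖x‖ ^ 3
  ζ_expansion : (fun x : Plane ↦ 2 * D.ζ x - quad (D.b' - D.b) x) =O[𝓝 0] fun x ↦ ‖x‖ ^ 3
  S_expansion : (fun x : Plane ↦ 2 * D.a * D.S x - quad D.Q x) =O[𝓝 0] fun x ↦ ‖x‖ ^ 3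

/-- After a smooth change `χ` of the transverse coordinates that is tangent to the identity at the
origin, the crease on the slice at time `s` is exactly the conic `Q_{AB} ξ^A ξ^B = 2 a s`. -/
def CreaseIsConic (D : LocalData) : Prop :=
  ∃ χ : OpenPartialHomeomorph Plane Plane, 0 ∈ χ.source ∧ χ 0 = 0 ∧
    ContDiffOn ℝ ∞ χ χ.source ∧ ContDiffOn ℝ ∞ χ.symm χ.target ∧
    HasFDerivAt χ (ContinuousLinearMap.id ℝ Plane) 0 ∧
    ∀ x ∈ χ.source, 2 * D.a * D.S x = quad D.Q (χ x)

end LocalData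

/-! ### Angle, length and area -/

/-- `Ω` is the angle at which the two smooth sections of the horizon cross-section meet at the
crease point `q`: with `n A` the unit normal of the section `f A = 0` within the level set of `τ`
through `q` (on the side to which that section moves), `cos (π - Ω) = h(n 0, n 1)`. -/
def IsCreaseAngle (τ : M → ℝ) (f : Fin 2 → M → ℝ) (q : M) (Ω : ℝ) : Prop :=
  ∃ n : Fin 2 → TangentSpace (𝓡 4) q,
    (∀ A, diff τ q (n A) = 0 ∧ 𝓢.metric q (n A) (n A) = 1 ∧ 0 < diff (f A) q (n A) ∧
      ∀ w, diff τ q w = 0 → diff (f A) q w = 0 → 𝓢.metric q (n A) w = 0) ∧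
    Ω ∈ Icc 0 Real.pi ∧ Real.cos (Real.pi - Ω) = 𝓢.metric q (n 0) (n 1)

/-- The velocity of a curve. -/
def velocity (γ : ℝ → M) (s : ℝ) : TangentSpace (𝓡 4) (γ s) :=
  mfderiv 𝓘(ℝ, ℝ) (𝓡 4) γ s (1 : ℝ)

/-- `C` is a smoothly parametrized simple closed curve of length `L`. -/
def IsClosedCurveOfLength (C : Set M) (L : ℝ) : Prop :=
  ∃ γ : ℝ → M, ContMDiff 𝓘(ℝ, ℝ) (𝓡 4) ∞ γ ∧ Function.Periodic γ (2 * Real.pi) ∧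
    InjOn γ (Ico 0 (2 * Real.pi)) ∧ range γ = C ∧
    L = ∫ s in (0 : ℝ)..(2 * Real.pi),
      Real.sqrt (𝓢.metric (γ s) (velocity γ s) (velocity γ s))

/-- `∂σ/∂x^i` for a parametrized surface `σ`. -/
def partialVelocity (σ : Plane → M) (x : Plane) (i : Fin 2) : TangentSpace (𝓡 4) (σ x) :=
  mfderiv (𝓡 2) (𝓡 4) σ x (EuclideanSpace.single i (1 : ℝ) : Plane)

/-- `A` is a compact smoothly parametrized surface of area `α`. -/
def IsSurfaceOfArea (A : Set M) (α : ℝ) : Prop :=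
  ∃ (σ : Plane → M) (O R : Set Plane), IsOpen O ∧ IsCompact R ∧ R ⊆ O ∧
    ContMDiffOn (𝓡 2) (𝓡 4) ∞ σ O ∧ InjOn σ O ∧ σ '' R = A ∧
    α = ∫ x in R, Real.sqrt (Matrix.det (Matrix.of fun i j : Fin 2 ↦
      𝓢.metric (σ x) (partialVelocity σ x i) (partialVelocity σ x j)))

end Manifold

/-! ### Perestroikas

Below, `B s`, `H s` and `C s` are the parts of the black hole region, of the horizon and of the
crease in the slice at time `s`, inside a fixed neighbourhood of the pinch point `p`. -/

/-- A homeomorphism of `K` onto `K'` that takes `H` to `H'` and `C` to `C'`. -/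
def TripleHomeo {X Y : Type*} [TopologicalSpace X] [TopologicalSpace Y]
    (K H C : Set X) (K' H' C' : Set Y) : Prop :=
  C ⊆ H ∧ H ⊆ K ∧ ∃ e : K ≃ₜ K',
    (∀ q : K, (q : X) ∈ H ↔ (e q : Y) ∈ H') ∧ (∀ q : K, (q : X) ∈ C ↔ (e q : Y) ∈ C')

section Types

variable {M : Type*} [TopologicalSpace M]

/-- Nucleation of a flying saucer: nothing before, a point at the pinch, and afterwards a black
hole region that is a ball, bounded by a horizon of spherical topology with the crease running
around its equator. -/
structure SaucerNucleation (τ₀ : ℝ) (B H C : ℝ → Set M) (p : M) : Prop where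
  before : ∀ s ∈ Ioo (-τ₀) 0, B s = ∅ ∧ H s = ∅ ∧ C s = ∅
  pinch : B 0 = ∅ ∧ H 0 = {p} ∧ C 0 = {p}
  after : ∀ s ∈ Ioo 0 τ₀, TripleHomeo (H s ∪ B s) (H s) (C s)
    (Metric.closedBall (0 : Space) 1) (Metric.sphere (0 : Space) 1)
    {y : Space | ‖y‖ = 1 ∧ y 2 = 0}

/-- Collapse of a hole: before, the black hole region surrounds a hole, with a circular crease
around its rim (`S¹` times the wedge `|w| ≤ u`, with the horizon at `|w| = u` and the crease at
`u = 0`); at the pinch the horizon consists of two discs that touch at one point; afterwards it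
consists of two disjoint discs with the black hole region between them, without a crease. -/
structure HoleCollapse (τ₀ : ℝ) (B H C : ℝ → Set M) (p : M) : Prop where
  before : ∀ s ∈ Ioo (-τ₀) 0, TripleHomeo (H s ∪ B s) (H s) (C s)
    {y : Circle × ℝ × ℝ | |y.2.2| ≤ y.2.1} {y : Circle × ℝ × ℝ | |y.2.2| = y.2.1}
    {y : Circle × ℝ × ℝ | y.2 = 0}
  pinch : C 0 = {p} ∧ TripleHomeo (H 0 ∪ B 0) (H 0) (C 0)
    {y : Plane × ℝ | |y.2| ≤ ‖y.1‖} {y : Plane × ℝ | |y.2| = ‖y.1‖} {0}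
  after : ∀ s ∈ Ioo 0 τ₀, TripleHomeo (H s ∪ B s) (H s) (C s)
    {y : Plane × ℝ | |y.2| ≤ 1} {y : Plane × ℝ | |y.2| = 1} ∅

/-- The black hole region, with its horizon, consists of two closed pieces with intersection `J`,
each of which is homeomorphic to a line times the wedge `|w| ≤ u`, the crease being its edge. -/
def TwoWedges (B H C J : Set M) : Prop :=
  ∃ P : Fin 2 → Set M, P 0 ∪ P 1 = H ∪ B ∧ P 0 ∩ P 1 = J ∧
    (∀ i, IsClosed ((↑) ⁻¹' P i : Set ↥(H ∪ B))) ∧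
    ∀ i, TripleHomeo (P i) (P i ∩ H) (P i ∩ C)
      {y : ℝ × ℝ × ℝ | |y.2.2| ≤ y.2.1} {y : ℝ × ℝ × ℝ | |y.2.2| = y.2.1}
      {y : ℝ × ℝ × ℝ | y.2 = 0}

/-- Merger by formation of a bridge: before, there are two disjoint pieces, each with a crease
along its edge; at the pinch they touch at one point; afterwards the region is a solid tube,
bounded by a connected horizon with two creases, running along the two edges of the bridge. -/
structure BridgeMerger (τ₀ : ℝ) (B H C : ℝ → Set M) (p : M) : Prop where
  before : ∀ s ∈ Ioo (-τ₀) 0, TwoWedges (B s) (H s) (C s) ∅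
  pinch : TwoWedges (B 0) (H 0) (C 0) {p} ∧ p ∈ C 0
  after : ∀ s ∈ Ioo 0 τ₀, TripleHomeo (H s ∪ B s) (H s) (C s)
    {y : Plane × ℝ | ‖y.1‖ ≤ 1} {y : Plane × ℝ | ‖y.1‖ = 1}
    {y : Plane × ℝ | ‖y.1‖ = 1 ∧ y.1 1 = 0}

end Types

section Scaling

variable {M : Type*} [TopologicalSpace M] [ChartedSpace E4 M] [IsManifold (𝓡 4) ∞ M]
  (𝓢 : Spacetime M)

/-- `r` is of order `ρ`, with constants `c` and `C`. -/
def OfOrder (c C ρ r : ℝ) : Prop := c * ρ ≤ r ∧ r ≤ C * ρ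

/-- An elliptical crease at time `s`: it is a closed curve whose length, transverse size and
angle are of order `√|s|`, and `z` is `O(|s|)` on it. -/
structure EllipticScaling (τ : M → ℝ) (f : Fin 2 → M → ℝ) (ψ : OpenPartialHomeomorph M E4)
    (k₁ k₂ s : ℝ) (C : Set M) : Prop where
  length : ∃ L, IsClosedCurveOfLength 𝓢 C L ∧ OfOrder k₁ k₂ (Real.sqrt |s|) L
  width : ∀ q ∈ C, OfOrder k₁ k₂ (Real.sqrt |s|) ‖transverse (ψ q)‖
  height : ∀ q ∈ C, |ψ q 3| ≤ k₂ * |s|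
  angle : ∀ q ∈ C, ∃ Ω, IsCreaseAngle 𝓢 τ f q Ω ∧ OfOrder k₁ k₂ (Real.sqrt |s|) Ω

/-- The flying saucer at time `s > 0`: width `√s`, height `s` and area `s`, up to constants. -/
structure SaucerScaling (f : Fin 2 → M → ℝ) (ψ : OpenPartialHomeomorph M E4)
    (k₁ k₂ s : ℝ) (H : Set M) : Prop where
  width : ∀ q ∈ H, ‖transverse (ψ q)‖ ≤ k₂ * Real.sqrt s
  height_le : ∀ q ∈ H, |ψ q 3| ≤ k₂ * s
  le_height : ∃ q ∈ H, ∃ q' ∈ H, k₁ * s ≤ ψ q 3 - ψ q' 3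
  area : ∃ α : Fin 2 → ℝ, (∀ A, IsSurfaceOfArea 𝓢 {q ∈ H | f A q = 0} (α A)) ∧
    OfOrder k₁ k₂ s (α 0 + α 1)

/-- `q` and `q'` lie on different branches of the crease `C`, and their distance is, up to a
factor of at most `2`, the least possible one. (Near the pinch point the coordinate distance and
the distance in the induced metric of the slice agree up to a factor close to `1`, so that closest
points in either sense are included.) -/
def AreClosest (ψ : OpenPartialHomeomorph M E4) (C : Set M) (q q' : M) : Prop :=
  q ∈ C ∧ q' ∈ C ∧ q' ∉ connectedComponentIn C q ∧
    ∀ r ∈ C, ∀ r' ∈ C, r' ∉ connectedComponentIn C r →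
      dist (ψ q) (ψ q') ≤ 2 * dist (ψ r) (ψ r')

/-- A hyperbolic crease at time `s ≠ 0`: where its two branches are closest, their separation and
the angles along them are of order `√|s|`, and `z` is `O(|s|)`. -/
structure HyperbolicScaling (τ : M → ℝ) (f : Fin 2 → M → ℝ) (ψ : OpenPartialHomeomorph M E4)
    (k₁ k₂ s : ℝ) (C : Set M) : Prop where
  exists_closest : ∃ q q', AreClosest ψ C q q'
  separation : ∀ q q', AreClosest ψ C q q' →
    OfOrder k₁ k₂ (Real.sqrt |s|) (dist (ψ q) (ψ q'))
  height : ∀ q q', AreClosest ψ C q q' → |ψ q 3| ≤ k₂ * |s|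
  angle : ∀ q q', AreClosest ψ C q q' →
    ∃ Ω, IsCreaseAngle 𝓢 τ f q Ω ∧ OfOrder k₁ k₂ (Real.sqrt |s|) Ω

/-- The part in `W` of the slice `τ = s` of a set. -/
def slice (τ : M → ℝ) (W A : Set M) (s : ℝ) : Set M := {q ∈ W ∩ A | τ q = s}

/-- The evolution of the horizon near the pinch point `p`, inside the neighbourhood `W`. The
horizon consists of the points of the two sheets that lie above the region `S ≤ τ` of the
transverse plane, and the black hole region of the points between the two sheets. Its evolution
is of one of three types, according to the signature of `Q`. -/
def Perestroika (D : LocalData) (τ : M → ℝ) (f : Fin 2 → M → ℝ) (p : M)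
    (ψ : OpenPartialHomeomorph M E4) (V W : Set M) (τ₀ k₁ k₂ : ℝ) : Prop :=
  let B := slice τ W (blackHole 𝓢 f V)
  let H := slice τ W (horizon 𝓢 f V)
  let C := slice τ W (crease f V)
  (∀ q ∈ W, q ∈ horizon 𝓢 f V ↔
    (f 0 q = 0 ∨ f 1 q = 0) ∧ D.S (transverse (ψ q)) ≤ τ q) ∧
  (∀ q ∈ W, q ∈ blackHole 𝓢 f V ↔
    D.Z 1 (τ q, transverse (ψ q)) < ψ q 3 ∧ ψ q 3 < D.Z 0 (τ q, transverse (ψ q))) ∧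
  (((-D.Q).PosDef ∧ HoleCollapse τ₀ B H C p ∧
      ∀ s ∈ Ioo (-τ₀) 0, EllipticScaling 𝓢 τ f ψ k₁ k₂ s (C s)) ∨
    (D.Q.PosDef ∧ SaucerNucleation τ₀ B H C p ∧
      ∀ s ∈ Ioo 0 τ₀, EllipticScaling 𝓢 τ f ψ k₁ k₂ s (C s) ∧
        SaucerScaling 𝓢 f ψ k₁ k₂ s (H s)) ∨
    (D.Q.det < 0 ∧ BridgeMerger τ₀ B H C p ∧
      ∀ s ∈ Ioo (-τ₀) τ₀, s ≠ 0 → HyperbolicScaling 𝓢 τ f ψ k₁ k₂ s (C s)))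

end Scaling

end Crease

end

noncomputable section

set_option linter.unusedSectionVars false

namespace Crease

open Metric (ball closedBall ball_subset_ball mem_ball_self isOpen_ball isClosed_closedBall
  eventually_nhds_iff_ball closedBall_subset_ball)
open EuclideanSpace (single)
open ContinuousLinearMap (fst snd)

local notation:max "𝒜" => IsManifold.maximalAtlas (𝓡 4) ∞
local notation:max "Form" => E4 →L[ℝ] E4 →L[ℝ] ℝ
local notation:max "disc" => ball (0 : Plane)

/-! ### Smoothness near a point -/

section SmoothNear

variable {E F H : Type*} [NormedAddCommGroup E] [NormedSpace ℝ E] [NormedAddCommGroup F]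
  [NormedSpace ℝ F] [NormedAddCommGroup H] [NormedSpace ℝ H]

/-- `f` is smooth on a neighbourhood of `x`. -/
def SmoothNear (f : E → F) (x : E) : Prop := ∀ᶠ y in 𝓝 x, ContDiffAt ℝ ∞ f y

lemma smoothNearZero_iff {f : E → ℝ} : SmoothNearZero f ↔ SmoothNear f 0 := by
  constructor
  · rintro ⟨O, hO, h0, hf⟩
    filter_upwards [hO.mem_nhds h0] with y hy
    exact hf.contDiffAt (hO.mem_nhds hy)
  · intro h
    obtain ⟨O, hO, hOo, h0⟩ := eventually_nhds_iff.1 h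
    exact ⟨O, hOo, h0, fun y hy ↦ (hO y hy).contDiffWithinAt⟩

lemma SmoothNear.contDiffAt {f : E → F} {x : E} (h : SmoothNear f x) : ContDiffAt ℝ ∞ f x :=
  h.self_of_nhds

lemma SmoothNear.continuousAt {f : E → F} {x : E} (h : SmoothNear f x) : ContinuousAt f x :=
  h.contDiffAt.continuousAt

lemma SmoothNear.differentiableAt {f : E → F} {x : E} (h : SmoothNear f x) :
    DifferentiableAt ℝ f x := h.contDiffAt.differentiableAt (by simp)

lemma SmoothNear.of_contDiff {f : E → F} {x : E} (h : ContDiff ℝ ∞ f) : SmoothNear f x :=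
  Eventually.of_forall fun _ ↦ h.contDiffAt

lemma SmoothNear.comp {g : F → H} {f : E → F} {x : E} (hg : SmoothNear g (f x))
    (hf : SmoothNear f x) : SmoothNear (fun y ↦ g (f y)) x := by
  filter_upwards [hf.continuousAt.eventually hg, hf] with y hy hy'
  exact hy.comp y hy'

lemma SmoothNear.fderiv {f : E → F} {x : E} (h : SmoothNear f x) :
    SmoothNear (fderiv ℝ f) x := by
  filter_upwards [h] with y hy
  exact hy.fderiv_right (m := ∞) (by simp)

lemma SmoothNear.prodMk {f : E → F} {g : E → H} {x : E} (hf : SmoothNear f x)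
    (hg : SmoothNear g x) : SmoothNear (fun y ↦ (f y, g y)) x := by
  filter_upwards [hf, hg] with y hy hy'
  exact hy.prodMk hy'

lemma SmoothNear.add {f g : E → F} {x : E} (hf : SmoothNear f x)
    (hg : SmoothNear g x) : SmoothNear (fun y ↦ f y + g y) x := by
  filter_upwards [hf, hg] with y hy hy'
  exact hy.add hy'

lemma SmoothNear.sub {f g : E → F} {x : E} (hf : SmoothNear f x)
    (hg : SmoothNear g x) : SmoothNear (fun y ↦ f y - g y) x := by
  filter_upwards [hf, hg] with y hy hy'
  exact hy.sub hy'

lemma SmoothNear.neg {f : E → F} {x : E} (hf : SmoothNear f x) :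
    SmoothNear (fun y ↦ - f y) x := by
  filter_upwards [hf] with y hy
  exact hy.neg

lemma SmoothNear.smul {f : E → ℝ} {g : E → F} {x : E} (hf : SmoothNear f x)
    (hg : SmoothNear g x) : SmoothNear (fun y ↦ f y • g y) x := by
  filter_upwards [hf, hg] with y hy hy'
  exact hy.smul hy'

lemma SmoothNear.clm_apply {f : E → F →L[ℝ] H} {g : E → F} {x : E} (hf : SmoothNear f x)
    (hg : SmoothNear g x) : SmoothNear (fun y ↦ f y (g y)) x := by
  filter_upwards [hf, hg] with y hy hy'
  exact hy.clm_apply hy'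

lemma SmoothNear.inv {f : E → ℝ} {x : E} (hf : SmoothNear f x) (h : f x ≠ 0) :
    SmoothNear (fun y ↦ (f y)⁻¹) x := by
  filter_upwards [hf, hf.continuousAt.eventually_ne h] with y hy hy'
  exact hy.inv hy'

lemma SmoothNear.sqrt {f : E → ℝ} {x : E} (hf : SmoothNear f x) (h : f x ≠ 0) :
    SmoothNear (fun y ↦ √(f y)) x := by
  filter_upwards [hf, hf.continuousAt.eventually_ne h] with y hy hy'
  exact hy.sqrt hy'

lemma SmoothNear.clm_inverse [CompleteSpace F] {f : E → F →L[ℝ] H} {x : E}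
    (hf : SmoothNear f x)
    (h : (f x).IsInvertible) : SmoothNear (fun y ↦ (f y).inverse) x := by
  have h1 : ∀ᶠ y in 𝓝 x, (f y).IsInvertible := by
    obtain ⟨e, he⟩ := h
    have := ContinuousLinearEquiv.nhds e
    rw [he] at this
    filter_upwards [hf.continuousAt.eventually this] with y hy
    obtain ⟨e', he'⟩ := hy
    exact ⟨e', he'⟩
  filter_upwards [hf, h1] with y hy hy'
  obtain ⟨e, he⟩ := hy'
  have := contDiffAt_map_inverse (𝕜 := ℝ) (n := ∞) e
  rw [he] at this
  exact this.comp y hy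

/-- A function which is smooth near the origin agrees there with a globally smooth one. -/
lemma SmoothNear.exists_contDiff [FiniteDimensional ℝ E] {f : E → F}
    (hf : SmoothNear f 0) : ∃ g : E → F, ContDiff ℝ ∞ g ∧ g =ᶠ[𝓝 0] f := by
  obtain ⟨r, hr, hball⟩ := eventually_nhds_iff_ball.1 hf
  let b : ContDiffBump (0 : E) := ⟨r / 3, r / 2, by positivity, by linarith⟩
  refine ⟨fun x ↦ b x • f x, ?_, ?_⟩
  · rw [contDiff_iff_contDiffAt]
    intro x
    by_cases hx : x ∈ ball (0 : E) r
    · exact b.contDiffAt.smul (hball x hx)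
    · have : (fun y ↦ b y • f y) =ᶠ[𝓝 x] fun _ ↦ 0 := by
        have hx' : x ∈ (closedBall (0 : E) (r / 2))ᶜ := by
          simp only [Metric.mem_ball, not_lt, mem_compl_iff, Metric.mem_closedBall, not_le] at hx ⊢
          linarith
        filter_upwards [isClosed_closedBall.isOpen_compl.mem_nhds hx'] with y hy
        have : b y = 0 := b.zero_of_le_dist (by
          simp only [mem_compl_iff, Metric.mem_closedBall, not_le] at hy
          exact hy.le)
        simp [this]
      exact contDiffAt_const.congr_of_eventuallyEq this
  · filter_upwards [b.eventuallyEq_one] with y hy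
    simp [hy]

end SmoothNear

/-! ### Taylor expansion to second order -/

section Taylor

variable {E F : Type*} [NormedAddCommGroup E] [NormedSpace ℝ E] [NormedAddCommGroup F]
  [NormedSpace ℝ F] [CompleteSpace F]

lemma taylor_two_of_smoothNear {f : E → F} (hf : SmoothNear f 0) :
    (fun x ↦ f x - (f 0 + fderiv ℝ f 0 x + (1 / 2 : ℝ) • fderiv ℝ (fderiv ℝ f) 0 x x))
      =O[𝓝 0] fun x ↦ ‖x‖ ^ 3 := by
  have hc : ContinuousAt (iteratedFDeriv ℝ 3 f) 0 :=
    (hf.contDiffAt.iteratedFDeriv_right (i := 3) (m := 0) (by norm_cast)).continuousAt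
  have hb : ∀ᶠ x in 𝓝 (0 : E), ‖iteratedFDeriv ℝ 3 f x‖ < ‖iteratedFDeriv ℝ 3 f 0‖ + 1 :=
    hc.norm.eventually_lt_const (by linarith)
  obtain ⟨r, hr, hball⟩ := eventually_nhds_iff_ball.1 (hf.and hb)
  set C := ‖iteratedFDeriv ℝ 3 f 0‖ + 1
  refine IsBigO.of_bound C ?_
  filter_upwards [Metric.ball_mem_nhds (0 : E) hr] with x hx
  have hmem t (ht : t ∈ Icc (0 : ℝ) 1) : (0 : E) + t • x ∈ ball (0 : E) r := by
    simp only [zero_add, Metric.mem_ball, dist_zero_right, norm_smul, Real.norm_eq_abs,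
      abs_of_nonneg ht.1] at hx ⊢
    nlinarith [ht.2, norm_nonneg x]
  have key := map_add_eq_sum_add_integral_iteratedFDeriv (n := 2) (f := f) (x := 0) (y := x)
    (fun t ht ↦ (hball _ (hmem t ht)).1.of_le (by norm_cast))
  have hJ : ‖∫ t in (0 : ℝ)..1, (1 - t) ^ 2 • iteratedFDeriv ℝ 3 f (0 + t • x) (fun _ ↦ x)‖
      ≤ (C * ‖x‖ ^ 3) * |1 - 0| := by
    apply intervalIntegral.norm_integral_le_of_norm_le_const
    intro t ht
    rw [uIoc_of_le zero_le_one] at ht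
    have h1 : ‖iteratedFDeriv ℝ 3 f (0 + t • x) (fun _ ↦ x)‖ ≤ C * ‖x‖ ^ 3 := by
      refine ((iteratedFDeriv ℝ 3 f (0 + t • x)).le_opNorm _).trans ?_
      simp only [Finset.prod_const, Finset.card_univ, Fintype.card_fin]
      gcongr
      exact (hball _ (hmem t ⟨ht.1.le, ht.2⟩)).2.le
    rw [norm_smul]
    have h2 : ‖(1 - t) ^ 2‖ ≤ 1 := by
      rw [Real.norm_eq_abs, abs_of_nonneg (sq_nonneg _)]
      nlinarith [ht.1, ht.2]
    calc _ ≤ 1 * (C * ‖x‖ ^ 3) := by gcongr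
      _ = _ := one_mul _
  rw [zero_add, Finset.sum_range_succ, Finset.sum_range_succ, Finset.sum_range_one] at key
  simp only [Nat.factorial, iteratedFDeriv_zero_apply, iteratedFDeriv_one_apply,
    iteratedFDeriv_two_apply] at key
  norm_num at key hJ
  rw [key]
  simp only [add_sub_cancel_left, norm_smul]
  norm_num
  have : 0 ≤ C * ‖x‖ ^ 3 := by positivity
  calc _ ≤ (1 / 2 : ℝ) * (C * ‖x‖ ^ 3) := by gcongr
    _ ≤ _ := by linarith

/-- A homogeneous quadratic function that vanishes to third order is zero. -/
lemma eq_zero_of_isBigO_cube {q : E → ℝ} (hq : ∀ (t : ℝ) x, q (t • x) = t ^ 2 * q x)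
    (h : q =O[𝓝 0] fun x ↦ ‖x‖ ^ 3) (x : E) : q x = 0 := by
  obtain ⟨C, hC⟩ := h.bound
  have ht : Tendsto (fun t : ℝ ↦ t • x) (𝓝[>] 0) (𝓝 0) := by
    have : Tendsto (fun t : ℝ ↦ t • x) (𝓝 0) (𝓝 ((0 : ℝ) • x)) :=
      (continuous_id.smul continuous_const).tendsto _
    rw [zero_smul] at this
    exact this.mono_left nhdsWithin_le_nhds
  have h1 : ∀ᶠ t : ℝ in 𝓝[>] 0, |q x| ≤ C * ‖x‖ ^ 3 * t := by
    filter_upwards [ht.eventually hC, self_mem_nhdsWithin] with t hCt htpos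
    have htpos : 0 < t := htpos
    rw [hq, norm_mul, Real.norm_eq_abs, Real.norm_eq_abs, abs_of_nonneg (sq_nonneg t), norm_pow,
      norm_norm, norm_smul, Real.norm_eq_abs, abs_of_pos htpos] at hCt
    have : t ^ 2 * |q x| ≤ t ^ 2 * (C * ‖x‖ ^ 3 * t) := by
      calc _ ≤ _ := hCt
        _ = _ := by ring
    exact le_of_mul_le_mul_left this (by positivity)
  have h2 : Tendsto (fun t : ℝ ↦ C * ‖x‖ ^ 3 * t) (𝓝[>] 0) (𝓝 0) := by
    have : Tendsto (fun t : ℝ ↦ C * ‖x‖ ^ 3 * t) (𝓝 0) (𝓝 (C * ‖x‖ ^ 3 * 0)) :=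
      (continuous_const.mul continuous_id).tendsto _
    rw [mul_zero] at this
    exact this.mono_left nhdsWithin_le_nhds
  have h3 := ge_of_tendsto h2 h1
  exact abs_eq_zero.1 (le_antisymm h3 (abs_nonneg _))

end Taylor

/-! ### A scalar implicit function theorem -/

section Implicit

variable {E : Type*} [NormedAddCommGroup E] [NormedSpace ℝ E]

lemma eventually_strictMono_of_fderiv_pos {k : E × ℝ → ℝ} (hk : SmoothNear k 0)
    (hd : 0 < fderiv ℝ k 0 (0, 1)) :
    ∃ r > 0, ∀ x : E, ‖x‖ < r → StrictMonoOn (fun y ↦ k (x, y)) (Ioo (-r) r) := by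
  have h1 : ∀ᶠ u in 𝓝 (0 : E × ℝ), 0 < fderiv ℝ k u (0, 1) := by
    have : ContinuousAt (fun u ↦ fderiv ℝ k u (0, 1)) 0 :=
      hk.fderiv.continuousAt.clm_apply continuousAt_const
    exact this.eventually_const_lt hd
  obtain ⟨r, hr, hball⟩ := eventually_nhds_iff_ball.1 (h1.and hk)
  refine ⟨r, hr, fun x hx ↦ ?_⟩
  have hmem y (hy : y ∈ Ioo (-r) r) : (x, y) ∈ ball (0 : E × ℝ) r := by
    rw [mem_ball_zero_iff, Prod.norm_def]
    exact max_lt hx (abs_lt.2 hy)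
  have hder y (hy : y ∈ Ioo (-r) r) : HasDerivAt (fun y ↦ k (x, y)) (fderiv ℝ k (x, y) (0, 1)) y := by
    have := ((hball _ (hmem y hy)).2.differentiableAt (by simp)).hasFDerivAt
    exact this.comp_hasDerivAt y ((hasDerivAt_const y x).prodMk (hasDerivAt_id y))
  refine strictMonoOn_of_deriv_pos (convex_Ioo _ _)
    (fun y hy ↦ (hder y hy).continuousAt.continuousWithinAt) ?_
  intro y hy
  rw [interior_Ioo] at hy
  rw [(hder y hy).deriv]
  exact (hball _ (hmem y hy)).1

/-- The implicit function theorem for one scalar equation, with signs. -/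
lemma exists_implicit [CompleteSpace E] {k : E × ℝ → ℝ} (hk : SmoothNear k 0) (h0 : k 0 = 0)
    (hd : 0 < fderiv ℝ k 0 (0, 1)) :
    ∃ φ : E → ℝ, SmoothNear φ 0 ∧ φ 0 = 0 ∧ (∀ᶠ x in 𝓝 0, k (x, φ x) = 0) ∧
      ∀ᶠ u in 𝓝 (0 : E × ℝ), (0 < k u ↔ φ u.1 < u.2) ∧ (k u = 0 ↔ u.2 = φ u.1) := by
  have hinv (u : E × ℝ) : 0 < fderiv ℝ k u (0, 1) →
      (fderiv ℝ k u ∘L .inr ℝ E ℝ).IsInvertible := by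
    intro hu
    refine ⟨ContinuousLinearEquiv.unitsEquivAut ℝ (Units.mk0 _ hu.ne'), ?_⟩
    ext
    simp
  have hd' : ∀ᶠ u in 𝓝 (0 : E × ℝ), 0 < fderiv ℝ k u (0, 1) := by
    have : ContinuousAt (fun u ↦ fderiv ℝ k u (0, 1)) 0 :=
      hk.fderiv.continuousAt.clm_apply continuousAt_const
    exact this.eventually_const_lt hd
  have hne : (∞ : WithTop ℕ∞) ≠ 0 := by simp
  set φ := hk.contDiffAt.implicitFunction hne (hinv 0 hd) with hφ
  have hφ0 : φ 0 = 0 := hk.contDiffAt.implicitFunction_apply_self hne (hinv 0 hd)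
  have hφs : ContDiffAt ℝ ∞ φ 0 := hk.contDiffAt.contDiffAt_implicitFunction hne (hinv 0 hd)
  have hφk : ∀ᶠ x in 𝓝 0, k (x, φ x) = 0 := by
    have := hk.contDiffAt.eventually_apply_implicitFunction hne (hinv 0 hd)
    rw [h0] at this
    exact this
  have hφc : ∀ᶠ x in 𝓝 0, ContinuousAt φ x :=
    ((hφs.of_le (m := 1) (by simp)).eventually (by simp)).mono fun x hx ↦ hx.continuousAt
  have hpair : ContinuousAt (fun x ↦ (x, φ x)) 0 := continuousAt_id.prodMk hφs.continuousAt
  have hpair' : Tendsto (fun x ↦ (x, φ x)) (𝓝 0) (𝓝 (0 : E × ℝ)) := by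
    have : Tendsto (fun x ↦ (x, φ x)) (𝓝 0) (𝓝 (0, φ 0)) := hpair
    rwa [hφ0] at this
  obtain ⟨r, hr, hmono⟩ := eventually_strictMono_of_fderiv_pos hk hd
  refine ⟨φ, ?_, hφ0, hφk, ?_⟩
  · filter_upwards [hφc, hpair'.eventually hd', hpair'.eventually hk,
      eventually_eventually_nhds.2 hφk] with x hxc hxd hxk hxe
    have hiff := hxk.eventually_apply_eq_iff_implicitFunction hne (hinv _ hxd)
    have hs := hxk.contDiffAt_implicitFunction hne (hinv _ hxd)
    refine hs.congr_of_eventuallyEq ?_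
    have hpx : Tendsto (fun x ↦ (x, φ x)) (𝓝 x) (𝓝 (x, φ x)) := continuousAt_id.prodMk hxc
    filter_upwards [hpx.eventually hiff, hxe] with y hy hy'
    rw [hxe.self_of_nhds] at hy
    exact (hy.1 hy').symm
  · have e1 : ∀ᶠ u in 𝓝 (0 : E × ℝ), ‖u.1‖ < r ∧ u.2 ∈ Ioo (-r) r := by
      filter_upwards [Metric.ball_mem_nhds (0 : E × ℝ) hr] with u hu
      rw [mem_ball_zero_iff, Prod.norm_def, max_lt_iff] at hu
      exact ⟨hu.1, abs_lt.1 hu.2⟩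
    have hfst : Tendsto (fun u : E × ℝ ↦ u.1) (𝓝 0) (𝓝 0) := continuous_fst.tendsto _
    have e2 : ∀ᶠ u in 𝓝 (0 : E × ℝ), φ u.1 ∈ Ioo (-r) r := by
      have : Tendsto φ (𝓝 0) (𝓝 0) := by
        have : Tendsto φ (𝓝 0) (𝓝 (φ 0)) := hφs.continuousAt
        rwa [hφ0] at this
      exact (this.comp hfst).eventually (Ioo_mem_nhds (by linarith) hr)
    filter_upwards [e1, e2, hfst.eventually hφk] with u hu hφu hku
    have hm := hmono u.1 hu.1
    constructor
    · rw [← hm.lt_iff_lt hφu hu.2]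
      simp only [hku]
    · rw [← hm.injOn.eq_iff hu.2 hφu]
      simp only [hku]

end Implicit

/-! ### Integrals depending smoothly on a parameter -/

section Parametric

variable {E : Type} [NormedAddCommGroup E] [NormedSpace ℝ E] [FiniteDimensional ℝ E]

lemma hasFDerivAt_integral_of_contDiff {F : Type} [NormedAddCommGroup F] [NormedSpace ℝ F]
    [CompleteSpace F] {g : ℝ × E → F} (hg : ContDiff ℝ ∞ g) (x₀ : E) :
    HasFDerivAt (fun x ↦ ∫ t in (0 : ℝ)..1, g (t, x))
      (∫ t in (0 : ℝ)..1, (fderiv ℝ g (t, x₀)).comp (.inr ℝ ℝ E)) x₀ := by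
  have : ProperSpace E := FiniteDimensional.proper ℝ E
  have hg' : Continuous fun u ↦ (fderiv ℝ g u).comp (.inr ℝ ℝ E) :=
    (hg.continuous_fderiv (by simp)).clm_comp continuous_const
  obtain ⟨C, hC⟩ := ((isCompact_Icc (a := (0 : ℝ)) (b := 1)).prod
    (isCompact_closedBall x₀ 1)).exists_bound_of_continuousOn hg'.continuousOn
  refine intervalIntegral.hasFDerivAt_integral_of_dominated_of_fderiv_le
    (F := fun x t ↦ g (t, x)) (F' := fun x t ↦ (fderiv ℝ g (t, x)).comp (.inr ℝ ℝ E))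
    (bound := fun _ ↦ C) (Metric.ball_mem_nhds x₀ one_pos) ?_ ?_ ?_ ?_ ?_ ?_
  · exact Eventually.of_forall fun x ↦
      (hg.continuous.comp (by fun_prop : Continuous fun t : ℝ ↦ (t, x))).aestronglyMeasurable
  · exact (hg.continuous.comp (by fun_prop : Continuous fun t : ℝ ↦ (t, x₀))).intervalIntegrable _ _
  · exact (hg'.comp (by fun_prop : Continuous fun t : ℝ ↦ (t, x₀))).aestronglyMeasurable
  · refine Eventually.of_forall fun t ht x hx ↦ hC (t, x) ⟨?_, Metric.ball_subset_closedBall hx⟩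
    rw [uIoc_of_le zero_le_one] at ht
    exact ⟨ht.1.le, ht.2⟩
  · simp
  · refine Eventually.of_forall fun t _ x _ ↦ ?_
    have h1 := ((hg.differentiable (by simp)) (t, x)).hasFDerivAt
    exact h1.comp x (hasFDerivAt_prodMk_right t x)

lemma contDiff_integral (n : ℕ) : ∀ {F : Type} [NormedAddCommGroup F] [NormedSpace ℝ F]
    [CompleteSpace F] {g : ℝ × E → F}, ContDiff ℝ ∞ g →
    ContDiff ℝ n (fun x ↦ ∫ t in (0 : ℝ)..1, g (t, x)) := by
  induction n with
  | zero =>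
    intro F _ _ _ g hg
    refine contDiff_zero.2 ?_
    exact (continuous_iff_continuousAt.2 fun x ↦
      (hasFDerivAt_integral_of_contDiff hg x).continuousAt)
  | succ n ih =>
    intro F _ _ _ g hg
    push_cast
    rw [contDiff_succ_iff_fderiv]
    refine ⟨fun x ↦ (hasFDerivAt_integral_of_contDiff hg x).differentiableAt, by simp, ?_⟩
    have : fderiv ℝ (fun x ↦ ∫ t in (0 : ℝ)..1, g (t, x)) =
        fun x ↦ ∫ t in (0 : ℝ)..1, (fderiv ℝ g (t, x)).comp (.inr ℝ ℝ E) :=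
      funext fun x ↦ (hasFDerivAt_integral_of_contDiff hg x).fderiv
    rw [this]
    refine ih (g := fun u ↦ (fderiv ℝ g u).comp (.inr ℝ ℝ E)) ?_
    exact (hg.fderiv_right (m := ∞) (by simp)).clm_comp contDiff_const

lemma contDiff_infty_integral {F : Type} [NormedAddCommGroup F] [NormedSpace ℝ F]
    [CompleteSpace F] {g : ℝ × E → F} (hg : ContDiff ℝ ∞ g) :
    ContDiff ℝ ∞ (fun x ↦ ∫ t in (0 : ℝ)..1, g (t, x)) :=
  contDiff_infty.2 fun n ↦ contDiff_integral n hg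

lemma exists_weighted_integral {F : Type} [NormedAddCommGroup F] [NormedSpace ℝ F]
    [CompleteSpace F] {D : E → F} (hD : ContDiff ℝ ∞ D) :
    ∃ B : E → F, ContDiff ℝ ∞ B ∧ ∀ (l : F →L[ℝ] ℝ) (x : E),
      l (B x) = ∫ t in (0 : ℝ)..1, (1 - t) * l (D (t • x)) := by
  have hg : ContDiff ℝ ∞ fun u : ℝ × E ↦ (1 - u.1) • D (u.1 • u.2) :=
    (contDiff_const.sub contDiff_fst).smul (hD.comp (contDiff_fst.smul contDiff_snd))
  refine ⟨fun x ↦ ∫ t in (0 : ℝ)..1, (1 - t) • D (t • x), contDiff_infty_integral hg, ?_⟩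
  intro l x
  rw [← l.intervalIntegral_comp_comm]
  · simp
  · exact (hg.continuous.comp (by fun_prop : Continuous fun t : ℝ ↦ (t, x))).intervalIntegrable _ _

/-- Hadamard's lemma to second order. -/
lemma exists_hadamard_two {f : E → ℝ} (hf : ContDiff ℝ ∞ f) (h0 : f 0 = 0)
    (h1 : fderiv ℝ f 0 = 0) :
    ∃ B : E → E →L[ℝ] E →L[ℝ] ℝ, ContDiff ℝ ∞ B ∧ (∀ x v w, B x v w = B x w v) ∧
      ∀ x, f x = B x x x := by
  have hD : ContDiff ℝ ∞ (fderiv ℝ (fderiv ℝ f)) :=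
    (hf.fderiv_right (m := ∞) (by simp)).fderiv_right (m := ∞) (by simp)
  obtain ⟨B, hB, hBl⟩ := exists_weighted_integral hD
  have happ : ∀ x v w : E, B x v w =
      ∫ t in (0 : ℝ)..1, (1 - t) * fderiv ℝ (fderiv ℝ f) (t • x) v w := fun x v w ↦
    hBl ((ContinuousLinearMap.apply ℝ ℝ w).comp (ContinuousLinearMap.apply ℝ (E →L[ℝ] ℝ) v)) x
  refine ⟨B, hB, ?_, ?_⟩
  · intro x v w
    rw [happ, happ]
    refine intervalIntegral.integral_congr fun t _ ↦ ?_
    have : IsSymmSndFDerivAt ℝ f (t • x) :=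
      (hf.contDiffAt (x := t • x)).isSymmSndFDerivAt (by simp; norm_cast)
    simp only [this.eq v w]
  · intro x
    rw [happ]
    have key := map_add_eq_sum_add_integral_iteratedFDeriv (n := 1) (f := f) (x := 0) (y := x)
      (fun t ht ↦ hf.contDiffAt.of_le (by norm_cast))
    rw [zero_add, Finset.sum_range_succ, Finset.sum_range_one] at key
    simp only [iteratedFDeriv_zero_apply, iteratedFDeriv_one_apply, h0, h1, zero_add,
      Nat.reduceAdd, iteratedFDeriv_two_apply] at key
    simpa using key

end Parametric

/-! ### Local diffeomorphisms and the Morse lemma in the plane -/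

lemma exists_localDiffeo {E : Type*} [NormedAddCommGroup E] [NormedSpace ℝ E] [CompleteSpace E]
    {g : E → E} (hg : SmoothNear g 0) (e : E ≃L[ℝ] E)
    (hd : HasFDerivAt g (e : E →L[ℝ] E) 0) (N : Set E) (hN : N ∈ 𝓝 0) :
    ∃ χ : OpenPartialHomeomorph E E, 0 ∈ χ.source ∧ χ.source ⊆ N ∧ (∀ x, χ x = g x) ∧
      ContDiffOn ℝ ∞ χ χ.source ∧ ContDiffOn ℝ ∞ χ.symm χ.target := by
  have hne : (∞ : WithTop ℕ∞) ≠ 0 := by simp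
  set χ₀ := hg.contDiffAt.toOpenPartialHomeomorph g hd hne
  have hχ₀ : ∀ x, χ₀ x = g x := fun _ ↦ rfl
  have h0s : (0 : E) ∈ χ₀.source := hg.contDiffAt.mem_toOpenPartialHomeomorph_source hd hne
  have hinv : ∀ᶠ x in 𝓝 (0 : E), ∃ e' : E ≃L[ℝ] E, (e' : E →L[ℝ] E) = fderiv ℝ g x := by
    have h1 : ContinuousAt (fderiv ℝ g) 0 := hg.fderiv.continuousAt
    have h2 := ContinuousLinearEquiv.nhds e
    rw [← hd.fderiv] at h2
    exact h1.eventually h2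
  obtain ⟨O, hO, hOo, hO0⟩ := eventually_nhds_iff.1 ((hinv.and hg).and hN)
  refine ⟨χ₀.restrOpen O hOo, ⟨h0s, hO0⟩, fun x hx ↦ (hO x hx.2).2, fun x ↦ rfl, ?_, ?_⟩
  · intro x hx
    exact (hO x hx.2).1.2.contDiffWithinAt
  · intro y hy
    set χ := χ₀.restrOpen O hOo
    have hx : χ.symm y ∈ χ.source := χ.map_target hy
    obtain ⟨⟨⟨e', he'⟩, hs⟩, -⟩ := hO _ hx.2
    refine (χ.contDiffAt_symm hy (f₀' := e') ?_ hs).contDiffWithinAt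
    rw [he']
    exact (hs.differentiableAt (by simp)).hasFDerivAt

lemma plane_eq_sum (x : Plane) :
    x = x 0 • single 0 (1 : ℝ) + x 1 • single 1 (1 : ℝ) := by
  ext i
  fin_cases i <;> simp

/-- The Morse lemma for a function of two variables whose Hessian is `diag (2 ε₀, 2 ε₁)`. -/
lemma morse_plane {f : Plane → ℝ} (hf : SmoothNear f 0) {ε₀ ε₁ : ℝ} (h₀ : ε₀ ^ 2 = 1)
    (h₁ : ε₁ ^ 2 = 1)
    (hexp : (fun x : Plane ↦ f x - (ε₀ * x 0 ^ 2 + ε₁ * x 1 ^ 2)) =O[𝓝 0] fun x ↦ ‖x‖ ^ 3) :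
    ∃ χ : OpenPartialHomeomorph Plane Plane, 0 ∈ χ.source ∧ χ 0 = 0 ∧
      ContDiffOn ℝ ∞ χ χ.source ∧ ContDiffOn ℝ ∞ χ.symm χ.target ∧
      HasFDerivAt χ (ContinuousLinearMap.id ℝ Plane) 0 ∧
      ∀ x ∈ χ.source, f x = ε₀ * χ x 0 ^ 2 + ε₁ * χ x 1 ^ 2 := by
  obtain ⟨g, hg, hgf⟩ := hf.exists_contDiff
  have hexp' : (fun x : Plane ↦ g x - (ε₀ * x 0 ^ 2 + ε₁ * x 1 ^ 2)) =O[𝓝 0] fun x ↦ ‖x‖ ^ 3 :=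
    hexp.congr' (hgf.mono fun x hx ↦ by simp only [hx]) EventuallyEq.rfl
  have hquad : (fun x : Plane ↦ ε₀ * x 0 ^ 2 + ε₁ * x 1 ^ 2) =O[𝓝 0] fun x ↦ ‖x‖ ^ 2 := by
    refine IsBigO.of_bound (|ε₀| + |ε₁|) (Eventually.of_forall fun x ↦ ?_)
    have a0 : |x 0| ≤ ‖x‖ := PiLp.norm_apply_le x 0
    have a1 : |x 1| ≤ ‖x‖ := PiLp.norm_apply_le x 1
    rw [Real.norm_eq_abs, Real.norm_eq_abs, abs_of_nonneg (sq_nonneg ‖x‖)]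
    refine (abs_add_le _ _).trans ?_
    rw [abs_mul, abs_mul, abs_pow, abs_pow, add_mul]
    gcongr
  have hO2 : g =O[𝓝 0] fun x ↦ ‖x‖ ^ 2 := by
    have h3 : (fun x : Plane ↦ ‖x‖ ^ 3) =O[𝓝 0] fun x ↦ ‖x‖ ^ 2 := by
      refine IsBigO.of_bound 1 ?_
      filter_upwards [Metric.ball_mem_nhds (0 : Plane) one_pos] with x hx
      rw [mem_ball_zero_iff] at hx
      simp only [norm_pow, norm_norm, one_mul]
      exact pow_le_pow_of_le_one (norm_nonneg _) hx.le (by norm_num)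
    simpa using (hexp'.trans h3).add hquad
  have hO2' : g =O[𝓝 0] fun x ↦ ‖x - 0‖ ^ 2 := by simpa using hO2
  have hg0 : g 0 = 0 := hO2'.eq_zero_of_norm_pow (by norm_num)
  have hg1 : fderiv ℝ g 0 = 0 := (hO2'.hasFDerivAt (by norm_num)).fderiv
  obtain ⟨B, hB, hBs, hgB⟩ := exists_hadamard_two hg hg0 hg1
  set e₀ : Plane := single 0 (1 : ℝ)
  set e₁ : Plane := single 1 (1 : ℝ)
  have hexpand (x y : Plane) : B x y y = B x e₀ e₀ * y 0 ^ 2 + 2 * B x e₀ e₁ * (y 0 * y 1) + B x e₁ e₁ * y 1 ^ 2 := by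
    conv_lhs => rw [plane_eq_sum y]
    have := hBs x e₁ e₀
    simp only [map_add, map_smul, add_apply, smul_apply,
      smul_eq_mul]
    rw [show B x (single 1 1) (single 0 1) = B x e₀ e₁ from this]
    ring
  have hB0 : ∀ x : Plane, B 0 x x - (ε₀ * x 0 ^ 2 + ε₁ * x 1 ^ 2) = 0 := by
    refine eq_zero_of_isBigO_cube ?_ ?_
    · intro t x
      simp only [map_smul, smul_apply, smul_eq_mul, PiLp.smul_apply]
      ring
    · have h1 : (fun x ↦ B x - B 0) =O[𝓝 0] fun x : Plane ↦ x := by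
        simpa using (hB.contDiffAt.differentiableAt (by simp)).hasFDerivAt.isBigO_sub (x₀ := 0)
      have h2 : (fun x ↦ (B x - B 0) x x) =O[𝓝 0] fun x : Plane ↦ ‖x‖ ^ 3 := by
        obtain ⟨C, hC⟩ := h1.bound
        refine IsBigO.of_bound C ?_
        filter_upwards [hC] with x hx
        refine ((B x - B 0).le_opNorm₂ x x).trans ?_
        calc _ ≤ C * ‖x‖ * ‖x‖ * ‖x‖ := by gcongr
          _ = _ := by simp; ring
      refine (hexp'.sub h2).congr_left fun x ↦ ?_
      rw [hgB x]
      simp only [sub_apply]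
      ring
  set α : Plane → ℝ := fun x ↦ B x e₀ e₀
  set β : Plane → ℝ := fun x ↦ B x e₀ e₁
  set γ : Plane → ℝ := fun x ↦ B x e₁ e₁
  have hα : SmoothNear α 0 := .of_contDiff ((hB.clm_apply contDiff_const).clm_apply contDiff_const)
  have hβ : SmoothNear β 0 := .of_contDiff ((hB.clm_apply contDiff_const).clm_apply contDiff_const)
  have hγ : SmoothNear γ 0 := .of_contDiff ((hB.clm_apply contDiff_const).clm_apply contDiff_const)
  have hα0 : α 0 = ε₀ := by
    have := hB0 e₀
    simp only [e₀, PiLp.single_apply] at this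
    simpa [sub_eq_zero] using this
  have hγ0 : γ 0 = ε₁ := by
    have := hB0 e₁
    simp only [e₁, PiLp.single_apply] at this
    simpa [sub_eq_zero] using this
  have hβ0 : β 0 = 0 := by
    have := hB0 (e₀ + e₁)
    rw [hexpand] at this
    simp only [e₀, e₁, PiLp.add_apply, PiLp.single_apply] at this
    norm_num at this
    have h1 : α 0 + 2 * β 0 + γ 0 - (ε₀ + ε₁) = 0 := this
    linarith
  have hε₀ : ε₀ ≠ 0 := by rintro rfl; norm_num at h₀
  have hε₁ : ε₁ ≠ 0 := by rintro rfl; norm_num at h₁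
  have hμ : SmoothNear (fun x ↦ (α x)⁻¹) 0 := hα.inv (by rw [hα0]; exact hε₀)
  have hA : SmoothNear (fun x ↦ √(ε₀ • α x)) 0 := by
    refine SmoothNear.sqrt ((SmoothNear.of_contDiff contDiff_const).smul hα) ?_
    simp only [hα0, smul_eq_mul]
    exact mul_ne_zero hε₀ hε₀
  have hD' : SmoothNear (fun x ↦ ε₁ • (γ x - (β x • β x) • (α x)⁻¹)) 0 :=
    (SmoothNear.of_contDiff contDiff_const).smul (hγ.sub ((hβ.smul hβ).smul hμ))
  have hD : SmoothNear (fun x ↦ √(ε₁ • (γ x - (β x • β x) • (α x)⁻¹))) 0 := by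
    refine hD'.sqrt ?_
    simp only [hγ0, hβ0, smul_eq_mul]
    simp [hε₁]
  have hx0 : SmoothNear (fun x : Plane ↦ x 0) 0 := .of_contDiff (by fun_prop)
  have hx1 : SmoothNear (fun x : Plane ↦ x 1) 0 := .of_contDiff (by fun_prop)
  set a : Plane → ℝ := fun x ↦ √(ε₀ • α x)
  set d : Plane → ℝ := fun x ↦ √(ε₁ • (γ x - (β x • β x) • (α x)⁻¹))
  have ha0 : a 0 = 1 := by simp [a, hα0, ← sq, h₀]
  have hd0 : d 0 = 1 := by simp [d, hγ0, hβ0, ← sq, h₁]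
  set b : Plane → ℝ := fun x ↦ a x • (β x • (α x)⁻¹)
  have hb : SmoothNear b 0 := hA.smul (hβ.smul hμ)
  have hb0 : b 0 = 0 := by simp [b, hβ0]
  set η : Plane → Plane := fun x ↦ (a x • x 0 + b x • x 1) • e₀ + (d x • x 1) • e₁
  have hη : SmoothNear η 0 :=
    (((hA.smul hx0).add (hb.smul hx1)).smul (.of_contDiff contDiff_const)).add
      ((hD.smul hx1).smul (.of_contDiff contDiff_const))
  have hη0 : η 0 = 0 := by simp [η]
  have hmul : ∀ (u : Plane → ℝ) (i : Fin 2), SmoothNear u 0 →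
      HasFDerivAt (fun x : Plane ↦ u x • x i)
        (u 0 • (EuclideanSpace.proj i : Plane →L[ℝ] ℝ)) 0 := by
    intro u i hu
    have h1 := hu.differentiableAt.hasFDerivAt
    have h2 : HasFDerivAt (fun x : Plane ↦ x i) (EuclideanSpace.proj i : Plane →L[ℝ] ℝ) 0 :=
      (EuclideanSpace.proj i : Plane →L[ℝ] ℝ).hasFDerivAt
    have := h1.smul h2
    convert! this using 1
    ext v
    simp
  have hηd : HasFDerivAt η (ContinuousLinearMap.id ℝ Plane) 0 := by
    have h1 := (((hmul a 0 hA).add (hmul b 1 hb)).smul_const e₀).add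
      ((hmul d 1 hD).smul_const e₁)
    convert! h1 using 1
    ext v i
    simp only [ha0, hb0, hd0]
    fin_cases i <;> simp [e₀, e₁]
  obtain ⟨χ, h0s, hsub, hχ, hs, hs'⟩ := exists_localDiffeo hη (ContinuousLinearEquiv.refl ℝ _)
    hηd {x | g x = f x ∧ 0 < ε₀ • α x ∧ 0 < ε₁ • (γ x - (β x • β x) • (α x)⁻¹)} (by
      have c1 : ContinuousAt (fun x ↦ ε₀ • α x) 0 :=
        ((SmoothNear.of_contDiff contDiff_const).smul hα).continuousAt
      filter_upwards [hgf, c1.eventually_const_lt (u := 0) (by simp [hα0, ← sq, h₀]),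
        hD'.continuousAt.eventually_const_lt (u := 0) (by simp [hγ0, hβ0, ← sq, h₁])]
        with x k1 k2 k3
      exact ⟨k1, k2, k3⟩)
  have hfun : (χ : Plane → Plane) = η := funext hχ
  refine ⟨χ, h0s, by rw [hχ, hη0], hs, hs', by rw [hfun]; exact hηd, ?_⟩
  intro x hx
  obtain ⟨k1, k2, k3⟩ := hsub hx
  have hηx0 : η x 0 = a x * (x 0 + β x * (α x)⁻¹ * x 1) := by
    simp [η, b, e₀, e₁]
    ring
  have hηx1 : η x 1 = d x * x 1 := by simp [η, e₀, e₁]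
  have hαx : α x ≠ 0 := by
    rintro h
    simp [h] at k2
  have ha2 : a x ^ 2 = ε₀ * α x := Real.sq_sqrt k2.le
  have hd2 : d x ^ 2 = ε₁ * (γ x - (β x * β x) * (α x)⁻¹) := Real.sq_sqrt k3.le
  rw [hfun, hηx0, hηx1, mul_pow, mul_pow, ha2, hd2, ← k1, hgB, hexpand]
  change α x * x 0 ^ 2 + 2 * β x * (x 0 * x 1) + γ x * x 1 ^ 2 = _
  have e0 : ε₀ * ε₀ = 1 := by rw [← sq, h₀]
  have e1 : ε₁ * ε₁ = 1 := by rw [← sq, h₁]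
  calc α x * x 0 ^ 2 + 2 * β x * (x 0 * x 1) + γ x * x 1 ^ 2
      = 1 * α x * (x 0 + β x * (α x)⁻¹ * x 1) ^ 2
        + 1 * (γ x - (β x * β x) * (α x)⁻¹) * x 1 ^ 2 := by field_simp; ring
    _ = _ := by rw [← e0]; nth_rewrite 2 [e0]; rw [← e1]; ring

/-! ### Lorentzian linear algebra -/

lemma minkowski_pos_of_orthogonal {a b c d p q r s : ℝ}
    (hT : -(a * a) + b * b + c * c + d * d < 0) (hTw : -(a * p) + b * q + c * r + d * s = 0)
    (hw : ¬ (p = 0 ∧ q = 0 ∧ r = 0 ∧ s = 0)) : 0 < -(p * p) + q * q + r * r + s * s := by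
  by_contra hcon
  push Not at hcon
  have hap : a * p = b * q + c * r + d * s := by linarith
  have hcs : (a * p) ^ 2 ≤ (b ^ 2 + c ^ 2 + d ^ 2) * (q ^ 2 + r ^ 2 + s ^ 2) := by
    rw [hap]
    nlinarith [sq_nonneg (b * r - c * q), sq_nonneg (b * s - d * q), sq_nonneg (c * s - d * r)]
  have h1 : q ^ 2 + r ^ 2 + s ^ 2 ≤ p ^ 2 := by linarith [sq p, sq q, sq r, sq s]
  have h2 : b ^ 2 + c ^ 2 + d ^ 2 < a ^ 2 := by linarith [sq a, sq b, sq c, sq d]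
  have hp : p = 0 := by
    by_contra hp
    have hp : 0 < p ^ 2 := by positivity
    have h3 : (b ^ 2 + c ^ 2 + d ^ 2) * (q ^ 2 + r ^ 2 + s ^ 2) ≤
        (b ^ 2 + c ^ 2 + d ^ 2) * p ^ 2 := by gcongr
    have h4 : (b ^ 2 + c ^ 2 + d ^ 2) * p ^ 2 < a ^ 2 * p ^ 2 := by gcongr
    linarith [mul_pow a p 2]
  rw [hp] at h1
  have hq : q ^ 2 = 0 := by linarith [sq_nonneg q, sq_nonneg r, sq_nonneg s]
  have hr : r ^ 2 = 0 := by linarith [sq_nonneg q, sq_nonneg r, sq_nonneg s]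
  have hs : s ^ 2 = 0 := by linarith [sq_nonneg q, sq_nonneg r, sq_nonneg s]
  exact hw ⟨hp, by simpa using hq, by simpa using hr, by simpa using hs⟩

/-- A nonzero vector orthogonal to a timelike vector is spacelike. -/
lemma spacelike_of_orthogonal {V : Type*} [AddCommGroup V] [Module ℝ V] (g : V →ₗ[ℝ] V →ₗ[ℝ] ℝ)
    (e : Module.Basis (Fin 4) ℝ V) (he : ∀ i j, g (e i) (e j) = minkowski (e4 i) (e4 j))
    {T w : V} (hT : g T T < 0) (hTw : g T w = 0) (hw : w ≠ 0) : 0 < g w w := by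
  have key (v w : V) : g v w = -(e.repr v 0 * e.repr w 0) + e.repr v 1 * e.repr w 1
      + e.repr v 2 * e.repr w 2 + e.repr v 3 * e.repr w 3 := by
    conv_lhs => rw [← e.sum_repr v, ← e.sum_repr w]
    simp only [map_add, map_smul, LinearMap.add_apply, LinearMap.smul_apply, he,
      Fin.sum_univ_four, smul_eq_mul]
    simp [minkowski, e4]
    ring
  rw [key] at hT hTw ⊢
  refine minkowski_pos_of_orthogonal hT hTw ?_
  rintro ⟨h0, h1, h2, h3⟩
  apply hw
  apply e.repr.injective
  ext i
  fin_cases i <;> simp [h0, h1, h2, h3]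

/-! ### The metric in a chart -/

section Chart

variable {M : Type*} [TopologicalSpace M] [ChartedSpace E4 M] [IsManifold (𝓡 4) ∞ M]
  (𝓢 : Spacetime M)

lemma Spacetime.spacelike {x : M} {T w : TangentSpace (𝓡 4) x} (hT : 𝓢.metric x T T < 0)
    (hTw : 𝓢.metric x T w = 0) (hw : w ≠ 0) : 0 < 𝓢.metric x w w := by
  obtain ⟨e, he⟩ := 𝓢.signature x
  let g : TangentSpace (𝓡 4) x →ₗ[ℝ] TangentSpace (𝓡 4) x →ₗ[ℝ] ℝ :=
    LinearMap.mk₂ ℝ (fun v w ↦ 𝓢.metric x v w) (by simp) (by simp) (by simp) (by simp)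
  exact spacelike_of_orthogonal g e he hT hTw hw

variable {𝓢}

lemma IsTimeFunction.futureTimelike_iff {τ : M → ℝ} (hτ : IsTimeFunction 𝓢 τ) {x : M}
    {v : TangentSpace (𝓡 4) x} :
    𝓢.FutureTimelike x v ↔ 𝓢.metric x v v < 0 ∧ 0 < diff τ x v := by
  refine ⟨fun h ↦ ⟨h.1, hτ.pos_of_timelike x v h⟩, fun ⟨h1, h2⟩ ↦ ⟨h1, ?_⟩⟩
  by_contra hcon
  push Not at hcon
  rcases hcon.eq_or_lt with h | h
  · have hv : v ≠ 0 := by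
      rintro rfl
      simp at h1
    have := 𝓢.spacelike (𝓢.timeDir_timelike x) h.symm hv
    linarith
  · have := hτ.pos_of_timelike x (-v) ⟨by simpa using h1, by simpa using h⟩
    simp only [map_neg] at this
    linarith

lemma IsTimeFunction.futureNull_iff {τ : M → ℝ} (hτ : IsTimeFunction 𝓢 τ) {x : M}
    {v : TangentSpace (𝓡 4) x} :
    𝓢.FutureNull x v ↔ 𝓢.metric x v v = 0 ∧ 0 < diff τ x v := by
  refine ⟨fun h ↦ ⟨h.1, hτ.pos_of_null x v h⟩, fun ⟨h1, h2⟩ ↦ ⟨h1, ?_⟩⟩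
  by_contra hcon
  push Not at hcon
  rcases hcon.eq_or_lt with h | h
  · have hv : v ≠ 0 := by
      rintro rfl
      simp at h2
    have := 𝓢.spacelike (𝓢.timeDir_timelike x) h.symm hv
    linarith
  · have := hτ.pos_of_null x (-v) ⟨by simpa using h1, by simpa using h⟩
    simp only [map_neg] at this
    linarith

lemma IsTimeFunction.spacelike {τ : M → ℝ} (hτ : IsTimeFunction 𝓢 τ) {x : M}
    {v : TangentSpace (𝓡 4) x} (hv : diff τ x v = 0) (hv0 : v ≠ 0) : 0 < 𝓢.metric x v v := by
  by_contra hcon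
  push Not at hcon
  have hT : 𝓢.metric x (𝓢.timeDir x) v ≠ 0 := fun h ↦
    absurd (𝓢.spacelike (𝓢.timeDir_timelike x) h hv0) (not_lt.2 hcon)
  have hmain (w : TangentSpace (𝓡 4) x) : 𝓢.metric x w w ≤ 0 → diff τ x w = 0 →
      ¬ 𝓢.metric x (𝓢.timeDir x) w < 0 := by
    intro hw hd hTw
    rcases hw.lt_or_eq with h | h
    · exact (hτ.pos_of_timelike x w ⟨h, hTw⟩).ne' hd
    · exact (hτ.pos_of_null x w ⟨h, hTw⟩).ne' hd
  rcases hT.lt_or_gt with h | h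
  · exact hmain v hcon hv h
  · refine hmain (-v) (by simpa using hcon) (by simp [hv]) (by simpa using h)

variable (𝓢)

/-- The metric in a chart, as a function with values in the bilinear forms. -/
def coordG (φ : OpenPartialHomeomorph M E4) (X : E4) : Form :=
  let m : Form := 𝓢.metric (φ.symm X)
  let d : E4 →L[ℝ] E4 := mfderiv (𝓡 4) (𝓡 4) φ.symm X
  m.bilinearComp d d

lemma coordG_apply (φ : OpenPartialHomeomorph M E4) (X v w : E4) :
    coordG 𝓢 φ X v w = coordMetric 𝓢 φ X v w := rfl

variable {𝓢} {φ : OpenPartialHomeomorph M E4}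

lemma contMDiffOn_mfderiv_symm (hφ : φ ∈ 𝒜 M) (v : E4) :
    ContMDiffOn (𝓡 4) (𝓡 4).tangent ∞ (fun X ↦ (⟨φ.symm X, mfderiv (𝓡 4) (𝓡 4) φ.symm X v⟩ :
      TangentBundle (𝓡 4) M)) φ.target := by
  have h1 : ContMDiffOn (𝓡 4) (𝓡 4) ∞ φ.symm φ.target := contMDiffOn_symm_of_mem_maximalAtlas hφ
  have h2 := h1.contMDiffOn_tangentMapWithin (m := ∞) (by simp) φ.open_target.uniqueMDiffOn
  have h3 : ContMDiff (𝓡 4) (𝓡 4).tangent ∞ (fun X : E4 ↦ (⟨X, v⟩ : TangentBundle (𝓡 4) E4)) :=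
    contMDiff_vectorSpace_iff_contDiff.2 contDiff_const
  have h4 := h2.comp h3.contMDiffOn (s := φ.target) (fun X hX ↦ hX)
  refine h4.congr fun X hX ↦ ?_
  simp only [Function.comp, tangentMapWithin]
  rw [mfderivWithin_of_isOpen φ.open_target hX]

lemma contDiffOn_coordMetric (hφ : φ ∈ 𝒜 M) (v w : E4) :
    ContDiffOn ℝ ∞ (fun X ↦ coordMetric 𝓢 φ X v w) φ.target := by
  have h1 : ContMDiffOn (𝓡 4) (𝓡 4) ∞ φ.symm φ.target := contMDiffOn_symm_of_mem_maximalAtlas hφ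
  intro X hX
  have h2 : ContMDiffWithinAt (𝓡 4) ((𝓡 4).prod 𝓘(ℝ)) ∞
      (fun X ↦ Bundle.TotalSpace.mk' ℝ (E := Bundle.Trivial M ℝ) (φ.symm X)
        (𝓢.metric (φ.symm X) (mfderiv (𝓡 4) (𝓡 4) φ.symm X v)
          (mfderiv (𝓡 4) (𝓡 4) φ.symm X w))) φ.target X := by
    apply ContMDiffWithinAt.clm_bundle_apply₂ (F₁ := E4) (F₂ := E4)
    · exact ContMDiffAt.comp_contMDiffWithinAt X 𝓢.contMDiff.contMDiffAt (h1 X hX)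
    · exact contMDiffOn_mfderiv_symm hφ v X hX
    · exact contMDiffOn_mfderiv_symm hφ w X hX
  simp only [Bundle.contMDiffWithinAt_totalSpace] at h2
  exact h2.2.contDiffWithinAt

lemma contDiffOn_coordG (hφ : φ ∈ 𝒜 M) :
    ContDiffOn ℝ ∞ (coordG 𝓢 φ) φ.target :=
  contDiffOn_clm_apply.2 fun v ↦ contDiffOn_clm_apply.2 fun w ↦ contDiffOn_coordMetric hφ v w

lemma mdifferentiable_of_mem_maximalAtlas (hφ : φ ∈ 𝒜 M) :
    φ.MDifferentiable (𝓡 4) (𝓡 4) :=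
  ⟨(contMDiffOn_of_mem_maximalAtlas hφ).mdifferentiableOn (by simp),
    (contMDiffOn_symm_of_mem_maximalAtlas hφ).mdifferentiableOn (by simp)⟩

lemma diff_mfderiv_symm (hφ : φ ∈ 𝒜 M) {X : E4}
    (hX : X ∈ φ.target) {f : M → ℝ} (hf : MDifferentiableAt (𝓡 4) 𝓘(ℝ, ℝ) f (φ.symm X)) (v : E4) :
    diff f (φ.symm X) (mfderiv (𝓡 4) (𝓡 4) φ.symm X v) = fderiv ℝ (f ∘ φ.symm) X v := by
  have h := (mdifferentiable_of_mem_maximalAtlas hφ).mdifferentiableAt_symm hX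
  rw [← mfderiv_eq_fderiv, mfderiv_comp X hf h]
  rfl

lemma exists_mfderiv_symm_eq (hφ : φ ∈ 𝒜 M) {X : E4}
    (hX : X ∈ φ.target) (l : TangentSpace (𝓡 4) (φ.symm X)) :
    ∃ v : E4, mfderiv (𝓡 4) (𝓡 4) φ.symm X v = l :=
  (mdifferentiable_of_mem_maximalAtlas hφ).symm.mfderiv_surjective hX l

lemma mfderiv_symm_injective (hφ : φ ∈ 𝒜 M) {X : E4}
    (hX : X ∈ φ.target) : Function.Injective (mfderiv (𝓡 4) (𝓡 4) φ.symm X) :=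
  (mdifferentiable_of_mem_maximalAtlas hφ).symm.mfderiv_injective hX

/-- There is a nonconstant differentiable curve in `S` from `r` to `q`, all of whose velocities
satisfy `P`; the version of `JoinedBy` in coordinate space. -/
def CoordJoined (P : E4 → E4 → Prop) (S : Set E4) (r q : E4) : Prop :=
  ∃ (c : ℝ → E4) (l : ℝ), 0 < l ∧ c 0 = r ∧ c l = q ∧ ∀ s ∈ Icc 0 l, c s ∈ S ∧
    ∃ v, P (c s) v ∧ HasDerivWithinAt c v (Icc 0 l) s

lemma joinedBy_iff_coordJoined (hφ : φ ∈ 𝒜 M)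
    {P : (x : M) → TangentSpace (𝓡 4) x → Prop} {P' : E4 → E4 → Prop} {S : Set M}
    (hP : ∀ X v, φ.symm X ∈ S → X ∈ φ.target →
      (P' X v ↔ P (φ.symm X) (mfderiv (𝓡 4) (𝓡 4) φ.symm X v)))
    (hS : S ⊆ φ.source) {r q : M} (hr : r ∈ φ.source) (hq : q ∈ φ.source) :
    JoinedBy P S r q ↔
      CoordJoined P' {X | X ∈ φ.target ∧ φ.symm X ∈ S} (φ r) (φ q) := by
  have hmd := mdifferentiable_of_mem_maximalAtlas hφ
  constructor
  · rintro ⟨c, l, hl, h0, h1, hc⟩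
    refine ⟨φ ∘ c, l, hl, by simp [h0], by simp [h1], fun s hs ↦ ?_⟩
    obtain ⟨hcs, v, hPv, hv⟩ := hc s hs
    have hsrc := hS hcs
    have htgt : φ (c s) ∈ φ.target := φ.map_source hsrc
    have hinv : φ.symm (φ (c s)) = c s := φ.left_inv hsrc
    let d : E4 →L[ℝ] E4 := mfderiv (𝓡 4) (𝓡 4) φ (c s)
    let v' : E4 := v
    refine ⟨⟨htgt, by simpa [hinv] using hcs⟩, d v', ?_, ?_⟩
    · refine (hP (φ (c s)) (d v') (by simpa [hinv] using hcs) htgt).2 ?_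
      have hcomp := hmd.symm_comp_deriv hsrc
      have hcv : mfderiv (𝓡 4) (𝓡 4) φ.symm (φ (c s)) (mfderiv (𝓡 4) (𝓡 4) φ (c s) v) = v :=
        DFunLike.congr_fun hcomp v
      have gen : ∀ (x : M), x = c s → ∀ w : E4, w = (v : E4) → P x w := by
        rintro x rfl w rfl
        exact hPv
      exact gen _ hinv _ hcv
    · have h2 := (hmd.mdifferentiableAt hsrc).hasMFDerivAt
      have h3 := h2.comp_hasMFDerivWithinAt s hv
      have h4 : HasFDerivWithinAt (φ ∘ c) (d.comp ((1 : ℝ →L[ℝ] ℝ).smulRight v')) (Icc 0 l) s :=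
        h3.hasFDerivWithinAt
      simpa using h4.hasDerivWithinAt
  · rintro ⟨c, l, hl, h0, h1, hc⟩
    refine ⟨φ.symm ∘ c, l, hl, by simp [h0, φ.left_inv hr], by simp [h1, φ.left_inv hq],
      fun s hs ↦ ?_⟩
    obtain ⟨⟨htgt, hcs⟩, v, hPv, hv⟩ := hc s hs
    refine ⟨hcs, mfderiv (𝓡 4) (𝓡 4) φ.symm (c s) v, (hP _ _ hcs htgt).1 hPv, ?_⟩
    have h2 := (hmd.mdifferentiableAt_symm htgt).hasMFDerivAt
    have h3 : HasMFDerivWithinAt 𝓘(ℝ, ℝ) (𝓡 4) c (Icc 0 l) s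
      ((1 : ℝ →L[ℝ] ℝ).smulRight (v : TangentSpace (𝓡 4) (c s))) :=
      hv.hasFDerivWithinAt.hasMFDerivWithinAt
    have h4 := h2.comp_hasMFDerivWithinAt s h3
    have h5 : (mfderiv (𝓡 4) (𝓡 4) φ.symm (c s)).comp
        ((1 : ℝ →L[ℝ] ℝ).smulRight (v : TangentSpace (𝓡 4) (c s))) =
        (1 : ℝ →L[ℝ] ℝ).smulRight (mfderiv (𝓡 4) (𝓡 4) φ.symm (c s) v) :=
      ContinuousLinearMap.ext fun t ↦ (mfderiv (𝓡 4) (𝓡 4) φ.symm (c s)).map_smul t v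
    exact h5 ▸ h4

end Chart

/-- The metric `G`, the time function `h` and the defining functions `f A` of the two null sheets
in normal coordinates adapted to a pinch point. -/
structure PinchModel (G : E4 → Form) (h : E4 → ℝ) (f : Fin 2 → E4 → ℝ) :
    Prop where
  G_smooth : SmoothNear G 0
  h_smooth : SmoothNear h 0
  f_smooth : ∀ A, SmoothNear (f A) 0
  G_symm : ∀ X v w, G X v w = G X w v
  G_zero : ∀ v w, G 0 v w = minkowski v w
  G_deriv : fderiv ℝ G 0 = 0
  h_zero : h 0 = 0
  h_tangent : ∀ v : E4, v 0 = 0 → fderiv ℝ h 0 v = 0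
  h_future : 0 < fderiv ℝ h 0 (e4 0)
  spacelike : ∀ᶠ X in 𝓝 0, ∀ w, fderiv ℝ h X w = 0 → w ≠ 0 → 0 < G X w w
  f_zero : ∀ A, f A 0 = 0
  null : ∀ A, ∀ᶠ X in 𝓝 0, f A X = 0 → ∃ l, G X l l = 0 ∧ 0 < fderiv ℝ h X l ∧
    ∀ v, G X l v = fderiv ℝ (f A) X v
  tangent : ∀ v, fderiv ℝ (f 0) 0 v = 0 → fderiv ℝ (f 1) 0 v = 0 → fderiv ℝ h 0 v = 0

section Chart

variable {M : Type*} [TopologicalSpace M] [ChartedSpace E4 M] [IsManifold (𝓡 4) ∞ M]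
  {𝓢 : Spacetime M} {φ : OpenPartialHomeomorph M E4}

lemma coordMetric_symm (X v w : E4) : coordMetric 𝓢 φ X v w = coordMetric 𝓢 φ X w v :=
  𝓢.symm _ _ _

lemma IsNormalChart.zero_mem_target {p : M} (hφ : IsNormalChart 𝓢 p φ) :
    (0 : E4) ∈ φ.target := by
  rw [← hφ.map_zero]
  exact φ.map_source hφ.mem_source

lemma IsNormalChart.symm_zero {p : M} (hφ : IsNormalChart 𝓢 p φ) : φ.symm 0 = p := by
  rw [← hφ.map_zero, φ.left_inv hφ.mem_source]

lemma IsNormalChart.smoothNear_coordG {p : M} (hφ : IsNormalChart 𝓢 p φ) :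
    SmoothNear (coordG 𝓢 φ) 0 := by
  filter_upwards [φ.open_target.mem_nhds hφ.zero_mem_target] with X hX
  exact (contDiffOn_coordG hφ.mem_atlas).contDiffAt (φ.open_target.mem_nhds hX)

lemma geodesicEquation_smul_iff {G : E4 → E4 → E4 → ℝ} (hG : ∀ X w, G X 0 w = 0) (v : E4)
    (s : ℝ) : GeodesicEquation G (fun r ↦ r • v) s ↔ ∀ w, christoffel G (s • v) v v w = 0 := by
  have h1 : deriv (fun r : ℝ ↦ r • v) = fun _ ↦ v := by
    funext r
    simpa using ((hasDerivAt_id r).smul_const v).deriv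
  simp only [GeodesicEquation, h1, deriv_const, hG, zero_add]

lemma coordMetric_zero_left (X w : E4) : coordMetric 𝓢 φ X 0 w = 0 := by
  rw [← coordG_apply]
  simp

lemma IsNormalChart.christoffel_zero {p : M} (hφ : IsNormalChart 𝓢 p φ) (u v w : E4) :
    christoffel (coordMetric 𝓢 φ) 0 u v w = 0 := by
  have hG := hφ.smoothNear_coordG.differentiableAt
  have hd (u v w : E4) : fderiv ℝ (fun Y ↦ coordMetric 𝓢 φ Y v w) 0 u =
      fderiv ℝ (coordG 𝓢 φ) 0 u v w := by
    have h1 := (hG.hasFDerivAt.clm_apply (hasFDerivAt_const v (0 : E4))).clm_apply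
      (hasFDerivAt_const w (0 : E4))
    have h2 : fderiv ℝ (fun Y ↦ coordMetric 𝓢 φ Y v w) 0 = _ := h1.fderiv
    rw [h2]
    simp
  have hs (u v w : E4) : fderiv ℝ (coordG 𝓢 φ) 0 u v w = fderiv ℝ (coordG 𝓢 φ) 0 u w v := by
    rw [← hd, ← hd]
    simp_rw [coordMetric_symm _ v w]
  have hdiag (v w : E4) : christoffel (coordMetric 𝓢 φ) 0 v v w = 0 := by
    have h1 := hφ.geodesic v 0 (by simpa using hφ.zero_mem_target)
    rw [geodesicEquation_smul_iff coordMetric_zero_left] at h1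
    simpa using h1 w
  have h1 := hdiag (u + v) w
  have h2 := hdiag u w
  have h3 := hdiag v w
  simp only [christoffel, hd, map_add, add_apply] at h1 h2 h3 ⊢
  have h4 := hs w u v
  linarith

lemma IsNormalChart.fderiv_coordG {p : M} (hφ : IsNormalChart 𝓢 p φ) :
    fderiv ℝ (coordG 𝓢 φ) 0 = 0 := by
  have hG := hφ.smoothNear_coordG.differentiableAt
  have hd (u v w : E4) : fderiv ℝ (fun Y ↦ coordMetric 𝓢 φ Y v w) 0 u =
      fderiv ℝ (coordG 𝓢 φ) 0 u v w := by
    have h1 := (hG.hasFDerivAt.clm_apply (hasFDerivAt_const v (0 : E4))).clm_apply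
      (hasFDerivAt_const w (0 : E4))
    have h2 : fderiv ℝ (fun Y ↦ coordMetric 𝓢 φ Y v w) 0 = _ := h1.fderiv
    rw [h2]
    simp
  have hs (u v w : E4) : fderiv ℝ (coordG 𝓢 φ) 0 u v w = fderiv ℝ (coordG 𝓢 φ) 0 u w v := by
    rw [← hd, ← hd]
    simp_rw [coordMetric_symm _ v w]
  ext1 u
  ext1 v
  ext1 w
  have h1 := hφ.christoffel_zero u v w
  have h2 := hφ.christoffel_zero u w v
  simp only [christoffel, hd] at h1 h2
  have h3 := hs v u w
  have h4 := hs u v w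
  have h5 := hs w u v
  simp only [zero_apply]
  linarith

lemma IsPinchPoint.pinchModel {τ : M → ℝ} {U : Set M} {f : Fin 2 → M → ℝ} {p : M}
    (hp : IsPinchPoint 𝓢 τ U f p) (hφ : IsAdaptedNormalChart 𝓢 τ p φ) :
    PinchModel (coordG 𝓢 φ) (τ ∘ φ.symm) (fun A ↦ f A ∘ φ.symm) := by
  have hat := hφ.mem_atlas
  have h0 := hφ.zero_mem_target
  obtain rfl := hφ.symm_zero
  have htgt : ∀ᶠ X in 𝓝 (0 : E4), X ∈ φ.target := φ.open_target.mem_nhds h0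
  have hsymm : ContMDiffOn (𝓡 4) (𝓡 4) ∞ φ.symm φ.target := contMDiffOn_symm_of_mem_maximalAtlas hat
  have hU : ∀ᶠ X in 𝓝 (0 : E4), φ.symm X ∈ U := by
    have h1 : ContinuousAt φ.symm 0 := φ.continuousAt_symm h0
    exact h1.eventually (hp.isOpen.mem_nhds hp.mem)
  have hτd : ∀ x, MDifferentiableAt (𝓡 4) 𝓘(ℝ, ℝ) τ x := fun x ↦
    hp.time.smooth.mdifferentiableAt (by simp)
  have hfd : ∀ A, ∀ x ∈ U, MDifferentiableAt (𝓡 4) 𝓘(ℝ, ℝ) (f A) x := fun A x hx ↦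
    ((hp.sheet A).smooth.contMDiffAt (hp.isOpen.mem_nhds hx)).mdifferentiableAt (by simp)
  have e0 : ∀ A v, fderiv ℝ (f A ∘ φ.symm) 0 v =
      diff (f A) (φ.symm 0) (mfderiv (𝓡 4) (𝓡 4) φ.symm 0 v) := fun A v ↦
    (diff_mfderiv_symm hat h0 (hfd A _ hU.self_of_nhds) v).symm
  refine
    { G_smooth := hφ.smoothNear_coordG
      h_smooth := ?_
      f_smooth := ?_
      G_symm := fun X v w ↦ coordMetric_symm X v w
      G_zero := fun v w ↦ hφ.metric_zero v w
      G_deriv := hφ.fderiv_coordG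
      h_zero := hp.time_zero
      h_tangent := hφ.tangent
      h_future := hφ.future
      spacelike := ?_
      f_zero := hp.mem_sheet
      null := ?_
      tangent := ?_ }
  · filter_upwards [htgt] with X hX
    exact (hp.time.smooth.contMDiffAt.comp X
      (hsymm.contMDiffAt (φ.open_target.mem_nhds hX))).contDiffAt
  · intro A
    filter_upwards [htgt, hU] with X hX hXU
    exact (((hp.sheet A).smooth.contMDiffAt (hp.isOpen.mem_nhds hXU)).comp X
      (hsymm.contMDiffAt (φ.open_target.mem_nhds hX))).contDiffAt
  · filter_upwards [htgt] with X hX w hw hw0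
    rw [← diff_mfderiv_symm hat hX (hτd _)] at hw
    refine hp.time.spacelike hw fun h ↦ hw0 ?_
    exact mfderiv_symm_injective hat hX (h.trans (map_zero _).symm)
  · intro A
    filter_upwards [htgt, hU] with X hX hXU hf
    obtain ⟨l, hl, hlv⟩ := (hp.sheet A).null _ hXU hf
    obtain ⟨l', hl'⟩ := exists_mfderiv_symm_eq hat hX l
    rw [hp.time.futureNull_iff] at hl
    refine ⟨l', ?_, ?_, ?_⟩
    · rw [← hl.1, ← hl']
      rfl
    · rw [← diff_mfderiv_symm hat hX (hτd _), hl']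
      exact hl.2
    · intro v
      rw [← diff_mfderiv_symm hat hX (hfd A _ hXU), ← hlv, ← hl']
      rfl
  · intro v h1 h2
    rw [e0] at h1 h2
    rw [← diff_mfderiv_symm hat h0 (hτd _)]
    exact hp.tangent _ h1 h2

end Chart

/-! ### Splitting coordinates -/

variable {M : Type*} [TopologicalSpace M] [ChartedSpace E4 M] [IsManifold (𝓡 4) ∞ M]
  {𝓢 : Spacetime M} {φ ψ : OpenPartialHomeomorph M E4} {τ : M → ℝ} {p : M} {V W : Set M}
  {G : E4 → Form} {h : E4 → ℝ} {F : Fin 2 → Space → ℝ} {T : ℝ × Space → ℝ}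
  {Z : Fin 2 → ℝ × Plane → ℝ} {ζ S : Plane → ℝ} {η : OpenPartialHomeomorph Plane Plane}
  {D : Set Plane} {Δ : LocalData} {e : Plane ≃L[ℝ] Plane} {a ε₀ ε₁ τ₁ : ℝ}

/-- The point with time coordinate `t` and spatial coordinates `y`, as a linear map. -/
def ptL : ℝ × Space →L[ℝ] E4 := LinearMap.toContinuousLinearMap
  { toFun := fun u ↦ !₂[u.1, u.2 0, u.2 1, u.2 2]
    map_add' := fun u v ↦ by ext i; fin_cases i <;> simp
    map_smul' := fun c u ↦ by ext i; fin_cases i <;> simp }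

def pt (t : ℝ) (y : Space) : E4 := ptL (t, y)

def spatialL : E4 →L[ℝ] Space := LinearMap.toContinuousLinearMap
  { toFun := spatial
    map_add' := fun u v ↦ by ext i; fin_cases i <;> simp [spatial]
    map_smul' := fun c u ↦ by ext i; fin_cases i <;> simp [spatial] }

def transverseL : E4 →L[ℝ] Plane := LinearMap.toContinuousLinearMap
  { toFun := transverse
    map_add' := fun u v ↦ by ext i; fin_cases i <;> simp [transverse]
    map_smul' := fun c u ↦ by ext i; fin_cases i <;> simp [transverse] }

/-- The spatial point with transverse coordinates `x` and third coordinate `z`, as a linear map. -/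
def sptL : Plane × ℝ →L[ℝ] Space := LinearMap.toContinuousLinearMap
  { toFun := fun u ↦ !₂[u.1 0, u.1 1, u.2]
    map_add' := fun u v ↦ by ext i; fin_cases i <;> simp
    map_smul' := fun c u ↦ by ext i; fin_cases i <;> simp }

def spt (x : Plane) (z : ℝ) : Space := sptL (x, z)

lemma spatialL_apply (X : E4) : spatialL X = spatial X := rfl

lemma transverseL_apply (X : E4) : transverseL X = transverse X := rfl

@[simp] theorem pt_zero' (t : ℝ) (y : Space) : pt t y 0 = t := rfl
@[simp] theorem pt_one' (t : ℝ) (y : Space) : pt t y 1 = y 0 := rfl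
@[simp] theorem pt_two' (t : ℝ) (y : Space) : pt t y 2 = y 1 := rfl
@[simp] theorem pt_three' (t : ℝ) (y : Space) : pt t y 3 = y 2 := rfl
@[simp] theorem spt_zero' (x : Plane) (z : ℝ) : spt x z 0 = x 0 := rfl
@[simp] theorem spt_one' (x : Plane) (z : ℝ) : spt x z 1 = x 1 := rfl
@[simp] theorem spt_two' (x : Plane) (z : ℝ) : spt x z 2 = z := rfl
@[simp] theorem spatial_zero' (X : E4) : spatial X 0 = X 1 := rfl
@[simp] theorem spatial_one' (X : E4) : spatial X 1 = X 2 := rfl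
@[simp] theorem spatial_two' (X : E4) : spatial X 2 = X 3 := rfl
@[simp] theorem transverse_zero' (X : E4) : transverse X 0 = X 1 := rfl
@[simp] theorem transverse_one' (X : E4) : transverse X 1 = X 2 := rfl

@[simp] theorem spatial_pt (t : ℝ) (y : Space) : spatial (pt t y) = y := by
  ext i; fin_cases i <;> rfl

@[simp] theorem pt_spatial (X : E4) : pt (X 0) (spatial X) = X := by
  ext i; fin_cases i <;> rfl

@[simp] theorem transverse_pt_spt (t : ℝ) (x : Plane) (z : ℝ) :
    transverse (pt t (spt x z)) = x := by
  ext i; fin_cases i <;> rfl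

@[simp] theorem spt_transverse (X : E4) : spt (transverse X) (X 3) = spatial X := by
  ext i; fin_cases i <;> rfl

@[simp] theorem pt_zero_zero : pt 0 0 = 0 := map_zero ptL

@[simp] theorem spt_zero_zero : spt 0 0 = 0 := map_zero sptL

@[simp] theorem spatial_zero_eq : spatial 0 = 0 := map_zero spatialL

@[simp] theorem transverse_zero_eq : transverse 0 = 0 := map_zero transverseL

lemma abs_apply_le_norm {n : ℕ} (x : EuclideanSpace ℝ (Fin n)) (i : Fin n) : |x i| ≤ ‖x‖ :=
  PiLp.norm_apply_le x i

lemma sq_norm_pt (t : ℝ) (y : Space) : ‖pt t y‖ ^ 2 = t ^ 2 + ‖y‖ ^ 2 := by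
  simp only [EuclideanSpace.norm_sq_eq, Fin.sum_univ_four, Fin.sum_univ_three, Real.norm_eq_abs,
    sq_abs, pt_zero', pt_one', pt_two', pt_three']
  ring

lemma sq_norm_spt (x : Plane) (z : ℝ) : ‖spt x z‖ ^ 2 = ‖x‖ ^ 2 + z ^ 2 := by
  simp only [EuclideanSpace.norm_sq_eq, Fin.sum_univ_two, Fin.sum_univ_three, Real.norm_eq_abs,
    sq_abs, spt_zero', spt_one', spt_two']

lemma norm_le_norm_pt (t : ℝ) (y : Space) : ‖y‖ ≤ ‖pt t y‖ := by
  refine abs_le_of_sq_le_sq' ?_ (by positivity) |>.2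
  rw [sq_norm_pt]
  nlinarith [sq_nonneg t]

lemma norm_le_norm_spt (x : Plane) (z : ℝ) : ‖x‖ ≤ ‖spt x z‖ := by
  refine abs_le_of_sq_le_sq' ?_ (by positivity) |>.2
  rw [sq_norm_spt]
  nlinarith [sq_nonneg z]

lemma norm_spatial_le (X : E4) : ‖spatial X‖ ≤ ‖X‖ := by
  conv_rhs => rw [← pt_spatial X]
  exact norm_le_norm_pt _ _

lemma norm_transverse_le (X : E4) : ‖transverse X‖ ≤ ‖X‖ :=
  (norm_le_norm_spt _ (X 3)).trans (by rw [spt_transverse]; exact norm_spatial_le X)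

lemma minkowski_eq (v w : E4) :
    minkowski v w = -(v 0 * w 0) + inner ℝ (spatial v) (spatial w) := by
  simp only [minkowski, PiLp.inner_apply, Fin.sum_univ_three, spatial_zero', spatial_one',
    spatial_two', RCLike.inner_apply, conj_trivial]
  ring

lemma e4_zero_eq : e4 0 = pt 1 0 := by
  ext i; fin_cases i <;> simp [e4]

lemma pt_add (s t : ℝ) (y z : Space) : pt (s + t) (y + z) = pt s y + pt t z :=
  map_add ptL (s, y) (t, z)

lemma pt_smul (c t : ℝ) (y : Space) : pt (c * t) (c • y) = c • pt t y :=
  map_smul ptL c (t, y)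

lemma pt_eq_add_smul (t s : ℝ) (y : Space) : pt t y = pt s y + (t - s) • e4 0 := by
  rw [e4_zero_eq, ← pt_smul, ← pt_add]
  simp

/-! ### Raising indices -/

lemma isInvertible_of_injective {B : Form} (hB : ∀ v, B v = 0 → v = 0) :
    B.IsInvertible := by
  have hinj : Function.Injective (B : E4 →ₗ[ℝ] E4 →L[ℝ] ℝ) :=
    (injective_iff_map_eq_zero _).2 hB
  have hfin : Module.finrank ℝ E4 = Module.finrank ℝ (E4 →L[ℝ] ℝ) := by
    rw [← (LinearMap.toContinuousLinearMap (𝕜 := ℝ) (E := E4) (F' := ℝ)).finrank_eq]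
    exact Subspace.dual_finrank_eq.symm
  refine ⟨(LinearEquiv.ofInjectiveOfFinrankEq _ hinj hfin).toContinuousLinearEquiv, ?_⟩
  ext v w
  simp
  rfl

lemma minkowski_nondegenerate {v : E4} (h : ∀ w, minkowski v w = 0) : v = 0 := by
  have h0 := h (e4 0)
  have h1 := h (e4 1)
  have h2 := h (e4 2)
  have h3 := h (e4 3)
  simp [minkowski, e4] at h0 h1 h2 h3
  ext i
  fin_cases i <;> simp [h0, h1, h2, h3]

namespace PinchModel

variable {f : Fin 2 → E4 → ℝ}

lemma isInvertible_zero (m : PinchModel G h f) : (G 0).IsInvertible := by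
  refine isInvertible_of_injective fun v hv ↦ minkowski_nondegenerate fun w ↦ ?_
  rw [← m.G_zero, hv]
  rfl

lemma eventually_isInvertible (m : PinchModel G h f) : ∀ᶠ X in 𝓝 0, (G X).IsInvertible := by
  obtain ⟨e, he⟩ := m.isInvertible_zero
  have := ContinuousLinearEquiv.nhds e
  rw [he] at this
  filter_upwards [m.G_smooth.continuousAt.eventually this] with y hy
  obtain ⟨e', he'⟩ := hy
  exact ⟨e', he'⟩

lemma eventually_inverse_apply (m : PinchModel G h f) :
    ∀ᶠ X in 𝓝 0, ∀ β : E4 →L[ℝ] ℝ, G X ((G X).inverse β) = β := by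
  filter_upwards [m.eventually_isInvertible] with X hX β
  obtain ⟨e, he⟩ := hX
  rw [← he, ContinuousLinearMap.inverse_equiv]
  simp

lemma fderiv_h_zero (m : PinchModel G h f) (v : E4) :
    fderiv ℝ h 0 v = fderiv ℝ h 0 (e4 0) * v 0 := by
  have h1 : v = pt 0 (spatial v) + v 0 • e4 0 := by
    conv_lhs => rw [← pt_spatial v, pt_eq_add_smul _ 0]
    simp
  conv_lhs => rw [h1]
  rw [map_add, map_smul, m.h_tangent _ (by simp), zero_add, smul_eq_mul, mul_comm]

/-- The future-directed null normal of a sheet at the origin. -/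
lemma exists_normal (m : PinchModel G h f) (A : Fin 2) :
    ∃ (κ : ℝ) (n : Space), 0 < κ ∧ ‖n‖ = 1 ∧
      ∀ v, fderiv ℝ (f A) 0 v = κ * (-v 0 + inner ℝ n (spatial v)) := by
  obtain ⟨l, hl, hhl, hlv⟩ := (m.null A).self_of_nhds (m.f_zero A)
  rw [m.fderiv_h_zero] at hhl
  have hl0 : 0 < l 0 := pos_of_mul_pos_right hhl m.h_future.le
  rw [m.G_zero, minkowski_eq, real_inner_self_eq_norm_sq] at hl
  have hn : ‖spatial l‖ = l 0 := by
    have : ‖spatial l‖ ^ 2 = l 0 ^ 2 := by linarith [sq (l 0)]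
    exact (sq_eq_sq₀ (norm_nonneg _) hl0.le).1 this
  refine ⟨l 0, (l 0)⁻¹ • spatial l, hl0, ?_, ?_⟩
  · rw [norm_smul, hn, norm_inv, Real.norm_eq_abs, abs_of_pos hl0]
    exact inv_mul_cancel₀ hl0.ne'
  · intro v
    rw [← hlv, m.G_zero, minkowski_eq, inner_smul_left]
    simp
    field_simp

/-- At the origin the two sheets move in opposite directions. -/
lemma exists_opposite_normals (m : PinchModel G h f) :
    ∃ (κ : Fin 2 → ℝ) (n : Fin 2 → Space), (∀ A, 0 < κ A) ∧ ‖n 0‖ = 1 ∧ n 1 = - n 0 ∧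
      ∀ A v, fderiv ℝ (f A) 0 v = κ A * (-v 0 + inner ℝ (n A) (spatial v)) := by
  choose κ n hκ hn hf using m.exists_normal
  refine ⟨κ, n, hκ, hn 0, ?_, hf⟩
  set q := inner ℝ (n 0) (n 1) with hq
  have h0 : inner ℝ (n 0) (n 0) = (1 : ℝ) := by rw [real_inner_self_eq_norm_sq, hn]; norm_num
  have h1 : inner ℝ (n 1) (n 1) = (1 : ℝ) := by rw [real_inner_self_eq_norm_sq, hn]; norm_num
  have h2 := m.tangent (pt (1 + q) (n 0 + n 1))
    (by rw [hf, spatial_pt, pt_zero', inner_add_right, h0, ← hq]; ring)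
    (by rw [hf, spatial_pt, pt_zero', inner_add_right, h1, real_inner_comm, ← hq]; ring)
  rw [m.fderiv_h_zero] at h2
  have h3 : 1 + q = 0 := by
    rcases mul_eq_zero.1 h2 with h | h
    · exact absurd h m.h_future.ne'
    · simpa using h
  have h4 : ‖n 1 + n 0‖ ^ 2 = 0 := by
    rw [← real_inner_self_eq_norm_sq, inner_add_left, inner_add_right, inner_add_right, h0, h1,
      real_inner_comm (n 0) (n 1), ← hq]
    linarith
  exact eq_neg_of_add_eq_zero_left (norm_eq_zero.1 (by simpa using h4))

end PinchModel

/-- `F` describes the null sheet `f = 0` as a graph `t = F y` near the origin, where `f`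
is negative above the graph. -/
structure IsSheetGraph (f : E4 → ℝ) (F : Space → ℝ) : Prop where
  smooth : SmoothNear F 0
  zero : F 0 = 0
  apply_graph : ∀ᶠ y in 𝓝 0, f (pt (F y) y) = 0
  neg_iff : ∀ᶠ X in 𝓝 0, f X < 0 ↔ F (spatial X) < X 0
  eq_iff : ∀ᶠ X in 𝓝 0, f X = 0 ↔ X 0 = F (spatial X)

lemma smoothNear_ptL {u : ℝ × Space} : SmoothNear ptL u := .of_contDiff ptL.contDiff

lemma exists_isSheetGraph {f : E4 → ℝ} (hf : SmoothNear f 0) (h0 : f 0 = 0)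
    (hd : fderiv ℝ f 0 (e4 0) < 0) : ∃ F, IsSheetGraph f F := by
  have hsw : HasFDerivAt (fun u : Space × ℝ ↦ pt u.2 u.1)
      (ptL.comp (snd ℝ Space ℝ |>.prod (fst ℝ Space ℝ))) 0 :=
    (ptL.comp (snd ℝ Space ℝ |>.prod
      (fst ℝ Space ℝ))).hasFDerivAt
  have hsws : SmoothNear (fun u : Space × ℝ ↦ pt u.2 u.1) 0 :=
    .of_contDiff (ptL.comp (snd ℝ Space ℝ |>.prod
      (fst ℝ Space ℝ))).contDiff
  have hk : SmoothNear (fun u : Space × ℝ ↦ -f (pt u.2 u.1)) 0 := by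
    refine (SmoothNear.comp (g := f) ?_ hsws).neg
    simpa using hf
  have hkd : HasFDerivAt (fun u : Space × ℝ ↦ -f (pt u.2 u.1)) (-(fderiv ℝ f 0).comp (ptL.comp
      (snd ℝ Space ℝ |>.prod (fst ℝ Space ℝ)))) 0 := by
    have h1 : HasFDerivAt f (fderiv ℝ f 0) ((fun u : Space × ℝ ↦ pt u.2 u.1) 0) := by
      simpa using hf.differentiableAt.hasFDerivAt
    exact (HasFDerivAt.comp (f := fun u : Space × ℝ ↦ pt u.2 u.1) (0 : Space × ℝ) h1 hsw).neg
  obtain ⟨F, hFs, hF0, hFk, hF⟩ := exists_implicit hk (by simp [h0]) (by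
    rw [hkd.fderiv]
    simp only [neg_apply, ContinuousLinearMap.comp_apply]
    have : ptL (((snd ℝ Space ℝ).prod (fst ℝ Space ℝ))
      ((0 : Space), (1 : ℝ))) = e4 0 := by rw [e4_zero_eq]; rfl
    rw [this]
    linarith)
  have ht : Tendsto (fun X : E4 ↦ (spatial X, X 0)) (𝓝 0) (𝓝 (0 : Space × ℝ)) := by
    have : Continuous (fun X : E4 ↦ (spatial X, X 0)) :=
      spatialL.continuous.prodMk (by fun_prop)
    have h2 := this.tendsto 0
    rwa [spatial_zero_eq] at h2
  refine ⟨F, hFs, hF0, ?_, ?_, ?_⟩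
  · filter_upwards [hFk] with y hy
    simpa using hy
  · filter_upwards [ht.eventually hF] with X hX
    simpa using hX.1
  · filter_upwards [ht.eventually hF] with X hX
    simpa using hX.2

namespace IsSheetGraph

variable {f : E4 → ℝ} {F : Space → ℝ}

lemma smoothNear_graph (hF : IsSheetGraph f F) : SmoothNear (fun y ↦ pt (F y) y) 0 :=
  SmoothNear.comp (g := ptL) smoothNear_ptL (hF.smooth.prodMk (.of_contDiff contDiff_id))

lemma tendsto_graph (hF : IsSheetGraph f F) : Tendsto (fun y ↦ pt (F y) y) (𝓝 0) (𝓝 0) := by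
  have := hF.smoothNear_graph.continuousAt.tendsto
  simpa [hF.zero] using this

lemma hasFDerivAt_graph {y : Space} (hF : DifferentiableAt ℝ F y) :
    HasFDerivAt (fun y ↦ pt (F y) y)
      (ptL.comp ((fderiv ℝ F y).prod (ContinuousLinearMap.id ℝ Space))) y :=
  ptL.hasFDerivAt.comp y (hF.hasFDerivAt.prodMk (hasFDerivAt_id y))

/-- On the sheet, `df` is proportional to `d(t - F)`. -/
lemma eventually_fderiv_eq (hF : IsSheetGraph f F) (hf : SmoothNear f 0) :
    ∀ᶠ y in 𝓝 0, ∀ v, fderiv ℝ f (pt (F y) y) v =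
      fderiv ℝ f (pt (F y) y) (e4 0) * (v 0 - fderiv ℝ F y (spatial v)) := by
  filter_upwards [hF.smooth, hF.tendsto_graph.eventually hf,
    eventually_eventually_nhds.2 hF.apply_graph] with y hFy hfy hy v
  have h1 := hasFDerivAt_graph (hFy.differentiableAt (by simp))
  have h2 := HasFDerivAt.comp (f := fun y ↦ pt (F y) y) y
    (hfy.differentiableAt (by simp)).hasFDerivAt h1
  have h3 : HasFDerivAt (f ∘ fun y ↦ pt (F y) y) (0 : Space →L[ℝ] ℝ) y :=
    (hasFDerivAt_const (0 : ℝ) y).congr_of_eventuallyEq hy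
  have h4 := DFunLike.congr_fun (h2.unique h3) (spatial v)
  simp only [ContinuousLinearMap.comp_apply, ContinuousLinearMap.prod_apply, zero_apply,
    ContinuousLinearMap.id_apply] at h4
  have hv : v = pt (fderiv ℝ F y (spatial v)) (spatial v)
      + (v 0 - fderiv ℝ F y (spatial v)) • e4 0 := by
    rw [← pt_eq_add_smul, pt_spatial]
  conv_lhs => rw [hv, map_add, map_smul]
  rw [show fderiv ℝ f (pt (F y) y) (pt (fderiv ℝ F y (spatial v)) (spatial v)) = 0 from h4]
  simp [mul_comm]

end IsSheetGraph

namespace PinchModel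

variable {f : Fin 2 → E4 → ℝ}

lemma fderiv_sheet_zero (m : PinchModel G h f) {A : Fin 2} {F : Space → ℝ}
    (hF : IsSheetGraph (f A) F) {κ : ℝ} {n : Space} (hκ : 0 < κ)
    (hn : ∀ v, fderiv ℝ (f A) 0 v = κ * (-v 0 + inner ℝ n (spatial v))) (w : Space) :
    fderiv ℝ F 0 w = inner ℝ n w := by
  have h1 := (hF.eventually_fderiv_eq (m.f_smooth A)).self_of_nhds (pt 0 w)
  rw [hF.zero, pt_zero_zero, hn, hn, e4_zero_eq] at h1
  simp at h1
  exact (h1.resolve_right hκ.ne').symm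

/-- The second-order part of the eikonal equation at the origin. -/
lemma eikonal (m : PinchModel G h f) {A : Fin 2} {F : Space → ℝ}
    (hF : IsSheetGraph (f A) F) {κ : ℝ} {n : Space} (hκ : 0 < κ)
    (hn : ∀ v, fderiv ℝ (f A) 0 v = κ * (-v 0 + inner ℝ n (spatial v))) (w : Space) :
    fderiv ℝ (fderiv ℝ F) 0 w n = 0 := by
  have hF1 := m.fderiv_sheet_zero hF hκ hn
  set P : Space → E4 := fun y ↦ pt (F y) y with hPdef
  have hP0 : P 0 = 0 := by simp [P, hF.zero]
  have hP : SmoothNear P 0 := hF.smoothNear_graph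
  set β : Space → E4 →L[ℝ] ℝ := fun y ↦ EuclideanSpace.proj 0 - (fderiv ℝ F y).comp spatialL
    with hβdef
  have hβs : SmoothNear β 0 := by
    filter_upwards [hF.smooth.fderiv] with y hy
    exact contDiffAt_const.sub (hy.clm_comp contDiffAt_const)
  have hβ : ∀ y v, β y v = v 0 - fderiv ℝ F y (spatial v) := fun y v ↦ rfl
  set Γ : Space → Form := fun y ↦ G (P y)
  have hΓ : SmoothNear Γ 0 := SmoothNear.comp (g := G) (by rw [hP0]; exact m.G_smooth) hP
  have hΓ' : HasFDerivAt Γ (0 : Space →L[ℝ] Form) 0 := by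
    have h1 : HasFDerivAt G (fderiv ℝ G 0) (P 0) := by
      rw [hP0]; exact m.G_smooth.differentiableAt.hasFDerivAt
    have h2 := HasFDerivAt.comp (g := G) (g' := fderiv ℝ G 0) (f := P) (0 : Space) h1 hP.differentiableAt.hasFDerivAt
    rw [m.G_deriv, ContinuousLinearMap.zero_comp] at h2
    exact h2
  set L : Space → E4 := fun y ↦ (Γ y).inverse (β y)
  have hΓ0 : Γ 0 = G 0 := by simp [Γ, hP0]
  have hLs : SmoothNear L 0 := (hΓ.clm_inverse (by rw [hΓ0]; exact m.isInvertible_zero)).clm_apply hβs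
  have hPt : Tendsto P (𝓝 0) (𝓝 0) := by simpa [hP0] using hP.continuousAt.tendsto
  have hI : ∀ᶠ y in 𝓝 0, Γ y (L y) = β y := by
    filter_upwards [hPt.eventually m.eventually_inverse_apply] with y hy
    exact hy (β y)
  have hneg : ∀ᶠ X in 𝓝 0, fderiv ℝ (f A) X (e4 0) < 0 := by
    have : ContinuousAt (fun X ↦ fderiv ℝ (f A) X (e4 0)) 0 :=
      (m.f_smooth A).fderiv.continuousAt.clm_apply continuousAt_const
    refine this.eventually_lt_const ?_
    change fderiv ℝ (f A) 0 (e4 0) < 0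
    rw [hn, e4_zero_eq]
    simpa using hκ
  have hII : ∀ᶠ y in 𝓝 0, β y (L y) = 0 := by
    filter_upwards [hI, hPt.eventually (m.null A), hF.apply_graph, hPt.eventually hneg,
      hF.eventually_fderiv_eq (m.f_smooth A), hPt.eventually m.eventually_isInvertible]
      with y hIy hnull h0 hlt hdf hinv
    obtain ⟨l, hl, -, hlv⟩ := hnull h0
    have h1 : G (P y) l = G (P y) (fderiv ℝ (f A) (P y) (e4 0) • L y) := by
      rw [map_smul]
      ext v
      have h2 : G (P y) (L y) = β y := hIy
      rw [hlv, h2]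
      exact hdf v
    have h3 : l = fderiv ℝ (f A) (P y) (e4 0) • L y := hinv.injective h1
    rw [← hIy]
    rw [h3] at hl
    simp only [map_smul, smul_apply, smul_eq_mul] at hl
    rcases mul_eq_zero.1 hl with h | h
    · exact absurd h hlt.ne
    · rcases mul_eq_zero.1 h with h | h
      · exact absurd h hlt.ne
      · exact h
  have hβ' : HasFDerivAt β (fderiv ℝ β 0) 0 := hβs.differentiableAt.hasFDerivAt
  have hβd w v : fderiv ℝ β 0 w v = - fderiv ℝ (fderiv ℝ F) 0 w (spatial v) := by
    have h1 := hF.smooth.fderiv.differentiableAt.hasFDerivAt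
    have h2 : HasFDerivAt β _ 0 :=
      (hasFDerivAt_const (EuclideanSpace.proj 0 : E4 →L[ℝ] ℝ) (0 : Space)).sub
        (h1.clm_comp (hasFDerivAt_const spatialL (0 : Space)))
    rw [h2.fderiv]
    simp [spatialL_apply]
  have hL' := hLs.differentiableAt.hasFDerivAt
  have e1 w v : minkowski (fderiv ℝ L 0 w) v = - fderiv ℝ (fderiv ℝ F) 0 w (spatial v) := by
    have h1 := hΓ'.clm_apply hL'
    have h2 := (h1.congr_of_eventuallyEq (hI.mono fun y hy ↦ hy.symm)).unique hβ'
    have h3 := DFunLike.congr_fun (DFunLike.congr_fun h2 w) v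
    rw [hβd] at h3
    rw [← h3, ← m.G_zero, ← hΓ0]
    simp
  have e2 w : fderiv ℝ β 0 w (L 0) + β 0 (fderiv ℝ L 0 w) = 0 := by
    have h1 := hβ'.clm_apply hL'
    have h2 := (h1.congr_of_eventuallyEq (f₁ := fun _ ↦ (0 : ℝ)) (hII.mono fun y hy ↦ hy.symm)).unique
      (hasFDerivAt_const (0 : ℝ) (0 : Space))
    have h3 := DFunLike.congr_fun h2 w
    simp at h3
    linarith
  have hL0 : spatial (L 0) = - n := by
    refine ext_inner_right ℝ fun u ↦ ?_
    have h1 := DFunLike.congr_fun hI.self_of_nhds (pt 0 u)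
    rw [hΓ0, m.G_zero, minkowski_eq, hβ, hF1] at h1
    simp at h1
    rw [h1, inner_neg_left]
  have h0 : fderiv ℝ L 0 w 0 = 0 := by
    have := e1 w (e4 0)
    rw [minkowski_eq, e4_zero_eq] at this
    simpa using this
  have hsp u : inner ℝ (spatial (fderiv ℝ L 0 w)) u = - fderiv ℝ (fderiv ℝ F) 0 w u := by
    have := e1 w (pt 0 u)
    rw [minkowski_eq] at this
    simpa using this
  have h2 := e2 w
  rw [hβd, hL0, hβ, h0, hF1, real_inner_comm, hsp] at h2
  simp at h2
  linarith

end PinchModel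

/-! ### Rotations of the spatial coordinates -/

/-- The action of a matrix on spatial coordinates. -/
def matS (R : Matrix (Fin 3) (Fin 3) ℝ) : Space →L[ℝ] Space := LinearMap.toContinuousLinearMap
  { toFun := fun y ↦ !₂[∑ j, R 0 j * y j, ∑ j, R 1 j * y j, ∑ j, R 2 j * y j]
    map_add' := fun u v ↦ by
      ext i; fin_cases i <;> simp [Fin.sum_univ_three] <;> ring
    map_smul' := fun c u ↦ by
      ext i; fin_cases i <;> simp [Fin.sum_univ_three] <;> ring }

lemma matS_apply (R : Matrix (Fin 3) (Fin 3) ℝ) (y : Space) (i : Fin 3) :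
    matS R y i = ∑ j, R i j * y j := by
  fin_cases i <;> rfl

lemma matS_mul_apply {R T : Matrix (Fin 3) (Fin 3) ℝ} (h : R * T = 1) (y : Space) :
    matS R (matS T y) = y := by
  ext i
  simp only [matS_apply, Finset.mul_sum]
  rw [Finset.sum_comm]
  have : ∀ k, ∑ j, R i j * (T j k * y k) = (1 : Matrix (Fin 3) (Fin 3) ℝ) i k * y k := by
    intro k
    rw [← h, Matrix.mul_apply, Finset.sum_mul]
    exact Finset.sum_congr rfl fun j _ ↦ by ring
  simp only [this, Matrix.one_apply]
  simp

lemma inner_matS (R : Matrix (Fin 3) (Fin 3) ℝ) (x y : Space) :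
    inner ℝ (matS R x) y = inner ℝ x (matS R.transpose y) := by
  simp only [PiLp.inner_apply, matS_apply, RCLike.inner_apply, conj_trivial, Matrix.transpose_apply,
    Fin.sum_univ_three]
  ring

/-- The action of a spatial matrix on spacetime coordinates. -/
def matL (R : Matrix (Fin 3) (Fin 3) ℝ) : E4 →L[ℝ] E4 :=
  ptL.comp ((EuclideanSpace.proj 0 : E4 →L[ℝ] ℝ).prod ((matS R).comp spatialL))

lemma matL_apply (R : Matrix (Fin 3) (Fin 3) ℝ) (X : E4) :
    matL R X = pt (X 0) (matS R (spatial X)) := rfl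

lemma matL_mul_apply {R T : Matrix (Fin 3) (Fin 3) ℝ} (h : R * T = 1) (X : E4) :
    matL R (matL T X) = X := by
  simp [matL_apply, matS_mul_apply h]

/-- The linear automorphism of spacetime coordinates given by a spatial rotation. -/
def rotE {R : Matrix (Fin 3) (Fin 3) ℝ} (h : R * R.transpose = 1) : E4 ≃L[ℝ] E4 :=
  ContinuousLinearEquiv.equivOfInverse (matL R) (matL R.transpose)
    (matL_mul_apply (mul_eq_one_comm.1 h)) (matL_mul_apply h)

lemma rotE_symm_apply {R : Matrix (Fin 3) (Fin 3) ℝ} (h : R * R.transpose = 1) (X : E4) :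
    (rotE h).symm X = pt (X 0) (matS R.transpose (spatial X)) := rfl

lemma minkowski_rotE_symm {R : Matrix (Fin 3) (Fin 3) ℝ} (h : R * R.transpose = 1) (v w : E4) :
    minkowski ((rotE h).symm v) ((rotE h).symm w) = minkowski v w := by
  simp only [minkowski_eq, rotE_symm_apply, spatial_pt, pt_zero', inner_matS,
    Matrix.transpose_transpose, matS_mul_apply h]

section Chart

lemma transHomeomorph_mem_maximalAtlas (hφ : φ ∈ 𝒜 M)
    (L : E4 ≃L[ℝ] E4) :
    φ.transHomeomorph L.toHomeomorph ∈ 𝒜 M := by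
  rw [IsManifold.mem_maximalAtlas_iff_contMDiffOn]
  constructor
  · exact L.contDiff.contMDiff.comp_contMDiffOn (contMDiffOn_of_mem_maximalAtlas hφ)
  · exact (contMDiffOn_symm_of_mem_maximalAtlas hφ).comp L.symm.contDiff.contMDiff.contMDiffOn
      (fun X hX ↦ hX)

lemma coordMetric_transHomeomorph (hφ : φ ∈ 𝒜 M)
    (L : E4 ≃L[ℝ] E4) {X : E4} (hX : L.symm X ∈ φ.target) (v w : E4) :
    coordMetric 𝓢 (φ.transHomeomorph L.toHomeomorph) X v w =
      coordMetric 𝓢 φ (L.symm X) (L.symm v) (L.symm w) := by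
  have h1 := (mdifferentiable_of_mem_maximalAtlas hφ).mdifferentiableAt_symm hX
  have h2 : MDifferentiableAt (𝓡 4) (𝓡 4) L.symm X :=
    L.symm.differentiableAt.mdifferentiableAt
  have h3 (v : E4) : mfderiv (𝓡 4) (𝓡 4) (φ.transHomeomorph L.toHomeomorph).symm X v =
      mfderiv (𝓡 4) (𝓡 4) φ.symm (L.symm X) (L.symm v) := by
    have h4 : mfderiv (𝓡 4) (𝓡 4) (φ.symm ∘ L.symm) X = _ := mfderiv_comp X h1 h2
    have h5 : mfderiv (𝓡 4) (𝓡 4) L.symm X = (L.symm : E4 →L[ℝ] E4) := by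
      rw [mfderiv_eq_fderiv]
      exact L.symm.fderiv
    rw [h5] at h4
    exact DFunLike.congr_fun h4 v
  exact congrArg₂ (fun a b : E4 ↦ 𝓢.metric (φ.symm (L.symm X)) a b) (h3 v) (h3 w)

lemma christoffel_transHomeomorph (hφ : φ ∈ 𝒜 M)
    (L : E4 ≃L[ℝ] E4) {X : E4} (hX : L.symm X ∈ φ.target) (u v w : E4) :
    christoffel (coordMetric 𝓢 (φ.transHomeomorph L.toHomeomorph)) X u v w =
      christoffel (coordMetric 𝓢 φ) (L.symm X) (L.symm u) (L.symm v) (L.symm w) := by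
  have key (a b c : E4) : fderiv ℝ (fun Y ↦ coordMetric 𝓢 (φ.transHomeomorph L.toHomeomorph) Y a b) X c =
        fderiv ℝ (fun Y ↦ coordMetric 𝓢 φ Y (L.symm a) (L.symm b)) (L.symm X) (L.symm c) := by
    have h1 : (fun Y ↦ coordMetric 𝓢 (φ.transHomeomorph L.toHomeomorph) Y a b) =ᶠ[𝓝 X]
        (fun Y ↦ coordMetric 𝓢 φ Y (L.symm a) (L.symm b)) ∘ L.symm := by
      filter_upwards [L.symm.continuous.continuousAt.preimage_mem_nhds
        (φ.open_target.mem_nhds hX)] with Y hY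
      exact coordMetric_transHomeomorph hφ L hY a b
    rw [h1.fderiv_eq, L.symm.comp_right_fderiv]
    rfl
  simp only [christoffel, key]

/-- The chart obtained from `φ` by a rotation of the spatial coordinates. -/
def rotChart (φ : OpenPartialHomeomorph M E4) {R : Matrix (Fin 3) (Fin 3) ℝ}
    (h : R * R.transpose = 1) : OpenPartialHomeomorph M E4 :=
  φ.transHomeomorph (rotE h).toHomeomorph

lemma isSpatialRotation_rotChart {R : Matrix (Fin 3) (Fin 3) ℝ} (h : R * R.transpose = 1)
    (hdet : R.det = 1) : IsSpatialRotation φ (rotChart φ h) := by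
  refine ⟨rfl, R, ?_, fun q hq ↦ ⟨rfl, fun i ↦ ?_⟩⟩
  · rw [Matrix.mem_specialOrthogonalGroup_iff, Matrix.mem_orthogonalGroup_iff]
    exact ⟨h, hdet⟩
  · fin_cases i
    all_goals
      change ∑ j, _ * spatial (φ q) j = _
      simp [Fin.sum_univ_three]

lemma IsAdaptedNormalChart.rotChart {τ : M → ℝ} {p : M} (hφ : IsAdaptedNormalChart 𝓢 τ p φ)
    {R : Matrix (Fin 3) (Fin 3) ℝ} (h : R * R.transpose = 1) :
    IsAdaptedNormalChart 𝓢 τ p (rotChart φ h) := by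
  have hfd v : fderiv ℝ (τ ∘ (Crease.rotChart φ h).symm) 0 v =
      fderiv ℝ (τ ∘ φ.symm) 0 ((rotE h).symm v) := by
    have : τ ∘ (Crease.rotChart φ h).symm = (τ ∘ φ.symm) ∘ (rotE h).symm := rfl
    rw [this, (rotE h).symm.comp_right_fderiv, map_zero]
    rfl
  refine
    { mem_atlas := transHomeomorph_mem_maximalAtlas hφ.mem_atlas _
      mem_source := hφ.mem_source
      map_zero := ?_
      starConvex := ?_
      metric_zero := ?_
      geodesic := ?_
      tangent := ?_
      future := ?_ }
  · change rotE h (φ p) = 0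
    rw [hφ.map_zero, map_zero]
  · have := hφ.starConvex
    intro X hX a b ha hb hab
    have h1 := this hX ha hb hab
    change (rotE h).symm (a • 0 + b • X) ∈ φ.target
    simpa using h1
  · intro v w
    rw [Crease.rotChart, coordMetric_transHomeomorph hφ.mem_atlas _
      (by simpa using hφ.zero_mem_target), map_zero, hφ.metric_zero, minkowski_rotE_symm]
  · intro v s hs
    rw [geodesicEquation_smul_iff coordMetric_zero_left]
    intro w
    have hs' : (rotE h).symm (s • v) ∈ φ.target := hs
    rw [Crease.rotChart, christoffel_transHomeomorph hφ.mem_atlas _ hs']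
    rw [map_smul] at hs' ⊢
    exact (geodesicEquation_smul_iff coordMetric_zero_left _ _).1
      (hφ.geodesic ((rotE h).symm v) s hs') _
  · intro v hv
    rw [hfd]
    exact hφ.tangent _ hv
  · rw [hfd]
    convert! hφ.future using 2
    rw [rotE_symm_apply, e4_zero_eq]
    simp

end Chart

/-- There is a rotation of space taking a given unit vector to the third coordinate direction, and
making a given symmetric bilinear form diagonal in the first two directions. -/
lemma exists_rotation {n : Space} (hn : ‖n‖ = 1) (H : Space →L[ℝ] Space →L[ℝ] ℝ)
    (hH : ∀ v w, H v w = H w v) :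
    ∃ R : Matrix (Fin 3) (Fin 3) ℝ, R * R.transpose = 1 ∧ R.det = 1 ∧ (∀ j, R 2 j = n j) ∧
      H (matS R.transpose (single 0 1))
        (matS R.transpose (single 1 1)) = 0 := by
  obtain ⟨b, hb⟩ := Orthonormal.exists_orthonormalBasis_extension_of_card_eq (𝕜 := ℝ) (E := Space)
    (ι := Fin 3) (by simp) (v := fun _ ↦ n) (s := {2}) (by
      constructor
      · rintro ⟨i, hi⟩; simpa using hn
      · rintro ⟨i, hi⟩ ⟨j, hj⟩ hij
        simp at hi hj
        exact absurd (Subtype.ext (hi.trans hj.symm)) hij)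
  have hb2 : b 2 = n := hb 2 rfl
  have hbo := b.orthonormal
  have hin : ∀ i j, inner ℝ (b i) (b j) = if i = j then (1 : ℝ) else 0 :=
    fun i j ↦ orthonormal_iff_ite.1 hbo i j
  obtain ⟨θ, -, hθ⟩ : (0 : ℝ) ∈ (fun θ : ℝ ↦ H (Real.cos θ • b 0 + Real.sin θ • b 1)
      (-Real.sin θ • b 0 + Real.cos θ • b 1)) '' uIcc 0 (Real.pi / 2) := by
    refine intermediate_value_uIcc ?_ ?_
    · apply Continuous.continuousOn
      fun_prop
    · simp only [Real.cos_zero, Real.sin_zero, Real.cos_pi_div_two, Real.sin_pi_div_two]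
      simp
      rw [hH (b 1) (b 0), mem_uIcc]
      rcases le_total 0 (H (b 0) (b 1)) with h | h
      · right; constructor <;> linarith
      · left; constructor <;> linarith
  set c := Real.cos θ
  set s := Real.sin θ
  have hcs : c * c + s * s = 1 := by
    have := Real.cos_sq_add_sin_sq θ
    linarith [sq c, sq s]
  set u : Space := c • b 0 + s • b 1
  set w : Space := -s • b 0 + c • b 1
  have huu : inner ℝ u u = (1 : ℝ) := by
    simp only [u, inner_add_left, inner_add_right, inner_smul_left, inner_smul_right, hin]
    simp
    linarith
  have hww : inner ℝ w w = (1 : ℝ) := by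
    simp only [w, inner_add_left, inner_add_right, inner_smul_left, inner_smul_right, hin]
    simp
    linarith
  have huw : inner ℝ u w = (0 : ℝ) := by
    simp [u, w, inner_add_left, inner_add_right, inner_smul_left, inner_smul_right, hin]
    ring
  have hun : inner ℝ u n = (0 : ℝ) := by
    rw [← hb2]
    simp [u, inner_add_left, inner_smul_left, hin]
  have hwn : inner ℝ w n = (0 : ℝ) := by
    rw [← hb2]
    simp [w, inner_add_left, inner_smul_left, hin]
  have hnn : inner ℝ n n = (1 : ℝ) := by rw [real_inner_self_eq_norm_sq, hn]; norm_num
  simp only [PiLp.inner_apply, Fin.sum_univ_three, RCLike.inner_apply, conj_trivial]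
    at huu hww huw hun hwn hnn
  have hmat (d : ℝ) : d * d = 1 →
      (!![d * u 0, d * u 1, d * u 2; w 0, w 1, w 2; n 0, n 1, n 2] : Matrix (Fin 3) (Fin 3) ℝ) *
      (!![d * u 0, d * u 1, d * u 2; w 0, w 1, w 2; n 0, n 1, n 2] :
        Matrix (Fin 3) (Fin 3) ℝ).transpose = 1 := by
    intro hd
    ext i j
    fin_cases i <;> fin_cases j <;>
      simp [Matrix.mul_apply, Fin.sum_univ_three]
    · linear_combination d * d * huu + hd
    · linear_combination d * huw
    · linear_combination d * hun
    · linear_combination d * huw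
    · linear_combination hww
    · linear_combination hwn
    · linear_combination d * hun
    · linear_combination hwn
    · linear_combination hnn
  set d := (!![u 0, u 1, u 2; w 0, w 1, w 2; n 0, n 1, n 2] : Matrix (Fin 3) (Fin 3) ℝ).det
    with hd
  have hdd : d * d = 1 := by
    have h1 := congrArg Matrix.det (hmat 1 (by norm_num))
    rw [Matrix.det_mul, Matrix.det_transpose, Matrix.det_one] at h1
    simpa only [one_mul] using h1
  refine ⟨!![d * u 0, d * u 1, d * u 2; w 0, w 1, w 2; n 0, n 1, n 2], hmat d hdd, ?_, ?_, ?_⟩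
  · rw [← hdd]
    nth_rewrite 5 [hd]
    simp only [Matrix.det_fin_three]
    simp
    ring
  · intro j
    fin_cases j <;> rfl
  · have h1 : matS (!![d * u 0, d * u 1, d * u 2; w 0, w 1, w 2; n 0, n 1, n 2]).transpose
        (single 0 1) = d • u := by
      ext i
      fin_cases i <;> simp [matS_apply]
    have h2 : matS (!![d * u 0, d * u 1, d * u 2; w 0, w 1, w 2; n 0, n 1, n 2]).transpose
        (single 1 1) = w := by
      ext i
      fin_cases i <;> simp [matS_apply]
    have h3 : H u w = 0 := hθ
    rw [h1, h2, map_smul, smul_apply, h3, smul_zero]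

/-! ### Charts in which the sheets are normalized -/

/-- `F` describes the two null sheets as graphs, moving in the positive and in the negative third
coordinate direction, where the quadratic part of the first one is diagonal. -/
structure IsNormalizedPair (f : Fin 2 → E4 → ℝ) (F : Fin 2 → Space → ℝ) : Prop where
  graph : ∀ A, IsSheetGraph (f A) (F A)
  fderiv_f_zero : ∃ κ > 0, ∀ v, fderiv ℝ (f 0) 0 v = κ * (-v 0 + v 3)
  fderiv_f_one : ∃ κ > 0, ∀ v, fderiv ℝ (f 1) 0 v = κ * (-v 0 - v 3)
  diag : fderiv ℝ (fderiv ℝ (F 0)) 0 (single 0 1) (single 1 1) = 0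

lemma IsSheetGraph.rot {f : E4 → ℝ} {F : Space → ℝ} (hF : IsSheetGraph f F)
    {R : Matrix (Fin 3) (Fin 3) ℝ} (h : R * R.transpose = 1) :
    IsSheetGraph (f ∘ (rotE h).symm) (F ∘ matS R.transpose) := by
  have hS : Tendsto (matS R.transpose) (𝓝 0) (𝓝 0) := by
    simpa using (matS R.transpose).continuous.tendsto 0
  have hE : Tendsto (rotE h).symm (𝓝 0) (𝓝 0) := by
    simpa using (rotE h).symm.continuous.tendsto 0
  refine ⟨?_, by simp [hF.zero], ?_, ?_, ?_⟩
  · exact SmoothNear.comp (g := F) (by simpa using hF.smooth)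
      (.of_contDiff (matS R.transpose).contDiff)
  · filter_upwards [hS.eventually hF.apply_graph] with y hy
    simpa [rotE_symm_apply] using hy
  · filter_upwards [hE.eventually hF.neg_iff] with X hX
    simpa [rotE_symm_apply] using hX
  · filter_upwards [hE.eventually hF.eq_iff] with X hX
    simpa [rotE_symm_apply] using hX

lemma fderiv_fderiv_comp_clm {F : Space → ℝ} (hF : SmoothNear F 0) (T : Space →L[ℝ] Space)
    (v w : Space) : fderiv ℝ (fderiv ℝ (F ∘ T)) 0 v w = fderiv ℝ (fderiv ℝ F) 0 (T v) (T w) := by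
  have hT : Tendsto T (𝓝 0) (𝓝 0) := by simpa using T.continuous.tendsto 0
  have h1 : fderiv ℝ (F ∘ T) =ᶠ[𝓝 0] fun y ↦ (fderiv ℝ F (T y)).comp T := by
    filter_upwards [hT.eventually hF] with y hy
    exact ((hy.differentiableAt (by simp)).hasFDerivAt.comp y T.hasFDerivAt).fderiv
  rw [h1.fderiv_eq]
  have h2 : HasFDerivAt (fderiv ℝ F) (fderiv ℝ (fderiv ℝ F) 0) (T 0) := by
    rw [map_zero]
    exact hF.fderiv.differentiableAt.hasFDerivAt
  have h3 := HasFDerivAt.comp (f := T) (0 : Space) h2 T.hasFDerivAt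
  have h4 : HasFDerivAt (fun y ↦ (fderiv ℝ F (T y)).comp T) _ 0 :=
    h3.clm_comp (hasFDerivAt_const T (0 : Space))
  rw [h4.fderiv]
  simp

/-- After a rotation of the spatial coordinates, the two sheets are normalized. -/
lemma IsPinchPoint.exists_normalized_chart {τ : M → ℝ} {U : Set M} {f : Fin 2 → M → ℝ} {p : M}
    (hp : IsPinchPoint 𝓢 τ U f p) (hφ : IsAdaptedNormalChart 𝓢 τ p φ) :
    ∃ ψ, IsSpatialRotation φ ψ ∧ IsAdaptedNormalChart 𝓢 τ p ψ ∧
      ∃ F, IsNormalizedPair (fun A ↦ f A ∘ ψ.symm) F := by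
  have m := hp.pinchModel hφ
  obtain ⟨κ, n, hκ, hn, hn1, hfn⟩ := m.exists_opposite_normals
  have hgr : ∀ A, ∃ F, IsSheetGraph (f A ∘ φ.symm) F := fun A ↦
    exists_isSheetGraph (m.f_smooth A) (m.f_zero A) (by
      rw [hfn, e4_zero_eq]
      simpa using hκ A)
  choose F hF using hgr
  have hsymm : ∀ v w, fderiv ℝ (fderiv ℝ (F 0)) 0 v w = fderiv ℝ (fderiv ℝ (F 0)) 0 w v :=
    fun v w ↦ ((hF 0).smooth.contDiffAt.isSymmSndFDerivAt (by simp; norm_cast)).eq v w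
  obtain ⟨R, hR, hdet, hRn, hH⟩ := exists_rotation hn _ hsymm
  refine ⟨rotChart φ hR, isSpatialRotation_rotChart hR hdet, hφ.rotChart hR,
    fun A ↦ F A ∘ matS R.transpose, ?_⟩
  have hfd A v : fderiv ℝ (f A ∘ (rotChart φ hR).symm) 0 v =
      fderiv ℝ (f A ∘ φ.symm) 0 ((rotE hR).symm v) := by
    have : f A ∘ (rotChart φ hR).symm = (f A ∘ φ.symm) ∘ (rotE hR).symm := rfl
    rw [this, (rotE hR).symm.comp_right_fderiv, map_zero]
    rfl
  have hinner (v : Space) : inner ℝ (n 0) (matS R.transpose v) = v 2 := by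
    rw [← inner_matS]
    have h1 : matS R (n 0) = single 2 1 := by
      ext i
      rw [matS_apply]
      have h2 := congrFun (congrFun hR i) 2
      simp only [Matrix.mul_apply, Matrix.transpose_apply, hRn, Matrix.one_apply] at h2
      rw [h2]
      simp [PiLp.single_apply]
    rw [h1]
    simp [PiLp.inner_apply, Fin.sum_univ_three, PiLp.single_apply]
  refine ⟨fun A ↦ (hF A).rot hR, ⟨κ 0, hκ 0, fun v ↦ ?_⟩, ⟨κ 1, hκ 1, fun v ↦ ?_⟩, ?_⟩
  · rw [hfd, hfn, rotE_symm_apply]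
    simp [hinner]
  · rw [hfd, hfn, rotE_symm_apply, hn1]
    simp [hinner]
    left
    ring
  · rw [fderiv_fderiv_comp_clm (hF 0).smooth]
    exact hH

/-! ### Slices, sheets within slices, and crease as graphs -/

/-- The slices of `h` are graphs `t = T (s, y)`. -/
structure IsSliceGraph (h : E4 → ℝ) (T : ℝ × Space → ℝ) : Prop where
  smooth : SmoothNear T 0
  zero : T 0 = 0
  apply_graph : ∀ᶠ u in 𝓝 (0 : ℝ × Space), h (pt (T u) u.2) = u.1
  lt_iff : ∀ᶠ u in 𝓝 (0 : ℝ × E4), u.1 < h u.2 ↔ T (u.1, spatial u.2) < u.2 0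
  eq_iff : ∀ᶠ u in 𝓝 (0 : ℝ × E4), h u.2 = u.1 ↔ u.2 0 = T (u.1, spatial u.2)

/-- The sheets `F` within the slices `T` are graphs `z = Z (s, x)`, and they meet where `z = ζ x`,
at time `S x`. -/
structure IsCreaseGraph (h : E4 → ℝ) (F : Fin 2 → Space → ℝ) (T : ℝ × Space → ℝ)
    (Z : Fin 2 → ℝ × Plane → ℝ) (ζ S : Plane → ℝ) : Prop where
  Z_smooth : ∀ A, SmoothNear (Z A) 0
  Z_zero : ∀ A, Z A 0 = 0
  Z_apply : ∀ A, ∀ᶠ u in 𝓝 (0 : ℝ × Plane), F A (spt u.2 (Z A u)) = T (u.1, spt u.2 (Z A u))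
  Z_zero_lt_iff : ∀ᶠ u in 𝓝 (0 : (ℝ × Plane) × ℝ),
    F 0 (spt u.1.2 u.2) < T (u.1.1, spt u.1.2 u.2) ↔ u.2 < Z 0 u.1
  Z_one_lt_iff : ∀ᶠ u in 𝓝 (0 : (ℝ × Plane) × ℝ),
    F 1 (spt u.1.2 u.2) < T (u.1.1, spt u.1.2 u.2) ↔ Z 1 u.1 < u.2
  Z_eq_iff : ∀ A, ∀ᶠ u in 𝓝 (0 : (ℝ × Plane) × ℝ),
    F A (spt u.1.2 u.2) = T (u.1.1, spt u.1.2 u.2) ↔ u.2 = Z A u.1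
  ζ_smooth : SmoothNear ζ 0
  ζ_zero : ζ 0 = 0
  ζ_apply : ∀ᶠ x in 𝓝 0, F 0 (spt x (ζ x)) = F 1 (spt x (ζ x))
  ζ_lt_iff : ∀ᶠ u in 𝓝 (0 : Plane × ℝ), F 1 (spt u.1 u.2) < F 0 (spt u.1 u.2) ↔ ζ u.1 < u.2
  ζ_eq_iff : ∀ᶠ u in 𝓝 (0 : Plane × ℝ), F 0 (spt u.1 u.2) = F 1 (spt u.1 u.2) ↔ u.2 = ζ u.1
  S_eq : ∀ x, S x = h (pt (F 0 (spt x (ζ x))) (spt x (ζ x)))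

lemma exists_isSliceGraph {h : E4 → ℝ} (hh : SmoothNear h 0) (h0 : h 0 = 0)
    (hd : 0 < fderiv ℝ h 0 (e4 0)) : ∃ T, IsSliceGraph h T := by
  let J : (ℝ × Space) × ℝ →L[ℝ] E4 := ptL.comp ((snd ℝ (ℝ × Space) ℝ).prod
    ((snd ℝ ℝ Space).comp (fst ℝ (ℝ × Space) ℝ)))
  let s : (ℝ × Space) × ℝ →L[ℝ] ℝ :=
    (fst ℝ ℝ Space).comp (fst ℝ (ℝ × Space) ℝ)
  have hJ0 : J 0 = 0 := map_zero J
  have hk : SmoothNear (fun u ↦ h (J u) - s u) 0 :=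
    (SmoothNear.comp (g := h) (by rw [hJ0]; exact hh) (.of_contDiff J.contDiff)).sub
      (.of_contDiff s.contDiff)
  have hkd : HasFDerivAt (fun u ↦ h (J u) - s u) ((fderiv ℝ h 0).comp J - s) 0 := by
    have h1 : HasFDerivAt h (fderiv ℝ h 0) (J 0) := by
      rw [hJ0]; exact hh.differentiableAt.hasFDerivAt
    exact (HasFDerivAt.comp (f := J) 0 h1 J.hasFDerivAt).sub s.hasFDerivAt
  obtain ⟨T, hTs, hT0, hTk, hT⟩ := exists_implicit hk (by simp [h0]) (by
    rw [hkd.fderiv]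
    have h1 : J (0, 1) = e4 0 := by rw [e4_zero_eq]; rfl
    have h2 : s (0, 1) = 0 := rfl
    simpa [h1, h2] using hd)
  have ht : Tendsto (fun u : ℝ × E4 ↦ ((u.1, spatial u.2), u.2 0)) (𝓝 0)
      (𝓝 (0 : (ℝ × Space) × ℝ)) := by
    have : Continuous (fun u : ℝ × E4 ↦ ((u.1, spatial u.2), u.2 0)) :=
      (continuous_fst.prodMk (spatialL.continuous.comp continuous_snd)).prodMk (by fun_prop)
    have h2 := this.tendsto 0
    rwa [show ((((0 : ℝ × E4).1, spatial (0 : ℝ × E4).2), (0 : ℝ × E4).2 0) : (ℝ × Space) × ℝ) = 0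
      by simp] at h2
  have hJ : ∀ u : ℝ × E4, J ((u.1, spatial u.2), u.2 0) = u.2 := fun u ↦ pt_spatial u.2
  refine ⟨T, hTs, hT0, ?_, ?_, ?_⟩
  · filter_upwards [hTk] with y hy
    exact sub_eq_zero.1 hy
  · filter_upwards [ht.eventually hT] with u hu
    rw [← hu.1, hJ, sub_pos]
    rfl
  · filter_upwards [ht.eventually hT] with u hu
    rw [← hu.2, hJ, sub_eq_zero]
    rfl

lemma IsSliceGraph.hasFDerivAt {h : E4 → ℝ} {T : ℝ × Space → ℝ} (hT : IsSliceGraph h T)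
    (hh : SmoothNear h 0) (ht : ∀ v, fderiv ℝ h 0 v = fderiv ℝ h 0 (e4 0) * v 0)
    (hd : 0 < fderiv ℝ h 0 (e4 0)) (u : ℝ × Space) :
    fderiv ℝ T 0 u = (fderiv ℝ h 0 (e4 0))⁻¹ * u.1 := by
  have h1 : HasFDerivAt (fun u : ℝ × Space ↦ pt (T u) u.2)
      (ptL.comp ((fderiv ℝ T 0).prod (snd ℝ ℝ Space))) 0 :=
    ptL.hasFDerivAt.comp (0 : ℝ × Space) (hT.smooth.differentiableAt.hasFDerivAt.prodMk
      hasFDerivAt_snd)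
  have h2 : HasFDerivAt h (fderiv ℝ h 0) ((fun u : ℝ × Space ↦ pt (T u) u.2) 0) := by
    simpa [hT.zero] using hh.differentiableAt.hasFDerivAt
  have h3 := HasFDerivAt.comp (f := fun u : ℝ × Space ↦ pt (T u) u.2) 0 h2 h1
  have h4 : HasFDerivAt (h ∘ fun u : ℝ × Space ↦ pt (T u) u.2) (fst ℝ ℝ Space)
    0 := hasFDerivAt_fst.congr_of_eventuallyEq hT.apply_graph
  have h5 := DFunLike.congr_fun (h3.unique h4) u
  simp only [ContinuousLinearMap.comp_apply, ContinuousLinearMap.prod_apply,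
    ContinuousLinearMap.coe_fst'] at h5
  rw [ht] at h5
  have h6 : fderiv ℝ h 0 (e4 0) * fderiv ℝ T 0 u = u.1 := h5
  rw [← h6]
  field_simp

lemma exists_isCreaseGraph {h : E4 → ℝ} {F : Fin 2 → Space → ℝ} {T : ℝ × Space → ℝ}
    (hT : SmoothNear T 0) (hT0 : T 0 = 0) (hdT : ∀ y, fderiv ℝ T 0 (0, y) = 0)
    (hF : ∀ A, SmoothNear (F A) 0) (hF0 : ∀ A, F A 0 = 0)
    (hd0 : ∀ y, fderiv ℝ (F 0) 0 y = y 2) (hd1 : ∀ y, fderiv ℝ (F 1) 0 y = -y 2) :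
    ∃ Z ζ S, IsCreaseGraph h F T Z ζ S := by
  let J : (ℝ × Plane) × ℝ →L[ℝ] Space := sptL.comp
    (((snd ℝ ℝ Plane).comp (fst ℝ (ℝ × Plane) ℝ)).prod
      (snd ℝ (ℝ × Plane) ℝ))
  let J' : (ℝ × Plane) × ℝ →L[ℝ] ℝ × Space :=
    ((fst ℝ ℝ Plane).comp (fst ℝ (ℝ × Plane) ℝ)).prod J
  have hJ0 : J 0 = 0 := map_zero J
  have hJ0' : J' 0 = 0 := map_zero J'
  have hFJ : ∀ A, SmoothNear (fun u ↦ F A (J u)) 0 := fun A ↦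
    SmoothNear.comp (g := F A) (by rw [hJ0]; exact hF A) (.of_contDiff J.contDiff)
  have hTJ : SmoothNear (fun u ↦ T (J' u)) 0 :=
    SmoothNear.comp (g := T) (by rw [hJ0']; exact hT) (.of_contDiff J'.contDiff)
  have hFd : ∀ A, HasFDerivAt (fun u ↦ F A (J u)) ((fderiv ℝ (F A) 0).comp J) 0 := fun A ↦ by
    have h1 : HasFDerivAt (F A) (fderiv ℝ (F A) 0) (J 0) := by
      rw [hJ0]; exact (hF A).differentiableAt.hasFDerivAt
    exact HasFDerivAt.comp (f := J) 0 h1 J.hasFDerivAt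
  have hTd : HasFDerivAt (fun u ↦ T (J' u)) ((fderiv ℝ T 0).comp J') 0 := by
    have h1 : HasFDerivAt T (fderiv ℝ T 0) (J' 0) := by
      rw [hJ0']; exact hT.differentiableAt.hasFDerivAt
    exact HasFDerivAt.comp (f := J') 0 h1 J'.hasFDerivAt
  have hJ1 : (J (0, 1)) 2 = 1 := rfl
  have hT1 : fderiv ℝ T 0 (J' (0, 1)) = 0 := hdT _
  obtain ⟨Z₀, hZ₀s, hZ₀0, hZ₀k, hZ₀⟩ := exists_implicit ((hFJ 0).sub hTJ)
    (by simp [hF0, hT0]) (by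
      rw [((hFd 0).fun_sub hTd).fderiv]
      simp [hd0, hJ1, hT1])
  obtain ⟨Z₁, hZ₁s, hZ₁0, hZ₁k, hZ₁⟩ := exists_implicit (hTJ.sub (hFJ 1))
    (by simp [hF0, hT0]) (by
      rw [(hTd.fun_sub (hFd 1)).fderiv]
      simp [hd1, hJ1, hT1])
  have hFs : ∀ A, SmoothNear (fun u ↦ F A (sptL u)) 0 := fun A ↦
    SmoothNear.comp (g := F A) (by rw [map_zero]; exact hF A) (.of_contDiff sptL.contDiff)
  have hFsd : ∀ A, HasFDerivAt (fun u ↦ F A (sptL u)) ((fderiv ℝ (F A) 0).comp sptL) 0 := fun A ↦ by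
    have h1 : HasFDerivAt (F A) (fderiv ℝ (F A) 0) (sptL 0) := by
      rw [map_zero]; exact (hF A).differentiableAt.hasFDerivAt
    exact HasFDerivAt.comp (f := sptL) 0 h1 sptL.hasFDerivAt
  have hspt : (sptL (0, 1)) 2 = 1 := rfl
  obtain ⟨ζ, hζs, hζ0, hζk, hζ⟩ := exists_implicit ((hFs 0).sub (hFs 1))
    (by simp [hF0]) (by
      rw [((hFsd 0).fun_sub (hFsd 1)).fderiv]
      simp [hd0, hd1, hspt])
  refine ⟨![Z₀, Z₁], ζ, fun x ↦ h (pt (F 0 (spt x (ζ x))) (spt x (ζ x))), ?_⟩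
  refine ⟨?_, ?_, ?_, ?_, ?_, ?_, hζs, hζ0, ?_, ?_, ?_, fun x ↦ rfl⟩
  · intro A; fin_cases A
    exacts [hZ₀s, hZ₁s]
  · intro A; fin_cases A
    exacts [hZ₀0, hZ₁0]
  · intro A; fin_cases A
    · exact hZ₀k.mono fun u hu ↦ sub_eq_zero.1 hu
    · exact hZ₁k.mono fun u hu ↦ (sub_eq_zero.1 hu).symm
  · filter_upwards [hZ₀] with u hu
    have h1 : F 0 (J u) - T (J' u) < 0 ↔ u.2 < Z₀ u.1 := by
      rw [← not_le, ← not_le, le_iff_lt_or_eq, le_iff_lt_or_eq, hu.1, eq_comm (a := (0 : ℝ)), hu.2,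
        eq_comm]
    exact sub_neg.symm.trans h1
  · filter_upwards [hZ₁] with u hu
    exact sub_pos.symm.trans hu.1
  · intro A; fin_cases A
    · exact hZ₀.mono fun u hu ↦ sub_eq_zero.symm.trans hu.2
    · exact hZ₁.mono fun u hu ↦ (eq_comm.trans sub_eq_zero.symm).trans hu.2
  · exact hζk.mono fun u hu ↦ sub_eq_zero.1 hu
  · exact hζ.mono fun u hu ↦ sub_pos.symm.trans hu.1
  · exact hζ.mono fun u hu ↦ sub_eq_zero.symm.trans hu.2

namespace IsCreaseGraph

lemma smoothNear_spt (c : IsCreaseGraph h F T Z ζ S) : SmoothNear (fun x ↦ spt x (ζ x)) 0 :=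
  SmoothNear.comp (g := sptL) (.of_contDiff sptL.contDiff)
    ((SmoothNear.of_contDiff contDiff_id).prodMk c.ζ_smooth)

lemma smoothNear_θ (c : IsCreaseGraph h F T Z ζ S) (hF : SmoothNear (F 0) 0) :
    SmoothNear (fun x ↦ F 0 (spt x (ζ x))) 0 :=
  SmoothNear.comp (g := F 0) (by simpa [c.ζ_zero] using hF) c.smoothNear_spt

lemma smoothNear_pt (c : IsCreaseGraph h F T Z ζ S) (hF : SmoothNear (F 0) 0) :
    SmoothNear (fun x ↦ pt (F 0 (spt x (ζ x))) (spt x (ζ x))) 0 :=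
  SmoothNear.comp (g := ptL) smoothNear_ptL ((c.smoothNear_θ hF).prodMk c.smoothNear_spt)

lemma smoothNear_S (c : IsCreaseGraph h F T Z ζ S) (hh : SmoothNear h 0)
    (hF : SmoothNear (F 0) 0) (hF0 : F 0 0 = 0) : SmoothNear S 0 := by
  have : SmoothNear (fun x ↦ h (pt (F 0 (spt x (ζ x))) (spt x (ζ x)))) 0 :=
    SmoothNear.comp (g := h) (by simpa [c.ζ_zero, hF0] using hh) (c.smoothNear_pt hF)
  rwa [← funext c.S_eq] at this

/-- Comparison of the sheets within a slice with the crease above the same transverse point. -/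
lemma eventually_lt_iff (c : IsCreaseGraph h F T Z ζ S) (hT : IsSliceGraph h T)
    (hF : SmoothNear (F 0) 0) (hF0 : F 0 0 = 0) : ∀ᶠ u in 𝓝 (0 : ℝ × Plane),
      (S u.2 < u.1 ↔ ζ u.2 < Z 0 u) ∧ (S u.2 < u.1 ↔ Z 1 u < ζ u.2) ∧
      (S u.2 = u.1 ↔ Z 0 u = ζ u.2) ∧ (S u.2 = u.1 ↔ Z 1 u = ζ u.2) := by
  have t1 : Tendsto (fun u : ℝ × Plane ↦ (u, ζ u.2)) (𝓝 0) (𝓝 0) := by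
    have h1 : ContinuousAt (fun u : ℝ × Plane ↦ ζ u.2) 0 :=
      ContinuousAt.comp (g := ζ) (f := Prod.snd) c.ζ_smooth.continuousAt continuousAt_snd
    have h2 := h1.tendsto
    simp only [Prod.snd_zero, c.ζ_zero] at h2
    exact tendsto_id.prodMk_nhds h2
  have t2 : Tendsto (fun u : ℝ × Plane ↦ (u.1, pt (F 0 (spt u.2 (ζ u.2))) (spt u.2 (ζ u.2))))
      (𝓝 0) (𝓝 0) := by
    have h1 : ContinuousAt (fun u : ℝ × Plane ↦ pt (F 0 (spt u.2 (ζ u.2))) (spt u.2 (ζ u.2))) 0 :=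
      ContinuousAt.comp (g := fun x ↦ pt (F 0 (spt x (ζ x))) (spt x (ζ x))) (f := Prod.snd)
        (c.smoothNear_pt hF).continuousAt continuousAt_snd
    have h2 := h1.tendsto
    simp only [Prod.snd_zero, c.ζ_zero, spt_zero_zero, hF0, pt_zero_zero] at h2
    exact continuousAt_fst.tendsto.prodMk_nhds h2
  have t3 : Tendsto (fun u : ℝ × Plane ↦ u.2) (𝓝 0) (𝓝 0) := continuousAt_snd.tendsto
  filter_upwards [t1.eventually c.Z_zero_lt_iff, t1.eventually c.Z_one_lt_iff,
    t1.eventually (c.Z_eq_iff 0), t1.eventually (c.Z_eq_iff 1), t2.eventually hT.lt_iff,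
    t2.eventually hT.eq_iff, t3.eventually c.ζ_apply] with u h0 h1 h2 h3 h4 h5 h6
  simp only [spatial_pt, pt_zero', ← c.S_eq] at h4 h5
  rw [← h6] at h1 h3
  rw [← h0, ← h1, eq_comm (b := ζ u.2), ← h2, eq_comm (b := ζ u.2), ← h3, ← h5]
  have h7 : S u.2 < u.1 ↔ F 0 (spt u.2 (ζ u.2)) < T (u.1, spt u.2 (ζ u.2)) := by
    rw [← not_le, ← not_le, le_iff_lt_or_eq, le_iff_lt_or_eq, h4, eq_comm (a := u.1), h5, eq_comm]
  exact ⟨h7, h7, Iff.rfl, Iff.rfl⟩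

lemma eventually_point (c : IsCreaseGraph h F T Z ζ S) (hh : SmoothNear h 0) (h0 : h 0 = 0)
    (hT : IsSliceGraph h T) : ∀ᶠ X in 𝓝 (0 : E4),
      X 0 = T (h X, spatial X) ∧
      (F 0 (spatial X) < X 0 ↔ X 3 < Z 0 (h X, transverse X)) ∧
      (F 1 (spatial X) < X 0 ↔ Z 1 (h X, transverse X) < X 3) ∧
      (∀ A, X 0 = F A (spatial X) ↔ X 3 = Z A (h X, transverse X)) ∧
      (F 1 (spatial X) < F 0 (spatial X) ↔ ζ (transverse X) < X 3) ∧
      (F 0 (spatial X) = F 1 (spatial X) ↔ X 3 = ζ (transverse X)) := by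
  have t1 : Tendsto (fun X : E4 ↦ (h X, X)) (𝓝 0) (𝓝 0) := by
    have h2 := hh.continuousAt.tendsto
    rw [h0] at h2
    exact h2.prodMk_nhds tendsto_id
  have ht : Tendsto (fun X : E4 ↦ transverse X) (𝓝 0) (𝓝 0) := by
    have h2 := transverseL.continuous.tendsto 0
    rwa [map_zero] at h2
  have hz : Tendsto (fun X : E4 ↦ X 3) (𝓝 0) (𝓝 0) := by
    have : Continuous (fun X : E4 ↦ X 3) := by fun_prop
    simpa using this.tendsto 0
  have hh' : Tendsto h (𝓝 0) (𝓝 0) := by simpa [h0] using hh.continuousAt.tendsto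
  have t2 : Tendsto (fun X : E4 ↦ ((h X, transverse X), X 3)) (𝓝 0) (𝓝 0) :=
    (hh'.prodMk_nhds ht).prodMk_nhds hz
  have t3 : Tendsto (fun X : E4 ↦ (transverse X, X 3)) (𝓝 0) (𝓝 0) := ht.prodMk_nhds hz
  filter_upwards [t1.eventually hT.eq_iff, t2.eventually c.Z_zero_lt_iff,
    t2.eventually c.Z_one_lt_iff, t2.eventually (c.Z_eq_iff 0), t2.eventually (c.Z_eq_iff 1),
    t3.eventually c.ζ_lt_iff, t3.eventually c.ζ_eq_iff] with X h1 h2 h3 h4 h5 h6 h7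
  simp only [spt_transverse, true_iff] at *
  rw [← h1] at h2 h3 h4 h5
  refine ⟨h1, h2, h3, ?_, h6, h7⟩
  intro A
  fin_cases A
  · exact eq_comm.trans h4
  · exact eq_comm.trans h5

end IsCreaseGraph

/-! ### Second-order expansions -/

section Quad

variable {α : Type*} {l : Filter α} {n : ℕ}

lemma quad_smul (B : Matrix (Fin n) (Fin n) ℝ) (t : ℝ) (x : EuclideanSpace ℝ (Fin n)) :
    quad B (t • x) = t ^ 2 * quad B x := by
  simp only [quad, Finset.mul_sum, PiLp.smul_apply, smul_eq_mul]
  exact Finset.sum_congr rfl fun i _ ↦ Finset.sum_congr rfl fun j _ ↦ by ring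

lemma quad_bilin (B : EuclideanSpace ℝ (Fin n) →L[ℝ] EuclideanSpace ℝ (Fin n) →L[ℝ] ℝ)
    (x : EuclideanSpace ℝ (Fin n)) :
    B x x = quad (Matrix.of fun i j ↦ B (single i 1) (single j 1))
      x := by
  have hx : x = ∑ i, x i • single i (1 : ℝ) := by
    have := (EuclideanSpace.basisFun (Fin n) ℝ).sum_repr x
    simpa using this.symm
  conv_lhs => rw [hx]
  simp only [map_sum, map_smul, sum_apply, smul_apply, smul_eq_mul, quad, Matrix.of_apply,
    Finset.mul_sum]
  rw [Finset.sum_comm]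
  refine Finset.sum_congr rfl fun i _ ↦ Finset.sum_congr rfl fun j _ ↦ by ring

lemma quad_add_matrix (B B' : Matrix (Fin n) (Fin n) ℝ) (x : EuclideanSpace ℝ (Fin n)) :
    quad (B + B') x = quad B x + quad B' x := by
  simp [quad, add_mul, Finset.sum_add_distrib]

lemma quad_sub_matrix (B B' : Matrix (Fin n) (Fin n) ℝ) (x : EuclideanSpace ℝ (Fin n)) :
    quad (B - B') x = quad B x - quad B' x := by
  simp [quad, sub_mul, Finset.sum_sub_distrib]

lemma quad_smul_matrix (c : ℝ) (B : Matrix (Fin n) (Fin n) ℝ) (x : EuclideanSpace ℝ (Fin n)) :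
    quad (c • B) x = c * quad B x := by
  simp [quad, Finset.mul_sum, mul_assoc]

lemma isBigO_apply {v : α → EuclideanSpace ℝ (Fin n)} {g : α → ℝ} (hv : v =O[l] g) (i : Fin n) :
    (fun a ↦ v a i) =O[l] g :=
  (IsBigO.of_bound 1 (Eventually.of_forall fun a ↦ by
    rw [one_mul, Real.norm_eq_abs]; exact abs_apply_le_norm _ _)).trans hv

lemma isBigO_quad_add_sub (B : Matrix (Fin n) (Fin n) ℝ) {v w : α → EuclideanSpace ℝ (Fin n)}
    {g₁ g₂ : α → ℝ} (hv : v =O[l] g₁) (hw : w =O[l] g₂) (hg : g₂ =O[l] g₁) :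
    (fun a ↦ quad B (v a + w a) - quad B (v a)) =O[l] fun a ↦ g₁ a * g₂ a := by
  have h1 a : quad B (v a + w a) - quad B (v a) = ∑ i, ∑ j, B i j *
      (v a i * w a j + v a j * w a i + w a i * w a j) := by
    simp only [quad, ← Finset.sum_sub_distrib, PiLp.add_apply]
    exact Finset.sum_congr rfl fun i _ ↦ Finset.sum_congr rfl fun j _ ↦ by ring
  simp only [h1]
  refine IsBigO.fun_sum fun i _ ↦ IsBigO.fun_sum fun j _ ↦ IsBigO.const_mul_left ?_ _
  exact (((isBigO_apply hv i).mul (isBigO_apply hw j)).add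
    ((isBigO_apply hv j).mul (isBigO_apply hw i))).add
    (((isBigO_apply hw i).trans hg).mul (isBigO_apply hw j))

lemma isBigO_quad (B : Matrix (Fin n) (Fin n) ℝ) {v : α → EuclideanSpace ℝ (Fin n)}
    {g : α → ℝ} (hv : v =O[l] g) : (fun a ↦ quad B (v a)) =O[l] fun a ↦ g a ^ 2 := by
  have := isBigO_quad_add_sub B (v := fun _ ↦ 0) (g₁ := g) (isBigO_zero _ _) hv (isBigO_refl _ _)
  simpa [quad, sq] using this

lemma isBigO_bilin_add_sub {E : Type*} [NormedAddCommGroup E] [NormedSpace ℝ E]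
    (B : E →L[ℝ] E →L[ℝ] ℝ) {v w : α → E}
    {g₁ g₂ : α → ℝ} (hv : v =O[l] g₁) (hw : w =O[l] g₂) (hg : g₂ =O[l] g₁) :
    (fun a ↦ B (v a + w a) (v a + w a) - B (v a) (v a)) =O[l] fun a ↦ g₁ a * g₂ a := by
  have hB : ∀ {v' w' : α → E} {g g' : α → ℝ}, v' =O[l] g → w' =O[l] g' →
      (fun a ↦ B (v' a) (w' a)) =O[l] fun a ↦ g a * g' a := fun h h' ↦
    (B.isBoundedBilinearMap.isBigO_comp).trans (h.norm_left.mul h'.norm_left)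
  have h1 : (fun a ↦ B (v a + w a) (v a + w a) - B (v a) (v a)) =
      fun a ↦ B (v a) (w a) + B (w a) (v a) + B (w a) (w a) := by
    funext a
    simp only [map_add, add_apply]
    ring
  rw [h1]
  refine ((hB hv hw).add ?_).add (hB (hw.trans hg) hw)
  simpa only [mul_comm] using hB hw hv

lemma isBigO_pt {t : α → ℝ} {y : α → Space} {g : α → ℝ} (ht : t =O[l] g) (hy : y =O[l] g) :
    (fun a ↦ pt (t a) (y a)) =O[l] g :=
  (ptL.isBigO_comp (fun a ↦ (t a, y a)) l).trans (ht.prod_left hy)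

lemma isBigO_spt {x : α → Plane} {z : α → ℝ} {g : α → ℝ} (hx : x =O[l] g) (hz : z =O[l] g) :
    (fun a ↦ spt (x a) (z a)) =O[l] g :=
  (sptL.isBigO_comp (fun a ↦ (x a, z a)) l).trans (hx.prod_left hz)

lemma isBigO_sq_of_tendsto {g : α → ℝ} (hg : Tendsto g l (𝓝 0)) :
    (fun a ↦ g a ^ 2) =O[l] g := by
  have h1 : g =O[l] (fun _ ↦ (1 : ℝ)) := hg.isBigO_one ℝ
  simpa [sq] using h1.mul (isBigO_refl g l)

lemma quad_spt_zero (B : Matrix (Fin 3) (Fin 3) ℝ) (x : Plane) :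
    quad B (spt x 0) = quad (B.submatrix Fin.castSucc Fin.castSucc) x := by
  simp [quad, Fin.sum_univ_three, Fin.sum_univ_two]

end Quad

/-- An approximate zero of a scalar function with positive derivative is close to the zero. -/
lemma isBigO_sub_of_implicit {α E : Type*} {l : Filter α} [NormedAddCommGroup E]
    [NormedSpace ℝ E] {k : E × ℝ → ℝ}
    (hk : SmoothNear k 0) (hd : 0 < fderiv ℝ k 0 (0, 1)) {e : α → E} {φ P : α → ℝ}
    (he : Tendsto e l (𝓝 0)) (hφ : Tendsto φ l (𝓝 0)) (hP : Tendsto P l (𝓝 0))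
    (h0 : ∀ᶠ a in l, k (e a, φ a) = 0) : (fun a ↦ φ a - P a) =O[l] fun a ↦ k (e a, P a) := by
  set c := fderiv ℝ k 0 (0, 1) / 2 with hc
  have hcp : 0 < c := by positivity
  have hs : SmoothNear (fun u : E × ℝ ↦ c * u.2) 0 :=
    .of_contDiff (contDiff_const.mul contDiff_snd)
  have hsd : HasFDerivAt (fun u : E × ℝ ↦ c * u.2) (c • snd ℝ E ℝ) 0 :=
    (snd ℝ E ℝ).hasFDerivAt.const_mul c
  obtain ⟨r, hr, hmono⟩ := eventually_strictMono_of_fderiv_pos (hk.sub hs) (by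
    rw [(hk.differentiableAt.hasFDerivAt.fun_sub hsd).fderiv]
    simp
    linarith)
  refine IsBigO.of_bound c⁻¹ ?_
  have hI : Ioo (-r) r ∈ 𝓝 (0 : ℝ) := Ioo_mem_nhds (by linarith) hr
  filter_upwards [h0, he.eventually (Metric.ball_mem_nhds 0 hr), hφ.eventually hI,
    hP.eventually hI] with a ha hea hφa hPa
  have hm := (hmono (e a) (by simpa using hea)).monotoneOn
  rw [Real.norm_eq_abs, Real.norm_eq_abs, inv_mul_eq_div, le_div_iff₀ hcp]
  rcases le_total (φ a) (P a) with h | h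
  · have := hm hφa hPa h
    simp only [ha] at this
    rw [abs_of_nonpos (by linarith), abs_of_nonneg] <;> nlinarith
  · have := hm hPa hφa h
    simp only [ha] at this
    rw [abs_of_nonneg (by linarith), abs_of_nonpos] <;> nlinarith

/-- The matrix of second derivatives, times minus the lapse, is the extrinsic curvature. -/
def hessK (h : E4 → ℝ) : Matrix (Fin 3) (Fin 3) ℝ := Matrix.of fun i j ↦
  -((fderiv ℝ h 0 (e4 0))⁻¹ * fderiv ℝ (fderiv ℝ h) 0 (e4 i.succ) (e4 j.succ))

lemma hessK_symm {h : E4 → ℝ} (hh : SmoothNear h 0) : (hessK h).IsSymm := by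
  ext i j
  simp only [hessK, Matrix.transpose_apply, Matrix.of_apply]
  rw [(hh.contDiffAt.isSymmSndFDerivAt (by simp; norm_cast)).eq]

lemma pt_zero_single (i : Fin 3) : pt 0 (single i 1) = e4 i.succ := by
  ext j
  fin_cases i <;> fin_cases j <;> simp [e4]

lemma hess_pt_zero {h : E4 → ℝ} (hd : fderiv ℝ h 0 (e4 0) ≠ 0) (y : Space) :
    fderiv ℝ (fderiv ℝ h) 0 (pt 0 y) (pt 0 y) = -(fderiv ℝ h 0 (e4 0) * quad (hessK h) y) := by
  let J : Space →L[ℝ] E4 := ptL.comp (ContinuousLinearMap.inr ℝ ℝ Space)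
  have h1 := quad_bilin ((fderiv ℝ (fderiv ℝ h) 0).bilinearComp J J) y
  have h2 : fderiv ℝ (fderiv ℝ h) 0 (pt 0 y) (pt 0 y) = ((fderiv ℝ (fderiv ℝ h) 0).bilinearComp J J) y y := rfl
  have h3 : (Matrix.of fun i j ↦ ((fderiv ℝ (fderiv ℝ h) 0).bilinearComp J J)
      (single i 1) (single j 1)) =
      (-fderiv ℝ h 0 (e4 0)) • hessK h := by
    ext i j
    have : ((fderiv ℝ (fderiv ℝ h) 0).bilinearComp J J)
      (single i 1) (single j 1) =
      fderiv ℝ (fderiv ℝ h) 0 (e4 i.succ) (e4 j.succ) := by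
        rw [← pt_zero_single, ← pt_zero_single]; rfl
    simp only [Matrix.of_apply, this, Matrix.smul_apply, hessK, smul_eq_mul]
    field_simp
  rw [h2, h1, h3, quad_smul_matrix]
  ring

namespace PinchModel

variable {f : Fin 2 → E4 → ℝ}

lemma isBigO_h {α : Type*} {l : Filter α} (m : PinchModel G h f) {t g : α → ℝ} {y : α → Space}
    (hg : Tendsto g l (𝓝 0)) (ht : t =O[l] fun a ↦ g a ^ 2) (hy : y =O[l] g) :
    (fun a ↦ h (pt (t a) (y a)) - fderiv ℝ h 0 (e4 0) * (t a - quad (hessK h) (y a) / 2))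
      =O[l] fun a ↦ g a ^ 3 := by
  have hg2 := isBigO_sq_of_tendsto hg
  have hX := isBigO_pt (ht.trans hg2) hy
  have hT := (taylor_two_of_smoothNear m.h_smooth).comp_tendsto (hX.trans_tendsto hg)
  have hT2 := hT.trans (hX.norm_left.pow 3)
  have hv : (fun a ↦ pt 0 (y a)) =O[l] g := isBigO_pt (isBigO_zero _ _) hy
  have hw : (fun a ↦ pt (t a) 0) =O[l] fun a ↦ g a ^ 2 := isBigO_pt ht (isBigO_zero _ _)
  have hB := (isBigO_bilin_add_sub (fderiv ℝ (fderiv ℝ h) 0) hv hw hg2).const_mul_left (1 / 2 : ℝ)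
  have h3 : (fun a ↦ g a * g a ^ 2) = fun a ↦ g a ^ 3 := by funext a; ring
  rw [h3] at hB
  refine (hT2.add hB).congr_left fun a ↦ ?_
  have hadd : pt 0 (y a) + pt (t a) 0 = pt (t a) (y a) := by rw [← pt_add]; simp
  simp only [Function.comp_apply, hadd, hess_pt_zero m.h_future.ne', m.h_zero,
    m.fderiv_h_zero (pt _ _), pt_zero', smul_eq_mul]
  ring

end PinchModel

/-! #### The slices -/

/-- The coefficients of the second-order expansion of the slices. -/
def sliceC (T : ℝ × Space → ℝ) : ℝ := fderiv ℝ (fderiv ℝ T) 0 (1, 0) (1, 0) / 2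

def sliceD (T : ℝ × Space → ℝ) (i : Fin 3) : ℝ :=
  fderiv ℝ (fderiv ℝ T) 0 (1, 0) (0, single i 1)

lemma PinchModel.slice_expansion {G : E4 → Form} {h : E4 → ℝ}
    {f : Fin 2 → E4 → ℝ} (m : PinchModel G h f) {T : ℝ × Space → ℝ} (hT : IsSliceGraph h T) :
    (fun u : ℝ × Space ↦ T u - ((fderiv ℝ h 0 (e4 0))⁻¹ * u.1 + sliceC T * u.1 ^ 2
      + u.1 * ∑ i, sliceD T i * u.2 i + quad (hessK h) u.2 / 2)) =O[𝓝 0] fun u ↦ ‖u‖ ^ 3 := by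
  have hfd := hT.hasFDerivAt m.h_smooth m.fderiv_h_zero m.h_future
  have htay := taylor_two_of_smoothNear hT.smooth
  set B := fderiv ℝ (fderiv ℝ T) 0 with hB
  have hsymm : ∀ v w, B v w = B w v :=
    (hT.smooth.contDiffAt.isSymmSndFDerivAt (by simp; norm_cast)).eq
  have hdec (u : ℝ × Space) : B u u = 2 * (sliceC T * u.1 ^ 2 + u.1 * ∑ i, sliceD T i * u.2 i)
      + B (0, u.2) (0, u.2) := by
    have h1 : u = u.1 • ((1 : ℝ), (0 : Space)) + (0, u.2) := by ext <;> simp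
    have h2 : B (1, 0) (0, u.2) = ∑ i, sliceD T i * u.2 i := by
      have hx : u.2 = ∑ i, u.2 i • single i (1 : ℝ) := by
        have := (EuclideanSpace.basisFun (Fin 3) ℝ).sum_repr u.2
        simpa using this.symm
      have h3 : ((0 : ℝ), u.2) = ∑ i, u.2 i • ((0 : ℝ), (single i (1 : ℝ) : Space)) := by
        conv_lhs => rw [hx]
        rw [Prod.ext_iff, Prod.fst_sum, Prod.snd_sum]
        simp
      rw [h3, map_sum]
      refine Finset.sum_congr rfl fun i _ ↦ ?_
      rw [map_smul, smul_eq_mul, mul_comm]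
      rfl
    conv_lhs => rw [h1]
    simp only [map_add, map_smul, add_apply, smul_apply, smul_eq_mul]
    rw [hsymm (0, u.2) (1, 0), h2, sliceC]
    ring
  -- the spatial block
  have hK : ∀ y : Space, B (0, y) (0, y) - quad (hessK h) y = 0 := by
    refine eq_zero_of_isBigO_cube ?_ ?_
    · intro t y
      have : ((0 : ℝ), t • y) = t • ((0 : ℝ), y) := by simp
      rw [this, quad_smul, map_smul, map_smul, smul_apply, smul_eq_mul, smul_eq_mul]
      ring
    · have tn : Tendsto (fun y : Space ↦ ‖y‖) (𝓝 0) (𝓝 0) := by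
        simpa using (continuous_norm.tendsto (0 : Space))
      have ti : Tendsto (fun y : Space ↦ ((0 : ℝ), y)) (𝓝 0) (𝓝 0) :=
        (tendsto_const_nhds).prodMk_nhds tendsto_id
      have e1 : (fun y : Space ↦ T (0, y) - B (0, y) (0, y) / 2) =O[𝓝 0] fun y ↦ ‖y‖ ^ 3 := by
        have := htay.comp_tendsto ti
        refine (this.congr (fun y ↦ ?_) (fun y ↦ ?_) :)
        · simp only [Function.comp_apply, hT.zero, hfd, smul_eq_mul]
          ring
        · simp [Prod.norm_def]
      have hbil : (fun y : Space ↦ B (0, y) (0, y)) =O[𝓝 0] fun y ↦ ‖y‖ ^ 2 := by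
        have := B.isBoundedBilinearMap.isBigO_comp (g := fun y : Space ↦ ((0 : ℝ), y))
          (h := fun y : Space ↦ ((0 : ℝ), y)) (l := 𝓝 0)
        refine this.congr_right fun y ↦ ?_
        simp [Prod.norm_def, sq]
      have e2 : (fun y : Space ↦ T (0, y)) =O[𝓝 0] fun y ↦ ‖y‖ ^ 2 := by
        have h3 : (fun y : Space ↦ ‖y‖ ^ 3) =O[𝓝 0] fun y ↦ ‖y‖ ^ 2 := by
          refine ((tn.isBigO_one ℝ).mul (isBigO_refl (fun y : Space ↦ ‖y‖ ^ 2) (𝓝 0))).congr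
            (fun y ↦ by ring) fun y ↦ one_mul _
        refine ((e1.trans h3).add (hbil.const_mul_left (1 / 2))).congr_left fun y ↦ by ring
      have e3 := m.isBigO_h tn e2 (isBigO_norm_right.2 (isBigO_refl (fun y : Space ↦ y) (𝓝 0)))
      have e4' : (fun y : Space ↦ T (0, y) - quad (hessK h) y / 2) =O[𝓝 0] fun y ↦ ‖y‖ ^ 3 := by
        refine (e3.const_mul_left (-(fderiv ℝ h 0 (e4 0))⁻¹)).congr' ?_ EventuallyEq.rfl
        filter_upwards [ti.eventually hT.apply_graph] with y hy
        rw [hy]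
        have := m.h_future.ne'
        field_simp
        ring
      refine ((e4'.sub e1).const_mul_left 2).congr_left fun y ↦ by ring
  refine htay.congr_left fun u ↦ ?_
  rw [hfd, hT.zero, hdec, sub_eq_zero.1 (hK u.2)]
  simp only [smul_eq_mul]
  ring

/-! #### The sheets -/

lemma sheet_expansion {F : Space → ℝ} {ε : ℝ} (hF : SmoothNear F 0) (h0 : F 0 = 0)
    (hd : ∀ y, fderiv ℝ F 0 y = ε * y 2)
    (he : ∀ w, fderiv ℝ (fderiv ℝ F) 0 w (single 2 1) = 0) :
    (fun y : Space ↦ F y - (ε * y 2 + quad (Matrix.of fun i j : Fin 2 ↦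
      fderiv ℝ (fderiv ℝ F) 0 (single i.castSucc 1)
        (single j.castSucc 1) / 2) !₂[y 0, y 1])) =O[𝓝 0] fun y ↦ ‖y‖ ^ 3 := by
  refine (taylor_two_of_smoothNear hF).congr_left fun y ↦ ?_
  have hsymm : ∀ v w, fderiv ℝ (fderiv ℝ F) 0 v w = fderiv ℝ (fderiv ℝ F) 0 w v :=
    (hF.contDiffAt.isSymmSndFDerivAt (by simp; norm_cast)).eq
  rw [quad_bilin, hd, h0]
  simp [quad, Fin.sum_univ_three, Fin.sum_univ_two, he, hsymm (single 2 1)]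
  ring

section Gauge

/-- The gauge of the remainders of the sheets within the slices. -/
lemma gauge_cube_le {n σ : ℝ} (hn : 0 ≤ n) (hσ : 0 ≤ σ) (hn1 : n ≤ 1) (hσ1 : σ ≤ 1) :
    (n + σ) ^ 3 ≤ 7 * (n ^ 3 + σ * n + σ ^ 2) := by
  have h1 : n ^ 2 * σ ≤ n * σ := by nlinarith [mul_nonneg hn hσ, mul_nonneg (mul_nonneg hn hσ) (sub_nonneg.2 hn1)]
  have h2 : n * σ ^ 2 ≤ n * σ := by nlinarith [mul_nonneg hn hσ, mul_nonneg (mul_nonneg hn hσ) (sub_nonneg.2 hσ1)]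
  have h3 : σ ^ 3 ≤ σ ^ 2 := by nlinarith [mul_nonneg (sq_nonneg σ) (sub_nonneg.2 hσ1)]
  have h4 : 0 ≤ n ^ 3 := by positivity
  have h5 := mul_nonneg hn hσ
  nlinarith [sq_nonneg σ]

lemma gauge_mul_le {n σ : ℝ} (hn : 0 ≤ n) (hσ : 0 ≤ σ) (hn1 : n ≤ 1) :
    (n + σ) * (σ + n ^ 2) ≤ 2 * (n ^ 3 + σ * n + σ ^ 2) := by
  have h1 : n ^ 2 * σ ≤ n * σ := by nlinarith [mul_nonneg hn hσ, mul_nonneg (mul_nonneg hn hσ) (sub_nonneg.2 hn1)]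
  have h4 : 0 ≤ n ^ 3 := by positivity
  nlinarith [mul_nonneg hn hσ, sq_nonneg σ]

end Gauge

/-- A sheet within the slices, to second order. -/
lemma sheet_slice_expansion {F : Space → ℝ} {T : ℝ × Space → ℝ} {Z : ℝ × Plane → ℝ} {ε a c : ℝ}
    {d : Fin 3 → ℝ} {b : Matrix (Fin 2) (Fin 2) ℝ} {K : Matrix (Fin 3) (Fin 3) ℝ}
    (hε : ε * ε = 1) (hF : SmoothNear F 0) (hT : SmoothNear T 0) (hZ : ContinuousAt Z 0)
    (hFd : ∀ y, fderiv ℝ F 0 y = ε * y 2) (hTd : ∀ y, fderiv ℝ T 0 (0, y) = 0) (hZ0 : Z 0 = 0)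
    (hZF : ∀ᶠ u in 𝓝 (0 : ℝ × Plane), F (spt u.2 (Z u)) = T (u.1, spt u.2 (Z u)))
    (hFe : (fun y : Space ↦ F y - (ε * y 2 + quad b !₂[y 0, y 1])) =O[𝓝 0] fun y ↦ ‖y‖ ^ 3)
    (hTe : (fun u : ℝ × Space ↦ T u - (a * u.1 + c * u.1 ^ 2
      + u.1 * ∑ i, d i * u.2 i + quad K u.2 / 2)) =O[𝓝 0] fun u ↦ ‖u‖ ^ 3) :
    (fun u : ℝ × Plane ↦ a * u.1 - (ε * Z u +
      quad (b - (1 / 2 : ℝ) • K.submatrix Fin.castSucc Fin.castSucc) u.2))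
    =O[𝓝 0] fun u ↦ ‖u.2‖ ^ 3 + |u.1| * ‖u.2‖ + u.1 ^ 2 := by
  set KT := K.submatrix Fin.castSucc Fin.castSucc
  let J : (ℝ × Plane) × ℝ →L[ℝ] Space := sptL.comp
    (((snd ℝ ℝ Plane).comp (fst ℝ (ℝ × Plane) ℝ)).prod
      (snd ℝ (ℝ × Plane) ℝ))
  let J' : (ℝ × Plane) × ℝ →L[ℝ] ℝ × Space :=
    ((fst ℝ ℝ Plane).comp (fst ℝ (ℝ × Plane) ℝ)).prod J
  have hJ0 : J 0 = 0 := map_zero J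
  have hJ0' : J' 0 = 0 := map_zero J'
  have hk : SmoothNear (fun u ↦ ε * (F (J u) - T (J' u))) 0 := by
    have h1 : SmoothNear (fun u ↦ F (J u)) 0 :=
      SmoothNear.comp (g := F) (by rw [hJ0]; exact hF) (.of_contDiff J.contDiff)
    have h2 : SmoothNear (fun u ↦ T (J' u)) 0 :=
      SmoothNear.comp (g := T) (by rw [hJ0']; exact hT) (.of_contDiff J'.contDiff)
    exact (SmoothNear.of_contDiff contDiff_const).smul (h1.sub h2)
  have hkd : 0 < fderiv ℝ (fun u ↦ ε * (F (J u) - T (J' u))) 0 (0, 1) := by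
    have h1 : HasFDerivAt F (fderiv ℝ F 0) (J 0) := by
      rw [hJ0]; exact hF.differentiableAt.hasFDerivAt
    have h2 : HasFDerivAt T (fderiv ℝ T 0) (J' 0) := by
      rw [hJ0']; exact hT.differentiableAt.hasFDerivAt
    have h3 := ((HasFDerivAt.comp (f := J) 0 h1 J.hasFDerivAt).fun_sub
      (HasFDerivAt.comp (f := J') 0 h2 J'.hasFDerivAt)).const_mul ε
    have h4 : fderiv ℝ (fun u ↦ ε * (F (J u) - T (J' u))) 0 = _ := h3.fderiv
    rw [h4]
    have hJ1 : (J (0, 1)) 2 = 1 := rfl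
    have hT1 : fderiv ℝ T 0 (J' (0, 1)) = 0 := hTd _
    simp [hFd, hJ1, hT1, hε]
  set g : ℝ × Plane → ℝ := fun u ↦ ‖u.2‖ ^ 3 + |u.1| * ‖u.2‖ + u.1 ^ 2
  set g₁ : ℝ × Plane → ℝ := fun u ↦ ‖u.2‖ + |u.1|
  set g₂ : ℝ × Plane → ℝ := fun u ↦ |u.1| + ‖u.2‖ ^ 2
  set P : ℝ × Plane → ℝ := fun u ↦ ε * (a * u.1 - quad (b - (1 / 2 : ℝ) • KT) u.2) with hPdef
  have tx : Tendsto (fun u : ℝ × Plane ↦ ‖u.2‖) (𝓝 0) (𝓝 0) := by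
    have : Continuous (fun u : ℝ × Plane ↦ ‖u.2‖) := by fun_prop
    simpa using this.tendsto 0
  have ts : Tendsto (fun u : ℝ × Plane ↦ |u.1|) (𝓝 0) (𝓝 0) := by
    have : Continuous (fun u : ℝ × Plane ↦ |u.1|) := by fun_prop
    simpa using this.tendsto 0
  have tx1 : ∀ᶠ u : ℝ × Plane in 𝓝 0, ‖u.2‖ ≤ 1 := tx.eventually_le_const one_pos
  have ts1 : ∀ᶠ u : ℝ × Plane in 𝓝 0, |u.1| ≤ 1 := ts.eventually_le_const one_pos
  have tg₁ : Tendsto g₁ (𝓝 0) (𝓝 0) := by simpa using tx.add ts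
  have hx₁ : (fun u : ℝ × Plane ↦ u.2) =O[𝓝 0] g₁ := .of_bound 1 (Eventually.of_forall fun u ↦ by
    rw [one_mul, Real.norm_of_nonneg (by positivity)]; exact le_add_of_nonneg_right (abs_nonneg _))
  have hs₁ : (fun u : ℝ × Plane ↦ u.1) =O[𝓝 0] g₁ := .of_bound 1 (Eventually.of_forall fun u ↦ by
    rw [one_mul, Real.norm_of_nonneg (r := g₁ u) (by positivity)]
    exact le_add_of_nonneg_left (norm_nonneg _))
  have hs₂ : (fun u : ℝ × Plane ↦ u.1) =O[𝓝 0] g₂ := .of_bound 1 (Eventually.of_forall fun u ↦ by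
    rw [one_mul, Real.norm_of_nonneg (r := g₂ u) (by positivity)]
    exact le_add_of_nonneg_right (sq_nonneg ‖u.2‖))
  have hx₂ : (fun u : ℝ × Plane ↦ ‖u.2‖ ^ 2) =O[𝓝 0] g₂ := .of_bound 1 (Eventually.of_forall fun u ↦ by
    rw [one_mul, Real.norm_of_nonneg (by positivity), Real.norm_of_nonneg (by positivity)]
    exact le_add_of_nonneg_left (abs_nonneg _))
  have hg₂₁ : g₂ =O[𝓝 0] g₁ := by
    have h1 : (fun u : ℝ × Plane ↦ ‖u.2‖ ^ 2) =O[𝓝 0] g₁ :=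
      (isBigO_sq_of_tendsto tx).trans hx₁.norm_left
    exact hs₁.norm_left.add h1
  have hP₂ : P =O[𝓝 0] g₂ :=
    ((hs₂.const_mul_left a).sub ((isBigO_quad _ (isBigO_norm_right.2
      (isBigO_refl (fun u : ℝ × Plane ↦ u.2) (𝓝 0)))).trans hx₂)).const_mul_left ε
  have hP₁ := hP₂.trans hg₂₁
  have tP : Tendsto P (𝓝 0) (𝓝 0) := hP₁.trans_tendsto tg₁
  have hg₁₃ : (fun u ↦ g₁ u ^ 3) =O[𝓝 0] g := by
    refine .of_bound 7 ?_
    filter_upwards [tx1, ts1] with u hu hu'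
    rw [Real.norm_of_nonneg (by positivity), Real.norm_of_nonneg (by positivity)]
    have := gauge_cube_le (norm_nonneg u.2) (abs_nonneg u.1) hu hu'
    rwa [sq_abs] at this
  have hg₁₂ : (fun u ↦ g₁ u * g₂ u) =O[𝓝 0] g := by
    refine .of_bound 2 ?_
    filter_upwards [tx1] with u hu
    rw [Real.norm_of_nonneg (by positivity), Real.norm_of_nonneg (by positivity)]
    have := gauge_mul_le (norm_nonneg u.2) (abs_nonneg u.1) hu
    rwa [sq_abs] at this
  have hsg : (fun u : ℝ × Plane ↦ u.1 * g₁ u) =O[𝓝 0] g :=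
    ((hs₂.mul (isBigO_refl g₁ (𝓝 0))).congr_right fun u ↦ mul_comm _ _).trans hg₁₂
  have hy₁ : (fun u : ℝ × Plane ↦ spt u.2 (P u)) =O[𝓝 0] g₁ := isBigO_spt hx₁ hP₁
  have ty := hy₁.trans_tendsto tg₁
  have hFe' := ((hFe.comp_tendsto ty).trans (hy₁.norm_left.pow 3)).trans hg₁₃
  have hu₁ : (fun u : ℝ × Plane ↦ (u.1, spt u.2 (P u))) =O[𝓝 0] g₁ := hs₁.prod_left hy₁
  have hTe' := ((hTe.comp_tendsto (hu₁.trans_tendsto tg₁)).trans (hu₁.norm_left.pow 3)).trans hg₁₃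
  have hQ : (fun u : ℝ × Plane ↦ quad K (spt u.2 (P u)) - quad K (spt u.2 0)) =O[𝓝 0] g := by
    have h1 := isBigO_quad_add_sub K (v := fun u : ℝ × Plane ↦ spt u.2 0)
      (w := fun u ↦ spt 0 (P u)) (isBigO_spt hx₁ (isBigO_zero _ _))
      (isBigO_spt (isBigO_zero _ _) hP₂) hg₂₁
    refine (h1.trans hg₁₂).congr_left fun u ↦ ?_
    have : spt u.2 0 + spt 0 (P u) = spt u.2 (P u) := by
      ext i; fin_cases i <;> simp
    rw [this]
  have hs2 : (fun u : ℝ × Plane ↦ c * u.1 ^ 2) =O[𝓝 0] g := by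
    refine IsBigO.const_mul_left ?_ _
    simpa [sq] using (((isBigO_refl (fun u : ℝ × Plane ↦ u.1) (𝓝 0)).mul hs₁).trans hsg)
  have hsd : (fun u : ℝ × Plane ↦ u.1 * ∑ i, d i * (spt u.2 (P u)) i) =O[𝓝 0] g := by
    refine ((isBigO_refl (fun u : ℝ × Plane ↦ u.1) (𝓝 0)).mul (IsBigO.fun_sum fun i _ ↦ ?_)).trans hsg
    exact (isBigO_apply hy₁ i).const_mul_left _
  have hkP : (fun u : ℝ × Plane ↦ ε * (F (spt u.2 (P u)) - T (u.1, spt u.2 (P u)))) =O[𝓝 0] g := by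
    refine IsBigO.const_mul_left ?_ _
    refine ((((hFe'.sub hTe').sub (hQ.const_mul_left (1 / 2))).sub hs2).sub hsd).congr_left fun u ↦ ?_
    have e1 : (!₂[(spt u.2 (P u)) 0, (spt u.2 (P u)) 1] : Plane) = u.2 := by
      ext i; fin_cases i <;> simp
    have e2 : ε * P u = a * u.1 - quad b u.2 + quad KT u.2 / 2 := by
      rw [hPdef]
      simp only [quad_sub_matrix, quad_smul_matrix]
      rw [← mul_assoc, hε]
      ring
    simp only [Function.comp_apply, e1, quad_spt_zero, spt_two', e2]
    ring
  have hmain := (isBigO_sub_of_implicit hk hkd (e := fun u : ℝ × Plane ↦ u) tendsto_id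
    (by rw [← hZ0]; exact hZ) tP (by
      filter_upwards [hZF] with u hu
      have : F (J (u, Z u)) = T (J' (u, Z u)) := hu
      rw [this, sub_self, mul_zero])).trans hkP
  refine (hmain.const_mul_left (-ε)).congr_left fun u ↦ ?_
  rw [hPdef]
  have : ε * ε * (a * u.1 - quad (b - (1 / 2 : ℝ) • KT) u.2) = a * u.1 - quad (b - (1 / 2 : ℝ) • KT) u.2 := by
    rw [hε, one_mul]
  linear_combination this

/-! ### The local description -/

/-- A pinch point in normalized coordinates, with its sheets, slices and crease as graphs. -/
structure NormalModel (G : E4 → Form) (h : E4 → ℝ) (f : Fin 2 → E4 → ℝ)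
    (F : Fin 2 → Space → ℝ) (T : ℝ × Space → ℝ) (Z : Fin 2 → ℝ × Plane → ℝ)
    (ζ S : Plane → ℝ) : Prop where
  model : PinchModel G h f
  pair : IsNormalizedPair f F
  slice : IsSliceGraph h T
  crease : IsCreaseGraph h F T Z ζ S

/-- The quadratic coefficients of a sheet. -/
def sheetB (F : Space → ℝ) : Matrix (Fin 2) (Fin 2) ℝ := Matrix.of fun i j ↦
  fderiv ℝ (fderiv ℝ F) 0 (single i.castSucc 1)
    (single j.castSucc 1) / 2

def localData (h : E4 → ℝ) (F : Fin 2 → Space → ℝ) (T : ℝ × Space → ℝ)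
    (Z : Fin 2 → ℝ × Plane → ℝ) (ζ S : Plane → ℝ) : LocalData where
  a := (fderiv ℝ h 0 (e4 0))⁻¹
  b := sheetB (F 0)
  b' := sheetB (F 1)
  K := hessK h
  c := sliceC T
  d := sliceD T
  F := F
  T := T
  Z := Z
  θ := fun x ↦ F 0 (spt x (ζ x))
  ζ := ζ
  S := S

lemma sheetB_symm {F : Space → ℝ} (hF : SmoothNear F 0) : (sheetB F).IsSymm := by
  ext i j
  simp only [sheetB, Matrix.transpose_apply, Matrix.of_apply]
  rw [(hF.contDiffAt.isSymmSndFDerivAt (by simp; norm_cast)).eq]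

lemma inner_single_two (v : Space) : inner ℝ (single 2 (1 : ℝ)) v = v 2 := by
  simp [PiLp.inner_apply, Fin.sum_univ_three, PiLp.single_apply]

namespace PinchModel

variable {f : Fin 2 → E4 → ℝ}

lemma isExtrinsicCurvature_hessK (m : PinchModel G h f) :
    IsExtrinsicCurvature (fun X v w ↦ G X v w) h (hessK h) := by
  set ν : E4 → E4 := fun X ↦ (G X).inverse (fderiv ℝ h X)
  have hν : SmoothNear ν 0 :=
    (m.G_smooth.clm_inverse m.isInvertible_zero).clm_apply m.h_smooth.fderiv
  have hGν : ∀ᶠ X in 𝓝 0, ∀ w, G X (ν X) w = fderiv ℝ h X w := by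
    filter_upwards [m.eventually_inverse_apply] with X hX w
    exact DFunLike.congr_fun (hX (fderiv ℝ h X)) w
  set N : E4 → ℝ := fun X ↦ -fderiv ℝ h X (ν X)
  have hN : SmoothNear N 0 := (m.h_smooth.fderiv.clm_apply hν).neg
  set h₀ := fderiv ℝ h 0 (e4 0)
  have hh₀ : 0 < h₀ := m.h_future
  have hν0 : ν 0 0 = -h₀ := by
    have := hGν.self_of_nhds (e4 0)
    rw [m.G_zero, minkowski_eq, e4_zero_eq] at this
    simp at this
    rw [← e4_zero_eq] at this
    linarith
  have hN0 : N 0 = h₀ ^ 2 := by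
    simp only [N]
    rw [m.fderiv_h_zero, hν0]
    ring
  have hNpos : ∀ᶠ X in 𝓝 0, 0 < N X := hN.continuousAt.eventually_const_lt (by
    rw [hN0]; positivity)
  set α : E4 → ℝ := fun X ↦ -(√(N X))⁻¹
  have hNne : N 0 ≠ 0 := by rw [hN0]; positivity
  have hα : SmoothNear α 0 :=
    ((hN.sqrt hNne).inv (by rw [hN0, Real.sqrt_sq hh₀.le]; exact hh₀.ne')).neg
  have hα0 : α 0 = -h₀⁻¹ := by simp only [α, hN0, Real.sqrt_sq hh₀.le]
  set n : E4 → E4 := fun X ↦ α X • ν X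
  have hn : SmoothNear n 0 := hα.smul hν
  have hGn : ∀ᶠ X in 𝓝 0, ∀ w, G X (n X) w = α X * fderiv ℝ h X w := by
    filter_upwards [hGν] with X hX w
    simp only [n, map_smul, smul_apply, smul_eq_mul, hX]
  refine ⟨n, hn.differentiableAt, ?_, ?_⟩
  · filter_upwards [hGn, hNpos] with X hX hXN
    have hsq := Real.mul_self_sqrt hXN.le
    have hs : 0 < √(N X) := Real.sqrt_pos.2 hXN
    have hDn : fderiv ℝ h X (n X) = √(N X) := by
      simp only [n, map_smul, smul_eq_mul, α]
      have : fderiv ℝ h X (ν X) = - N X := by simp [N]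
      rw [this]
      field_simp
      nlinarith
    refine ⟨?_, ?_, ?_⟩
    · rw [hX, hDn]
      simp only [α]
      field_simp
    · rw [hDn]; exact hs
    · intro w hw
      rw [hX, hw, mul_zero]
  · intro i j
    have hchr : christoffel (fun X v w ↦ G X v w) 0 (e4 i.succ) (n 0) (e4 j.succ) = 0 := by
      have hd (v w : E4) : fderiv ℝ (fun Y ↦ G Y v w) 0 = 0 := by
        have h1 := (m.G_smooth.differentiableAt.hasFDerivAt.clm_apply
          (hasFDerivAt_const v (0 : E4))).clm_apply (hasFDerivAt_const w (0 : E4))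
        rw [h1.fderiv]
        ext u
        simp [m.G_deriv]
      simp [christoffel, hd]
    have h1 := (m.G_smooth.differentiableAt.hasFDerivAt.clm_apply
      hn.differentiableAt.hasFDerivAt).clm_apply (hasFDerivAt_const (e4 j.succ) (0 : E4))
    have h2 := hα.differentiableAt.hasFDerivAt.mul
      (m.h_smooth.fderiv.differentiableAt.hasFDerivAt.clm_apply
        (hasFDerivAt_const (e4 j.succ) (0 : E4)))
    have h3 := (h2.congr_of_eventuallyEq (hGn.mono fun X hX ↦ hX (e4 j.succ))).unique h1
    have h4 := DFunLike.congr_fun h3 (e4 i.succ)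
    have hj : fderiv ℝ h 0 (e4 j.succ) = 0 := m.h_tangent _ (by simp [e4])
    simp [m.G_deriv, hj] at h4
    rw [hα0] at h4
    rw [hchr, add_zero]
    refine Eq.trans ?_ h4
    change -((fderiv ℝ h 0 (e4 0))⁻¹ * _) = _
    rw [neg_mul]

end PinchModel

namespace NormalModel

variable {f : Fin 2 → E4 → ℝ}

lemma fderiv_F (N : NormalModel G h f F T Z ζ S) :
    (∀ y, fderiv ℝ (F 0) 0 y = y 2) ∧ (∀ y, fderiv ℝ (F 1) 0 y = -y 2) := by
  obtain ⟨κ, hκ, hf⟩ := N.pair.fderiv_f_zero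
  obtain ⟨κ', hκ', hf'⟩ := N.pair.fderiv_f_one
  constructor
  · intro y
    rw [N.model.fderiv_sheet_zero (N.pair.graph 0) (n := single 2 1) hκ
      (fun v ↦ by rw [hf, inner_single_two, spatial_two']), inner_single_two]
  · intro y
    rw [N.model.fderiv_sheet_zero (N.pair.graph 1) (n := -single 2 1) hκ'
      (fun v ↦ by rw [hf', inner_neg_left, inner_single_two, spatial_two', sub_eq_add_neg]), inner_neg_left,
      inner_single_two]

lemma hess_F (N : NormalModel G h f F T Z ζ S) (A : Fin 2) (w : Space) :
    fderiv ℝ (fderiv ℝ (F A)) 0 w (single 2 1) = 0 := by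
  obtain ⟨κ, hκ, hf⟩ := N.pair.fderiv_f_zero
  obtain ⟨κ', hκ', hf'⟩ := N.pair.fderiv_f_one
  fin_cases A
  · exact N.model.eikonal (N.pair.graph 0) (n := single 2 1) hκ
      (fun v ↦ by rw [hf, inner_single_two, spatial_two']) w
  · have := N.model.eikonal (N.pair.graph 1) (n := -single 2 1) hκ'
      (fun v ↦ by rw [hf', inner_neg_left, inner_single_two, spatial_two', sub_eq_add_neg]) w
    rw [map_neg, neg_eq_zero] at this
    exact this

lemma F_zero_expansion (N : NormalModel G h f F T Z ζ S) :
    (fun y : Space ↦ F 0 y - (y 2 + quad (sheetB (F 0)) !₂[y 0, y 1])) =O[𝓝 0] fun y ↦ ‖y‖ ^ 3 := by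
  have := sheet_expansion (ε := 1) (N.pair.graph 0).smooth (N.pair.graph 0).zero
    (fun y ↦ by rw [N.fderiv_F.1, one_mul]) (N.hess_F 0)
  simp only [one_mul] at this
  exact this

lemma F_one_expansion (N : NormalModel G h f F T Z ζ S) :
    (fun y : Space ↦ F 1 y - (-y 2 + quad (sheetB (F 1)) !₂[y 0, y 1])) =O[𝓝 0] fun y ↦ ‖y‖ ^ 3 := by
  have := sheet_expansion (ε := -1) (N.pair.graph 1).smooth (N.pair.graph 1).zero
    (fun y ↦ by rw [N.fderiv_F.2]; ring) (N.hess_F 1)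
  simp only [neg_one_mul] at this
  exact this

lemma fderiv_T (N : NormalModel G h f F T Z ζ S) (y : Space) : fderiv ℝ T 0 (0, y) = 0 := by
  rw [N.slice.hasFDerivAt N.model.h_smooth N.model.fderiv_h_zero N.model.h_future]
  simp

lemma tendsto_norm_plane : Tendsto (fun x : Plane ↦ ‖x‖) (𝓝 0) (𝓝 0) := by
  simpa using (continuous_norm.tendsto (0 : Plane))

lemma isBigO_id_norm : (fun x : Plane ↦ x) =O[𝓝 0] fun x ↦ ‖x‖ :=
  isBigO_norm_right.2 (isBigO_refl _ _)

lemma ζ_expansion (N : NormalModel G h f F T Z ζ S) :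
    (fun x : Plane ↦ 2 * ζ x - quad (sheetB (F 1) - sheetB (F 0)) x) =O[𝓝 0] fun x ↦ ‖x‖ ^ 3 := by
  set P : Plane → ℝ := fun x ↦ quad (sheetB (F 1) - sheetB (F 0)) x / 2 with hPdef
  have tn := tendsto_norm_plane
  have hP2 : P =O[𝓝 0] fun x ↦ ‖x‖ ^ 2 := by
    refine ((isBigO_quad (sheetB (F 1) - sheetB (F 0)) isBigO_id_norm).const_mul_left
      (1 / 2)).congr_left fun x ↦ ?_
    rw [hPdef]
    ring
  have hP1 := hP2.trans (isBigO_sq_of_tendsto tn)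
  have hy := isBigO_spt isBigO_id_norm hP1
  have ty := hy.trans_tendsto tn
  have e0 := (N.F_zero_expansion.comp_tendsto ty).trans (hy.norm_left.pow 3)
  have e1 := (N.F_one_expansion.comp_tendsto ty).trans (hy.norm_left.pow 3)
  have hk : (fun x : Plane ↦ F 0 (sptL (x, P x)) - F 1 (sptL (x, P x))) =O[𝓝 0] fun x ↦ ‖x‖ ^ 3 := by
    refine (e0.sub e1).congr_left fun x ↦ ?_
    have e1 : (!₂[(spt x (P x)) 0, (spt x (P x)) 1] : Plane) = x := by
      ext i; fin_cases i <;> simp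
    simp only [Function.comp_apply, e1, spt_two']
    have e2 : P x = (quad (sheetB (F 1)) x - quad (sheetB (F 0)) x) / 2 := by
      rw [hPdef]; simp only [quad_sub_matrix]
    rw [show sptL (x, P x) = spt x (P x) from rfl]
    linear_combination (-2) * e2
  have hF := fun A ↦ (N.pair.graph A).smooth
  have hFs : ∀ A, SmoothNear (fun u ↦ F A (sptL u)) 0 := fun A ↦
    SmoothNear.comp (g := F A) (by rw [map_zero]; exact hF A) (.of_contDiff sptL.contDiff)
  have hFsd : ∀ A, HasFDerivAt (fun u ↦ F A (sptL u)) ((fderiv ℝ (F A) 0).comp sptL) 0 := fun A ↦ by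
    have h1 : HasFDerivAt (F A) (fderiv ℝ (F A) 0) (sptL 0) := by
      rw [map_zero]; exact (hF A).differentiableAt.hasFDerivAt
    exact HasFDerivAt.comp (f := sptL) 0 h1 sptL.hasFDerivAt
  have hspt : (sptL (0, 1)) 2 = 1 := rfl
  have hd := isBigO_sub_of_implicit ((hFs 0).sub (hFs 1)) (by
      rw [((hFsd 0).fun_sub (hFsd 1)).fderiv]
      simp [N.fderiv_F.1, N.fderiv_F.2, hspt]) (e := fun x : Plane ↦ x) (φ := ζ) (P := P) tendsto_id
      (by have := N.crease.ζ_smooth.continuousAt.tendsto; rwa [N.crease.ζ_zero] at this)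
      (hP1.trans_tendsto tn) (N.crease.ζ_apply.mono fun x hx ↦ sub_eq_zero.2 hx)
  refine ((hd.trans hk).const_mul_left 2).congr_left fun x ↦ ?_
  rw [hPdef]
  ring

lemma ζ_isBigO (N : NormalModel G h f F T Z ζ S) : ζ =O[𝓝 0] fun x ↦ ‖x‖ ^ 2 := by
  have h3 : (fun y : Plane ↦ ‖y‖ ^ 3) =O[𝓝 0] fun y ↦ ‖y‖ ^ 2 :=
    ((tendsto_norm_plane.isBigO_one ℝ).mul (isBigO_refl (fun y : Plane ↦ ‖y‖ ^ 2) (𝓝 0))).congr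
            (fun y ↦ by ring) fun y ↦ one_mul _
  refine (((N.ζ_expansion.trans h3).add (isBigO_quad (sheetB (F 1) - sheetB (F 0))
    isBigO_id_norm)).const_mul_left (1 / 2)).congr_left fun x ↦ by ring

lemma θ_expansion (N : NormalModel G h f F T Z ζ S) :
    (fun x : Plane ↦ 2 * F 0 (spt x (ζ x)) - quad (sheetB (F 0) + sheetB (F 1)) x)
      =O[𝓝 0] fun x ↦ ‖x‖ ^ 3 := by
  have tn := tendsto_norm_plane
  have hy := isBigO_spt isBigO_id_norm (N.ζ_isBigO.trans (isBigO_sq_of_tendsto tn))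
  have e0 := (N.F_zero_expansion.comp_tendsto (hy.trans_tendsto tn)).trans (hy.norm_left.pow 3)
  refine ((e0.const_mul_left 2).add N.ζ_expansion).congr_left fun x ↦ ?_
  have e1 : (!₂[(spt x (ζ x)) 0, (spt x (ζ x)) 1] : Plane) = x := by
    ext i; fin_cases i <;> simp
  simp only [Function.comp_apply, e1, spt_two', quad_sub_matrix, quad_add_matrix]
  ring

lemma θ_isBigO (N : NormalModel G h f F T Z ζ S) :
    (fun x ↦ F 0 (spt x (ζ x))) =O[𝓝 0] fun x ↦ ‖x‖ ^ 2 := by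
  have h3 : (fun y : Plane ↦ ‖y‖ ^ 3) =O[𝓝 0] fun y ↦ ‖y‖ ^ 2 :=
    ((tendsto_norm_plane.isBigO_one ℝ).mul (isBigO_refl (fun y : Plane ↦ ‖y‖ ^ 2) (𝓝 0))).congr
            (fun y ↦ by ring) fun y ↦ one_mul _
  refine (((N.θ_expansion.trans h3).add (isBigO_quad (sheetB (F 0) + sheetB (F 1))
    isBigO_id_norm)).const_mul_left (1 / 2)).congr_left fun x ↦ by ring

lemma S_expansion (N : NormalModel G h f F T Z ζ S) :
    (fun x : Plane ↦ 2 * (localData h F T Z ζ S).a * S x - quad (localData h F T Z ζ S).Q x)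
      =O[𝓝 0] fun x ↦ ‖x‖ ^ 3 := by
  have tn := tendsto_norm_plane
  have hsq := isBigO_sq_of_tendsto tn
  have hy := isBigO_spt isBigO_id_norm (N.ζ_isBigO.trans hsq)
  have e0 := N.model.isBigO_h tn N.θ_isBigO hy
  have hQ := isBigO_quad_add_sub (hessK h) (v := fun x : Plane ↦ spt x 0)
      (w := fun x ↦ spt 0 (ζ x)) (isBigO_spt isBigO_id_norm (isBigO_zero _ _))
      (isBigO_spt (isBigO_zero _ _) N.ζ_isBigO) hsq
  have h3 : (fun x : Plane ↦ ‖x‖ * ‖x‖ ^ 2) = fun x ↦ ‖x‖ ^ 3 := by funext a; ring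
  rw [h3] at hQ
  have hne := N.model.h_future.ne'
  refine (((e0.const_mul_left (2 * (fderiv ℝ h 0 (e4 0))⁻¹)).add N.θ_expansion).sub hQ).congr_left
    fun x ↦ ?_
  have : spt x 0 + spt 0 (ζ x) = spt x (ζ x) := by
    ext i; fin_cases i <;> simp
  simp only [this, quad_spt_zero, ← N.crease.S_eq, localData, LocalData.Q, LocalData.KT,
    quad_sub_matrix, quad_add_matrix]
  field_simp
  ring

end NormalModel

lemma PinchModel.exists_normalModel {G : E4 → Form} {h : E4 → ℝ}
    {f : Fin 2 → E4 → ℝ} {F : Fin 2 → Space → ℝ} (m : PinchModel G h f)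
    (hF : IsNormalizedPair f F) : ∃ T Z ζ S, NormalModel G h f F T Z ζ S := by
  obtain ⟨T, hT⟩ := exists_isSliceGraph m.h_smooth m.h_zero m.h_future
  obtain ⟨κ, hκ, hf⟩ := hF.fderiv_f_zero
  obtain ⟨κ', hκ', hf'⟩ := hF.fderiv_f_one
  obtain ⟨Z, ζ, S, hc⟩ := exists_isCreaseGraph (h := h) (F := F) hT.smooth hT.zero
    (fun y ↦ by rw [hT.hasFDerivAt m.h_smooth m.fderiv_h_zero m.h_future]; simp)
    (fun A ↦ (hF.graph A).smooth) (fun A ↦ (hF.graph A).zero)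
    (fun y ↦ by
      rw [m.fderiv_sheet_zero (hF.graph 0) (n := single 2 1) hκ
        (fun v ↦ by rw [hf, inner_single_two, spatial_two']), inner_single_two])
    (fun y ↦ by
      rw [m.fderiv_sheet_zero (hF.graph 1) (n := -single 2 1) hκ'
      (fun v ↦ by rw [hf', inner_neg_left, inner_single_two, spatial_two', sub_eq_add_neg]), inner_neg_left,
      inner_single_two])
  exact ⟨T, Z, ζ, S, m, hF, hT, hc⟩

section Chart

variable {f : Fin 2 → M → ℝ}

lemma IsNormalChart.tendsto (hψ : IsNormalChart 𝓢 p ψ) : Tendsto ψ (𝓝 p) (𝓝 0) := by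
  have := (ψ.continuousAt hψ.mem_source).tendsto
  rwa [hψ.map_zero] at this

lemma IsNormalChart.eventually_of_coord (hψ : IsNormalChart 𝓢 p ψ) {P : E4 → Prop}
    (h : ∀ᶠ X in 𝓝 0, P X) : ∀ᶠ q in 𝓝 p, P (ψ q) ∧ ψ.symm (ψ q) = q := by
  filter_upwards [hψ.tendsto.eventually h, ψ.open_source.mem_nhds hψ.mem_source] with q hq hq'
  exact ⟨hq, ψ.left_inv hq'⟩

lemma NormalModel.describes (hψ : IsNormalChart 𝓢 p ψ)
    (N : NormalModel (coordG 𝓢 ψ) (τ ∘ ψ.symm) (fun A ↦ f A ∘ ψ.symm) F T Z ζ S) :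
    (localData (τ ∘ ψ.symm) F T Z ζ S).Describes 𝓢 τ f p ψ := by
  have hpoint := N.crease.eventually_point N.model.h_smooth N.model.h_zero N.slice
  have hθ : ∀ᶠ X in 𝓝 (0 : E4), F 0 (spt (transverse X) (ζ (transverse X))) =
      T (S (transverse X), spt (transverse X) (ζ (transverse X))) := by
    have t1 : Tendsto (fun X : E4 ↦ pt (F 0 (spt (transverse X) (ζ (transverse X))))
        (spt (transverse X) (ζ (transverse X)))) (𝓝 0) (𝓝 0) := by
      have h1 := (N.crease.smoothNear_pt (N.pair.graph 0).smooth).continuousAt.tendsto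
      simp only [N.crease.ζ_zero, spt_zero_zero, (N.pair.graph 0).zero, pt_zero_zero] at h1
      have h2 := transverseL.continuous.tendsto 0
      rw [map_zero] at h2
      exact h1.comp h2
    filter_upwards [t1.eventually hpoint] with X hX
    have := hX.1
    rwa [← N.crease.S_eq, spatial_pt, pt_zero'] at this
  have hsheet A : ∀ᶠ q in 𝓝 p, f A q = 0 ↔ ψ q 0 = F A (spatial (ψ q)) := by
    filter_upwards [hψ.eventually_of_coord (N.pair.graph A).eq_iff] with q hq
    rw [← hq.1, Function.comp_apply, hq.2]
  constructor
  · exact inv_pos.2 N.model.h_future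
  · intro i j hij
    change fderiv ℝ (fderiv ℝ (F 0)) 0 _ _ / 2 = 0
    have hd := N.pair.diag
    have hd' := hd
    rw [((N.pair.graph 0).smooth.contDiffAt.isSymmSndFDerivAt (by simp; norm_cast)).eq] at hd'
    fin_cases i <;> fin_cases j
    · exact absurd rfl hij
    · simpa using hd
    · simpa using hd'
    · exact absurd rfl hij
  · exact sheetB_symm (N.pair.graph 1).smooth
  · exact hessK_symm N.model.h_smooth
  · exact N.model.isExtrinsicCurvature_hessK
  · exact fun A ↦ smoothNearZero_iff.2 (N.pair.graph A).smooth
  · exact hsheet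
  · exact N.F_zero_expansion
  · exact N.F_one_expansion
  · exact smoothNearZero_iff.2 N.slice.smooth
  · have t1 : Tendsto (fun u : ℝ × M ↦ (u.1, ψ u.2)) (𝓝 (0, p)) (𝓝 0) := by
      rw [nhds_prod_eq]
      have h1 := hψ.tendsto.comp (tendsto_snd (f := 𝓝 (0 : ℝ)) (g := 𝓝 p))
      exact tendsto_fst.prodMk_nhds h1
    have t2 : ∀ᶠ u : ℝ × M in 𝓝 (0, p), u.2 ∈ ψ.source :=
      continuousAt_snd.eventually (ψ.open_source.mem_nhds hψ.mem_source)
    filter_upwards [t1.eventually N.slice.eq_iff, t2] with u hu hu'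
    rw [Function.comp_apply, ψ.left_inv hu'] at hu
    exact hu
  · exact N.model.slice_expansion N.slice
  · exact fun A ↦ smoothNearZero_iff.2 (N.crease.Z_smooth A)
  · intro A
    filter_upwards [hψ.eventually_of_coord hpoint, hsheet A] with q hq hq'
    rw [hq']
    have := hq.1.2.2.2.1 A
    rwa [Function.comp_apply, hq.2] at this
  · have := sheet_slice_expansion (ε := 1) (by norm_num) (N.pair.graph 0).smooth N.slice.smooth
      (N.crease.Z_smooth 0).continuousAt (fun y ↦ by rw [N.fderiv_F.1, one_mul]) N.fderiv_T
      (N.crease.Z_zero 0) (N.crease.Z_apply 0) (by simpa only [one_mul] using N.F_zero_expansion)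
      (N.model.slice_expansion N.slice)
    simp only [one_mul] at this
    exact this
  · have := sheet_slice_expansion (ε := -1) (by norm_num) (N.pair.graph 1).smooth N.slice.smooth
      (N.crease.Z_smooth 1).continuousAt (fun y ↦ by rw [N.fderiv_F.2, neg_one_mul]) N.fderiv_T
      (N.crease.Z_zero 1) (N.crease.Z_apply 1) (by simpa only [neg_one_mul] using N.F_one_expansion)
      (N.model.slice_expansion N.slice)
    simp only [neg_one_mul] at this
    exact this
  · exact smoothNearZero_iff.2 (N.crease.smoothNear_θ (N.pair.graph 0).smooth)
  · exact smoothNearZero_iff.2 N.crease.ζ_smooth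
  · exact smoothNearZero_iff.2 (N.crease.smoothNear_S N.model.h_smooth (N.pair.graph 0).smooth
      (N.pair.graph 0).zero)
  · filter_upwards [hψ.eventually_of_coord hpoint, hsheet 0, hsheet 1] with q hq h0 h1
    rw [h0, h1]
    obtain ⟨-, -, -, -, -, hz⟩ := hq.1
    constructor
    · rintro ⟨e0, e1⟩
      have := hz.1 (e0.symm.trans e1)
      refine ⟨?_, this⟩
      change ψ q 0 = F 0 (spt (transverse (ψ q)) (ζ (transverse (ψ q))))
      rw [← this, spt_transverse, e0]
    · rintro ⟨e0, e1⟩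
      change ψ q 0 = F 0 (spt (transverse (ψ q)) (ζ (transverse (ψ q)))) at e0
      change ψ q 3 = ζ (transverse (ψ q)) at e1
      rw [← e1, spt_transverse] at e0
      exact ⟨e0, e0.trans (hz.2 e1)⟩
  · filter_upwards [hψ.eventually_of_coord hpoint, hψ.eventually_of_coord hθ, hsheet 0, hsheet 1]
      with q hq hq' h0 h1
    rw [h0, h1]
    obtain ⟨hT, -, -, -, -, hz⟩ := hq.1
    rw [Function.comp_apply, hq.2] at hT
    have hS : S (transverse (ψ q)) = _ := N.crease.S_eq (transverse (ψ q))
    constructor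
    · rintro ⟨e0, e1⟩
      have e2 := hz.1 (e0.symm.trans e1)
      refine ⟨?_, e2⟩
      change τ q = S (transverse (ψ q))
      rw [hS, ← e2, spt_transverse, ← e0, pt_spatial, Function.comp_apply, hq.2]
    · rintro ⟨e0, e1⟩
      change τ q = S (transverse (ψ q)) at e0
      change ψ q 3 = ζ (transverse (ψ q)) at e1
      have e2 := hq'.1
      rw [← e0, ← e1, spt_transverse, ← hT] at e2
      exact ⟨e2.symm, e2.symm.trans (hz.2 e1)⟩
  · exact N.θ_expansion
  · exact N.ζ_expansion
  · exact N.S_expansion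

end Chart

/-! ### Morse coordinates for the crease -/

/-- The linear automorphism of the plane with a given invertible matrix. -/
def planeEquiv (a b c d : ℝ) (h : a * d - b * c ≠ 0) : Plane ≃L[ℝ] Plane :=
  LinearEquiv.toContinuousLinearEquiv
    { toFun := fun x ↦ !₂[a * x 0 + b * x 1, c * x 0 + d * x 1]
      invFun := fun x ↦ !₂[(d * x 0 - b * x 1) / (a * d - b * c),
        (a * x 1 - c * x 0) / (a * d - b * c)]
      map_add' := fun x y ↦ by ext i; fin_cases i <;> simp <;> ring
      map_smul' := fun r x ↦ by ext i; fin_cases i <;> simp <;> ring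
      left_inv := fun x ↦ by
        ext i
        fin_cases i
        · change (d * (a * x 0 + b * x 1) - b * (c * x 0 + d * x 1)) / (a * d - b * c) = x 0
          rw [div_eq_iff h]; ring
        · change (a * (c * x 0 + d * x 1) - c * (a * x 0 + b * x 1)) / (a * d - b * c) = x 1
          rw [div_eq_iff h]; ring
      right_inv := fun x ↦ by
        ext i
        fin_cases i
        · change a * ((d * x 0 - b * x 1) / (a * d - b * c))
            + b * ((a * x 1 - c * x 0) / (a * d - b * c)) = x 0
          rw [← mul_div_assoc, ← mul_div_assoc, ← add_div, div_eq_iff h]; ring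
        · change c * ((d * x 0 - b * x 1) / (a * d - b * c))
            + d * ((a * x 1 - c * x 0) / (a * d - b * c)) = x 1
          rw [← mul_div_assoc, ← mul_div_assoc, ← add_div, div_eq_iff h]; ring }

@[simp] theorem planeEquiv_zero {a b c d : ℝ} (h : a * d - b * c ≠ 0) (x : Plane) :
    planeEquiv a b c d h x 0 = a * x 0 + b * x 1 := rfl

@[simp] theorem planeEquiv_one {a b c d : ℝ} (h : a * d - b * c ≠ 0) (x : Plane) :
    planeEquiv a b c d h x 1 = c * x 0 + d * x 1 := rfl

lemma posDef_of_quad_pos {Q : Matrix (Fin 2) (Fin 2) ℝ} (hQ : Q.IsSymm)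
    (h : ∀ x : Plane, x ≠ 0 → 0 < quad Q x) : Q.PosDef := by
  refine Matrix.PosDef.of_dotProduct_mulVec_pos (by
    rw [Matrix.IsHermitian, Matrix.conjTranspose_eq_transpose_of_trivial]; exact hQ) fun x hx ↦ ?_
  have h1 := h (WithLp.toLp 2 x) (fun h0 ↦ hx (by
    have := congrArg WithLp.ofLp h0
    simpa using this))
  simp [quad, Fin.sum_univ_two, Matrix.mulVec, dotProduct] at h1 ⊢
  linarith

/-- Sylvester's law for a nondegenerate binary quadratic form. -/
lemma exists_normal_form {Q : Matrix (Fin 2) (Fin 2) ℝ} (hQ : Q.IsSymm) (hdet : Q.det ≠ 0) :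
    ∃ (e : Plane ≃L[ℝ] Plane) (ε₀ ε₁ : ℝ),
      (∀ x, quad Q x = ε₀ * e x 0 ^ 2 + ε₁ * e x 1 ^ 2) ∧
      ((ε₀ = -1 ∧ ε₁ = -1 ∧ (-Q).PosDef) ∨ (ε₀ = 1 ∧ ε₁ = 1 ∧ Q.PosDef) ∨
        (ε₀ = 1 ∧ ε₁ = -1 ∧ Q.det < 0)) := by
  have h10 : Q 1 0 = Q 0 1 := congrFun (congrFun hQ 0) 1
  have hdet' : Q.det = Q 0 0 * Q 1 1 - Q 0 1 ^ 2 := by rw [Matrix.det_fin_two, h10]; ring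
  have hq (x : Plane) : quad Q x = Q 0 0 * x 0 ^ 2 + 2 * Q 0 1 * x 0 * x 1 + Q 1 1 * x 1 ^ 2 := by
    simp only [quad, Fin.sum_univ_two, h10]
    ring
  by_cases h00 : Q 0 0 = 0
  · have h01 : Q 0 1 ≠ 0 := by
      rintro h
      rw [hdet', h00, h] at hdet
      simp at hdet
    refine ⟨planeEquiv (Q 0 1) ((Q 1 1 + 1) / 2) (Q 0 1) ((Q 1 1 - 1) / 2) (by ring_nf; simpa), 1, -1,
      fun x ↦ ?_, Or.inr (Or.inr ⟨rfl, rfl, ?_⟩)⟩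
    · rw [hq, planeEquiv_zero, planeEquiv_one, h00]; ring
    · rw [hdet', h00]
      have : 0 < Q 0 1 ^ 2 := by positivity
      linarith
  · set D := Q.det / Q 0 0 with hD
    have hD0 : D ≠ 0 := div_ne_zero hdet h00
    have hform (x : Plane) : quad Q x = Q 0 0 * (x 0 + Q 0 1 / Q 0 0 * x 1) ^ 2 + D * x 1 ^ 2 := by
      rw [hq, hD, hdet']
      field_simp
      ring
    have hs0 : 0 < √|Q 0 0| := Real.sqrt_pos.2 (abs_pos.2 h00)
    have hs1 : 0 < √|D| := Real.sqrt_pos.2 (abs_pos.2 hD0)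
    have e0 : √|Q 0 0| ^ 2 = |Q 0 0| := Real.sq_sqrt (abs_nonneg _)
    have e1 : √|D| ^ 2 = |D| := Real.sq_sqrt (abs_nonneg _)
    rcases lt_or_gt_of_ne h00 with hn | hp <;> rcases lt_or_gt_of_ne hD0 with hn' | hp'
    · refine ⟨planeEquiv (√|Q 0 0|) (√|Q 0 0| * (Q 0 1 / Q 0 0)) 0 (√|D|)
        (by simp [hs0.ne', hs1.ne']), -1, -1, ?_, Or.inl ⟨rfl, rfl, ?_⟩⟩
      · intro x
        rw [hform, planeEquiv_zero, planeEquiv_one]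
        rw [abs_of_neg hn] at *
        rw [abs_of_neg hn'] at *
        linear_combination (x 0 + Q 0 1 / Q 0 0 * x 1) ^ 2 * e0 + (x 1) ^ 2 * e1
      · refine posDef_of_quad_pos (Matrix.IsSymm.neg hQ) fun x hx ↦ ?_
        have : quad (-Q) x = - quad Q x := by simp [quad, Fin.sum_univ_two]; ring
        rw [this, hform]
        by_cases h1 : x 1 = 0
        · have h0 : x 0 ≠ 0 := fun h0 ↦ hx (by ext i; fin_cases i <;> simp [h0, h1])
          have : 0 < x 0 ^ 2 := by positivity
          rw [h1]
          simp
          nlinarith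
        · have h2 : 0 < x 1 ^ 2 := by positivity
          nlinarith [sq_nonneg (x 0 + Q 0 1 / Q 0 0 * x 1), mul_pos (neg_pos.2 hn') h2,
            mul_nonneg (neg_pos.2 hn).le (sq_nonneg (x 0 + Q 0 1 / Q 0 0 * x 1))]
    · refine ⟨planeEquiv 0 (√|D|) (√|Q 0 0|) (√|Q 0 0| * (Q 0 1 / Q 0 0))
        (by simp [hs0.ne', hs1.ne']), 1, -1, ?_, Or.inr (Or.inr ⟨rfl, rfl, ?_⟩)⟩
      · intro x
        rw [hform, planeEquiv_zero, planeEquiv_one]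
        rw [abs_of_neg hn] at *
        rw [abs_of_pos hp'] at *
        linear_combination (x 0 + Q 0 1 / Q 0 0 * x 1) ^ 2 * e0 - (x 1) ^ 2 * e1
      · have : Q.det = D * Q 0 0 := by rw [hD]; field_simp
        rw [this]
        exact mul_neg_of_pos_of_neg hp' hn
    · refine ⟨planeEquiv (√|Q 0 0|) (√|Q 0 0| * (Q 0 1 / Q 0 0)) 0 (√|D|)
        (by simp [hs0.ne', hs1.ne']), 1, -1, ?_, Or.inr (Or.inr ⟨rfl, rfl, ?_⟩)⟩
      · intro x
        rw [hform, planeEquiv_zero, planeEquiv_one]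
        rw [abs_of_pos hp] at *
        rw [abs_of_neg hn'] at *
        linear_combination -(x 0 + Q 0 1 / Q 0 0 * x 1) ^ 2 * e0 + (x 1) ^ 2 * e1
      · have : Q.det = D * Q 0 0 := by rw [hD]; field_simp
        rw [this]
        exact mul_neg_of_neg_of_pos hn' hp
    · refine ⟨planeEquiv (√|Q 0 0|) (√|Q 0 0| * (Q 0 1 / Q 0 0)) 0 (√|D|)
        (by simp [hs0.ne', hs1.ne']), 1, 1, ?_, Or.inr (Or.inl ⟨rfl, rfl, ?_⟩)⟩
      · intro x
        rw [hform, planeEquiv_zero, planeEquiv_one]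
        rw [abs_of_pos hp] at *
        rw [abs_of_pos hp'] at *
        linear_combination -(x 0 + Q 0 1 / Q 0 0 * x 1) ^ 2 * e0 - (x 1) ^ 2 * e1
      · refine posDef_of_quad_pos hQ fun x hx ↦ ?_
        rw [hform]
        by_cases h1 : x 1 = 0
        · have h0 : x 0 ≠ 0 := fun h0 ↦ hx (by ext i; fin_cases i <;> simp [h0, h1])
          have : 0 < x 0 ^ 2 := by positivity
          rw [h1]
          simp
          nlinarith
        · have h2 : 0 < x 1 ^ 2 := by positivity
          nlinarith [sq_nonneg (x 0 + Q 0 1 / Q 0 0 * x 1), mul_pos hp' h2,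
            mul_nonneg hp.le (sq_nonneg (x 0 + Q 0 1 / Q 0 0 * x 1))]

/-- Coordinates `η` of the transverse plane in which `2 a S` is a sum of signed squares. -/
structure IsMorseChart (a : ℝ) (S : Plane → ℝ) (e : Plane ≃L[ℝ] Plane) (ε₀ ε₁ : ℝ)
    (η : OpenPartialHomeomorph Plane Plane) : Prop where
  zero_mem : 0 ∈ η.source
  map_zero : η 0 = 0
  smooth : ContDiffOn ℝ ∞ η η.source
  smooth_symm : ContDiffOn ℝ ∞ η.symm η.target
  hasFDerivAt : HasFDerivAt η (e : Plane →L[ℝ] Plane) 0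
  eq : ∀ x ∈ η.source, 2 * a * S x = ε₀ * η x 0 ^ 2 + ε₁ * η x 1 ^ 2

lemma exists_isMorseChart {a : ℝ} {S : Plane → ℝ} {Q : Matrix (Fin 2) (Fin 2) ℝ}
    {e : Plane ≃L[ℝ] Plane} {ε₀ ε₁ : ℝ} (hS : SmoothNear S 0)
    (hexp : (fun x : Plane ↦ 2 * a * S x - quad Q x) =O[𝓝 0] fun x ↦ ‖x‖ ^ 3)
    (h₀ : ε₀ ^ 2 = 1) (h₁ : ε₁ ^ 2 = 1)
    (he : ∀ x, quad Q x = ε₀ * e x 0 ^ 2 + ε₁ * e x 1 ^ 2) :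
    ∃ η, IsMorseChart a S e ε₀ ε₁ η := by
  have hsymm : Tendsto e.symm (𝓝 0) (𝓝 0) := by
    have := e.symm.continuous.tendsto 0
    rwa [_root_.map_zero] at this
  obtain ⟨χ, h0, hχ0, hχ, hχs, hχd, hχf⟩ := morse_plane (f := fun x ↦ 2 * a * S (e.symm x))
    (by
      have h1 : SmoothNear (fun x ↦ S (e.symm x)) 0 :=
        SmoothNear.comp (g := S) (by rw [_root_.map_zero]; exact hS) (.of_contDiff e.symm.contDiff)
      exact (SmoothNear.of_contDiff contDiff_const).smul h1) h₀ h₁ (by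
    refine ((hexp.comp_tendsto hsymm).congr_left fun x ↦ ?_).trans
      (((e.symm : Plane →L[ℝ] Plane).isBigO_id (𝓝 0)).norm_left.norm_right.pow 3)
    simp [he])
  refine ⟨e.toHomeomorph.toOpenPartialHomeomorph.trans χ, ?_, ?_, ?_, ?_, ?_, ?_⟩
  · simpa using h0
  · simpa using hχ0
  · refine hχ.comp (g := χ) (f := e) (e.contDiff.contDiffOn) ?_
    intro x hx
    simpa using hx
  · have h2 : ContDiffOn ℝ ∞ (e.symm ∘ χ.symm) χ.target := e.symm.contDiff.comp_contDiffOn hχs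
    refine h2.mono ?_
    intro x hx
    simpa using hx
  · have h3 : HasFDerivAt χ (ContinuousLinearMap.id ℝ Plane) (e 0) := by
      rw [_root_.map_zero]; exact hχd
    exact HasFDerivAt.comp (f := e) 0 h3 e.hasFDerivAt
  · intro x hx
    have := hχf (e x) (by simpa using hx)
    simpa using this

lemma IsMorseChart.creaseIsConic {D : LocalData} {e : Plane ≃L[ℝ] Plane} {ε₀ ε₁ : ℝ}
    {η : OpenPartialHomeomorph Plane Plane} (hη : IsMorseChart D.a D.S e ε₀ ε₁ η)
    (he : ∀ x, quad D.Q x = ε₀ * e x 0 ^ 2 + ε₁ * e x 1 ^ 2) : D.CreaseIsConic := by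
  refine ⟨η.trans e.symm.toHomeomorph.toOpenPartialHomeomorph, ?_, ?_, ?_, ?_, ?_, ?_⟩
  · simpa using hη.zero_mem
  · simpa using hη.map_zero
  · have : ContDiffOn ℝ ∞ (e.symm ∘ η) η.source := e.symm.contDiff.comp_contDiffOn hη.smooth
    refine this.mono ?_
    intro x hx
    simpa using hx
  · refine hη.smooth_symm.comp (g := η.symm) (f := e) (e.contDiff.contDiffOn) ?_
    intro x hx
    simpa using hx
  · have h1 : HasFDerivAt (e.symm ∘ η) _ 0 := e.symm.hasFDerivAt.comp (0 : Plane) hη.hasFDerivAt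
    rw [ContinuousLinearEquiv.coe_symm_comp_coe] at h1
    exact h1
  · intro x hx
    have := hη.eq x (by simpa using hx)
    rw [this, he]
    simp

/-! ### Causality near the pinch point -/

lemma exists_flow {E : Type*} [NormedAddCommGroup E] [NormedSpace ℝ E] [CompleteSpace E]
    {f : E → E} (hf : ContDiffAt ℝ 1 f 0) {N : Set E} (hN : N ∈ 𝓝 0) :
    ∃ ε > 0, ∃ r > 0, ∀ x : E, ‖x‖ ≤ r → ∃ α : ℝ → E, α 0 = x ∧
      ∀ s ∈ Icc (-ε) ε, α s ∈ N ∧ HasDerivAt α (f (α s)) s := by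
  obtain ⟨ε, hε, a, r, L, K, hr, hpl⟩ := IsPicardLindelof.of_contDiffAt_one hf
  obtain ⟨α, hα, hcont⟩ :=
    (hpl 0).exists_forall_mem_closedBall_eq_hasDerivWithinAt_continuousOn
  have hr' : (0 : ℝ) < r := hr
  have hca : ContinuousAt α (0, 0) := by
    refine hcont.continuousAt ?_
    exact prod_mem_nhds (Metric.closedBall_mem_nhds _ hr') (Icc_mem_nhds (by linarith) (by linarith))
  have h0 : α (0, 0) = 0 := (hα 0 (Metric.mem_closedBall_self hr'.le)).1
  have hev : ∀ᶠ u in 𝓝 ((0 : E), (0 : ℝ)), α u ∈ N := hca.eventually (by rwa [h0])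
  obtain ⟨δ, hδ, hball⟩ := eventually_nhds_iff_ball.1 hev
  refine ⟨min (ε / 2) (δ / 2), by positivity, min r (δ / 2), by positivity, fun x hx ↦ ?_⟩
  have hxr : x ∈ closedBall (0 : E) r := by
    simpa using hx.trans (min_le_left _ _)
  refine ⟨fun s ↦ α (x, s), (hα x hxr).1, fun s hs ↦ ⟨?_, ?_⟩⟩
  · refine hball (x, s) ?_
    have h1 : ‖x‖ < δ := by have := hx.trans (min_le_right _ _); linarith
    have h2 : |s| < δ := by
      have h3 : |s| ≤ min (ε / 2) (δ / 2) := abs_le.2 hs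
      have := h3.trans (min_le_right _ _)
      linarith
    simpa [Prod.dist_eq] using ⟨h1, h2⟩
  · have hs1 : -ε < s := by
      have := hs.1; have := min_le_left (ε / 2) (δ / 2); linarith
    have hs2 : s < ε := by
      have := hs.2; have := min_le_left (ε / 2) (δ / 2); linarith
    exact ((hα x hxr).2 s ⟨by linarith, by linarith⟩).hasDerivAt
      (Icc_mem_nhds (by linarith) (by linarith))

/-- A function that can only cross zero upwards, starting from a nonnegative value. -/
lemma pos_of_barrier {g : ℝ → ℝ} {l : ℝ} (hl : 0 < l) (hg : ContinuousOn g (Icc 0 l))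
    (h0 : 0 ≤ g 0) (hd : ∀ s ∈ Icc 0 l, g s = 0 → ∃ d > 0, HasDerivWithinAt g d (Icc 0 l) s) :
    0 < g l := by
  have key : Icc 0 l ⊆ {s | 0 ≤ g s} := by
    refine IsClosed.Icc_subset_of_forall_exists_gt ?_ h0 ?_
    · have := hg.preimage_isClosed_of_isClosed isClosed_Icc (isClosed_Ici (a := (0 : ℝ)))
      rwa [inter_comm] at this
    · rintro x ⟨hx, hxl⟩ y hy
      have hxI : x ∈ Icc 0 l := ⟨hxl.1, hxl.2.le⟩
      have hfin : ∀ᶠ z in 𝓝[>] x, 0 ≤ g z := by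
        have hmem : 𝓝[>] x ≤ 𝓝[Icc 0 l] x := by
          rw [← nhdsWithin_Ioo_eq_nhdsGT hxl.2]
          exact nhdsWithin_mono _ fun z hz ↦ ⟨hxl.1.trans hz.1.le, hz.2.le⟩
        rcases (show 0 ≤ g x from hx).eq_or_lt with h | h
        · obtain ⟨d, hdp, hd'⟩ := hd x hxI h.symm
          have h1 := (hasDerivWithinAt_iff_tendsto_slope.1 hd').eventually_const_lt hdp
          have h2 : 𝓝[>] x ≤ 𝓝[Icc 0 l \ {x}] x := by
            rw [← nhdsWithin_Ioo_eq_nhdsGT hxl.2]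
            exact nhdsWithin_mono _ fun z hz ↦ ⟨⟨hxl.1.trans hz.1.le, hz.2.le⟩, hz.1.ne'⟩
          filter_upwards [h2 h1, self_mem_nhdsWithin] with z hz hzx
          rw [slope_def_field, ← h, sub_zero] at hz
          exact ((div_pos_iff_of_pos_right (sub_pos.2 hzx)).1 hz).le
        · filter_upwards [hmem ((hg x hxI).eventually_const_lt h)] with z hz
          exact hz.le
      have h3 : ∀ᶠ z in 𝓝[>] x, z ∈ Ioc x y := Ioc_mem_nhdsGT hy
      obtain ⟨z, hz, hz'⟩ := (hfin.and h3).exists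
      exact ⟨z, hz, hz'⟩
  have hlI : l ∈ Icc 0 l := ⟨hl.le, le_rfl⟩
  rcases (show 0 ≤ g l from key hlI).eq_or_lt with h | h
  · exfalso
    obtain ⟨d, hdp, hd'⟩ := hd l hlI h.symm
    have h1 := (hasDerivWithinAt_iff_tendsto_slope.1 hd').eventually_const_lt hdp
    have h2 : 𝓝[<] l ≤ 𝓝[Icc 0 l \ {l}] l := by
      rw [← nhdsWithin_Ioo_eq_nhdsLT hl]
      exact nhdsWithin_mono _ fun z hz ↦ ⟨⟨hz.1.le, hz.2.le⟩, hz.2.ne⟩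
    have h3 : ∀ᶠ z in 𝓝[<] l, z ∈ Ico 0 l := Ico_mem_nhdsLT hl
    obtain ⟨z, ⟨hz, hzl⟩⟩ := ((h1.filter_mono h2).and h3).exists
    rw [slope_def_field, ← h, sub_zero] at hz
    have h4 : 0 ≤ g z := key ⟨hzl.1, hzl.2.le⟩
    have : g z / (z - l) ≤ 0 := div_nonpos_of_nonneg_of_nonpos h4 (by linarith [hzl.2])
    linarith
  · exact h

/-- The gradient of `f`. -/
def grad (G : E4 → Form) (f : E4 → ℝ) (X : E4) : E4 :=
  (G X).inverse (fderiv ℝ f X)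

lemma PinchModel.smoothNear_grad {G : E4 → Form} {h : E4 → ℝ}
    {f : Fin 2 → E4 → ℝ} (m : PinchModel G h f) {k : E4 → ℝ} (hk : SmoothNear k 0) :
    SmoothNear (grad G k) 0 :=
  (m.G_smooth.clm_inverse m.isInvertible_zero).clm_apply hk.fderiv

/-- Pointwise facts, valid near the pinch point, on which the causality arguments rest. -/
structure IsGoodPoint (G : E4 → Form) (h : E4 → ℝ) (f : Fin 2 → E4 → ℝ)
    (F : Fin 2 → Space → ℝ) (X : E4) : Prop where
  symm : ∀ v w, G X v w = G X w v
  spacelike : ∀ w, fderiv ℝ h X w = 0 → w ≠ 0 → 0 < G X w w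
  grad_apply : ∀ A v, G X (grad G (f A) X) v = fderiv ℝ (f A) X v
  grad_null : ∀ A, f A X = 0 → G X (grad G (f A) X) (grad G (f A) X) = 0
  grad_future : ∀ A, f A X = 0 → 0 < fderiv ℝ h X (grad G (f A) X)
  differentiableAt_f : ∀ A, DifferentiableAt ℝ (f A) X
  differentiableAt_F : ∀ A, DifferentiableAt ℝ (F A) (spatial X)
  eq_iff : ∀ A, f A X = 0 ↔ X 0 = F A (spatial X)
  fderiv_f_neg : ∀ A, fderiv ℝ (f A) X (e4 0) < 0
  fderiv_f : ∀ A, f A X = 0 → ∀ v, fderiv ℝ (f A) X v =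
    fderiv ℝ (f A) X (e4 0) * (v 0 - fderiv ℝ (F A) (spatial X) (spatial v))
  diverge : ∀ A, 0 < (grad G (f A) X) 0 -
    fderiv ℝ (F (1 - A)) (spatial X) (spatial (grad G (f A) X))
  vertical_timelike : G X (e4 0) (e4 0) < 0
  vertical_future : 0 < fderiv ℝ h X (e4 0)

namespace IsGoodPoint

variable {f : Fin 2 → E4 → ℝ} {X : E4}

lemma sub_smul (g : IsGoodPoint G h f F X) {l : E4} (hl : G X l l = 0) (hhl : 0 < fderiv ℝ h X l)
    (v : E4) : ∃ w, v = w + (fderiv ℝ h X v / fderiv ℝ h X l) • l ∧ fderiv ℝ h X w = 0 ∧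
      G X w w = G X v v - 2 * (fderiv ℝ h X v / fderiv ℝ h X l) * G X l v := by
  refine ⟨v - (fderiv ℝ h X v / fderiv ℝ h X l) • l, by simp, ?_, ?_⟩
  · rw [map_sub, map_smul, smul_eq_mul]
    field_simp
    simp
  · simp only [map_sub, map_smul, sub_apply, smul_apply, smul_eq_mul, hl]
    rw [g.symm v l]
    ring

lemma eq_smul_of_null (g : IsGoodPoint G h f F X) {A : Fin 2} (hA : f A X = 0) {v : E4}
    (hv : G X v v = 0) (hhv : 0 < fderiv ℝ h X v) (ht : fderiv ℝ (f A) X v = 0) :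
    ∃ c : ℝ, 0 < c ∧ v = c • grad G (f A) X := by
  obtain ⟨w, hw, hw0, hww⟩ := g.sub_smul (g.grad_null A hA) (g.grad_future A hA) v
  refine ⟨fderiv ℝ h X v / fderiv ℝ h X (grad G (f A) X), div_pos hhv (g.grad_future A hA), ?_⟩
  rw [hv, g.grad_apply, ht] at hww
  by_contra hne
  have : w ≠ 0 := by
    rintro rfl
    rw [zero_add] at hw
    exact hne hw
  have := g.spacelike w hw0 this
  linarith

lemma fderiv_neg_of_timelike (g : IsGoodPoint G h f F X) {A : Fin 2} (hA : f A X = 0) {v : E4}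
    (hv : G X v v < 0) (hhv : 0 < fderiv ℝ h X v) : fderiv ℝ (f A) X v < 0 := by
  obtain ⟨w, hw, hw0, hww⟩ := g.sub_smul (g.grad_null A hA) (g.grad_future A hA) v
  rw [g.grad_apply] at hww
  have h1 : 0 ≤ G X w w := by
    rcases eq_or_ne w 0 with rfl | h
    · simp
    · exact (g.spacelike w hw0 h).le
  have h2 := div_pos hhv (g.grad_future A hA)
  nlinarith

end IsGoodPoint

lemma NormalModel.eventually_isGoodPoint {G : E4 → Form} {h : E4 → ℝ}
    {f : Fin 2 → E4 → ℝ} {F : Fin 2 → Space → ℝ} {T : ℝ × Space → ℝ} {Z : Fin 2 → ℝ × Plane → ℝ}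
    {ζ S : Plane → ℝ} (N : NormalModel G h f F T Z ζ S) :
    ∀ᶠ X in 𝓝 0, IsGoodPoint G h f F X := by
  have m := N.model
  have ts : Tendsto spatial (𝓝 0) (𝓝 0) := by
    have := spatialL.continuous.tendsto 0
    rwa [map_zero] at this
  obtain ⟨κ, hκ, hf0⟩ := N.pair.fderiv_f_zero
  obtain ⟨κ', hκ', hf1⟩ := N.pair.fderiv_f_one
  have hgrad A : ∀ᶠ X in 𝓝 0, ∀ v, G X (grad G (f A) X) v = fderiv ℝ (f A) X v := by
    filter_upwards [m.eventually_inverse_apply] with X hX v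
    exact DFunLike.congr_fun (hX (fderiv ℝ (f A) X)) v
  have hnull A : ∀ᶠ X in 𝓝 0, f A X = 0 → G X (grad G (f A) X) (grad G (f A) X) = 0 ∧
      0 < fderiv ℝ h X (grad G (f A) X) := by
    filter_upwards [m.null A, hgrad A, m.eventually_isInvertible] with X hX hg hi h0
    obtain ⟨l, hl, hhl, hlv⟩ := hX h0
    have : l = grad G (f A) X := hi.injective (by ext v; rw [hlv, hg])
    rw [← this]
    exact ⟨hl, hhl⟩
  have hneg A : ∀ᶠ X in 𝓝 0, fderiv ℝ (f A) X (e4 0) < 0 := by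
    have hc : ContinuousAt (fun X ↦ fderiv ℝ (f A) X (e4 0)) 0 :=
      (m.f_smooth A).fderiv.continuousAt.clm_apply continuousAt_const
    refine hc.eventually_lt_const ?_
    fin_cases A
    · change fderiv ℝ (f 0) 0 (e4 0) < 0
      rw [hf0, e4_zero_eq]; simpa using hκ
    · change fderiv ℝ (f 1) 0 (e4 0) < 0
      rw [hf1, e4_zero_eq]; simpa using hκ'
  have hdf A : ∀ᶠ X in 𝓝 0, f A X = 0 → ∀ v, fderiv ℝ (f A) X v =
      fderiv ℝ (f A) X (e4 0) * (v 0 - fderiv ℝ (F A) (spatial X) (spatial v)) := by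
    filter_upwards [ts.eventually ((N.pair.graph A).eventually_fderiv_eq (m.f_smooth A)),
      (N.pair.graph A).eq_iff] with X hX hX' h0 v
    have h1 := hX v
    rwa [← hX'.1 h0, pt_spatial] at h1
  have hdiv A : ∀ᶠ X in 𝓝 0, 0 < (grad G (f A) X) 0 -
      fderiv ℝ (F (1 - A)) (spatial X) (spatial (grad G (f A) X)) := by
    have hc1 : ContinuousAt (grad G (f A)) 0 := (m.smoothNear_grad (m.f_smooth A)).continuousAt
    have hc2 : ContinuousAt (fun X ↦ fderiv ℝ (F (1 - A)) (spatial X)) 0 :=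
      ContinuousAt.comp (g := fderiv ℝ (F (1 - A))) (f := spatial)
        (by rw [spatial_zero_eq]; exact (N.pair.graph (1 - A)).smooth.fderiv.continuousAt)
        spatialL.continuous.continuousAt
    have hc3 : ContinuousAt (fun X ↦ spatial (grad G (f A) X)) 0 :=
      ContinuousAt.comp (g := spatial) spatialL.continuous.continuousAt hc1
    have hc4 : ContinuousAt (fun X ↦ (grad G (f A) X) 0) 0 := by
      have : Continuous fun X : E4 ↦ X 0 := by fun_prop
      exact ContinuousAt.comp (g := fun X : E4 ↦ X 0) this.continuousAt hc1
    have hc := hc4.sub (hc2.clm_apply hc3)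
    have h0 := (hgrad A).self_of_nhds (e4 0)
    have h3 := (hgrad A).self_of_nhds (e4 3)
    rw [m.G_zero] at h0 h3
    refine hc.eventually_const_lt ?_
    simp only [minkowski, e4, PiLp.single_apply] at h0 h3
    simp only [Pi.sub_apply, spatial_zero_eq]
    fin_cases A
    · change 0 < (grad G (f 0) 0) 0 - fderiv ℝ (F 1) 0 (spatial (grad G (f 0) 0))
      simp [hf0] at h0 h3
      rw [N.fderiv_F.2, spatial_two', h0, h3]
      linarith
    · change 0 < (grad G (f 1) 0) 0 - fderiv ℝ (F 0) 0 (spatial (grad G (f 1) 0))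
      simp [hf1] at h0 h3
      rw [N.fderiv_F.1, spatial_two', h0, h3]
      linarith
  have hvt : ∀ᶠ X in 𝓝 0, G X (e4 0) (e4 0) < 0 := by
    have hc : ContinuousAt (fun X ↦ G X (e4 0) (e4 0)) 0 :=
      (m.G_smooth.continuousAt.clm_apply continuousAt_const).clm_apply continuousAt_const
    refine hc.eventually_lt_const ?_
    change G 0 (e4 0) (e4 0) < 0
    rw [m.G_zero, minkowski_eq, e4_zero_eq]
    simp
  have hvf : ∀ᶠ X in 𝓝 0, 0 < fderiv ℝ h X (e4 0) := by
    have hc : ContinuousAt (fun X ↦ fderiv ℝ h X (e4 0)) 0 :=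
      m.h_smooth.fderiv.continuousAt.clm_apply continuousAt_const
    exact hc.eventually_const_lt m.h_future
  filter_upwards [m.spacelike, eventually_all.2 hgrad, eventually_all.2 hnull,
    eventually_all.2 fun A ↦ (m.f_smooth A : ∀ᶠ X in 𝓝 0, ContDiffAt ℝ ∞ (f A) X),
    eventually_all.2 fun A ↦ ts.eventually (N.pair.graph A).smooth,
    eventually_all.2 fun A ↦ (N.pair.graph A).eq_iff, eventually_all.2 hneg,
    eventually_all.2 hdf, eventually_all.2 hdiv, hvt, hvf]
    with X h1 h2 h3 h4 h5 h6 h7 h8 h9 h10 h11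
  exact ⟨m.G_symm X, h1, h2, fun A hA ↦ (h3 A hA).1, fun A hA ↦ (h3 A hA).2,
    fun A ↦ (h4 A).differentiableAt (by simp), fun A ↦ (h5 A).differentiableAt (by simp), h6, h7, h8,
    h9, h10, h11⟩

/-! ### Horizon and black hole region in coordinates -/

def CoordNull (G : E4 → Form) (h : E4 → ℝ) (X v : E4) : Prop :=
  G X v v = 0 ∧ 0 < fderiv ℝ h X v

def CoordTimelike (G : E4 → Form) (h : E4 → ℝ) (X v : E4) : Prop :=
  G X v v < 0 ∧ 0 < fderiv ℝ h X v

def coordCrease (f : Fin 2 → E4 → ℝ) (V : Set E4) : Set E4 := {X ∈ V | f 0 X = 0 ∧ f 1 X = 0}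

def coordHorizon (G : E4 → Form) (h : E4 → ℝ) (f : Fin 2 → E4 → ℝ) (V : Set E4) :
    Set E4 := {X | X ∈ coordCrease f V ∨
      ∃ A, ∃ r ∈ coordCrease f V, CoordJoined (CoordNull G h) {Y ∈ V | f A Y = 0} r X}

def coordBlackHole (G : E4 → Form) (h : E4 → ℝ) (f : Fin 2 → E4 → ℝ)
    (V : Set E4) : Set E4 :=
  {X | ∃ r ∈ coordHorizon G h f V, CoordJoined (CoordTimelike G h) V r X}

section

variable {f : Fin 2 → E4 → ℝ} {V : Set E4}

lemma CoordJoined.mem {P : E4 → E4 → Prop} {r q : E4} (h : CoordJoined P V r q) : q ∈ V := by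
  obtain ⟨c, l, hl, h0, h1, hc⟩ := h
  rw [← h1]
  exact (hc l ⟨hl.le, le_rfl⟩).1

lemma mem_of_mem_coordHorizon {X : E4} (hX : X ∈ coordHorizon G h f V) : X ∈ V := by
  rcases hX with h | ⟨A, r, hr, hj⟩
  · exact h.1
  · exact hj.mem.1

lemma hasDerivWithinAt_height {F : Space → ℝ} {c : ℝ → E4} {v : E4} {I : Set ℝ} {s : ℝ}
    (hF : DifferentiableAt ℝ F (spatial (c s))) (hc : HasDerivWithinAt c v I s) :
    HasDerivWithinAt (fun s ↦ c s 0 - F (spatial (c s)))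
      (v 0 - fderiv ℝ F (spatial (c s)) (spatial v)) I s := by
  have h1 : HasDerivWithinAt (fun s ↦ c s 0) (v 0) I s :=
    ((EuclideanSpace.proj 0 : E4 →L[ℝ] ℝ).hasFDerivAt.comp_hasDerivWithinAt s hc :)
  have h2 : HasDerivWithinAt (fun s ↦ spatial (c s)) (spatial v) I s :=
    (spatialL.hasFDerivAt.comp_hasDerivWithinAt s hc :)
  exact h1.sub (hF.hasFDerivAt.comp_hasDerivWithinAt s h2)

lemma fin_two_cases (A B : Fin 2) : B = A ∨ B = 1 - A := by
  fin_cases A <;> fin_cases B <;> simp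

/-- Points of the horizon lie on the upper envelope of the two sheets. -/
lemma height_of_mem_coordHorizon (hV : ∀ X ∈ V, IsGoodPoint G h f F X) {X : E4}
    (hX : X ∈ coordHorizon G h f V) :
    (∀ A, F A (spatial X) ≤ X 0) ∧ ∃ A, X 0 = F A (spatial X) := by
  rcases hX with hX | ⟨A, r, hr, c, l, hl, h0, h1, hc⟩
  · have g := hV X hX.1
    have e0 := (g.eq_iff 0).1 hX.2.1
    have e1 := (g.eq_iff 1).1 hX.2.2
    refine ⟨fun A ↦ ?_, 0, e0⟩
    fin_cases A
    · exact e0.ge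
    · exact e1.ge
  · have hlI : l ∈ Icc 0 l := ⟨hl.le, le_rfl⟩
    have hder s (hs : s ∈ Icc 0 l) : ∃ d > 0, HasDerivWithinAt
        (fun s ↦ c s 0 - F (1 - A) (spatial (c s))) d (Icc 0 l) s := by
      obtain ⟨⟨hcV, hcA⟩, v, hv, hcv⟩ := hc s hs
      have g := hV _ hcV
      have ht : fderiv ℝ (f A) (c s) v = 0 := by
        have h2 := (g.differentiableAt_f A).hasFDerivAt.comp_hasDerivWithinAt s hcv
        have h3 : HasDerivWithinAt (f A ∘ c) 0 (Icc 0 l) s :=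
          (hasDerivWithinAt_const s (Icc 0 l) (0 : ℝ)).congr
            (fun x hx ↦ (hc x hx).1.2) (hc s hs).1.2
        exact (uniqueDiffOn_Icc hl s hs).eq_deriv _ h2 h3
      obtain ⟨k, hk, rfl⟩ := g.eq_smul_of_null hcA hv.1 hv.2 ht
      refine ⟨_, ?_, hasDerivWithinAt_height (g.differentiableAt_F (1 - A)) hcv⟩
      have h4 : spatial (k • grad G (f A) (c s)) = k • spatial (grad G (f A) (c s)) :=
        map_smul spatialL _ _
      rw [h4, map_smul, smul_eq_mul, PiLp.smul_apply, smul_eq_mul, ← mul_sub]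
      exact mul_pos hk (g.diverge A)
    have hpos : 0 < c l 0 - F (1 - A) (spatial (c l)) := by
      refine pos_of_barrier (g := fun s ↦ c s 0 - F (1 - A) (spatial (c s))) hl
        (fun s hs ↦ ?_) ?_ (fun s hs _ ↦ hder s hs)
      · obtain ⟨d, -, hd⟩ := hder s hs
        exact hd.continuousWithinAt
      · rw [h0]
        have g := hV r hr.1
        have : f (1 - A) r = 0 := by
          fin_cases A
          · exact hr.2.2
          · exact hr.2.1
        rw [(g.eq_iff (1 - A)).1 this, sub_self]
    have hgl := hV _ (hc l hlI).1.1
    have hA := (hgl.eq_iff A).1 (hc l hlI).1.2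
    rw [h1] at hA hpos
    refine ⟨fun B ↦ ?_, A, hA⟩
    rcases fin_two_cases A B with rfl | rfl
    · exact hA.ge
    · linarith

lemma height_of_mem_coordBlackHole (hV : ∀ X ∈ V, IsGoodPoint G h f F X) {X : E4}
    (hX : X ∈ coordBlackHole G h f V) (A : Fin 2) : F A (spatial X) < X 0 := by
  obtain ⟨r, hr, c, l, hl, h0, h1, hc⟩ := hX
  have hder s (hs : s ∈ Icc 0 l) : ∃ v, CoordTimelike G h (c s) v ∧ HasDerivWithinAt
      (fun s ↦ c s 0 - F A (spatial (c s)))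
      (v 0 - fderiv ℝ (F A) (spatial (c s)) (spatial v)) (Icc 0 l) s := by
    obtain ⟨hcV, v, hv, hcv⟩ := hc s hs
    exact ⟨v, hv, hasDerivWithinAt_height ((hV _ hcV).differentiableAt_F A) hcv⟩
  have hpos : 0 < c l 0 - F A (spatial (c l)) := by
    refine pos_of_barrier (g := fun s ↦ c s 0 - F A (spatial (c s))) hl
      (fun s hs ↦ ?_) ?_ (fun s hs hs0 ↦ ?_)
    · obtain ⟨v, -, hd⟩ := hder s hs
      exact hd.continuousWithinAt
    · rw [h0]
      exact sub_nonneg.2 ((height_of_mem_coordHorizon hV hr).1 A)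
    · obtain ⟨v, hv, hd⟩ := hder s hs
      refine ⟨_, ?_, hd⟩
      have g := hV _ (hc s hs).1
      have hA : f A (c s) = 0 := (g.eq_iff A).2 (sub_eq_zero.1 hs0)
      have h3 := g.fderiv_neg_of_timelike hA hv.1 hv.2
      rw [g.fderiv_f A hA] at h3
      exact pos_of_mul_neg_right h3 (g.fderiv_f_neg A).le
  rw [h1] at hpos
  linarith

end

namespace NormalModel

variable {f : Fin 2 → E4 → ℝ}

/-- Points of the sheet `A` above the other sheet are reached from the crease along a generator. -/
lemma eventually_mem_coordHorizon (N : NormalModel G h f F T Z ζ S) {V : Set E4} (hV : V ∈ 𝓝 0)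
    (A : Fin 2) : ∀ᶠ y in 𝓝 (0 : Space), F (1 - A) y < F A y →
      pt (F A y) y ∈ coordHorizon G h f V := by
  set P : Space → E4 := fun y ↦ pt (F A y) y with hPdef
  have hPt : Tendsto P (𝓝 0) (𝓝 0) := (N.pair.graph A).tendsto_graph
  have hPs : SmoothNear P 0 := (N.pair.graph A).smoothNear_graph
  have hP0 : P 0 = 0 := by simp [P, (N.pair.graph A).zero]
  set X : Space → Space := fun y ↦ spatial (grad G (f A) (P y)) with hXdef
  have hX : SmoothNear X 0 :=
    SmoothNear.comp (g := spatialL) (.of_contDiff spatialL.contDiff)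
      (SmoothNear.comp (g := grad G (f A)) (by
        rw [hP0]; exact N.model.smoothNear_grad (N.model.f_smooth A)) hPs)
  set g : Space → ℝ := fun y ↦ F A y - F (1 - A) y with hgdef
  have hg : SmoothNear g 0 := (N.pair.graph A).smooth.sub (N.pair.graph (1 - A)).smooth
  have hg0 : g 0 = 0 := by simp [g, (N.pair.graph _).zero]
  have hgood := N.eventually_isGoodPoint
  set k₀ := fderiv ℝ g 0 (X 0) / 2 with hk₀
  -- the generator direction, lifted to the sheet
  have hlift : ∀ᶠ y in 𝓝 0, IsGoodPoint G h f F (P y) ∧ f A (P y) = 0 ∧ P y ∈ V ∧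
      DifferentiableAt ℝ g y ∧ k₀ ≤ fderiv ℝ g y (X y) ∧ 0 < k₀ := by
    have hpos : 0 < k₀ := by
      have h1 := hgood.self_of_nhds
      have h2 := h1.diverge A
      have h3 := h1.grad_null A (N.model.f_zero A)
      rw [h1.grad_apply, h1.fderiv_f A (N.model.f_zero A)] at h3
      have h4 := (mul_eq_zero.1 h3).resolve_left (h1.fderiv_f_neg A).ne
      have h5 : fderiv ℝ g 0 = fderiv ℝ (F A) 0 - fderiv ℝ (F (1 - A)) 0 :=
        fderiv_fun_sub (N.pair.graph A).smooth.differentiableAt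
          (N.pair.graph (1 - A)).smooth.differentiableAt
      rw [hk₀, h5]
      simp only [X, hP0, sub_apply]
      rw [spatial_zero_eq] at h2 h4
      linarith
    have hc : ContinuousAt (fun y ↦ fderiv ℝ g y (X y)) 0 :=
      hg.fderiv.continuousAt.clm_apply hX.continuousAt
    have hlt : k₀ < fderiv ℝ g 0 (X 0) := by rw [hk₀] at hpos ⊢; linarith
    filter_upwards [hPt.eventually hgood, (N.pair.graph A).apply_graph, hPt.eventually hV, hg,
      hc.eventually_const_lt hlt] with y h1 h2 h3 h4 h5
    exact ⟨h1, h2, h3, h4.differentiableAt (by simp), h5.le, hpos⟩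
  obtain ⟨ε, hε, r, hr, hflow⟩ := exists_flow (hX.contDiffAt.of_le (by norm_cast)) hlift
  have hk₀pos := hlift.self_of_nhds.2.2.2.2.2
  have hsmall : ∀ᶠ y in 𝓝 0, g y < k₀ * ε :=
    hg.continuousAt.eventually_lt_const (by rw [hg0]; positivity)
  filter_upwards [hsmall, Metric.closedBall_mem_nhds (0 : Space) hr] with y hy hyr hlt
  obtain ⟨α, hα0, hα⟩ := hflow y (by simpa using hyr)
  have hcont : ContinuousOn α (Icc (-ε) ε) := fun s hs ↦ (hα s hs).2.continuousAt.continuousWithinAt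
  have hgα : ∀ s ∈ Icc (-ε) ε, HasDerivAt (fun s ↦ g (α s)) (fderiv ℝ g (α s) (X (α s))) s :=
    fun s hs ↦ (hα s hs).1.2.2.2.1.hasFDerivAt.comp_hasDerivAt s (hα s hs).2
  have hneg : g (α (-ε)) < 0 := by
    have hmono : MonotoneOn (fun s ↦ g (α s) - k₀ * s) (Icc (-ε) ε) := by
      have hd : ∀ s ∈ Icc (-ε) ε, HasDerivAt (fun s ↦ g (α s) - k₀ * s)
          (fderiv ℝ g (α s) (X (α s)) - k₀) s := fun s hs ↦ by
        exact ((hgα s hs).fun_sub ((hasDerivAt_id s).const_mul k₀)).congr_deriv (by simp)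
      refine monotoneOn_of_hasDerivWithinAt_nonneg (convex_Icc _ _)
        (fun s hs ↦ (hd s hs).continuousAt.continuousWithinAt)
        (fun s hs ↦ (hd s (interior_subset hs)).hasDerivWithinAt) fun s hs ↦ ?_
      exact sub_nonneg.2 (hα s (interior_subset hs)).1.2.2.2.2.1
    have := hmono ⟨le_rfl, by linarith⟩ ⟨by linarith, hε.le⟩ (by linarith : -ε ≤ 0)
    simp only [hα0] at this
    linarith
  obtain ⟨s₀, hs₀, hgs₀⟩ : ∃ s₀ ∈ Icc (-ε) 0, g (α s₀) = 0 := by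
    have hc : ContinuousOn (fun s ↦ g (α s)) (Icc (-ε) 0) := fun s hs ↦
      (hgα s ⟨hs.1, hs.2.trans hε.le⟩).continuousAt.continuousWithinAt
    have := intermediate_value_Icc (by linarith) hc
    exact this ⟨hneg.le, by rw [hα0]; exact (sub_pos.2 hlt).le⟩
  have hs₀neg : s₀ < 0 := by
    refine lt_of_le_of_ne hs₀.2 ?_
    rintro rfl
    rw [hα0] at hgs₀
    exact (sub_pos.2 hlt).ne' hgs₀
  have hs₀I : s₀ ∈ Icc (-ε) ε := ⟨hs₀.1, by linarith⟩
  refine Or.inr ⟨A, P (α s₀), ⟨(hα s₀ hs₀I).1.2.2.1, ?_⟩, fun s ↦ P (α (s₀ + s)), -s₀,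
    by linarith, by simp, by simp [hα0, P], ?_⟩
  · have g1 := (hα s₀ hs₀I).1.1
    have e1 := (hα s₀ hs₀I).1.2.1
    have e2 : f (1 - A) (P (α s₀)) = 0 := by
      rw [g1.eq_iff]
      simp only [P, pt_zero', spatial_pt]
      exact sub_eq_zero.1 hgs₀
    fin_cases A
    · exact ⟨e1, e2⟩
    · exact ⟨e2, e1⟩
  · intro s hs
    have hsI : s₀ + s ∈ Icc (-ε) ε := ⟨by linarith [hs.1, hs₀.1], by linarith [hs.2]⟩
    obtain ⟨⟨g1, e1, e2, -, -, -⟩, hd⟩ := hα _ hsI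
    refine ⟨⟨e2, e1⟩, grad G (f A) (P (α (s₀ + s))), ⟨g1.grad_null A e1, g1.grad_future A e1⟩, ?_⟩
    have h1 : HasDerivAt (fun s ↦ α (s₀ + s)) (X (α (s₀ + s))) s := hd.comp_const_add s₀ s
    have h2 := (g1.differentiableAt_F A)
    simp only [P, spatial_pt] at h2
    have h3 := (IsSheetGraph.hasFDerivAt_graph h2).comp_hasDerivAt s h1
    refine (h3.congr_deriv ?_).hasDerivWithinAt
    have h4 := g1.grad_null A e1
    rw [g1.grad_apply, g1.fderiv_f A e1] at h4
    have h5 := (mul_eq_zero.1 h4).resolve_left (g1.fderiv_f_neg A).ne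
    have h6 : spatial (P (α (s₀ + s))) = α (s₀ + s) := spatial_pt _ _
    rw [h6] at h5
    change pt (fderiv ℝ (F A) (α (s₀ + s)) (X (α (s₀ + s)))) (X (α (s₀ + s))) = _
    rw [← sub_eq_zero.1 h5]
    exact pt_spatial _

lemma eventually_mem_coordHorizon_iff (N : NormalModel G h f F T Z ζ S) :
    ∃ O ∈ 𝓝 (0 : E4), ∀ V ⊆ O, V ∈ 𝓝 0 → ∀ᶠ X in 𝓝 (0 : E4),
      (X ∈ coordHorizon G h f V ↔
        (∀ A, F A (spatial X) ≤ X 0) ∧ ∃ A, X 0 = F A (spatial X)) ∧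
      (X ∈ coordBlackHole G h f V ↔ ∀ A, F A (spatial X) < X 0) := by
  refine ⟨_, N.eventually_isGoodPoint, fun V hVO hV ↦ ?_⟩
  have ts : Tendsto spatial (𝓝 0) (𝓝 0) := by
    have := spatialL.continuous.tendsto 0
    rwa [map_zero] at this
  have key : ∀ᶠ X in 𝓝 (0 : E4), ((∀ A, F A (spatial X) ≤ X 0) ∧ ∃ A, X 0 = F A (spatial X)) →
      X ∈ coordHorizon G h f V := by
    filter_upwards [ts.eventually (eventually_all.2 (N.eventually_mem_coordHorizon hV)), hV]
      with X hX hXV ⟨hle, A, hA⟩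
    have g := hVO hXV
    rcases (hle (1 - A)).eq_or_lt with he | hlt
    · left
      have e1 := (g.eq_iff A).2 hA
      have e2 := (g.eq_iff (1 - A)).2 he.symm
      refine ⟨hXV, ?_⟩
      fin_cases A
      · exact ⟨e1, e2⟩
      · exact ⟨e2, e1⟩
    · have := hX A (by rwa [← hA])
      rwa [← hA, pt_spatial] at this
  obtain ⟨ρ, hρ, hball⟩ := Metric.mem_nhds_iff.1 (inter_mem hV key)
  have tmax : ∀ᶠ X : E4 in 𝓝 0, ∀ A, pt (F A (spatial X)) (spatial X) ∈ ball (0 : E4) ρ :=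
    eventually_all.2 fun A ↦ ts.eventually
      ((N.pair.graph A).tendsto_graph.eventually (Metric.ball_mem_nhds 0 hρ))
  filter_upwards [key, tmax, Metric.ball_mem_nhds (0 : E4) hρ] with X hX hXm hXρ
  refine ⟨⟨height_of_mem_coordHorizon hVO, hX⟩, height_of_mem_coordBlackHole hVO, fun hlt ↦ ?_⟩
  obtain ⟨A, hA⟩ : ∃ A, F (1 - A) (spatial X) ≤ F A (spatial X) := by
    rcases le_total (F 1 (spatial X)) (F 0 (spatial X)) with h | h
    · exact ⟨0, h⟩
    · exact ⟨1, h⟩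
  set t₀ := F A (spatial X)
  set Y := pt t₀ (spatial X)
  refine ⟨Y, (hball (hXm A)).2 ⟨fun B ↦ ?_, A, ?_⟩, fun s ↦ pt (t₀ + s) (spatial X), X 0 - t₀,
    sub_pos.2 (hlt A), by simp [Y], by simp, fun s hs ↦ ?_⟩
  · rcases fin_two_cases A B with rfl | rfl
    · simp [Y, t₀]
    · simpa [Y] using hA
  · simp [Y, t₀]
  · have hin : pt (t₀ + s) (spatial X) ∈ ball (0 : E4) ρ := by
      have hseg := (convex_ball (0 : E4) ρ) (hXm A) hXρ
      have hpos : 0 < X 0 - t₀ := sub_pos.2 (hlt A)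
      have h1 : 0 ≤ 1 - s / (X 0 - t₀) := by
        rw [sub_nonneg, div_le_one hpos]; exact hs.2
      have h2 := hseg h1 (div_nonneg hs.1 hpos.le) (by ring)
      convert h2 using 1
      have e1 : 1 - s / (X 0 - t₀) + s / (X 0 - t₀) = 1 := by ring
      have e2 : (s / (X 0 - t₀)) • X =
          pt (s / (X 0 - t₀) * X 0) ((s / (X 0 - t₀)) • spatial X) := by
        rw [pt_smul, pt_spatial]
      rw [e2, ← pt_smul, ← pt_add, ← add_smul, e1, one_smul]
      congr 1
      field_simp
      ring
    have hmem := (hball hin).1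
    refine ⟨hmem, e4 0, ⟨(hVO hmem).vertical_timelike, (hVO hmem).vertical_future⟩, ?_⟩
    have h3 : (fun s ↦ pt (t₀ + s) (spatial X)) = fun s ↦ Y + s • e4 0 := by
      funext s
      rw [pt_eq_add_smul (t₀ + s) t₀]
      simp [Y]
    rw [h3]
    have := ((hasDerivAt_id s).smul_const (e4 0)).const_add Y
    simpa using this.hasDerivWithinAt

end NormalModel

/-! ### Horizon and black hole region near the pinch point -/

variable {f : Fin 2 → M → ℝ}

lemma mem_crease_iff_coord {V : Set M} (hV : V ⊆ ψ.source) {q : M} (hq : q ∈ ψ.source) :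
    q ∈ crease f V ↔ ψ q ∈ coordCrease (fun A ↦ f A ∘ ψ.symm) {X | X ∈ ψ.target ∧ ψ.symm X ∈ V} := by
  simp only [crease, coordCrease, mem_ofPred_eq, Function.comp_apply, ψ.left_inv hq,
    ψ.map_source hq, true_and]

lemma mem_horizon_iff_coord (hψ : ψ ∈ 𝒜 M)
    (hτ : IsTimeFunction 𝓢 τ) {V : Set M} (hV : V ⊆ ψ.source) {q : M} (hq : q ∈ ψ.source) :
    q ∈ horizon 𝓢 f V ↔ ψ q ∈ coordHorizon (coordG 𝓢 ψ) (τ ∘ ψ.symm) (fun A ↦ f A ∘ ψ.symm)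
      {X | X ∈ ψ.target ∧ ψ.symm X ∈ V} := by
  have hP : ∀ (S : Set M) (X v : E4), ψ.symm X ∈ S → X ∈ ψ.target →
      (CoordNull (coordG 𝓢 ψ) (τ ∘ ψ.symm) X v ↔
        𝓢.FutureNull (ψ.symm X) (mfderiv (𝓡 4) (𝓡 4) ψ.symm X v)) := by
    intro S X v _ hX
    rw [hτ.futureNull_iff, diff_mfderiv_symm hψ hX (hτ.smooth.mdifferentiableAt (by simp))]
    rfl
  have hset A : {X | X ∈ ψ.target ∧ ψ.symm X ∈ {x ∈ V | f A x = 0}} =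
      {Y ∈ {X | X ∈ ψ.target ∧ ψ.symm X ∈ V} | (f A ∘ ψ.symm) Y = 0} := by
    ext X
    simp [and_assoc]
  refine or_congr (mem_crease_iff_coord hV hq) (exists_congr fun A ↦ ?_)
  constructor
  · rintro ⟨r, hr, hj⟩
    have hrs := hV hr.1
    refine ⟨ψ r, (mem_crease_iff_coord hV hrs).1 hr, ?_⟩
    have := (joinedBy_iff_coordJoined hψ (hP _) (fun x hx ↦ hV hx.1) hrs hq).1 hj
    rwa [hset] at this
  · rintro ⟨R, hR, hj⟩
    have hrs : ψ.symm R ∈ ψ.source := ψ.map_target hR.1.1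
    have hRR := ψ.right_inv hR.1.1
    refine ⟨ψ.symm R, (mem_crease_iff_coord hV hrs).2 (by rwa [hRR]), ?_⟩
    rw [joinedBy_iff_coordJoined hψ (hP _) (fun x hx ↦ hV hx.1) hrs hq, hset, hRR]
    exact hj

lemma mem_blackHole_iff_coord (hψ : ψ ∈ 𝒜 M)
    (hτ : IsTimeFunction 𝓢 τ) {V : Set M} (hV : V ⊆ ψ.source) {q : M} (hq : q ∈ ψ.source) :
    q ∈ blackHole 𝓢 f V ↔ ψ q ∈ coordBlackHole (coordG 𝓢 ψ) (τ ∘ ψ.symm) (fun A ↦ f A ∘ ψ.symm)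
      {X | X ∈ ψ.target ∧ ψ.symm X ∈ V} := by
  have hP : ∀ (X v : E4), ψ.symm X ∈ V → X ∈ ψ.target →
      (CoordTimelike (coordG 𝓢 ψ) (τ ∘ ψ.symm) X v ↔
        𝓢.FutureTimelike (ψ.symm X) (mfderiv (𝓡 4) (𝓡 4) ψ.symm X v)) := by
    intro X v _ hX
    rw [hτ.futureTimelike_iff, diff_mfderiv_symm hψ hX (hτ.smooth.mdifferentiableAt (by simp))]
    rfl
  constructor
  · rintro ⟨r, hr, hj⟩
    have hrs : r ∈ ψ.source := by
      obtain ⟨c, l, hl, h0, h1, hc⟩ := hj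
      have := (hc 0 ⟨le_rfl, hl.le⟩).1
      rw [h0] at this
      exact hV this
    exact ⟨ψ r, (mem_horizon_iff_coord hψ hτ hV hrs).1 hr,
      (joinedBy_iff_coordJoined hψ hP hV hrs hq).1 hj⟩
  · rintro ⟨R, hR, hj⟩
    have hRV := mem_of_mem_coordHorizon hR
    have hrs : ψ.symm R ∈ ψ.source := ψ.map_target hRV.1
    have hRR := ψ.right_inv hRV.1
    refine ⟨ψ.symm R, (mem_horizon_iff_coord hψ hτ hV hrs).2 (by rwa [hRR]), ?_⟩
    rw [joinedBy_iff_coordJoined hψ hP hV hrs hq, hRR]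
    exact hj

/-- Comparison of time with the time of the crease, for the two sheets over one point. -/
lemma le_iff_of_compare {s S z₀ z₁ ζ : ℝ} (h : (S < s ↔ ζ < z₀) ∧ (S < s ↔ z₁ < ζ) ∧
    (S = s ↔ z₀ = ζ) ∧ (S = s ↔ z₁ = ζ)) : (S ≤ s ↔ z₁ ≤ z₀) ∧ (S = s ↔ z₁ = z₀) := by
  obtain ⟨h1, h2, h3, h4⟩ := h
  rcases lt_trichotomy S s with hlt | heq | hgt
  · have := h1.1 hlt; have := h2.1 hlt
    exact ⟨⟨fun _ ↦ by linarith, fun _ ↦ hlt.le⟩, ⟨fun h ↦ absurd h hlt.ne, fun h ↦ by linarith⟩⟩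
  · have := h3.1 heq; have := h4.1 heq
    exact ⟨⟨fun _ ↦ by linarith, fun _ ↦ heq.le⟩, ⟨fun h ↦ by linarith, fun h ↦ heq⟩⟩
  · have n1 : z₀ < ζ := lt_of_le_of_ne (not_lt.1 fun h ↦ absurd (h1.2 h) hgt.not_gt)
      fun h ↦ hgt.ne' (h3.2 h)
    have n2 : ζ < z₁ := lt_of_le_of_ne (not_lt.1 fun h ↦ absurd (h2.2 h) hgt.not_gt)
      fun h ↦ hgt.ne' (h4.2 h.symm)
    exact ⟨⟨fun h ↦ absurd h hgt.not_ge, fun h ↦ by linarith⟩,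
      ⟨fun h ↦ absurd h hgt.ne', fun h ↦ by linarith⟩⟩

lemma NormalModel.eventually_horizon_iff (hψ : IsNormalChart 𝓢 p ψ) (hτ : IsTimeFunction 𝓢 τ)
    (N : NormalModel (coordG 𝓢 ψ) (τ ∘ ψ.symm) (fun A ↦ f A ∘ ψ.symm) F T Z ζ S) :
    ∀ᶠ V in (𝓝 p).smallSets, V ∈ 𝓝 p → ∀ᶠ q in 𝓝 p,
      (q ∈ horizon 𝓢 f V ↔ (f 0 q = 0 ∨ f 1 q = 0) ∧ S (transverse (ψ q)) ≤ τ q) ∧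
      (q ∈ blackHole 𝓢 f V ↔ Z 1 (τ q, transverse (ψ q)) < ψ q 3 ∧
        ψ q 3 < Z 0 (τ q, transverse (ψ q))) := by
  obtain ⟨O, hO, hcoord⟩ := N.eventually_mem_coordHorizon_iff
  have hsub : ψ.source ∩ ψ ⁻¹' O ∈ 𝓝 p :=
    inter_mem (ψ.open_source.mem_nhds hψ.mem_source) (hψ.tendsto hO)
  rw [eventually_smallSets]
  refine ⟨_, hsub, fun V hV hVp ↦ ?_⟩
  have hVs : V ⊆ ψ.source := fun x hx ↦ (hV hx).1
  have hV' : {X | X ∈ ψ.target ∧ ψ.symm X ∈ V} ⊆ O := fun X hX ↦ by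
    have := (hV hX.2).2
    rwa [mem_preimage, ψ.right_inv hX.1] at this
  have hV0 : {X | X ∈ ψ.target ∧ ψ.symm X ∈ V} ∈ 𝓝 (0 : E4) := by
    have h1 : ContinuousAt ψ.symm 0 := ψ.continuousAt_symm hψ.zero_mem_target
    exact inter_mem (ψ.open_target.mem_nhds hψ.zero_mem_target)
      (h1 (by rwa [hψ.symm_zero]))
  have hpoint := N.crease.eventually_point N.model.h_smooth N.model.h_zero N.slice
  have t : Tendsto (fun X : E4 ↦ ((τ ∘ ψ.symm) X, transverse X)) (𝓝 0) (𝓝 0) := by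
    have h1 := N.model.h_smooth.continuousAt.tendsto
    rw [N.model.h_zero] at h1
    have h2 := transverseL.continuous.tendsto 0
    rw [map_zero] at h2
    exact h1.prodMk_nhds h2
  have hcmp := t.eventually (N.crease.eventually_lt_iff N.slice (N.pair.graph 0).smooth
      (N.pair.graph 0).zero)
  have hsheet := eventually_all.2 fun A ↦ (N.pair.graph A).eq_iff
  filter_upwards [hψ.eventually_of_coord hpoint, hψ.eventually_of_coord hcmp,
    hψ.eventually_of_coord (hcoord _ hV' hV0), hψ.eventually_of_coord hsheet,
    ψ.open_source.mem_nhds hψ.mem_source] with q hp1 hp2 hp3 hp4 hq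
  have hqq := hp1.2
  obtain ⟨-, a0, a1, aA, -, -⟩ := hp1.1
  replace hp2 := hp2.1
  replace hp4 := hp4.1
  simp only [Function.comp_apply, hqq] at a0 a1 aA hp2 hp4
  obtain ⟨hle, -⟩ := le_iff_of_compare hp2
  rw [mem_horizon_iff_coord hψ.mem_atlas hτ hVs hq, mem_blackHole_iff_coord hψ.mem_atlas hτ hVs hq,
    hp3.1.1, hp3.1.2]
  constructor
  · rw [hle, hp4 0, hp4 1]
    simp only [Fin.forall_fin_two, Fin.exists_fin_two]
    constructor
    · rintro ⟨⟨l0, l1⟩, e | e⟩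
      · refine ⟨Or.inl e, ?_⟩
        rw [← (aA 0).1 e]
        rcases l1.eq_or_lt with h | h
        · exact ((aA 1).1 h.symm).ge
        · exact (a1.1 h).le
      · refine ⟨Or.inr e, ?_⟩
        rw [← (aA 1).1 e]
        rcases l0.eq_or_lt with h | h
        · exact ((aA 0).1 h.symm).le
        · exact (a0.1 h).le
    · rintro ⟨e | e, hl⟩
      · refine ⟨⟨e.ge, ?_⟩, Or.inl e⟩
        rw [← (aA 0).1 e] at hl
        rcases hl.eq_or_lt with h | h
        · exact ((aA 1).2 h.symm).ge
        · exact (a1.2 h).le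
      · refine ⟨⟨?_, e.ge⟩, Or.inr e⟩
        rw [← (aA 1).1 e] at hl
        rcases hl.eq_or_lt with h | h
        · exact ((aA 0).2 h).ge
        · exact (a0.2 h).le
  · rw [Fin.forall_fin_two, a0, a1, and_comm]

/-- The horizon, the black hole region and the crease inside a neighbourhood `W` of the pinch
point that corresponds to a domain `D` of the transverse plane in the coordinates `η`. -/
structure LocalPicture (𝓢 : Spacetime M) (ψ : OpenPartialHomeomorph M E4) (τ : M → ℝ)
    (f : Fin 2 → M → ℝ) (p : M) (T : ℝ × Space → ℝ) (Z : Fin 2 → ℝ × Plane → ℝ) (ζ S : Plane → ℝ)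
    (η : OpenPartialHomeomorph Plane Plane) (V W : Set M) (D : Set Plane) (τ₁ : ℝ) : Prop where
  isOpen : IsOpen W
  mem : p ∈ W
  subset : W ⊆ V
  subset_source : W ⊆ ψ.source
  symm_zero : ψ.symm 0 = p
  D_zero : 0 ∈ D
  η_zero : η.symm 0 = 0
  D_subset : D ⊆ η.target
  T_zero : T 0 = 0
  Z_zero : ∀ A, Z A 0 = 0
  horizon_iff : ∀ q ∈ W, q ∈ horizon 𝓢 f V ↔
    (f 0 q = 0 ∨ f 1 q = 0) ∧ S (transverse (ψ q)) ≤ τ q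
  blackHole_iff : ∀ q ∈ W, q ∈ blackHole 𝓢 f V ↔
    Z 1 (τ q, transverse (ψ q)) < ψ q 3 ∧ ψ q 3 < Z 0 (τ q, transverse (ψ q))
  sheet_iff : ∀ q ∈ W, ∀ A, f A q = 0 ↔ ψ q 3 = Z A (τ q, transverse (ψ q))
  coord : ∀ q ∈ W, |τ q| < τ₁ ∧ transverse (ψ q) ∈ η.source ∧ η (transverse (ψ q)) ∈ D ∧
    ψ q 0 = T (τ q, spatial (ψ q))
  point : ∀ s ξ z, |s| < τ₁ → ξ ∈ D → Z 1 (s, η.symm ξ) ≤ z → z ≤ Z 0 (s, η.symm ξ) →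
    pt (T (s, spt (η.symm ξ) z)) (spt (η.symm ξ) z) ∈ ψ.target ∧
    ψ.symm (pt (T (s, spt (η.symm ξ) z)) (spt (η.symm ξ) z)) ∈ W ∧
    τ (ψ.symm (pt (T (s, spt (η.symm ξ) z)) (spt (η.symm ξ) z))) = s ∧
    ContinuousAt T (s, spt (η.symm ξ) z)
  compare : ∀ s ξ, |s| < τ₁ → ξ ∈ D →
    (S (η.symm ξ) < s ↔ ζ (η.symm ξ) < Z 0 (s, η.symm ξ)) ∧
    (S (η.symm ξ) < s ↔ Z 1 (s, η.symm ξ) < ζ (η.symm ξ)) ∧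
    (S (η.symm ξ) = s ↔ Z 0 (s, η.symm ξ) = ζ (η.symm ξ)) ∧
    (S (η.symm ξ) = s ↔ Z 1 (s, η.symm ξ) = ζ (η.symm ξ))
  continuousAt_Z : ∀ A s ξ, |s| < τ₁ → ξ ∈ D → ContinuousAt (Z A) (s, η.symm ξ)

lemma NormalModel.exists_localPicture (hψ : IsNormalChart 𝓢 p ψ) (hτ : IsTimeFunction 𝓢 τ)
    (N : NormalModel (coordG 𝓢 ψ) (τ ∘ ψ.symm) (fun A ↦ f A ∘ ψ.symm) F T Z ζ S)
    {η : OpenPartialHomeomorph Plane Plane} (hη : 0 ∈ η.source) (hη0 : η 0 = 0) :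
    ∀ᶠ V in (𝓝 p).smallSets, V ∈ 𝓝 p → ∃ ρ > 0, ∃ τ₁ > 0, ∀ D ⊆ disc ρ,
      IsOpen D → 0 ∈ D → ∃ W, LocalPicture 𝓢 ψ τ f p T Z ζ S η V W D τ₁ := by
  filter_upwards [N.eventually_horizon_iff hψ hτ] with V hV hVp
  have hpoint := N.crease.eventually_point N.model.h_smooth N.model.h_zero N.slice
  have hcmp := N.crease.eventually_lt_iff N.slice (N.pair.graph 0).smooth (N.pair.graph 0).zero
  have hsheet := eventually_all.2 fun A ↦ (N.pair.graph A).eq_iff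
  have hsheetq : ∀ᶠ q in 𝓝 p, ∀ A, f A q = 0 ↔ ψ q 3 = Z A (τ q, transverse (ψ q)) := by
    filter_upwards [hψ.eventually_of_coord hpoint, hψ.eventually_of_coord hsheet] with q h1 h2 A
    have := h2.1 A
    simp only [Function.comp_apply, h2.2] at this
    rw [this]
    have h3 := h1.1.2.2.2.1 A
    rwa [Function.comp_apply, h2.2] at h3
  have hTq : ∀ᶠ q in 𝓝 p, ψ q 0 = T (τ q, spatial (ψ q)) := by
    filter_upwards [hψ.eventually_of_coord hpoint] with q h1
    have h3 := h1.1.1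
    rwa [Function.comp_apply, h1.2] at h3
  have hsrc : ∀ᶠ q in 𝓝 p, q ∈ ψ.source := ψ.open_source.mem_nhds hψ.mem_source
  have hVev : ∀ᶠ q in 𝓝 p, q ∈ V := hVp
  have hall := (hV hVp).and (hsheetq.and (hTq.and (hsrc.and hVev)))
  obtain ⟨O, hO, hOo, hpO⟩ := eventually_nhds_iff.1 hall
  have hη0' : η.symm 0 = 0 := by have := η.left_inv hη; rwa [hη0] at this
  have h0t : (0 : Plane) ∈ η.target := by have := η.map_source hη; rwa [hη0] at this
  have hηs : Tendsto η.symm (𝓝 0) (𝓝 0) := by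
    have := (η.continuousAt_symm h0t).tendsto
    rwa [hη0'] at this
  -- the inverse coordinates
  have tJ : Tendsto (fun u : ℝ × Plane × ℝ ↦ (u.1, spt (η.symm u.2.1) u.2.2)) (𝓝 0) (𝓝 0) := by
    have t1 : Tendsto (fun u : ℝ × Plane × ℝ ↦ u.2.1) (𝓝 0) (𝓝 0) :=
      (continuous_fst.comp continuous_snd).tendsto' _ _ rfl
    have t2 : Tendsto (fun u : ℝ × Plane × ℝ ↦ u.2.2) (𝓝 0) (𝓝 0) :=
      (continuous_snd.comp continuous_snd).tendsto' _ _ rfl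
    have t3 : Tendsto (fun u : ℝ × Plane × ℝ ↦ spt (η.symm u.2.1) u.2.2) (𝓝 0) (𝓝 0) :=
      (sptL.continuous.tendsto' (0 : Plane × ℝ) 0 (map_zero _)).comp ((hηs.comp t1).prodMk_nhds t2)
    exact (continuous_fst.tendsto' _ _ rfl).prodMk_nhds t3
  have hT0 : Tendsto T (𝓝 0) (𝓝 0) := by
    have := N.slice.smooth.continuousAt.tendsto
    rwa [N.slice.zero] at this
  have tP : Tendsto (fun u : ℝ × Space ↦ pt (T u) u.2) (𝓝 0) (𝓝 0) :=
    (ptL.continuous.tendsto' (0 : ℝ × Space) 0 (map_zero _)).comp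
      (hT0.prodMk_nhds (continuous_snd.tendsto' _ _ rfl))
  have hsymm : Tendsto ψ.symm (𝓝 0) (𝓝 p) := by
    have := (ψ.continuousAt_symm hψ.zero_mem_target).tendsto
    rwa [hψ.symm_zero] at this
  have hbox : ∀ᶠ u : ℝ × Plane × ℝ in 𝓝 0,
      pt (T (u.1, spt (η.symm u.2.1) u.2.2)) (spt (η.symm u.2.1) u.2.2) ∈ ψ.target ∧
      ψ.symm (pt (T (u.1, spt (η.symm u.2.1) u.2.2)) (spt (η.symm u.2.1) u.2.2)) ∈ O ∧
      τ (ψ.symm (pt (T (u.1, spt (η.symm u.2.1) u.2.2)) (spt (η.symm u.2.1) u.2.2))) = u.1 ∧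
      ContinuousAt T (u.1, spt (η.symm u.2.1) u.2.2) := by
    have h1 := tP.comp tJ
    filter_upwards [h1.eventually (ψ.open_target.mem_nhds hψ.zero_mem_target),
      (hsymm.comp h1).eventually (hOo.mem_nhds hpO), tJ.eventually N.slice.apply_graph,
      tJ.eventually N.slice.smooth] with u a1 a2 a3 a4
    exact ⟨a1, a2, a3, a4.continuousAt⟩
  obtain ⟨δ, hδ, hbox⟩ := eventually_nhds_iff_ball.1 hbox
  have tη : Tendsto (fun u : ℝ × Plane ↦ (u.1, η.symm u.2)) (𝓝 0) (𝓝 0) :=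
    (continuous_fst.tendsto' _ _ rfl).prodMk_nhds (hηs.comp (continuous_snd.tendsto' _ _ rfl))
  have hZ : ∀ᶠ u : ℝ × Plane in 𝓝 0, (∀ A, |Z A (u.1, η.symm u.2)| < δ) ∧
      (∀ A, ContinuousAt (Z A) (u.1, η.symm u.2)) ∧ u.2 ∈ η.target := by
    have h1 A : ∀ᶠ u : ℝ × Plane in 𝓝 0, |Z A u| < δ := by
      have := (N.crease.Z_smooth A).continuousAt.abs
      refine this.eventually_lt_const ?_
      simpa [N.crease.Z_zero A] using hδ
    have h2 : Tendsto (fun u : ℝ × Plane ↦ u.2) (𝓝 0) (𝓝 0) := continuous_snd.tendsto' _ _ rfl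
    filter_upwards [tη.eventually (eventually_all.2 h1), tη.eventually (eventually_all.2
      N.crease.Z_smooth), h2.eventually (η.open_target.mem_nhds h0t)] with u a1 a2 a3
    exact ⟨a1, fun A ↦ (a2 A).continuousAt, a3⟩
  obtain ⟨ρ, hρ, hall2⟩ := eventually_nhds_iff_ball.1 (hZ.and (tη.eventually hcmp))
  have hmem s ξ : |s| < min ρ δ → ξ ∈ disc (min ρ δ) →
      (s, ξ) ∈ ball (0 : ℝ × Plane) ρ := by
    intro hs hξ
    rw [mem_ball_zero_iff] at hξ ⊢
    exact max_lt (hs.trans_le (min_le_left _ _)) (hξ.trans_le (min_le_left _ _))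
  have hmin : 0 < min ρ δ := lt_min hρ hδ
  refine ⟨min ρ δ, hmin, min ρ δ, hmin, fun D hDρ hDo hD0 ↦ ?_⟩
  refine ⟨{q | q ∈ O ∧ |τ q| < min ρ δ ∧ (transverse (ψ q) ∈ η.source ∧
    η (transverse (ψ q)) ∈ D) ∧ |ψ q 3| < δ}, ?_⟩
  have hztarget : ∀ {z₀ z₁ z : ℝ}, |z₀| < δ → |z₁| < δ → z₁ ≤ z → z ≤ z₀ → |z| < δ := by
    intro z₀ z₁ z h0 h1 h2 h3
    rw [abs_lt] at *
    constructor <;> linarith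
  have hOc : ∀ q ∈ O, ContinuousAt ψ q := fun q hq ↦ ψ.continuousAt (hO q hq).2.2.2.1
  exact
    { isOpen := by
        rw [isOpen_iff_mem_nhds]
        rintro q ⟨hqO, hqτ, hqη, hqz⟩
        have c1 : ContinuousAt (fun q ↦ |τ q|) q :=
          (hτ.smooth.continuous.abs).continuousAt
        have c2 : ContinuousAt (fun q ↦ transverse (ψ q)) q :=
          ContinuousAt.comp (g := transverse) transverseL.continuous.continuousAt (hOc q hqO)
        have c3 : ContinuousAt (fun q ↦ |ψ q 3|) q := by
          have : Continuous fun X : E4 ↦ |X 3| := by fun_prop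
          exact ContinuousAt.comp (g := fun X : E4 ↦ |X 3|) this.continuousAt (hOc q hqO)
        have c4 := η.isOpen_inter_preimage hDo
        filter_upwards [hOo.mem_nhds hqO, c1.eventually_lt_const hqτ, c2 (c4.mem_nhds hqη),
          c3.eventually_lt_const hqz] with r a1 a2 a3 a4
        exact ⟨a1, a2, a3, a4⟩
      mem := by
        refine ⟨hpO, ?_, ?_, ?_⟩
        · have : τ p = 0 := by
            have := N.model.h_zero
            rwa [Function.comp_apply, hψ.symm_zero] at this
          rw [this, abs_zero]; exact hmin
        · rw [hψ.map_zero, transverse_zero_eq]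
          exact ⟨hη, by rwa [hη0]⟩
        · rw [hψ.map_zero]; simpa using hδ
      subset := fun q hq ↦ (hO q hq.1).2.2.2.2
      subset_source := fun q hq ↦ (hO q hq.1).2.2.2.1
      symm_zero := hψ.symm_zero
      D_zero := hD0
      η_zero := hη0'
      D_subset := fun ξ hξ ↦
        (hall2 (0, ξ) (hmem 0 ξ (by simpa using hmin) (hDρ hξ))).1.2.2
      T_zero := N.slice.zero
      Z_zero := N.crease.Z_zero
      horizon_iff := fun q hq ↦ (hO q hq.1).1.1
      blackHole_iff := fun q hq ↦ (hO q hq.1).1.2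
      sheet_iff := fun q hq ↦ (hO q hq.1).2.1
      coord := fun q hq ↦ ⟨hq.2.1, hq.2.2.1.1, hq.2.2.1.2, (hO q hq.1).2.2.1⟩
      point := by
        intro s ξ z hs hξ hz1 hz0
        have h1 := hall2 (s, ξ) (hmem s ξ hs (hDρ hξ))
        have hz := hztarget (h1.1.1 0) (h1.1.1 1) hz1 hz0
        have hξt : ξ ∈ η.target := h1.1.2.2
        have h2 := hbox (s, ξ, z) (by
          have hξ' := hDρ hξ
          rw [mem_ball_zero_iff] at hξ' ⊢
          exact max_lt (hs.trans_le (min_le_right _ _)) (max_lt (hξ'.trans_le (min_le_right _ _)) hz))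
        obtain ⟨b1, b2, b3, b4⟩ := h2
        refine ⟨b1, ⟨b2, ?_, ?_, ?_⟩, b3, b4⟩
        · rw [b3]; exact hs
        · rw [ψ.right_inv b1, transverse_pt_spt]
          exact ⟨η.map_target hξt, by rwa [η.right_inv hξt]⟩
        · rw [ψ.right_inv b1]; exact hz
      compare := fun s ξ hs hξ ↦ (hall2 (s, ξ) (hmem s ξ hs (hDρ hξ))).2
      continuousAt_Z := fun A s ξ hs hξ ↦ (hall2 (s, ξ) (hmem s ξ hs (hDρ hξ))).1.2.1 A }

local notation:max "ℒ" => LocalPicture 𝓢 ψ τ f p T Z ζ S η V W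
local notation:max "ℋ" => slice τ W (horizon 𝓢 f V)
local notation:max "ℬ" => slice τ W (blackHole 𝓢 f V)
local notation:max "𝒞" => slice τ W (crease f V)

/-! ### Regions between two graphs -/

lemma TripleHomeo.trans {X Y Y' : Type*} [TopologicalSpace X] [TopologicalSpace Y]
    [TopologicalSpace Y'] {K H C : Set X} {K' H' C' : Set Y} {K'' H'' C'' : Set Y'}
    (h : TripleHomeo K H C K' H' C') (h' : TripleHomeo K' H' C' K'' H'' C'') :
    TripleHomeo K H C K'' H'' C'' := by
  obtain ⟨hC, hH, e, eH, eC⟩ := h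
  obtain ⟨-, -, e', eH', eC'⟩ := h'
  exact ⟨hC, hH, e.trans e', fun q ↦ (eH q).trans (eH' _), fun q ↦ (eC q).trans (eC' _)⟩

lemma TripleHomeo.of_homeomorph {X Y : Type*} [TopologicalSpace X] [TopologicalSpace Y]
    {K H C : Set X} {K' H' C' : Set Y} (e : X ≃ₜ Y) (hC : C ⊆ H) (hH : H ⊆ K)
    (hK : ∀ x, x ∈ K ↔ e x ∈ K') (eH : ∀ x ∈ K, x ∈ H ↔ e x ∈ H')
    (eC : ∀ x ∈ K, x ∈ C ↔ e x ∈ C') : TripleHomeo K H C K' H' C' := by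
  refine ⟨hC, hH, e.subtype hK, fun q ↦ eH _ q.2, fun q ↦ eC _ q.2⟩

section Lens

variable {A B : Type*}

/-- The region over `X` between the graphs of `α` and `β`. -/
def Lens (X : Set A) (α β : A → ℝ) : Set (A × ℝ) := {u | u.1 ∈ X ∧ α u.1 ≤ u.2 ∧ u.2 ≤ β u.1}

def lensBoundary (X : Set A) (α β : A → ℝ) : Set (A × ℝ) :=
  {u ∈ Lens X α β | u.2 = α u.1 ∨ u.2 = β u.1}

def lensEdge (X : Set A) (α β : A → ℝ) : Set (A × ℝ) := {u ∈ Lens X α β | α u.1 = β u.1}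

lemma lensEdge_subset {X : Set A} {α β : A → ℝ} : lensEdge X α β ⊆ lensBoundary X α β :=
  fun _ hu ↦ ⟨hu.1, Or.inl (le_antisymm (hu.1.2.2.trans hu.2.ge) hu.1.2.1)⟩

/-- The affine map of the interval `[a, b]` onto `[a', b']`. -/
def stretch (a b a' b' z : ℝ) : ℝ := a' + (z - a) * ((b' - a') / (b - a))

lemma stretch_mem {a b a' b' z : ℝ} (h1 : a ≤ z) (h2 : z ≤ b) (h' : a' ≤ b') :
    a' ≤ stretch a b a' b' z ∧ stretch a b a' b' z ≤ b' := by
  have hq : 0 ≤ (b' - a') / (b - a) := div_nonneg (by linarith) (by linarith)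
  constructor
  · exact le_add_of_nonneg_right (mul_nonneg (by linarith) hq)
  · rcases (h1.trans h2).eq_or_lt with h | h
    · simp [stretch, h, h']
    · have h3 : (z - a) * ((b' - a') / (b - a)) ≤ (b - a) * ((b' - a') / (b - a)) :=
        mul_le_mul_of_nonneg_right (by linarith) hq
      rw [mul_div_cancel₀ _ (by linarith)] at h3
      simp only [stretch]
      linarith

lemma stretch_stretch {a b a' b' z : ℝ} (h1 : a ≤ z) (h2 : z ≤ b) (h : a = b ↔ a' = b') :
    stretch a' b' a b (stretch a b a' b' z) = z := by
  by_cases hab : a = b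
  · have : z = a := by linarith
    simp [stretch, hab, h.1 hab]
    linarith
  · have h3 : b - a ≠ 0 := fun h ↦ hab (by linarith)
    have h4 : b' - a' ≠ 0 := fun h' ↦ hab (h.2 (by linarith))
    simp only [stretch]
    field_simp
    ring

lemma stretch_boundary_iff {a b a' b' z : ℝ} (h1 : a ≤ z) (h2 : z ≤ b) (h : a = b ↔ a' = b') :
    (z = a ∨ z = b) ↔ (stretch a b a' b' z = a' ∨ stretch a b a' b' z = b') := by
  by_cases hab : a = b
  · have : z = a := by linarith
    simp [stretch, this]
  · have h3 : b - a ≠ 0 := fun h ↦ hab (by linarith)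
    have h4 : b' - a' ≠ 0 := fun h' ↦ hab (h.2 (by linarith))
    refine or_congr ?_ ?_
    · simp only [stretch, add_eq_left, mul_eq_zero, sub_eq_zero, div_eq_zero_iff]
      constructor
      · exact Or.inl
      · rintro (h | h | h)
        · exact h
        · exact absurd (sub_eq_zero.2 h) h4
        · exact absurd (sub_eq_zero.2 h) h3
    · constructor
      · rintro rfl
        simp only [stretch]
        field_simp
        ring
      · intro h5
        simp only [stretch] at h5
        have h6 : (z - a) * ((b' - a') / (b - a)) = b' - a' := by linarith
        field_simp at h6
        linarith

lemma continuous_stretch {P : Type*} [TopologicalSpace P] {a b a' b' z : P → ℝ}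
    (ha : Continuous a) (hb : Continuous b) (ha' : Continuous a') (hb' : Continuous b')
    (hz : Continuous z) (h1 : ∀ p, a p ≤ z p) (h2 : ∀ p, z p ≤ b p) (h' : ∀ p, a' p ≤ b' p)
    (heq : ∀ p, a p = b p ↔ a' p = b' p) :
    Continuous fun p ↦ stretch (a p) (b p) (a' p) (b' p) (z p) := by
  rw [continuous_iff_continuousAt]
  intro p
  by_cases hp : a p = b p
  · have hv : stretch (a p) (b p) (a' p) (b' p) (z p) = a' p := by simp [stretch, hp]
    rw [ContinuousAt, hv]
    refine tendsto_of_tendsto_of_tendsto_of_le_of_le ha'.continuousAt ?_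
      (fun p ↦ (stretch_mem (h1 p) (h2 p) (h' p)).1) fun p ↦ (stretch_mem (h1 p) (h2 p) (h' p)).2
    rw [(heq p).1 hp]
    exact hb'.continuousAt
  · have h3 : b p - a p ≠ 0 := fun h ↦ hp (by linarith)
    exact ha'.continuousAt.add ((hz.continuousAt.sub ha.continuousAt).mul
      ((hb'.continuousAt.sub ha'.continuousAt).div (hb.continuousAt.sub ha.continuousAt) h3))

variable [TopologicalSpace A] [TopologicalSpace B]

/-- Regions between graphs over homeomorphic bases, whose graphs meet over corresponding sets,
are homeomorphic. -/
lemma lens_tripleHomeo {X : Set A} {Y : Set B} {α β : A → ℝ} {α' β' : B → ℝ} (e : X ≃ₜ Y)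
    (hα : ContinuousOn α X) (hβ : ContinuousOn β X) (hα' : ContinuousOn α' Y)
    (hβ' : ContinuousOn β' Y) (hle : ∀ x ∈ X, α x ≤ β x) (hle' : ∀ y ∈ Y, α' y ≤ β' y)
    (heq : ∀ x : X, α x = β x ↔ α' (e x) = β' (e x)) :
    TripleHomeo (Lens X α β) (lensBoundary X α β) (lensEdge X α β)
      (Lens Y α' β') (lensBoundary Y α' β') (lensEdge Y α' β') := by
  have cα := continuousOn_iff_continuous_domRestrict.1 hα
  have cβ := continuousOn_iff_continuous_domRestrict.1 hβ
  have cα' := continuousOn_iff_continuous_domRestrict.1 hα'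
  have cβ' := continuousOn_iff_continuous_domRestrict.1 hβ'
  have heq' : ∀ y : Y, α' y = β' y ↔ α (e.symm y) = β (e.symm y) := fun y ↦ by
    rw [heq, e.apply_symm_apply]
  let b : Lens X α β → X := fun u ↦ ⟨u.1.1, u.2.1⟩
  let b' : Lens Y α' β' → Y := fun u ↦ ⟨u.1.1, u.2.1⟩
  have cb : Continuous b := (continuous_fst.comp continuous_subtype_val).subtype_mk _
  have cb' : Continuous b' := (continuous_fst.comp continuous_subtype_val).subtype_mk _
  let E : Lens X α β ≃ₜ Lens Y α' β' :=
    { toFun := fun u ↦ ⟨(e (b u), stretch (α (b u)) (β (b u)) (α' (e (b u))) (β' (e (b u))) u.1.2),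
        (e (b u)).2, stretch_mem u.2.2.1 u.2.2.2 (hle' _ (e (b u)).2)⟩
      invFun := fun u ↦ ⟨(e.symm (b' u), stretch (α' (b' u)) (β' (b' u)) (α (e.symm (b' u)))
        (β (e.symm (b' u))) u.1.2),
        (e.symm (b' u)).2, stretch_mem u.2.2.1 u.2.2.2 (hle _ (e.symm (b' u)).2)⟩
      left_inv := fun u ↦ by
        refine Subtype.ext (Prod.ext ?_ ?_)
        · change (e.symm (e (b u)) : A) = u.1.1
          rw [e.symm_apply_apply]
        · change stretch _ _ (α (e.symm (e (b u)))) (β (e.symm (e (b u)))) _ = u.1.2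
          rw [e.symm_apply_apply]
          exact stretch_stretch u.2.2.1 u.2.2.2 (heq (b u))
      right_inv := fun u ↦ by
        refine Subtype.ext (Prod.ext ?_ ?_)
        · change (e (e.symm (b' u)) : B) = u.1.1
          rw [e.apply_symm_apply]
        · change stretch _ _ (α' (e (e.symm (b' u)))) (β' (e (e.symm (b' u)))) _ = u.1.2
          rw [e.apply_symm_apply]
          exact stretch_stretch u.2.2.1 u.2.2.2 (heq' (b' u))
      continuous_toFun := by
        refine Continuous.subtype_mk (Continuous.prodMk ?_ ?_) _
        · exact continuous_subtype_val.comp (e.continuous.comp cb)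
        · exact continuous_stretch (cα.comp cb) (cβ.comp cb) (cα'.comp (e.continuous.comp cb))
            (cβ'.comp (e.continuous.comp cb)) (continuous_snd.comp continuous_subtype_val)
            (fun u ↦ u.2.2.1) (fun u ↦ u.2.2.2) (fun u ↦ hle' _ (e (b u)).2) fun u ↦ heq (b u)
      continuous_invFun := by
        refine Continuous.subtype_mk (Continuous.prodMk ?_ ?_) _
        · exact continuous_subtype_val.comp (e.symm.continuous.comp cb')
        · exact continuous_stretch (cα'.comp cb') (cβ'.comp cb') (cα.comp (e.symm.continuous.comp cb'))
            (cβ.comp (e.symm.continuous.comp cb')) (continuous_snd.comp continuous_subtype_val)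
            (fun u ↦ u.2.2.1) (fun u ↦ u.2.2.2) (fun u ↦ hle _ (e.symm (b' u)).2)
            fun u ↦ heq' (b' u) }
  refine ⟨lensEdge_subset, fun _ h ↦ h.1, E, fun u ↦ ?_, fun u ↦ ?_⟩
  · have h1 : (u : A × ℝ) ∈ lensBoundary X α β ↔ u.1.2 = α (b u) ∨ u.1.2 = β (b u) :=
      ⟨fun h ↦ h.2, fun h ↦ ⟨u.2, h⟩⟩
    have h2 : (E u : B × ℝ) ∈ lensBoundary Y α' β' ↔
        (E u).1.2 = α' (e (b u)) ∨ (E u).1.2 = β' (e (b u)) :=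
      ⟨fun h ↦ h.2, fun h ↦ ⟨(E u).2, h⟩⟩
    rw [h1, h2]
    exact stretch_boundary_iff u.2.2.1 u.2.2.2 (heq (b u))
  · have h1 : (u : A × ℝ) ∈ lensEdge X α β ↔ α (b u) = β (b u) := ⟨fun h ↦ h.2, fun h ↦ ⟨u.2, h⟩⟩
    have h2 : (E u : B × ℝ) ∈ lensEdge Y α' β' ↔ α' (e (b u)) = β' (e (b u)) :=
      ⟨fun h ↦ h.2, fun h ↦ ⟨(E u).2, h⟩⟩
    rw [h1, h2]
    exact heq (b u)

/-- The region between the graphs of `-g` and `g` is determined by `|t| ≤ g y`. -/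
lemma tripleHomeo_symm_lens {Y : Set A} {g : A → ℝ} {K H C : Set B} (E : A × ℝ ≃ₜ B)
    (hg : ∀ y ∈ Y, 0 ≤ g y) (hK : ∀ y t, y ∈ Y ∧ |t| ≤ g y ↔ E (y, t) ∈ K)
    (hH : ∀ y ∈ Y, ∀ t, |t| ≤ g y → (|t| = g y ↔ E (y, t) ∈ H))
    (hC : ∀ y ∈ Y, ∀ t, |t| ≤ g y → (g y = 0 ↔ E (y, t) ∈ C)) :
    TripleHomeo (Lens Y (fun y ↦ -g y) g) (lensBoundary Y (fun y ↦ -g y) g)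
      (lensEdge Y (fun y ↦ -g y) g) K H C := by
  refine .of_homeomorph E lensEdge_subset (fun _ h ↦ h.1) (fun u ↦ ?_) (fun u hu ↦ ?_) fun u hu ↦ ?_
  · rw [← hK u.1 u.2, abs_le]
    rfl
  · rw [← hH u.1 hu.1 u.2 (abs_le.2 hu.2), abs_eq (hg u.1 hu.1), or_comm]
    exact and_iff_right hu
  · rw [← hC u.1 hu.1 u.2 (abs_le.2 hu.2), ← neg_eq_self]
    exact and_iff_right hu

lemma tripleHomeo_wedge : TripleHomeo (Lens {y : A × ℝ | 0 ≤ y.2} (fun y ↦ -y.2) fun y ↦ y.2)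
    (lensBoundary {y : A × ℝ | 0 ≤ y.2} (fun y ↦ -y.2) fun y ↦ y.2)
    (lensEdge {y : A × ℝ | 0 ≤ y.2} (fun y ↦ -y.2) fun y ↦ y.2)
    {y : A × ℝ × ℝ | |y.2.2| ≤ y.2.1} {y : A × ℝ × ℝ | |y.2.2| = y.2.1}
    {y : A × ℝ × ℝ | y.2 = 0} := by
  refine tripleHomeo_symm_lens (Homeomorph.prodAssoc A ℝ ℝ) (fun _ h ↦ h)
    (fun y t ↦ and_iff_right_of_imp (abs_nonneg t).trans) (fun _ _ _ _ ↦ Iff.rfl) fun y _ t h ↦ ?_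
  change y.2 = 0 ↔ (y.2, t) = (0, 0)
  rw [Prod.mk.injEq]
  exact ⟨fun h0 ↦ ⟨h0, abs_nonpos_iff.1 (h0 ▸ h)⟩, fun h ↦ h.1⟩

lemma sqrt_one_sub_facts {v t : ℝ} : (v ^ 2 ≤ 1 ∧ |t| ≤ √(1 - v ^ 2) ↔ v ^ 2 + t ^ 2 ≤ 1) ∧
    (v ^ 2 ≤ 1 → (|t| = √(1 - v ^ 2) ↔ v ^ 2 + t ^ 2 = 1) ∧ (√(1 - v ^ 2) = 0 ↔ v ^ 2 = 1)) := by
  refine ⟨⟨fun ⟨h1, h2⟩ ↦ ?_, fun h ↦ ?_⟩, fun h1 ↦ ⟨?_, ?_⟩⟩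
  · rw [Real.le_sqrt (abs_nonneg _) (by linarith), sq_abs] at h2
    linarith
  · exact ⟨by nlinarith, Real.abs_le_sqrt (by linarith)⟩
  · rw [← pow_left_inj₀ (abs_nonneg t) (Real.sqrt_nonneg _) two_ne_zero, sq_abs,
      Real.sq_sqrt (by linarith)]
    constructor <;> intro h <;> linarith
  · rw [Real.sqrt_eq_zero (by linarith), sub_eq_zero, eq_comm]

end Lens

/-! ### Slices of the horizon as regions between graphs -/

namespace LocalPicture

variable {s : ℝ}

lemma le_iff (L : ℒ D τ₁)
    (hs : |s| < τ₁) {ξ : Plane} (hξ : ξ ∈ D) :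
    (S (η.symm ξ) ≤ s ↔ Z 1 (s, η.symm ξ) ≤ Z 0 (s, η.symm ξ)) ∧
      (S (η.symm ξ) = s ↔ Z 1 (s, η.symm ξ) = Z 0 (s, η.symm ξ)) :=
  le_iff_of_compare (L.compare s ξ hs hξ)

lemma mem_union_iff (L : ℒ D τ₁)
    {q : M} (hq : q ∈ W) : q ∈ horizon 𝓢 f V ∪ blackHole 𝓢 f V ↔
    Z 1 (τ q, transverse (ψ q)) ≤ ψ q 3 ∧ ψ q 3 ≤ Z 0 (τ q, transverse (ψ q)) := by
  obtain ⟨hτ, hsrc, hD, -⟩ := L.coord q hq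
  have hle := (L.le_iff hτ hD).1
  rw [η.left_inv hsrc] at hle
  rw [mem_union, L.horizon_iff q hq, L.blackHole_iff q hq, L.sheet_iff q hq, L.sheet_iff q hq, hle]
  constructor
  · rintro (⟨h | h, h'⟩ | ⟨h, h'⟩)
    · rw [h]; exact ⟨h', le_rfl⟩
    · rw [h]; exact ⟨le_rfl, h'⟩
    · exact ⟨h.le, h'.le⟩
  · rintro ⟨h, h'⟩
    rcases h.eq_or_lt with e | e
    · exact Or.inl ⟨Or.inr e.symm, h.trans h'⟩
    · rcases h'.eq_or_lt with e' | e'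
      · exact Or.inl ⟨Or.inl e', h.trans h'⟩
      · exact Or.inr ⟨e, e'⟩

lemma mem_horizon_iff (L : ℒ D τ₁)
    {q : M} (hq : q ∈ W)
    (hq' : Z 1 (τ q, transverse (ψ q)) ≤ ψ q 3 ∧ ψ q 3 ≤ Z 0 (τ q, transverse (ψ q))) :
    q ∈ horizon 𝓢 f V ↔
      (ψ q 3 = Z 1 (τ q, transverse (ψ q)) ∨ ψ q 3 = Z 0 (τ q, transverse (ψ q))) := by
  obtain ⟨hτ, hsrc, hD, -⟩ := L.coord q hq
  have hle := (L.le_iff hτ hD).1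
  rw [η.left_inv hsrc] at hle
  rw [L.horizon_iff q hq, L.sheet_iff q hq, L.sheet_iff q hq, hle, or_comm]
  exact ⟨fun h ↦ h.1, fun h ↦ ⟨h, hq'.1.trans hq'.2⟩⟩

lemma mem_crease_iff (L : ℒ D τ₁)
    {q : M} (hq : q ∈ W) :
    q ∈ crease f V ↔
      (ψ q 3 = Z 0 (τ q, transverse (ψ q)) ∧ ψ q 3 = Z 1 (τ q, transverse (ψ q))) := by
  rw [← L.sheet_iff q hq, ← L.sheet_iff q hq]
  exact ⟨fun h ↦ h.2, fun h ↦ ⟨L.subset hq, h⟩⟩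

/-- A part of a slice is homeomorphic to the region between the two sheets over the corresponding
part of the transverse plane. -/
lemma tripleHomeo_lens (L : ℒ D τ₁)
    (hs : |s| < τ₁) {X : Set Plane} (hX : X ⊆ D) :
    TripleHomeo {q ∈ ℋ s ∪ ℬ s |
        η (transverse (ψ q)) ∈ X}
      ({q ∈ ℋ s ∪ ℬ s |
        η (transverse (ψ q)) ∈ X} ∩ ℋ s)
      ({q ∈ ℋ s ∪ ℬ s |
        η (transverse (ψ q)) ∈ X} ∩ 𝒞 s)
      (Lens X (fun ξ ↦ Z 1 (s, η.symm ξ)) fun ξ ↦ Z 0 (s, η.symm ξ))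
      (lensBoundary X (fun ξ ↦ Z 1 (s, η.symm ξ)) fun ξ ↦ Z 0 (s, η.symm ξ))
      (lensEdge X (fun ξ ↦ Z 1 (s, η.symm ξ)) fun ξ ↦ Z 0 (s, η.symm ξ)) := by
  set K := {q ∈ ℋ s ∪ ℬ s |
        η (transverse (ψ q)) ∈ X} with hK
  set α : Plane → ℝ := fun ξ ↦ Z 1 (s, η.symm ξ)
  set β : Plane → ℝ := fun ξ ↦ Z 0 (s, η.symm ξ)
  have hKiff q : q ∈ K ↔ q ∈ W ∧ τ q = s ∧ η (transverse (ψ q)) ∈ X ∧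
      q ∈ horizon 𝓢 f V ∪ blackHole 𝓢 f V := by
    constructor
    · rintro ⟨h | h, hx⟩
      · exact ⟨h.1.1, h.2, hx, Or.inl h.1.2⟩
      · exact ⟨h.1.1, h.2, hx, Or.inr h.1.2⟩
    · rintro ⟨h1, h2, h3, h | h⟩
      · exact ⟨Or.inl ⟨⟨h1, h⟩, h2⟩, h3⟩
      · exact ⟨Or.inr ⟨⟨h1, h⟩, h2⟩, h3⟩
  have hKlens q (hq : q ∈ K) : (η (transverse (ψ q)), ψ q 3) ∈ Lens X α β := by
    obtain ⟨h1, h2, h3, h4⟩ := (hKiff q).1 hq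
    refine ⟨h3, ?_⟩
    have := (L.mem_union_iff h1).1 h4
    simp only [α, β, η.left_inv (L.coord q h1).2.1]
    rwa [h2] at this
  let Y : Plane × ℝ → E4 := fun u ↦
    pt (T (s, spt (η.symm u.1) u.2)) (spt (η.symm u.1) u.2)
  have hpt : ∀ u ∈ Lens X α β, Y u ∈ ψ.target ∧ ψ.symm (Y u) ∈ W ∧ τ (ψ.symm (Y u)) = s ∧
      ContinuousAt T (s, spt (η.symm u.1) u.2) :=
    fun u hu ↦ L.point s u.1 u.2 hs (hX hu.1) hu.2.1 hu.2.2
  have htr u (hu : u ∈ Lens X α β) : transverse (ψ (ψ.symm (Y u))) = η.symm u.1 ∧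
      ψ (ψ.symm (Y u)) 3 = u.2 := by
    rw [ψ.right_inv (hpt u hu).1]
    simp [Y]
  have hYK u (hu : u ∈ Lens X α β) : ψ.symm (Y u) ∈ K := by
    obtain ⟨h1, h2, h3, -⟩ := hpt u hu
    obtain ⟨h5, h6⟩ := htr u hu
    rw [hKiff]
    refine ⟨h2, h3, ?_, ?_⟩
    · rw [h5, η.right_inv (L.D_subset (hX hu.1))]; exact hu.1
    · rw [L.mem_union_iff h2, h3, h5, h6]
      exact hu.2
  let E : K ≃ₜ Lens X α β :=
    { toFun := fun q ↦ ⟨(η (transverse (ψ q)), ψ q 3), hKlens q q.2⟩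
      invFun := fun u ↦ ⟨ψ.symm (Y u), hYK u u.2⟩
      left_inv := fun q ↦ by
        obtain ⟨h1, h2, h3, h4⟩ := (hKiff q).1 q.2
        refine Subtype.ext ?_
        change ψ.symm (Y (η (transverse (ψ q)), ψ q 3)) = q
        have h5 := L.coord q h1
        simp only [Y, η.left_inv h5.2.1, spt_transverse]
        rw [← h2, ← h5.2.2.2, pt_spatial, ψ.left_inv (L.subset_source h1)]
      right_inv := fun u ↦ by
        obtain ⟨h5, h6⟩ := htr u u.2
        refine Subtype.ext (Prod.ext ?_ ?_)
        · change η (transverse (ψ (ψ.symm (Y u)))) = u.1.1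
          rw [h5, η.right_inv (L.D_subset (hX u.2.1))]
        · exact h6
      continuous_toFun := by
        refine Continuous.subtype_mk ?_ _
        rw [continuous_iff_continuousAt]
        intro q
        obtain ⟨h1, -, -, -⟩ := (hKiff q).1 q.2
        have c0 : ContinuousAt (fun q : K ↦ ψ q) q :=
          ContinuousAt.comp (g := ψ) (ψ.continuousAt (L.subset_source h1))
            continuous_subtype_val.continuousAt
        have c1 : ContinuousAt (fun q : K ↦ transverse (ψ q)) q :=
          ContinuousAt.comp (g := transverse) transverseL.continuous.continuousAt c0
        have c2 : ContinuousAt (fun q : K ↦ η (transverse (ψ q))) q :=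
          ContinuousAt.comp (g := η) (η.continuousAt (L.coord q h1).2.1) c1
        have c3 : Continuous fun X : E4 ↦ X 3 := by fun_prop
        exact c2.prodMk (ContinuousAt.comp (g := fun X : E4 ↦ X 3) c3.continuousAt c0)
      continuous_invFun := by
        refine Continuous.subtype_mk ?_ _
        rw [continuous_iff_continuousAt]
        intro u
        obtain ⟨h1, -, -, h4⟩ := hpt u u.2
        have c1 : ContinuousAt (fun u : Lens X α β ↦ η.symm u.1.1) u :=
          ContinuousAt.comp (g := η.symm) (η.continuousAt_symm (L.D_subset (hX u.2.1)))
            (continuous_fst.comp continuous_subtype_val).continuousAt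
        have c2 : ContinuousAt (fun u : Lens X α β ↦ spt (η.symm u.1.1) u.1.2) u :=
          ContinuousAt.comp (g := sptL) sptL.continuous.continuousAt
            (c1.prodMk (continuous_snd.comp continuous_subtype_val).continuousAt)
        have c3 : ContinuousAt (fun u : Lens X α β ↦ T (s, spt (η.symm u.1.1) u.1.2)) u :=
          ContinuousAt.comp (g := T) h4 (continuousAt_const.prodMk c2)
        have c4 : ContinuousAt (fun u : Lens X α β ↦ Y u) u :=
          ContinuousAt.comp (g := ptL) ptL.continuous.continuousAt (c3.prodMk c2)
        exact ContinuousAt.comp (g := ψ.symm) (ψ.continuousAt_symm h1) c4 }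
  have hcr : ∀ q ∈ W, q ∈ crease f V → q ∈ horizon 𝓢 f V := fun q _ h ↦ Or.inl h
  refine ⟨fun q hq ↦ ⟨hq.1, ⟨hq.2.1.1, hcr q hq.2.1.1 hq.2.1.2⟩, hq.2.2⟩, inter_subset_left, E,
    fun q ↦ ?_, fun q ↦ ?_⟩
  · obtain ⟨h1, h2, h3, h4⟩ := (hKiff q).1 q.2
    have h5 := L.mem_horizon_iff h1 ((L.mem_union_iff h1).1 h4)
    have h6 : (q : M) ∈ K ∩ ℋ s ↔ (q : M) ∈ horizon 𝓢 f V :=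
      ⟨fun h ↦ h.2.1.2, fun h ↦ ⟨q.2, ⟨h1, h⟩, h2⟩⟩
    rw [h6, h5]
    have h7 : ((E q : Plane × ℝ) ∈ lensBoundary X α β) ↔
        (ψ q 3 = α (η (transverse (ψ q))) ∨ ψ q 3 = β (η (transverse (ψ q)))) :=
      ⟨fun h ↦ h.2, fun h ↦ ⟨(E q).2, h⟩⟩
    rw [h7]
    simp only [α, β, η.left_inv (L.coord q h1).2.1, h2]
  · obtain ⟨h1, h2, h3, h4⟩ := (hKiff q).1 q.2
    have h5 := L.mem_crease_iff h1
    have h6 : (q : M) ∈ K ∩ 𝒞 s ↔ (q : M) ∈ crease f V :=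
      ⟨fun h ↦ h.2.1.2, fun h ↦ ⟨q.2, ⟨h1, h⟩, h2⟩⟩
    rw [h6, h5]
    have h7 : ((E q : Plane × ℝ) ∈ lensEdge X α β) ↔
        (α (η (transverse (ψ q))) = β (η (transverse (ψ q)))) :=
      ⟨fun h ↦ h.2, fun h ↦ ⟨(E q).2, h⟩⟩
    rw [h7]
    have h8 := (L.mem_union_iff h1).1 h4
    simp only [α, β, η.left_inv (L.coord q h1).2.1, h2] at h8 ⊢
    exact ⟨fun h ↦ h.2.symm.trans h.1, fun h ↦ ⟨by linarith [h8.1, h8.2], by linarith [h8.1, h8.2]⟩⟩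

end LocalPicture

/-! ### Homeomorphisms of plane regions -/

/-- The homeomorphism of `X` onto `Y` given by mutually inverse maps. -/
def homeoOfMaps {A B : Type*} [TopologicalSpace A] [TopologicalSpace B] {X : Set A} {Y : Set B}
    (f : A → B) (g : B → A) (hf : MapsTo f X Y) (hg : MapsTo g Y X) (cf : ContinuousOn f X)
    (cg : ContinuousOn g Y) (hl : LeftInvOn g f X) (hr : RightInvOn g f Y) : X ≃ₜ Y where
  toFun x := ⟨f x, hf x.2⟩
  invFun y := ⟨g y, hg y.2⟩
  left_inv x := Subtype.ext (hl x.2)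
  right_inv y := Subtype.ext (hr y.2)
  continuous_toFun := (continuousOn_iff_continuous_domRestrict.1 cf).subtype_mk _
  continuous_invFun := (continuousOn_iff_continuous_domRestrict.1 cg).subtype_mk _

lemma exists_disc_homeo {r : ℝ} (hr : 0 < r) :
    ∃ e : disc r ≃ₜ (univ : Set Plane), ∀ x, (e x : Plane) = 0 ↔ (x : Plane) = 0 := by
  let U := OpenPartialHomeomorph.univBall (0 : Plane) r
  have h1 : U.source = univ := OpenPartialHomeomorph.univBall_source 0 r
  have h2 : U.target = ball 0 r := OpenPartialHomeomorph.univBall_target 0 hr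
  have h0 : U 0 = 0 := OpenPartialHomeomorph.univBall_apply_zero 0 r
  have h0' : U.symm 0 = 0 := by
    have := U.left_inv (x := 0) (h1 ▸ mem_univ _)
    rwa [h0] at this
  refine ⟨homeoOfMaps U.symm U (mapsTo_univ _ _) (fun x _ ↦ h2 ▸ U.map_source (h1 ▸ mem_univ x))
    (h2 ▸ U.symm.continuousOn) (h1 ▸ U.continuousOn) (fun x hx ↦ U.right_inv (h2.symm ▸ hx))
    (fun x _ ↦ U.left_inv (h1 ▸ mem_univ x)), fun x ↦ ?_⟩
  change U.symm x = 0 ↔ _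
  constructor
  · intro h
    rw [← U.right_inv (h2.symm ▸ x.2 : (x : Plane) ∈ U.target), h, h0]
  · intro h; rw [h, h0']

lemma exists_closedBall_homeo {ρ : ℝ} (hρ : 0 < ρ) :
    ∃ e : closedBall (0 : Plane) ρ ≃ₜ closedBall (0 : Plane) 1,
      ∀ x, ‖(e x : Plane)‖ = ρ⁻¹ * ‖(x : Plane)‖ := by
  refine ⟨homeoOfMaps (fun x ↦ ρ⁻¹ • x) (fun x ↦ ρ • x) (fun x hx ↦ ?_) (fun x hx ↦ ?_)
    (by fun_prop) (by fun_prop) (fun x _ ↦ by simp [smul_smul, hρ.ne'])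
    (fun x _ ↦ by simp [smul_smul, hρ.ne']), fun x ↦ ?_⟩
  · simp only [mem_closedBall_zero_iff, norm_smul, norm_inv, Real.norm_eq_abs, abs_of_pos hρ] at hx ⊢
    rwa [inv_mul_le_iff₀ hρ, mul_one]
  · simp only [mem_closedBall_zero_iff, norm_smul, Real.norm_eq_abs, abs_of_pos hρ] at hx ⊢
    nlinarith
  · change ‖ρ⁻¹ • (x : Plane)‖ = _
    rw [norm_smul, norm_inv, Real.norm_eq_abs, abs_of_pos hρ]

/-- The map of `[ρ, r)` onto `[0, ∞)` and its inverse. -/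
lemma half_interval_inverse {ρ r n : ℝ} (hρ : ρ ≤ n) (hr : n < r) :
    (ρ + (n - ρ) / (r - n) * r) / (1 + (n - ρ) / (r - n)) = n ∧ 0 ≤ (n - ρ) / (r - n) := by
  have h1 : 0 < r - n := by linarith
  have h2 : r - ρ ≠ 0 := by linarith
  refine ⟨?_, div_nonneg (by linarith) h1.le⟩
  rw [div_eq_iff]
  · field_simp
    ring
  · have : 0 ≤ (n - ρ) / (r - n) := div_nonneg (by linarith) h1.le
    positivity

lemma half_interval_inverse' {ρ r t : ℝ} (h : ρ < r) (ht : 0 ≤ t) :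
    ρ ≤ (ρ + t * r) / (1 + t) ∧ (ρ + t * r) / (1 + t) < r ∧
      ((ρ + t * r) / (1 + t) - ρ) / (r - (ρ + t * r) / (1 + t)) = t := by
  have h1 : 0 < 1 + t := by linarith
  have h2 : r - ρ ≠ 0 := by linarith
  have e : r - (ρ + t * r) / (1 + t) = (r - ρ) / (1 + t) := by field_simp; ring
  refine ⟨?_, ?_, ?_⟩
  · rw [le_div_iff₀ h1]; nlinarith
  · rw [div_lt_iff₀ h1]; nlinarith
  · rw [e]
    field_simp
    ring

lemma exists_annulus_homeo {ρ r : ℝ} (hρ : 0 < ρ) (hr : ρ < r) :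
    ∃ e : {x : Plane | ρ ≤ ‖x‖ ∧ ‖x‖ < r} ≃ₜ {y : Circle × ℝ | 0 ≤ y.2},
      ∀ x, (e x : Circle × ℝ).2 = 0 ↔ ‖(x : Plane)‖ = ρ := by
  let j : Plane ≃ₗᵢ[ℝ] ℂ := Complex.orthonormalBasisOneI.repr.symm
  have hj : ∀ x, ‖j x‖ = ‖x‖ := j.norm_map
  have hpos : ∀ x : {x : Plane | ρ ≤ ‖x‖ ∧ ‖x‖ < r}, 0 < ‖(x : Plane)‖ := fun x ↦ hρ.trans_le x.2.1
  have hunit (x : {x : Plane | ρ ≤ ‖x‖ ∧ ‖x‖ < r}) : ‖j ((‖(x : Plane)‖⁻¹ : ℝ) • (x : Plane))‖ = 1 := by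
    rw [hj, norm_smul, norm_inv, norm_norm, inv_mul_cancel₀ (hpos x).ne']
  let g : {y : Circle × ℝ | 0 ≤ y.2} → ℝ := fun y ↦ (ρ + y.1.2 * r) / (1 + y.1.2)
  have hg : ∀ y, ρ ≤ g y ∧ g y < r ∧ (g y - ρ) / (r - g y) = y.1.2 := fun y ↦
    half_interval_inverse' hr y.2
  have hgn y : ‖g y • j.symm (y.1.1 : ℂ)‖ = g y := by
    rw [norm_smul, Real.norm_eq_abs, j.symm.norm_map, Circle.norm_coe, mul_one,
      abs_of_pos (hρ.trans_le (hg y).1)]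
  refine ⟨{
    toFun := fun x ↦ ⟨(⟨j ((‖(x : Plane)‖⁻¹ : ℝ) • (x : Plane)), mem_sphere_zero_iff_norm.2 (hunit x)⟩,
      (‖(x : Plane)‖ - ρ) / (r - ‖(x : Plane)‖)), (half_interval_inverse x.2.1 x.2.2).2⟩
    invFun := fun y ↦ ⟨g y • j.symm (y.1.1 : ℂ), by rw [mem_ofPred_eq, hgn]; exact ⟨(hg y).1, (hg y).2.1⟩⟩
    left_inv := fun x ↦ ?_
    right_inv := fun y ↦ ?_
    continuous_toFun := ?_
    continuous_invFun := ?_ }, fun x ↦ ?_⟩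
  · refine Subtype.ext ?_
    have h2 := (half_interval_inverse x.2.1 x.2.2).1
    change ((ρ + (‖(x : Plane)‖ - ρ) / (r - ‖(x : Plane)‖) * r) /
      (1 + (‖(x : Plane)‖ - ρ) / (r - ‖(x : Plane)‖))) •
      j.symm (j ((‖(x : Plane)‖⁻¹ : ℝ) • (x : Plane))) = x
    rw [h2, j.symm_apply_apply, smul_smul, mul_inv_cancel₀ (hpos x).ne', one_smul]
  · refine Subtype.ext (Prod.ext (Circle.ext ?_) ?_)
    · change j ((‖g y • j.symm (y.1.1 : ℂ)‖⁻¹ : ℝ) • g y • j.symm (y.1.1 : ℂ)) = (y.1.1 : ℂ)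
      rw [hgn, smul_smul, inv_mul_cancel₀ (hρ.trans_le (hg y).1).ne', one_smul, j.apply_symm_apply]
    · change (‖g y • j.symm (y.1.1 : ℂ)‖ - ρ) / (r - ‖g y • j.symm (y.1.1 : ℂ)‖) = y.1.2
      rw [hgn, (hg y).2.2]
  · have c1 : Continuous fun x : {x : Plane | ρ ≤ ‖x‖ ∧ ‖x‖ < r} ↦ (‖(x : Plane)‖⁻¹ : ℝ) :=
      (continuous_norm.comp continuous_subtype_val).inv₀ fun x ↦ (hpos x).ne'
    refine Continuous.subtype_mk (Continuous.prodMk ?_ ?_) _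
    · exact Continuous.subtype_mk (j.continuous.comp (c1.smul continuous_subtype_val)) _
    · exact Continuous.div (by fun_prop) (by fun_prop) fun x ↦ (sub_pos.2 x.2.2).ne'
  · refine Continuous.subtype_mk ?_ _
    have c1 : Continuous g := Continuous.div (by fun_prop) (by fun_prop) fun y ↦ by
      have := y.2
      change 0 ≤ y.1.2 at this
      linarith
    exact c1.smul (j.symm.continuous.comp
      (continuous_subtype_val.comp (continuous_fst.comp continuous_subtype_val)))
  · change (‖(x : Plane)‖ - ρ) / (r - ‖(x : Plane)‖) = 0 ↔ _
    rw [div_eq_zero_iff, sub_eq_zero, or_iff_left (sub_pos.2 x.2.2).ne']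

/-- The map of `(-R, R)` onto the line, and its inverse. -/
lemma interval_inverse {R u : ℝ} (hu : u ^ 2 < R ^ 2) (hR : 0 < R) :
    R * (u / √(R ^ 2 - u ^ 2)) / √(1 + (u / √(R ^ 2 - u ^ 2)) ^ 2) = u := by
  have h1 : 0 < R ^ 2 - u ^ 2 := by linarith
  have h2 : 0 < √(R ^ 2 - u ^ 2) := Real.sqrt_pos.2 h1
  have h3 : 1 + (u / √(R ^ 2 - u ^ 2)) ^ 2 = (R / √(R ^ 2 - u ^ 2)) ^ 2 := by
    rw [div_pow, div_pow, Real.sq_sqrt h1.le]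
    field_simp
    ring
  rw [h3, Real.sqrt_sq (by positivity)]
  field_simp

lemma interval_inverse' {R : ℝ} (w : ℝ) (hR : 0 < R) :
    (R * w / √(1 + w ^ 2)) ^ 2 < R ^ 2 ∧
      (R * w / √(1 + w ^ 2)) / √(R ^ 2 - (R * w / √(1 + w ^ 2)) ^ 2) = w := by
  have h1 : 0 < 1 + w ^ 2 := by positivity
  have h2 : 0 < √(1 + w ^ 2) := Real.sqrt_pos.2 h1
  have e : R ^ 2 - (R * w / √(1 + w ^ 2)) ^ 2 = (R / √(1 + w ^ 2)) ^ 2 := by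
    rw [div_pow, div_pow, Real.sq_sqrt h1.le]
    field_simp
    ring
  refine ⟨?_, ?_⟩
  · have : 0 < (R / √(1 + w ^ 2)) ^ 2 := by positivity
    linarith
  · rw [e, Real.sqrt_sq (by positivity)]
    field_simp

lemma exists_wedge_homeo {κ r σ : ℝ} (hκ : 0 ≤ κ) (hr : 0 < r) (hκr : κ < r ^ 2) (hσ : σ * σ = 1) :
    ∃ e : {x : Plane | √(x 0 ^ 2 + κ) ≤ σ * x 1 ∧ σ * x 1 < r} ≃ₜ {y : ℝ × ℝ | 0 ≤ y.2},
      ∀ x, (e x : ℝ × ℝ).2 = 0 ↔ σ * (x : Plane) 1 = √((x : Plane) 0 ^ 2 + κ) := by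
  obtain ⟨R, hR, hR2⟩ : ∃ R, 0 < R ∧ R ^ 2 = r ^ 2 - κ :=
    ⟨√(r ^ 2 - κ), Real.sqrt_pos.2 (by linarith), Real.sq_sqrt (by linarith)⟩
  have hu (x : Plane) : √(x 0 ^ 2 + κ) ≤ σ * x 1 → σ * x 1 < r → x 0 ^ 2 < R ^ 2 := by
    intro h1 h2
    have h3 := Real.sq_sqrt (show 0 ≤ x 0 ^ 2 + κ by positivity)
    have h4 := Real.sqrt_nonneg (x 0 ^ 2 + κ)
    have h5 : √(x 0 ^ 2 + κ) ^ 2 < r ^ 2 := by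
      apply pow_lt_pow_left₀ (h1.trans_lt h2) h4 (by norm_num)
    linarith
  let U : ℝ → ℝ := fun w ↦ R * w / √(1 + w ^ 2)
  have hU := fun w ↦ interval_inverse' w hR
  have hc w : √(U w ^ 2 + κ) < r := by
    rw [← Real.sqrt_sq hr.le]
    exact Real.sqrt_lt_sqrt (by positivity) (by have := (hU w).1; simp only [U]; linarith)
  have cU : Continuous U := Continuous.div (by fun_prop) (by fun_prop) fun w ↦
    (Real.sqrt_pos.2 (by positivity)).ne'
  have hσσ : ∀ v, σ * (σ * v) = v := fun v ↦ by rw [← mul_assoc, hσ, one_mul]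
  let f : Plane → ℝ × ℝ := fun x ↦ (x 0 / √(R ^ 2 - x 0 ^ 2),
    (σ * x 1 - √(x 0 ^ 2 + κ)) / (r - σ * x 1))
  let g : ℝ × ℝ → Plane := fun y ↦
    !₂[U y.1, σ * ((√(U y.1 ^ 2 + κ) + y.2 * r) / (1 + y.2))]
  have hg0 : ∀ y, g y 0 = U y.1 := fun y ↦ rfl
  have hg1 : ∀ y, σ * g y 1 = (√(U y.1 ^ 2 + κ) + y.2 * r) / (1 + y.2) := fun y ↦ hσσ _
  refine ⟨homeoOfMaps f g ?_ ?_ ?_ ?_ ?_ ?_, fun x ↦ ?_⟩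
  · rintro x ⟨h1, h2⟩
    exact (half_interval_inverse h1 h2).2
  · intro y hy
    have := half_interval_inverse' (hc y.1) hy
    refine ⟨?_, ?_⟩
    · rw [hg0, hg1]; exact this.1
    · rw [hg1]; exact this.2.1
  · refine ContinuousOn.prodMk ?_ ?_
    · refine ContinuousOn.div (by fun_prop) (by fun_prop) fun x hx ↦ (Real.sqrt_pos.2 ?_).ne'
      linarith [hu x hx.1 hx.2]
    · exact ContinuousOn.div (by fun_prop) (by fun_prop) fun x hx ↦ (sub_pos.2 hx.2).ne'
  · have c2 : ContinuousOn (fun y : ℝ × ℝ ↦ σ * ((√(U y.1 ^ 2 + κ) + y.2 * r) / (1 + y.2)))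
        {y : ℝ × ℝ | 0 ≤ y.2} := by
      refine continuousOn_const.mul (ContinuousOn.div (by fun_prop) (by fun_prop) fun y hy ↦ ?_)
      change 0 ≤ y.2 at hy
      linarith
    refine (PiLp.continuous_toLp 2 (fun _ : Fin 2 ↦ ℝ)).comp_continuousOn (continuousOn_pi.2 fun i ↦ ?_)
    fin_cases i
    · exact (cU.comp continuous_fst).continuousOn
    · exact c2
  · rintro x ⟨h1, h2⟩
    have e0 : U (f x).1 = x 0 := interval_inverse (hu x h1 h2) hR
    have e1 := (half_interval_inverse h1 h2).1
    ext i
    fin_cases i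
    · exact e0
    · change σ * ((√(U (f x).1 ^ 2 + κ) + (f x).2 * r) / (1 + (f x).2)) = x 1
      rw [e0]
      simp only [f]
      rw [e1, hσσ]
  · intro y hy
    refine Prod.ext ?_ ?_
    · exact (hU y.1).2
    · change (σ * g y 1 - √(g y 0 ^ 2 + κ)) / (r - σ * g y 1) = y.2
      rw [hg0, hg1]
      exact (half_interval_inverse' (hc y.1) hy).2.2
  · change (σ * (x : Plane) 1 - √((x : Plane) 0 ^ 2 + κ)) / (r - σ * (x : Plane) 1) = 0 ↔ _
    rw [div_eq_zero_iff, sub_eq_zero, or_iff_left (sub_pos.2 x.2.2).ne']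

lemma exists_strip_homeo {κ r : ℝ} (hκ : 0 < κ) (hr : 0 < r) :
    ∃ e : {x : Plane | |x 0| ≤ √(x 1 ^ 2 + κ) ∧ |x 1| < r} ≃ₜ {y : ℝ × ℝ | |y.1| ≤ 1},
      ∀ x, |(e x : ℝ × ℝ).1| = 1 ↔ |(x : Plane) 0| = √((x : Plane) 1 ^ 2 + κ) := by
  have hc : ∀ v, 0 < √(v ^ 2 + κ) := fun v ↦ Real.sqrt_pos.2 (by positivity)
  have hsq : ∀ {v}, |v| < r → v ^ 2 < r ^ 2 := fun h ↦ by
    rw [← sq_abs]; exact pow_lt_pow_left₀ h (abs_nonneg _) (by norm_num)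
  let U : ℝ → ℝ := fun w ↦ r * w / √(1 + w ^ 2)
  have hU := fun w ↦ interval_inverse' w hr
  have cU : Continuous U := Continuous.div (by fun_prop) (by fun_prop) fun w ↦
    (Real.sqrt_pos.2 (by positivity)).ne'
  let f : Plane → ℝ × ℝ := fun x ↦ (x 0 / √(x 1 ^ 2 + κ), x 1 / √(r ^ 2 - x 1 ^ 2))
  let g : ℝ × ℝ → Plane := fun y ↦ !₂[y.1 * √(U y.2 ^ 2 + κ), U y.2]
  have hg0 : ∀ y, g y 0 = y.1 * √(U y.2 ^ 2 + κ) := fun y ↦ rfl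
  have hg1 : ∀ y, g y 1 = U y.2 := fun y ↦ rfl
  refine ⟨homeoOfMaps f g ?_ ?_ ?_ ?_ ?_ ?_, fun x ↦ ?_⟩
  · rintro x ⟨h1, h2⟩
    change |x 0 / √(x 1 ^ 2 + κ)| ≤ 1
    rwa [abs_div, abs_of_pos (hc _), div_le_one (hc _)]
  · intro y hy
    refine ⟨?_, ?_⟩
    · rw [hg0, hg1, abs_mul, abs_of_pos (hc _)]
      exact mul_le_of_le_one_left (hc _).le hy
    · rw [hg1]
      exact abs_lt_of_sq_lt_sq (hU y.2).1 hr.le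
  · refine ContinuousOn.prodMk ?_ ?_
    · exact ContinuousOn.div (by fun_prop) (by fun_prop) fun x _ ↦ (hc _).ne'
    · refine ContinuousOn.div (by fun_prop) (by fun_prop) fun x hx ↦ (Real.sqrt_pos.2 ?_).ne'
      linarith [hsq hx.2]
  · refine Continuous.continuousOn ?_
    refine (PiLp.continuous_toLp 2 (fun _ : Fin 2 ↦ ℝ)).comp (continuous_pi fun i ↦ ?_)
    fin_cases i
    · change Continuous fun y : ℝ × ℝ ↦ y.1 * √(U y.2 ^ 2 + κ)
      fun_prop
    · exact cU.comp continuous_snd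
  · rintro x ⟨h1, h2⟩
    have e1 : U (f x).2 = x 1 := interval_inverse (hsq h2) hr
    ext i
    fin_cases i
    · change (f x).1 * √(U (f x).2 ^ 2 + κ) = x 0
      rw [e1]
      exact div_mul_cancel₀ _ (hc _).ne'
    · exact e1
  · intro y hy
    refine Prod.ext ?_ ?_
    · change g y 0 / √(g y 1 ^ 2 + κ) = y.1
      rw [hg0, hg1, mul_div_cancel_right₀ _ (hc _).ne']
    · exact (hU y.2).2
  · change |(x : Plane) 0 / √((x : Plane) 1 ^ 2 + κ)| = 1 ↔ _
    rw [abs_div, abs_of_pos (hc _), div_eq_one_iff_eq (hc _).ne']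

/-! ### The topology of the slices -/

namespace LocalPicture

variable {s : ℝ}

lemma mem_slice_union (L : ℒ D τ₁) {q : M}
    (hq : q ∈ ℋ s ∪ ℬ s) :
    q ∈ W ∧ τ q = s ∧ q ∈ horizon 𝓢 f V ∪ blackHole 𝓢 f V ∧
      η (transverse (ψ q)) ∈ D ∧ S (η.symm (η (transverse (ψ q)))) ≤ s := by
  obtain ⟨h1, h2, h3⟩ : q ∈ W ∧ τ q = s ∧ q ∈ horizon 𝓢 f V ∪ blackHole 𝓢 f V := by
    rcases hq with h | h
    · exact ⟨h.1.1, h.2, Or.inl h.1.2⟩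
    · exact ⟨h.1.1, h.2, Or.inr h.1.2⟩
  obtain ⟨h4, h5, h6, -⟩ := L.coord q h1
  refine ⟨h1, h2, h3, h6, ?_⟩
  rw [h2] at h4
  rw [(L.le_iff h4 h6).1, η.left_inv h5, ← h2]
  have := (L.mem_union_iff h1).1 h3
  exact this.1.trans this.2

lemma slice_crease_subset (L : ℒ D τ₁) :
    𝒞 s ⊆ ℋ s :=
  fun _ h ↦ ⟨⟨h.1.1, Or.inl h.1.2⟩, h.2⟩

lemma tripleHomeo_piece (L : ℒ D τ₁) {B : Type*}
    [TopologicalSpace B] (hs : |s| < τ₁) {X : Set Plane} {Y : Set B} {g : B → ℝ} (hX : X ⊆ D)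
    (hXS : ∀ ξ ∈ X, S (η.symm ξ) ≤ s) (e : X ≃ₜ Y) (hg : ContinuousOn g Y)
    (hg0 : ∀ y ∈ Y, 0 ≤ g y) (heq : ∀ x : X, S (η.symm x) = s ↔ g (e x) = 0) :
    TripleHomeo {q ∈ ℋ s ∪ ℬ s |
        η (transverse (ψ q)) ∈ X}
      ({q ∈ ℋ s ∪ ℬ s |
        η (transverse (ψ q)) ∈ X} ∩ ℋ s)
      ({q ∈ ℋ s ∪ ℬ s |
        η (transverse (ψ q)) ∈ X} ∩ 𝒞 s)
      (Lens Y (fun y ↦ -g y) g) (lensBoundary Y (fun y ↦ -g y) g)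
      (lensEdge Y (fun y ↦ -g y) g) := by
  have hc A : ContinuousOn (fun ξ ↦ Z A (s, η.symm ξ)) X := by
    intro ξ hξ
    refine ContinuousAt.continuousWithinAt ?_
    exact ContinuousAt.comp (g := Z A) (L.continuousAt_Z A s ξ hs (hX hξ))
      (continuousAt_const.prodMk (η.continuousAt_symm (L.D_subset (hX hξ))))
  exact (L.tripleHomeo_lens hs hX).trans (lens_tripleHomeo e (hc 1) (hc 0) hg.neg hg
    (fun ξ hξ ↦ (L.le_iff hs (hX hξ)).1.1 (hXS ξ hξ)) (fun y hy ↦ neg_le_self (hg0 y hy))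
    fun x ↦ (L.le_iff hs (hX x.2)).2.symm.trans ((heq x).trans neg_eq_self.symm))

lemma tripleHomeo_slice (L : ℒ D τ₁) {B : Type*}
    [TopologicalSpace B] (hs : |s| < τ₁) {X : Set Plane} {Y : Set B} {g : B → ℝ}
    (hX : ∀ ξ, ξ ∈ X ↔ ξ ∈ D ∧ S (η.symm ξ) ≤ s) (e : X ≃ₜ Y) (hg : ContinuousOn g Y)
    (hg0 : ∀ y ∈ Y, 0 ≤ g y) (heq : ∀ x : X, S (η.symm x) = s ↔ g (e x) = 0) :
    TripleHomeo (ℋ s ∪ ℬ s)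
      (ℋ s) (𝒞 s)
      (Lens Y (fun y ↦ -g y) g) (lensBoundary Y (fun y ↦ -g y) g)
      (lensEdge Y (fun y ↦ -g y) g) := by
  have h := L.tripleHomeo_piece hs (fun ξ hξ ↦ ((hX ξ).1 hξ).1) (fun ξ hξ ↦ ((hX ξ).1 hξ).2) e
    hg hg0 heq
  have h1 : {q ∈ ℋ s ∪ ℬ s |
      η (transverse (ψ q)) ∈ X} = ℋ s ∪ ℬ s := by
    ext q
    refine ⟨fun h ↦ h.1, fun h ↦ ⟨h, ?_⟩⟩
    obtain ⟨-, -, -, h4, h5⟩ := L.mem_slice_union h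
    exact (hX _).2 ⟨h4, h5⟩
  rwa [h1, inter_eq_right.2 subset_union_left,
    inter_eq_right.2 (L.slice_crease_subset.trans subset_union_left)] at h

lemma map_zero (L : ℒ D τ₁) (hτ₁ : 0 < τ₁) :
    τ p = 0 ∧ ψ p = 0 := by
  have hz : ∀ A, Z A (0, (0 : Plane)) = 0 := L.Z_zero
  have h := L.point 0 0 0 (by simpa using hτ₁) L.D_zero (by rw [L.η_zero, hz])
    (by rw [L.η_zero, hz])
  have hT : T (0, (0 : Space)) = 0 := L.T_zero
  rw [L.η_zero, spt_zero_zero, hT, pt_zero_zero, L.symm_zero] at h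
  exact ⟨h.2.2.1, by rw [← L.symm_zero, ψ.right_inv h.1]⟩

lemma mem_crease (L : ℒ D τ₁) (hτ₁ : 0 < τ₁) :
    p ∈ 𝒞 0 := by
  refine ⟨⟨L.mem, (L.mem_crease_iff L.mem).2 ?_⟩, (L.map_zero hτ₁).1⟩
  have hz : ∀ A, Z A (0, (0 : Plane)) = 0 := L.Z_zero
  have : transverse (0 : E4) = 0 := _root_.map_zero transverseL
  rw [(L.map_zero hτ₁).1, (L.map_zero hτ₁).2, this, hz, hz]
  exact ⟨rfl, rfl⟩

lemma transverse_zero (L : ℒ D τ₁) (hτ₁ : 0 < τ₁) :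
    η (transverse (ψ p)) = 0 := by
  have : transverse (0 : E4) = 0 := _root_.map_zero transverseL
  rw [(L.map_zero hτ₁).2, this, ← L.η_zero, η.right_inv (L.D_subset L.D_zero), L.η_zero]

lemma eq_of_transverse_zero (L : ℒ D τ₁) {q : M}
    (hq : q ∈ ℋ 0 ∪ ℬ 0)
    (hq0 : η (transverse (ψ q)) = 0) : q = p := by
  obtain ⟨h1, h2, h3, h4, h5⟩ := L.mem_slice_union hq
  obtain ⟨-, h6, -, h7⟩ := L.coord q h1
  have ht : transverse (ψ q) = 0 := by rw [← η.left_inv h6, hq0, L.η_zero]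
  have hz : ∀ A, Z A (0, (0 : Plane)) = 0 := L.Z_zero
  have hT : T (0, (0 : Space)) = 0 := L.T_zero
  have h8 := (L.mem_union_iff h1).1 h3
  rw [h2, ht, hz, hz] at h8
  have h9 : spatial (ψ q) = 0 := by
    rw [← spt_transverse, ht, le_antisymm h8.2 h8.1, spt_zero_zero]
  have h10 : ψ q = 0 := by
    rw [← pt_spatial (ψ q), h7, h2, h9, hT, pt_zero_zero]
  rw [← ψ.left_inv (L.subset_source h1), h10, L.symm_zero]

lemma slice_empty (L : ℒ D τ₁)
    (h : ∀ ξ ∈ D, s < S (η.symm ξ)) :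
    ℬ s = ∅ ∧ ℋ s = ∅ ∧
      𝒞 s = ∅ := by
  have h1 : ℋ s ∪ ℬ s = ∅ := by
    rw [eq_empty_iff_forall_notMem]
    intro q hq
    obtain ⟨-, -, -, h4, h5⟩ := L.mem_slice_union hq
    exact (h _ h4).not_ge h5
  obtain ⟨h2, h3⟩ := union_empty_iff.1 h1
  exact ⟨h3, h2, subset_empty_iff.1 (h2 ▸ L.slice_crease_subset)⟩

lemma mem_slice_crease_iff (L : ℒ D τ₁) {q : M} :
    q ∈ 𝒞 s ↔ q ∈ W ∧ τ q = s ∧ S (transverse (ψ q)) = s ∧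
      ψ q 3 = ζ (transverse (ψ q)) := by
  have key q (hq : q ∈ W) : τ q = s → (q ∈ crease f V ↔ S (transverse (ψ q)) = s ∧
      ψ q 3 = ζ (transverse (ψ q))) := by
    intro hs
    obtain ⟨h1, h2, h3, -⟩ := L.coord q hq
    rw [hs] at h1
    have hc := L.compare s _ h1 h3
    have hle := (L.le_iff h1 h3).2
    rw [η.left_inv h2] at hc hle
    rw [L.mem_crease_iff hq, hs]
    constructor
    · rintro ⟨h4, h5⟩
      have h6 := hle.2 (h5.symm.trans h4)
      exact ⟨h6, h4.trans (hc.2.2.1.1 h6)⟩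
    · rintro ⟨h4, h5⟩
      rw [h5, hc.2.2.1.1 h4, hc.2.2.2.1 h4]
      exact ⟨rfl, rfl⟩
  constructor
  · rintro ⟨⟨h1, h2⟩, h3⟩
    exact ⟨h1, h3, (key q h1 h3).1 h2⟩
  · rintro ⟨h1, h2, h3⟩
    exact ⟨⟨h1, (key q h1 h2).2 h3⟩, h2⟩

lemma mem_slice_crease_zero (L : ℒ D τ₁) (hτ₁ : 0 < τ₁)
    (h : ∀ ξ ∈ D, S (η.symm ξ) = 0 → ξ = 0) : 𝒞 0 = {p} := by
  refine Subset.antisymm (fun q hq ↦ ?_) (singleton_subset_iff.2 (L.mem_crease hτ₁))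
  obtain ⟨h1, h2, h3, h4⟩ := L.mem_slice_crease_iff.1 hq
  obtain ⟨-, h6, h7, -⟩ := L.coord q h1
  refine L.eq_of_transverse_zero (Or.inl (L.slice_crease_subset hq)) (h _ h7 ?_)
  rw [η.left_inv h6, h3]

lemma norm_sq_plane (ξ : Plane) : ‖ξ‖ ^ 2 = ξ 0 ^ 2 + ξ 1 ^ 2 := by
  simp [EuclideanSpace.norm_sq_eq, Fin.sum_univ_two]

lemma holeCollapse {r a τ₀ : ℝ}
    (L : ℒ (ball 0 r) τ₁) (hr : 0 < r) (ha : 0 < a)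
    (hS : ∀ ξ ∈ disc r, 2 * a * S (η.symm ξ) = -‖ξ‖ ^ 2) (hτ₀ : 0 < τ₀)
    (h₁ : τ₀ ≤ τ₁) (h₂ : 2 * a * τ₀ ≤ r ^ 2) :
    HoleCollapse τ₀ ℬ ℋ
      𝒞 p := by
  have hle s : ∀ ξ ∈ disc r, S (η.symm ξ) ≤ s ↔ -(2 * a * s) ≤ ‖ξ‖ ^ 2 := by
    intro ξ hξ
    have := hS ξ hξ
    rw [← mul_le_mul_iff_right₀ (show 0 < 2 * a by positivity), this, neg_le]
  have heq s : ∀ ξ ∈ disc r, S (η.symm ξ) = s ↔ -(2 * a * s) = ‖ξ‖ ^ 2 := by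
    intro ξ hξ
    have := hS ξ hξ
    rw [← mul_right_inj' (show 2 * a ≠ 0 by positivity), this, neg_eq_iff_eq_neg, eq_comm]
  obtain ⟨e₀, he₀⟩ := exists_disc_homeo hr
  refine ⟨fun s hs ↦ ?_, ⟨L.mem_slice_crease_zero (hτ₀.trans_le h₁) ?_, ?_⟩, fun s hs ↦ ?_⟩
  · have hs1 : |s| < τ₁ := by rw [abs_of_neg hs.2]; linarith [hs.1]
    obtain ⟨ρ, hρ, hρ2⟩ : ∃ ρ, 0 < ρ ∧ ρ ^ 2 = -(2 * a * s) :=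
      ⟨√(-(2 * a * s)), Real.sqrt_pos.2 (by nlinarith [hs.2]), Real.sq_sqrt (by nlinarith [hs.2])⟩
    have hρr : ρ < r := by
      refine lt_of_pow_lt_pow_left₀ 2 hr.le ?_
      rw [hρ2]
      nlinarith [hs.1]
    obtain ⟨e, he⟩ := exists_annulus_homeo hρ hρr
    refine (L.tripleHomeo_slice (X := {x : Plane | ρ ≤ ‖x‖ ∧ ‖x‖ < r}) hs1 (fun ξ ↦ ?_) e
      (by fun_prop) (fun _ hy ↦ hy) fun x ↦ ?_).trans tripleHomeo_wedge
    · change ρ ≤ ‖ξ‖ ∧ ‖ξ‖ < r ↔ _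
      rw [mem_ball_zero_iff, and_comm]
      refine and_congr_right fun hξ ↦ ?_
      rw [hle s ξ (mem_ball_zero_iff.2 hξ), ← hρ2, pow_le_pow_iff_left₀ hρ.le (norm_nonneg _) two_ne_zero]
    · rw [heq s x (mem_ball_zero_iff.2 x.2.2), ← hρ2,
        pow_left_inj₀ hρ.le (norm_nonneg _) two_ne_zero, eq_comm, ← he x]
  · intro ξ hξ h
    have := (heq 0 ξ hξ).1 h
    simpa using this.symm
  · refine (L.tripleHomeo_slice (by simpa using hτ₀.trans_le h₁) (fun ξ ↦ ?_) e₀ (g := norm)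
      (by fun_prop) (fun y _ ↦ norm_nonneg y) fun x ↦ ?_).trans (tripleHomeo_symm_lens (.refl _)
        (fun y _ ↦ norm_nonneg y) (fun y t ↦ and_iff_right (mem_univ y)) (fun _ _ _ _ ↦ Iff.rfl)
        fun y _ t h ↦ ?_)
    · refine (and_iff_left_of_imp fun hξ ↦ ?_).symm
      rw [hle 0 ξ hξ]
      simp
    · rw [heq 0 x x.2, norm_eq_zero, he₀ x, eq_comm]
      simp
    · change ‖y‖ = 0 ↔ (y, t) = (0, 0)
      rw [Prod.mk.injEq, norm_eq_zero]
      exact ⟨fun h0 ↦ ⟨h0, by simpa [h0] using h⟩, fun h ↦ h.1⟩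
  · have hs1 : |s| < τ₁ := by rw [abs_of_pos hs.1]; linarith [hs.2]
    have hs2 : 0 < 2 * a * s := by have := hs.1; positivity
    refine (L.tripleHomeo_slice hs1 (fun ξ ↦ ?_) e₀ (g := fun _ ↦ 1) (by fun_prop)
      (fun _ _ ↦ zero_le_one) fun x ↦ ?_).trans (tripleHomeo_symm_lens (.refl _)
        (fun _ _ ↦ zero_le_one) (fun y t ↦ and_iff_right (mem_univ y)) (fun _ _ _ _ ↦ Iff.rfl)
        fun y _ t h ↦ iff_of_false one_ne_zero id)
    · refine (and_iff_left_of_imp fun hξ ↦ ?_).symm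
      rw [hle s ξ hξ]
      nlinarith [sq_nonneg ‖ξ‖]
    · rw [heq s x x.2]
      exact iff_of_false (by nlinarith [sq_nonneg ‖(x : Plane)‖]) one_ne_zero

lemma saucerNucleation {r a τ₀ : ℝ}
    (L : ℒ (ball 0 r) τ₁) (hr : 0 < r) (ha : 0 < a)
    (hS : ∀ ξ ∈ disc r, 2 * a * S (η.symm ξ) = ‖ξ‖ ^ 2) (hτ₀ : 0 < τ₀)
    (h₁ : τ₀ ≤ τ₁) (h₂ : 2 * a * τ₀ ≤ r ^ 2) :
    SaucerNucleation τ₀ ℬ ℋ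
      𝒞 p := by
  have hle s : ∀ ξ ∈ disc r, S (η.symm ξ) ≤ s ↔ ‖ξ‖ ^ 2 ≤ 2 * a * s := by
    intro ξ hξ
    rw [← hS ξ hξ, mul_le_mul_iff_right₀ (show 0 < 2 * a by positivity)]
  have heq s : ∀ ξ ∈ disc r, S (η.symm ξ) = s ↔ ‖ξ‖ ^ 2 = 2 * a * s := by
    intro ξ hξ
    rw [← hS ξ hξ, mul_right_inj' (show 2 * a ≠ 0 by positivity)]
  have hC := L.mem_slice_crease_zero (hτ₀.trans_le h₁) fun ξ hξ h ↦ by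
    have := (heq 0 ξ hξ).1 h
    simpa using this
  have hall q (hq : q ∈ ℋ 0 ∪ ℬ 0) : q = p := by
    obtain ⟨-, -, -, h4, h5⟩ := L.mem_slice_union hq
    refine L.eq_of_transverse_zero hq ?_
    have := (hle 0 _ h4).1 h5
    rw [mul_zero] at this
    exact norm_eq_zero.1 (pow_eq_zero_iff two_ne_zero |>.1 (le_antisymm this (sq_nonneg _)))
  refine ⟨fun s hs ↦ L.slice_empty fun ξ hξ ↦ ?_, ⟨?_, ?_, hC⟩, fun s hs ↦ ?_⟩
  · by_contra! h
    have h1 := (hle s ξ hξ).1 h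
    have : 2 * a * s < 0 := by have := hs.2; nlinarith
    nlinarith [sq_nonneg ‖ξ‖]
  · rw [eq_empty_iff_forall_notMem]
    intro q hq
    have hqp := hall q (Or.inr hq)
    have h1 := (L.blackHole_iff q hq.1.1).1 hq.1.2
    have h2 := (L.mem_crease_iff L.mem).1 (L.mem_crease (hτ₀.trans_le h₁)).1.2
    rw [hqp] at h1
    linarith [h1.1, h1.2, h2.1, h2.2]
  · refine Subset.antisymm (fun q hq ↦ hall q (Or.inl hq)) ?_
    rw [singleton_subset_iff]
    exact L.slice_crease_subset (L.mem_crease (hτ₀.trans_le h₁))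
  · have hs1 : |s| < τ₁ := by rw [abs_of_pos hs.1]; linarith [hs.2]
    have hs2 : 0 < 2 * a * s := by have := hs.1; positivity
    obtain ⟨ρ, hρ, hρ2⟩ : ∃ ρ, 0 < ρ ∧ ρ ^ 2 = 2 * a * s :=
      ⟨√(2 * a * s), Real.sqrt_pos.2 hs2, Real.sq_sqrt hs2.le⟩
    have hρr : ρ < r := by
      refine lt_of_pow_lt_pow_left₀ 2 hr.le ?_
      rw [hρ2]
      nlinarith [hs.2]
    obtain ⟨e, he⟩ := exists_closedBall_homeo hρ
    have h1y : ∀ y : Plane, y ∈ closedBall (0 : Plane) 1 ↔ ‖y‖ ^ 2 ≤ 1 := fun y ↦ by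
      rw [mem_closedBall_zero_iff, sq_le_one_iff₀ (norm_nonneg _)]
    let E : Plane × ℝ ≃ₜ Space :=
      { toFun := fun u ↦ spt u.1 u.2
        invFun := fun y ↦ (!₂[y 0, y 1], y 2)
        left_inv := fun u ↦ Prod.ext (by ext i; fin_cases i <;> rfl) rfl
        right_inv := fun y ↦ by ext i; fin_cases i <;> rfl
        continuous_toFun := sptL.continuous
        continuous_invFun := by fun_prop }
    have hn : ∀ y t, ‖E (y, t)‖ ^ 2 = ‖y‖ ^ 2 + t ^ 2 := fun _ _ ↦ sq_norm_spt _ _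
    have hn1 : ∀ y t, ‖E (y, t)‖ = 1 ↔ ‖y‖ ^ 2 + t ^ 2 = 1 := fun y t ↦ by
      rw [← hn, pow_eq_one_iff_of_nonneg (norm_nonneg _) two_ne_zero]
    refine (L.tripleHomeo_slice hs1 (fun ξ ↦ ?_) e (g := fun y ↦ √(1 - ‖y‖ ^ 2)) (by fun_prop)
      (fun _ _ ↦ Real.sqrt_nonneg _) fun x ↦ ?_).trans (tripleHomeo_symm_lens E
        (fun _ _ ↦ Real.sqrt_nonneg _) (fun y t ↦ ?_) (fun y hy t _ ↦ ?_) fun y hy t h ↦ ?_)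
    · rw [mem_ball_zero_iff, mem_closedBall_zero_iff]
      constructor
      · intro h
        refine ⟨h.trans_lt hρr, ?_⟩
        rw [hle s ξ (mem_ball_zero_iff.2 (h.trans_lt hρr)), ← hρ2]
        exact pow_le_pow_left₀ (norm_nonneg _) h 2
      · rintro ⟨h3, h4⟩
        rw [hle s ξ (mem_ball_zero_iff.2 h3), ← hρ2] at h4
        exact le_of_sq_le_sq h4 hρ.le
    · have hx := mem_closedBall_zero_iff.1 x.2
      rw [heq s x (mem_ball_zero_iff.2 (hx.trans_lt hρr)), ← hρ2,
        pow_left_inj₀ (norm_nonneg _) hρ.le two_ne_zero,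
        ((sqrt_one_sub_facts (t := 0)).2 ((h1y _).1 (e x).2)).2,
        pow_eq_one_iff_of_nonneg (norm_nonneg _) two_ne_zero, he x, inv_mul_eq_one₀ hρ.ne', eq_comm]
    · rw [h1y, mem_closedBall_zero_iff, ← sq_le_one_iff₀ (norm_nonneg _), hn, sqrt_one_sub_facts.1]
    · rw [mem_sphere_zero_iff_norm, hn1, (sqrt_one_sub_facts.2 ((h1y y).1 hy)).1]
    · change _ ↔ ‖E (y, t)‖ = 1 ∧ t = 0
      rw [hn1, (sqrt_one_sub_facts (t := t).2 ((h1y y).1 hy)).2]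
      refine ⟨fun h0 ↦ ?_, fun ⟨h1, h2⟩ ↦ by simpa [h2] using h1⟩
      rw [h0, sub_self, Real.sqrt_zero, abs_nonpos_iff] at h
      simp [h, h0]

end LocalPicture

/-- The open rectangle `|ξ 0| < 2 r`, `|ξ 1| < r`. -/
def rectangle (r : ℝ) : Set Plane := {ξ | |ξ 0| < 2 * r ∧ |ξ 1| < r}

lemma isOpen_rectangle (r : ℝ) : IsOpen (rectangle r) := by
  have h0 : IsOpen {ξ : Plane | |ξ 0| < 2 * r} := isOpen_lt (by fun_prop) continuous_const
  have h1 : IsOpen {ξ : Plane | |ξ 1| < r} := isOpen_lt (by fun_prop) continuous_const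
  exact h0.inter h1

lemma rectangle_subset_ball {r ρ : ℝ} (hr : 0 < r) (h : 3 * r ≤ ρ) :
    rectangle r ⊆ ball 0 ρ := by
  rintro ξ ⟨h0, h1⟩
  rw [mem_ball_zero_iff]
  refine lt_of_lt_of_le (lt_of_pow_lt_pow_left₀ 2 (by positivity) ?_) h
  rw [LocalPicture.norm_sq_plane, ← sq_abs (ξ 0), ← sq_abs (ξ 1)]
  nlinarith [abs_nonneg (ξ 0), abs_nonneg (ξ 1)]

lemma zero_mem_rectangle {r : ℝ} (hr : 0 < r) : 0 ∈ rectangle r := by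
  constructor <;> simp [hr]

namespace LocalPicture

lemma twoWedges {r a τ₀ s : ℝ} {J : Set M}
    (L : ℒ (rectangle r) τ₁) (hr : 0 < r) (ha : 0 < a)
    (hS : ∀ ξ ∈ rectangle r, 2 * a * S (η.symm ξ) = ξ 0 ^ 2 - ξ 1 ^ 2) (hτ₀ : 0 < τ₀)
    (h₁ : τ₀ ≤ τ₁) (h₂ : 2 * a * τ₀ ≤ r ^ 2) (hs : s ∈ Ioc (-τ₀) 0)
    (hJ : ∀ q, q ∈ J ↔ s = 0 ∧ q = p) :
    TwoWedges (ℬ s) (ℋ s)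
      (𝒞 s) J := by
  have hτ₁ : 0 < τ₁ := hτ₀.trans_le h₁
  obtain ⟨κ, hκ⟩ : ∃ κ, κ = -(2 * a * s) := ⟨_, rfl⟩
  have hκ0 : 0 ≤ κ := by rw [hκ]; nlinarith [hs.2]
  have hκr : κ < r ^ 2 := by rw [hκ]; nlinarith [hs.1]
  have hs1 : |s| < τ₁ := by rw [abs_of_nonpos hs.2]; linarith [hs.1]
  have hle ξ (hξ : ξ ∈ rectangle r) : S (η.symm ξ) ≤ s ↔ ξ 0 ^ 2 + κ ≤ ξ 1 ^ 2 := by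
    rw [← mul_le_mul_iff_right₀ (show 0 < 2 * a by positivity), hS ξ hξ, hκ]
    constructor <;> intro h <;> linarith
  have heq ξ (hξ : ξ ∈ rectangle r) : S (η.symm ξ) = s ↔ ξ 0 ^ 2 + κ = ξ 1 ^ 2 := by
    rw [← mul_right_inj' (show 2 * a ≠ 0 by positivity), hS ξ hξ, hκ]
    constructor <;> intro h <;> linarith
  let σ : Fin 2 → ℝ := ![1, -1]
  have hσ : ∀ i, σ i * σ i = 1 := fun i ↦ by fin_cases i <;> simp [σ]
  let X : Fin 2 → Set Plane := fun i ↦ {x | √(x 0 ^ 2 + κ) ≤ σ i * x 1 ∧ σ i * x 1 < r}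
  let K := ℋ s ∪ ℬ s
  have habs : ∀ i (v : ℝ), 0 ≤ σ i * v → |v| = σ i * v := by
    intro i v h
    fin_cases i
    · simp [σ] at h ⊢; exact h
    · simp [σ] at h ⊢; exact h
  have hsq : ∀ i (v : ℝ), (σ i * v) ^ 2 = v ^ 2 := fun i v ↦ by rw [mul_pow, sq, hσ, one_mul]
  have hXD : ∀ i, X i ⊆ rectangle r := by
    rintro i x ⟨h1, h2⟩
    have h3 : |x 0| ≤ √(x 0 ^ 2 + κ) := Real.abs_le_sqrt (by linarith)
    rw [rectangle, mem_ofPred_eq, habs i _ ((Real.sqrt_nonneg _).trans h1)]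
    exact ⟨by linarith, h2⟩
  have hXle i : ∀ ξ ∈ rectangle r, ξ ∈ X i ↔ S (η.symm ξ) ≤ s ∧ 0 ≤ σ i * ξ 1 := by
    intro ξ hξ
    rw [hle ξ hξ]
    constructor
    · rintro ⟨h1, -⟩
      have h3 := (Real.sqrt_nonneg _).trans h1
      refine ⟨?_, h3⟩
      rw [Real.sqrt_le_iff, hsq] at h1
      exact h1.2
    · rintro ⟨h1, h2⟩
      refine ⟨Real.sqrt_le_iff.2 ⟨h2, by rwa [hsq]⟩, ?_⟩
      rw [← habs i _ h2]
      exact hξ.2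
  refine ⟨fun i ↦ {q ∈ K | η (transverse (ψ q)) ∈ X i}, ?_, ?_, fun i ↦ ?_, fun i ↦ ?_⟩
  · refine Subset.antisymm (union_subset (fun q h ↦ h.1) fun q h ↦ h.1) fun q hq ↦ ?_
    obtain ⟨-, -, -, h4, h5⟩ := L.mem_slice_union hq
    rcases le_total 0 (η (transverse (ψ q)) 1) with h | h
    · exact Or.inl ⟨hq, (hXle 0 _ h4).2 ⟨h5, by simpa [σ] using h⟩⟩
    · exact Or.inr ⟨hq, (hXle 1 _ h4).2 ⟨h5, by simpa [σ] using h⟩⟩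
  · ext q
    rw [hJ]
    constructor
    · rintro ⟨⟨h1, h2⟩, -, h3⟩
      obtain ⟨-, -, -, h4, h5⟩ := L.mem_slice_union h1
      have h6 := ((hXle 0 _ h4).1 h2).2
      have h7 := ((hXle 1 _ h4).1 h3).2
      simp only [σ, Matrix.cons_val_zero, Matrix.cons_val_one, one_mul, neg_mul, Left.nonneg_neg_iff] at h6 h7
      have h8 : η (transverse (ψ q)) 1 = 0 := le_antisymm h7 h6
      have h9 := (hle _ h4).1 h5
      rw [h8] at h9
      have h10 : κ = 0 := by nlinarith [sq_nonneg (η (transverse (ψ q)) 0)]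
      have h11 : η (transverse (ψ q)) 0 = 0 := by nlinarith [sq_nonneg (η (transverse (ψ q)) 0)]
      have hs0 : s = 0 := by
        rw [h10] at hκ
        have : 2 * a * s = 0 := by linarith
        simpa [ha.ne'] using this
      refine ⟨hs0, ?_⟩
      change q ∈ ℋ s ∪ ℬ s at h1
      rw [hs0] at h1
      refine L.eq_of_transverse_zero h1 ?_
      ext j; fin_cases j
      · exact h11
      · exact h8
    · rintro ⟨h1, rfl⟩
      have hK : q ∈ K := by
        simp only [K, h1]
        exact Or.inl (L.slice_crease_subset (L.mem_crease hτ₁))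
      have h3 := L.mem_slice_union hK
      refine ⟨⟨hK, (hXle 0 _ h3.2.2.2.1).2 ⟨h3.2.2.2.2, ?_⟩⟩,
        ⟨hK, (hXle 1 _ h3.2.2.2.1).2 ⟨h3.2.2.2.2, ?_⟩⟩⟩ <;> rw [L.transverse_zero hτ₁] <;> simp
  · have hc : Continuous fun q : K ↦ σ i * η (transverse (ψ q)) 1 := by
      rw [continuous_iff_continuousAt]
      intro q
      have h1 := (L.mem_slice_union q.2).1
      have c0 : ContinuousAt (fun q : K ↦ ψ q) q :=
        ContinuousAt.comp (g := ψ) (ψ.continuousAt (L.subset_source h1))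
          continuous_subtype_val.continuousAt
      have c1 : ContinuousAt (fun q : K ↦ transverse (ψ q)) q :=
        ContinuousAt.comp (g := transverse) transverseL.continuous.continuousAt c0
      have c2 : ContinuousAt (fun q : K ↦ η (transverse (ψ q))) q :=
        ContinuousAt.comp (g := η) (η.continuousAt (L.coord q h1).2.1) c1
      have c3 : Continuous fun x : Plane ↦ σ i * x 1 := by fun_prop
      exact ContinuousAt.comp (g := fun x : Plane ↦ σ i * x 1) c3.continuousAt c2
    have : ((↑) ⁻¹' {q ∈ K | η (transverse (ψ q)) ∈ X i} : Set K) =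
        {q : K | 0 ≤ σ i * η (transverse (ψ q)) 1} := by
      ext q
      obtain ⟨-, -, -, h4, h5⟩ := L.mem_slice_union q.2
      exact ⟨fun h ↦ ((hXle i _ h4).1 h.2).2, fun h ↦ ⟨q.2, (hXle i _ h4).2 ⟨h5, h⟩⟩⟩
    change IsClosed ((↑) ⁻¹' {q ∈ K | η (transverse (ψ q)) ∈ X i} : Set K)
    rw [this]
    exact isClosed_le continuous_const hc
  · obtain ⟨e, he⟩ := exists_wedge_homeo hκ0 hr hκr (hσ i)
    refine (L.tripleHomeo_piece hs1 (hXD i) (fun ξ hξ ↦ ((hXle i ξ (hXD i hξ)).1 hξ).1) e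
      (by fun_prop) (fun _ hy ↦ hy) fun x ↦ ?_).trans tripleHomeo_wedge
    have h3 := (Real.sqrt_nonneg _).trans x.2.1
    have h4 : (x : Plane) 0 ^ 2 + κ = (x : Plane) 1 ^ 2 ↔ (e x : ℝ × ℝ).2 = 0 := by
      rw [he x, eq_comm, ← hsq i, ← pow_left_inj₀ h3 (Real.sqrt_nonneg _) two_ne_zero,
        Real.sq_sqrt (by positivity)]
    rw [heq x (hXD i x.2), h4]

lemma bridgeMerger {r a τ₀ : ℝ}
    (L : ℒ (rectangle r) τ₁) (hr : 0 < r) (ha : 0 < a)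
    (hS : ∀ ξ ∈ rectangle r, 2 * a * S (η.symm ξ) = ξ 0 ^ 2 - ξ 1 ^ 2) (hτ₀ : 0 < τ₀)
    (h₁ : τ₀ ≤ τ₁) (h₂ : 2 * a * τ₀ ≤ r ^ 2) :
    BridgeMerger τ₀ ℬ ℋ
      𝒞 p := by
  refine ⟨fun s hs ↦ ?_, ⟨?_, L.mem_crease (hτ₀.trans_le h₁)⟩, fun s hs ↦ ?_⟩
  · refine L.twoWedges hr ha hS hτ₀ h₁ h₂ ⟨hs.1, hs.2.le⟩ fun q ↦ ?_
    exact ⟨fun h ↦ h.elim, fun h ↦ absurd h.1 hs.2.ne⟩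
  · exact L.twoWedges hr ha hS hτ₀ h₁ h₂ ⟨by linarith, le_rfl⟩ fun q ↦ by simp
  · have hs1 : |s| < τ₁ := by rw [abs_of_pos hs.1]; linarith [hs.2]
    obtain ⟨κ, hκ⟩ : ∃ κ, κ = 2 * a * s := ⟨_, rfl⟩
    have hκ0 : 0 < κ := by rw [hκ]; have := hs.1; positivity
    have hκr : κ < r ^ 2 := by rw [hκ]; nlinarith [hs.2]
    have hle ξ (hξ : ξ ∈ rectangle r) : S (η.symm ξ) ≤ s ↔ ξ 0 ^ 2 ≤ ξ 1 ^ 2 + κ := by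
      rw [← mul_le_mul_iff_right₀ (show 0 < 2 * a by positivity), hS ξ hξ, hκ]
      constructor <;> intro h <;> linarith
    have heq ξ (hξ : ξ ∈ rectangle r) : S (η.symm ξ) = s ↔ ξ 0 ^ 2 = ξ 1 ^ 2 + κ := by
      rw [← mul_right_inj' (show 2 * a ≠ 0 by positivity), hS ξ hξ, hκ]
      constructor <;> intro h <;> linarith
    have hX (ξ : Plane) : |ξ 0| ≤ √(ξ 1 ^ 2 + κ) → |ξ 1| < r → ξ ∈ rectangle r := by
      intro h1 h2
      refine ⟨?_, h2⟩
      rw [Real.le_sqrt (abs_nonneg _) (by positivity)] at h1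
      have : |ξ 1| ^ 2 < r ^ 2 := pow_lt_pow_left₀ h2 (abs_nonneg _) two_ne_zero
      rw [sq_abs (ξ 1)] at this
      nlinarith [abs_nonneg (ξ 0)]
    obtain ⟨e, he⟩ := exists_strip_homeo hκ0 hr
    let E : (ℝ × ℝ) × ℝ ≃ₜ Plane × ℝ :=
      { toFun := fun u ↦ (!₂[u.1.1, u.2], u.1.2)
        invFun := fun y ↦ ((y.1 0, y.2), y.1 1)
        left_inv := fun u ↦ rfl
        right_inv := fun y ↦ Prod.ext (by ext i; fin_cases i <;> rfl) rfl
        continuous_toFun := by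
          refine Continuous.prodMk ((PiLp.continuous_toLp 2 (fun _ : Fin 2 ↦ ℝ)).comp
            (continuous_pi fun i ↦ ?_)) (by fun_prop)
          fin_cases i
          · exact continuous_fst.comp continuous_fst
          · exact continuous_snd
        continuous_invFun := by fun_prop }
    have hn : ∀ y t, ‖(E (y, t)).1‖ ^ 2 = y.1 ^ 2 + t ^ 2 := fun _ _ ↦ norm_sq_plane _
    have hn1 : ∀ y t, ‖(E (y, t)).1‖ = 1 ↔ y.1 ^ 2 + t ^ 2 = 1 := fun y t ↦ by
      rw [← hn, pow_eq_one_iff_of_nonneg (norm_nonneg _) two_ne_zero]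
    refine (L.tripleHomeo_slice hs1 (fun ξ ↦ ?_) e (g := fun y ↦ √(1 - y.1 ^ 2)) (by fun_prop)
      (fun _ _ ↦ Real.sqrt_nonneg _) fun x ↦ ?_).trans (tripleHomeo_symm_lens E
        (fun _ _ ↦ Real.sqrt_nonneg _) (fun y t ↦ ?_) (fun y hy t _ ↦ ?_) fun y hy t h ↦ ?_)
    · change |ξ 0| ≤ √(ξ 1 ^ 2 + κ) ∧ |ξ 1| < r ↔ _
      constructor
      · rintro ⟨h1, h2⟩
        refine ⟨hX ξ h1 h2, (hle ξ (hX ξ h1 h2)).2 ?_⟩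
        rw [Real.le_sqrt (abs_nonneg _) (by positivity), sq_abs] at h1
        exact h1
      · rintro ⟨h3, h4⟩
        exact ⟨Real.abs_le_sqrt ((hle ξ h3).1 h4), h3.2⟩
    · rw [heq x (hX x x.2.1 x.2.2),
        ((sqrt_one_sub_facts (t := 0)).2 ((sq_le_one_iff_abs_le_one _).2 (e x).2)).2, ← sq_abs (e x : ℝ × ℝ).1,
        pow_eq_one_iff_of_nonneg (abs_nonneg _) two_ne_zero, he x,
        ← pow_left_inj₀ (abs_nonneg _) (Real.sqrt_nonneg _) two_ne_zero, sq_abs,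
        Real.sq_sqrt (by positivity)]
    · change |y.1| ≤ 1 ∧ _ ↔ ‖(E (y, t)).1‖ ≤ 1
      rw [← sq_le_one_iff₀ (norm_nonneg _), hn, ← sq_le_one_iff_abs_le_one, sqrt_one_sub_facts.1]
    · change _ ↔ ‖(E (y, t)).1‖ = 1
      rw [hn1, (sqrt_one_sub_facts.2 ((sq_le_one_iff_abs_le_one _).2 hy)).1]
    · change _ ↔ ‖(E (y, t)).1‖ = 1 ∧ t = 0
      rw [hn1, ((sqrt_one_sub_facts (t := t)).2 ((sq_le_one_iff_abs_le_one _).2 hy)).2]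
      refine ⟨fun h0 ↦ ?_, fun ⟨h1, h2⟩ ↦ by simpa [h2] using h1⟩
      rw [h0, sub_self, Real.sqrt_zero, abs_nonpos_iff] at h
      simp [h, h0]

end LocalPicture

/-! ### Bounds for families of bilinear forms -/

lemma eventually_norm_sub_lt {P V : Type*} [TopologicalSpace P] [NormedAddCommGroup V] {B : P → V}
    {x : P} (hB : ContinuousAt B x) {c : ℝ} (hc : 0 < c) :
    ∀ᶠ y in 𝓝 x, ‖B y - B x‖ < c ∧ ‖B y‖ < ‖B x‖ + c := by
  filter_upwards [Metric.continuousAt_iff'.1 hB c hc] with y hy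
  rw [dist_eq_norm] at hy
  refine ⟨hy, ?_⟩
  linarith [norm_sub_norm_le (B y) (B x)]

lemma eventually_bilin_bounds {P E : Type*} [TopologicalSpace P] [NormedAddCommGroup E]
    [NormedSpace ℝ E] {B : P → E →L[ℝ] E →L[ℝ] ℝ} {x : P} (hB : ContinuousAt B x) {c : ℝ}
    (hc : 0 < c) (h : ∀ v, c * ‖v‖ ^ 2 ≤ B x v v) :
    ∃ C > 0, ∀ᶠ y in 𝓝 x, ‖B y‖ ≤ C ∧ ∀ v, c / 2 * ‖v‖ ^ 2 ≤ B y v v ∧ B y v v ≤ C * ‖v‖ ^ 2 := by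
  refine ⟨‖B x‖ + c / 2, by positivity, ?_⟩
  have hB' := eventually_norm_sub_lt (V := E →L[ℝ] E →L[ℝ] ℝ) (B := B) hB (half_pos hc)
  filter_upwards [hB'] with y hy'
  obtain ⟨hy, hy'⟩ := hy'
  have key v : |B y v v - B x v v| ≤ c / 2 * ‖v‖ ^ 2 := by
    have h1 := (B y - B x).le_opNorm₂ v v
    rw [sub_apply, sub_apply, Real.norm_eq_abs] at h1
    nlinarith [mul_le_mul_of_nonneg_right hy.le (sq_nonneg ‖v‖)]
  refine ⟨hy'.le, fun v ↦ ?_⟩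
  · have h1 := abs_le.1 (key v)
    have h2 := (B x).le_opNorm₂ v v
    have h3 := (le_abs_self _).trans h2
    constructor
    · linarith [h v]
    · nlinarith

lemma exists_isBigO_bound {E F : Type*} [NormedAddCommGroup E] [NormedSpace ℝ E]
    [NormedAddCommGroup F] {u : E → F} {n : ℕ} (h : u =O[𝓝 0] fun x ↦ ‖x‖ ^ n) :
    ∃ C > 0, ∀ᶠ x in 𝓝 0, ‖u x‖ ≤ C * ‖x‖ ^ n := by
  obtain ⟨C, hC, hb⟩ := h.exists_pos
  refine ⟨C, hC, hb.bound.mono fun x hx ↦ ?_⟩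
  simpa using hx

/-! ### The crease in adapted coordinates -/

/-- The point of the crease with transverse coordinates `η.symm ξ`. -/
def creaseMap (F : Fin 2 → Space → ℝ) (ζ : Plane → ℝ) (η : OpenPartialHomeomorph Plane Plane)
    (ξ : Plane) : E4 :=
  pt (F 0 (spt (η.symm ξ) (ζ (η.symm ξ)))) (spt (η.symm ξ) (ζ (η.symm ξ)))

section

variable {f : Fin 2 → E4 → ℝ}

lemma transverse_creaseMap (ξ : Plane) : transverse (creaseMap F ζ η ξ) = η.symm ξ := by
  simp [creaseMap]

namespace IsMorseChart

lemma symm_zero (hη : IsMorseChart a S e ε₀ ε₁ η) : η.symm 0 = 0 := by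
  have := η.left_inv hη.zero_mem
  rwa [hη.map_zero] at this

lemma zero_mem_target (hη : IsMorseChart a S e ε₀ ε₁ η) : 0 ∈ η.target := by
  have := η.map_source hη.zero_mem
  rwa [hη.map_zero] at this

lemma smoothNear_symm (hη : IsMorseChart a S e ε₀ ε₁ η) : SmoothNear η.symm 0 := by
  filter_upwards [η.open_target.mem_nhds hη.zero_mem_target] with y hy
  exact hη.smooth_symm.contDiffAt (η.open_target.mem_nhds hy)

lemma hasFDerivAt_symm (hη : IsMorseChart a S e ε₀ ε₁ η) :
    HasFDerivAt η.symm (e.symm : Plane →L[ℝ] Plane) 0 := by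
  have h := hη.hasFDerivAt
  refine η.hasFDerivAt_symm hη.zero_mem_target ?_
  rwa [hη.symm_zero]

lemma tendsto_symm (hη : IsMorseChart a S e ε₀ ε₁ η) : Tendsto η.symm (𝓝 0) (𝓝 0) := by
  have := hη.smoothNear_symm.continuousAt.tendsto
  rwa [hη.symm_zero] at this

lemma isBigO_symm (hη : IsMorseChart a S e ε₀ ε₁ η) : η.symm =O[𝓝 0] fun ξ ↦ ‖ξ‖ := by
  have := hη.smoothNear_symm.differentiableAt.isBigO_sub
  simp only [hη.symm_zero, sub_zero] at this
  exact this.norm_right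

/-- Both `η` and its inverse are Lipschitz near the origin. -/
lemma exists_lipschitz (hη : IsMorseChart a S e ε₀ ε₁ η) :
    ∃ K > 0, ∃ δ > 0, ∀ ξ ∈ disc δ, ∀ ξ' ∈ disc δ,
      ‖ξ - ξ'‖ ≤ K * ‖η.symm ξ - η.symm ξ'‖ := by
  have h1 : ContDiffAt ℝ 1 η 0 :=
    ((hη.smooth.contDiffAt (η.open_source.mem_nhds hη.zero_mem)).of_le (by norm_cast))
  obtain ⟨K, t, ht, hK⟩ := h1.exists_lipschitzOnWith
  have h2 := hη.tendsto_symm.eventually ht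
  obtain ⟨δ, hδ, hb⟩ := eventually_nhds_iff_ball.1
    (h2.and (η.open_target.mem_nhds hη.zero_mem_target))
  refine ⟨K + 1, by positivity, δ, hδ, fun ξ hξ ξ' hξ' ↦ ?_⟩
  have h3 := hK.dist_le_mul _ (hb ξ hξ).1 _ (hb ξ' hξ').1
  rw [η.right_inv (hb ξ hξ).2, η.right_inv (hb ξ' hξ').2, dist_eq_norm, dist_eq_norm] at h3
  nlinarith [norm_nonneg (η.symm ξ - η.symm ξ')]

/-- A map of the plane into spacetime with transverse coordinates `η.symm ξ` is an immersion. -/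
lemma exists_norm_le_mul_fderiv (hη : IsMorseChart a S e ε₀ ε₁ η) :
    ∃ c > 0, ∀ᶠ ξ in 𝓝 0, ∀ u : Plane → E4, (∀ ξ, transverse (u ξ) = η.symm ξ) →
      DifferentiableAt ℝ u ξ → ∀ w, c * ‖w‖ ≤ ‖fderiv ℝ u ξ w‖ := by
  obtain ⟨c, hc, h0⟩ : ∃ c > 0, ∀ w, c * ‖w‖ ≤ ‖fderiv ℝ η.symm 0 w‖ := by
    refine ⟨(‖(e : Plane →L[ℝ] Plane)‖ + 1)⁻¹, by positivity, fun w ↦ ?_⟩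
    rw [inv_mul_le_iff₀ (by positivity), hη.hasFDerivAt_symm.fderiv]
    have h1 := (e : Plane →L[ℝ] Plane).le_opNorm (e.symm w)
    rw [ContinuousLinearEquiv.coe_coe, e.apply_symm_apply] at h1
    exact h1.trans (mul_le_mul_of_nonneg_right (by linarith) (norm_nonneg _))
  refine ⟨c / 2, by positivity, ?_⟩
  filter_upwards [eventually_norm_sub_lt hη.smoothNear_symm.fderiv.continuousAt
    (half_pos hc)] with ξ hξ u hu hud w
  have h1 := (fderiv ℝ η.symm ξ - fderiv ℝ η.symm 0).le_opNorm w
  rw [sub_apply] at h1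
  have h2 := h1.trans (mul_le_mul_of_nonneg_right hξ.1.le (norm_nonneg w))
  have h3 := norm_sub_norm_le (fderiv ℝ η.symm 0 w) (fderiv ℝ η.symm ξ w)
  rw [norm_sub_rev] at h3
  have h4 : HasFDerivAt η.symm (transverseL ∘L fderiv ℝ u ξ) ξ := by
    have := transverseL.hasFDerivAt.comp ξ hud.hasFDerivAt
    have h5 : transverseL ∘ u = η.symm := funext hu
    rwa [h5] at this
  have h5 : ‖fderiv ℝ η.symm ξ w‖ ≤ ‖fderiv ℝ u ξ w‖ := by
    rw [h4.fderiv]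
    exact norm_transverse_le _
  linarith [h0 w]

end IsMorseChart

namespace NormalModel

lemma smoothNear_creaseMap (N : NormalModel G h f F T Z ζ S)
    (hη : IsMorseChart a S e ε₀ ε₁ η) : SmoothNear (creaseMap F ζ η) 0 :=
  SmoothNear.comp (g := fun x ↦ pt (F 0 (spt x (ζ x))) (spt x (ζ x)))
    (by rw [hη.symm_zero]; exact N.crease.smoothNear_pt (N.pair.graph 0).smooth) hη.smoothNear_symm

lemma creaseMap_zero (N : NormalModel G h f F T Z ζ S) (hη : IsMorseChart a S e ε₀ ε₁ η) :
    creaseMap F ζ η 0 = 0 := by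
  simp [creaseMap, hη.symm_zero, N.crease.ζ_zero, (N.pair.graph 0).zero]

lemma tendsto_creaseMap (N : NormalModel G h f F T Z ζ S) (hη : IsMorseChart a S e ε₀ ε₁ η) :
    Tendsto (creaseMap F ζ η) (𝓝 0) (𝓝 0) := by
  have := (N.smoothNear_creaseMap hη).continuousAt.tendsto
  rwa [N.creaseMap_zero hη] at this

lemma eventually_creaseMap (N : NormalModel G h f F T Z ζ S) (hη : IsMorseChart a S e ε₀ ε₁ η) :
    ∀ᶠ ξ in 𝓝 0, (∀ A, f A (creaseMap F ζ η ξ) = 0) ∧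
      2 * a * h (creaseMap F ζ η ξ) = ε₀ * ξ 0 ^ 2 + ε₁ * ξ 1 ^ 2 := by
  have ht : Tendsto (fun ξ ↦ spt (η.symm ξ) (ζ (η.symm ξ))) (𝓝 0) (𝓝 0) := by
    have := N.crease.smoothNear_spt.continuousAt.tendsto
    simp only [N.crease.ζ_zero, spt_zero_zero] at this
    exact this.comp hη.tendsto_symm
  filter_upwards [ht.eventually (N.pair.graph 0).apply_graph,
    ht.eventually (N.pair.graph 1).apply_graph, hη.tendsto_symm.eventually N.crease.ζ_apply,
    η.open_target.mem_nhds hη.zero_mem_target] with ξ h0 h1 h2 h3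
  constructor
  · rw [Fin.forall_fin_two]
    refine ⟨h0, ?_⟩
    rw [creaseMap, h2]
    exact h1
  · have := hη.eq _ (η.map_target h3)
    rwa [η.right_inv h3, N.crease.S_eq] at this

end NormalModel

/-! ### The angle between the sheets -/

/-- A multiple of the normal, within the level set of `h`, of the null hypersurface `k = 0`. -/
def sheetNormal (G : E4 → Form) (h k : E4 → ℝ) (X : E4) : E4 :=
  grad G h X - (fderiv ℝ h X (grad G h X) * (fderiv ℝ h X (grad G k X))⁻¹) • grad G k X

namespace NormalModel

lemma fderiv_grad_zero (N : NormalModel G h f F T Z ζ S) {k : E4 → ℝ} :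
    fderiv ℝ h 0 (grad G k 0) = - (fderiv ℝ h 0 (e4 0) * fderiv ℝ k 0 (e4 0)) ∧
      ∀ w, minkowski (grad G k 0) w = fderiv ℝ k 0 w := by
  have h1 w : minkowski (grad G k 0) w = fderiv ℝ k 0 w := by
    rw [← N.model.G_zero]
    exact DFunLike.congr_fun (N.model.eventually_inverse_apply.self_of_nhds (fderiv ℝ k 0)) w
  refine ⟨?_, h1⟩
  rw [N.model.fderiv_h_zero, ← h1]
  simp [minkowski, e4]

lemma sheetNormal_zero (N : NormalModel G h f F T Z ζ S) :
    sheetNormal G h (f 0) 0 + sheetNormal G h (f 1) 0 = 0 := by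
  obtain ⟨κ, hκ, hf⟩ := N.pair.fderiv_f_zero
  obtain ⟨κ', hκ', hf'⟩ := N.pair.fderiv_f_one
  have hh := N.model.h_future
  refine minkowski_nondegenerate fun w ↦ ?_
  rw [← N.model.G_zero]
  simp only [sheetNormal, map_add, map_sub, map_smul, add_apply,
    sub_apply, smul_apply, smul_eq_mul]
  simp only [N.model.G_zero, N.fderiv_grad_zero.2, N.fderiv_grad_zero.1, hf, hf']
  rw [N.model.fderiv_h_zero w]
  have e0 : (e4 0) 0 = 1 := by simp [e4]
  have e3 : (e4 0) 3 = 0 := by simp [e4]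
  rw [e0, e3]
  field_simp
  ring

lemma smoothNear_sheetNormal (N : NormalModel G h f F T Z ζ S) (A : Fin 2) :
    SmoothNear (sheetNormal G h (f A)) 0 := by
  have hh := N.model.smoothNear_grad N.model.h_smooth
  have hf := N.model.smoothNear_grad (N.model.f_smooth A)
  have h0 : fderiv ℝ h 0 (grad G (f A) 0) ≠ 0 :=
    (N.eventually_isGoodPoint.self_of_nhds.grad_future A (N.model.f_zero A)).ne'
  have hd := N.model.h_smooth.fderiv
  have h1 : SmoothNear (fun X ↦ (fderiv ℝ h X (grad G h X) * (fderiv ℝ h X (grad G (f A) X))⁻¹)) 0 :=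
    (hd.clm_apply hh).smul ((hd.clm_apply hf).inv h0)
  exact hh.sub (h1.smul hf)

end NormalModel

lemma angle_bounds {g P : ℝ} (hP : 0 ≤ P) (hg : 2 + 2 * g = P ^ 2) (hg1 : g ≤ 1) :
    ∃ Ω ∈ Icc 0 Real.pi, Real.cos (Real.pi - Ω) = g ∧ P ≤ Ω ∧ Ω ≤ 2 * P := by
  have hg0 : -1 ≤ g := by nlinarith
  refine ⟨Real.arccos (-g), ⟨Real.arccos_nonneg _, Real.arccos_le_pi _⟩, ?_, ?_⟩
  · rw [Real.cos_pi_sub, Real.cos_arccos (by linarith) (by linarith), neg_neg]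
  · have h0 := Real.arccos_nonneg (-g)
    have hpi := Real.arccos_le_pi (-g)
    have hcos := Real.cos_arccos (x := -g) (by linarith) (by linarith)
    set Ω := Real.arccos (-g)
    have h1 : P ^ 2 = (2 * Real.sin (Ω / 2)) ^ 2 := by
      rw [mul_pow, Real.sin_sq_eq_half_sub, mul_div_cancel₀ _ two_ne_zero, hcos]
      linarith
    have h2 : 0 ≤ Real.sin (Ω / 2) := Real.sin_nonneg_of_nonneg_of_le_pi (by linarith) (by linarith)
    have h3 : P = 2 * Real.sin (Ω / 2) := (pow_left_inj₀ hP (by positivity) two_ne_zero).1 h1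
    have h4 := Real.mul_le_sin (show 0 ≤ Ω / 2 by linarith) (by linarith)
    have h5 := Real.sin_le (show 0 ≤ Ω / 2 by linarith)
    refine ⟨by linarith, ?_⟩
    rw [h3]
    have h6 : 1 / 2 ≤ 2 / Real.pi := by
      rw [div_le_div_iff₀ (by norm_num) Real.pi_pos]; linarith [Real.pi_le_four]
    nlinarith

/-- The angle at which the two sheets meet at a point `X` of the crease. -/
lemma IsGoodPoint.exists_angle {X : E4} (g : IsGoodPoint G h f F X) (hf : ∀ A, f A X = 0)
    (hgrad : ∀ v, G X (grad G h X) v = fderiv ℝ h X v) (hneg : fderiv ℝ h X (grad G h X) < 0) :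
    (fderiv ℝ h X (sheetNormal G h (f 0) X + sheetNormal G h (f 1) X) = 0) ∧
    (∀ v, fderiv ℝ (f 0) X v = 0 → fderiv ℝ (f 1) X v = 0 →
      G X (sheetNormal G h (f 0) X + sheetNormal G h (f 1) X) v = 2 * fderiv ℝ h X v) ∧
    ∃ n : Fin 2 → E4, (∀ A, fderiv ℝ h X (n A) = 0 ∧ G X (n A) (n A) = 1 ∧
        0 < fderiv ℝ (f A) X (n A) ∧
        ∀ w, fderiv ℝ h X w = 0 → fderiv ℝ (f A) X w = 0 → G X (n A) w = 0) ∧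
      ∀ P, 0 ≤ P → -fderiv ℝ h X (grad G h X) * P ^ 2 =
        G X (sheetNormal G h (f 0) X + sheetNormal G h (f 1) X)
          (sheetNormal G h (f 0) X + sheetNormal G h (f 1) X) →
        ∃ Ω ∈ Icc 0 Real.pi, Real.cos (Real.pi - Ω) = G X (n 0) (n 1) ∧ P ≤ Ω ∧ Ω ≤ 2 * P := by
  have hl : ∀ A, fderiv ℝ h X (grad G (f A) X) ≠ 0 := fun A ↦ (g.grad_future A (hf A)).ne'
  obtain ⟨ν, hν, hν2⟩ : ∃ ν, 0 < ν ∧ ν ^ 2 = -fderiv ℝ h X (grad G h X) :=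
    ⟨√(-fderiv ℝ h X (grad G h X)), Real.sqrt_pos.2 (by linarith), Real.sq_sqrt (by linarith)⟩
  have hd A : fderiv ℝ h X (sheetNormal G h (f A) X) = 0 := by
    have := hl A
    simp only [sheetNormal, map_sub, map_smul, smul_eq_mul]
    field_simp
    ring
  have hG A v : G X (sheetNormal G h (f A) X) v = fderiv ℝ h X v -
      fderiv ℝ h X (grad G h X) * (fderiv ℝ h X (grad G (f A) X))⁻¹ * fderiv ℝ (f A) X v := by
    simp only [sheetNormal, map_sub, map_smul, sub_apply,
      smul_apply, smul_eq_mul, hgrad, g.grad_apply]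
  have hfn A : fderiv ℝ (f A) X (sheetNormal G h (f A) X) = fderiv ℝ h X (grad G (f A) X) := by
    rw [← g.grad_apply, g.symm, hG, ← g.grad_apply, g.grad_null A (hf A)]
    ring
  have hnn A : G X (sheetNormal G h (f A) X) (sheetNormal G h (f A) X) = ν ^ 2 := by
    have := hl A
    rw [hG, hd, hfn, hν2]
    field_simp
    ring
  refine ⟨by rw [map_add, hd, hd, add_zero], fun v h0 h1 ↦ ?_,
    fun A ↦ ν⁻¹ • sheetNormal G h (f A) X, fun A ↦ ⟨?_, ?_, ?_, fun w hw hw' ↦ ?_⟩, fun P hP hP2 ↦ ?_⟩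
  · rw [map_add, add_apply, hG, hG, h0, h1]
    ring
  · rw [map_smul, hd, smul_zero]
  · simp only [map_smul, smul_apply, smul_eq_mul, hnn]
    field_simp
  · rw [map_smul, hfn, smul_eq_mul]
    exact mul_pos (inv_pos.2 hν) (g.grad_future A (hf A))
  · rw [map_smul, smul_apply, hG, hw, hw']
    simp
  · have hcross : G X (sheetNormal G h (f 0) X) (sheetNormal G h (f 1) X) =
        ν ^ 2 * G X (ν⁻¹ • sheetNormal G h (f 0) X) (ν⁻¹ • sheetNormal G h (f 1) X) := by
      simp only [map_smul, smul_apply, smul_eq_mul]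
      field_simp
    refine angle_bounds hP ?_ ?_
    · rw [← hν2] at hP2
      simp only [map_add, add_apply, hnn] at hP2
      rw [g.symm (sheetNormal G h (f 1) X) (sheetNormal G h (f 0) X), hcross] at hP2
      have : ν ^ 2 ≠ 0 := by positivity
      apply mul_left_cancel₀ this
      rw [hP2]; ring
    · have h0 : 0 ≤ G X (sheetNormal G h (f 0) X - sheetNormal G h (f 1) X)
          (sheetNormal G h (f 0) X - sheetNormal G h (f 1) X) := by
        by_cases hz : sheetNormal G h (f 0) X - sheetNormal G h (f 1) X = 0
        · rw [hz]; simp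
        · exact (g.spacelike _ (by rw [map_sub, hd, hd, sub_zero]) hz).le
      simp only [map_sub, sub_apply, hnn] at h0
      rw [g.symm (sheetNormal G h (f 1) X) (sheetNormal G h (f 0) X), hcross] at h0
      by_contra! hlt
      nlinarith [mul_lt_mul_of_pos_left hlt (show 0 < ν ^ 2 by positivity)]

end

section

variable {f : Fin 2 → E4 → ℝ}

namespace NormalModel

/-- The metric is uniformly positive definite on the tangent spaces of the slices. -/
lemma eventually_spacelike_bounds (N : NormalModel G h f F T Z ζ S) :
    ∃ C > 0, ∀ᶠ X in 𝓝 0, ∀ v, fderiv ℝ h X v = 0 →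
      1 / 2 * ‖v‖ ^ 2 ≤ G X v v ∧ G X v v ≤ C * ‖v‖ ^ 2 := by
  have hh := N.model.h_future
  set b := fderiv ℝ h 0 (e4 0) with hb
  let B : E4 → Form := fun X ↦
    G X + (2 / b ^ 2) • (fderiv ℝ h X).smulRight (fderiv ℝ h X)
  have hB X v : B X v v = G X v v + 2 / b ^ 2 * (fderiv ℝ h X v) ^ 2 := by
    simp only [B, add_apply, smul_apply, ContinuousLinearMap.smulRight_apply, smul_eq_mul]
    ring
  have hd := N.model.h_smooth.fderiv
  have hc : ContinuousAt B 0 := by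
    have h1 : SmoothNear (fun X ↦ (fderiv ℝ h X).smulRight (fderiv ℝ h X)) 0 := by
      filter_upwards [hd] with X hX
      exact hX.smulRight hX
    have h2 : SmoothNear (fun X ↦ (2 / b ^ 2) • (fderiv ℝ h X).smulRight (fderiv ℝ h X)) 0 :=
      SmoothNear.smul (.of_contDiff contDiff_const) h1
    exact (N.model.G_smooth.add h2).continuousAt
  have h0 v : 1 * ‖v‖ ^ 2 ≤ B 0 v v := by
    rw [hB, N.model.G_zero, N.model.fderiv_h_zero, ← hb, EuclideanSpace.norm_sq_eq, minkowski]
    simp only [Fin.sum_univ_four, Real.norm_eq_abs, sq_abs]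
    field_simp
    linarith
  obtain ⟨C, hC, hev⟩ := eventually_bilin_bounds hc one_pos h0
  refine ⟨C, hC, hev.mono fun X hX v hv ↦ ?_⟩
  have := hX.2 v
  rw [hB, hv] at this
  simpa using this

lemma eventually_fderiv_grad (N : NormalModel G h f F T Z ζ S) :
    ∃ b > 0, ∀ᶠ X in 𝓝 0, -(2 * b) < fderiv ℝ h X (grad G h X) ∧
      fderiv ℝ h X (grad G h X) < -(b / 2) := by
  have hh := N.model.h_future
  refine ⟨_, mul_pos hh hh, ?_⟩
  have hc : ContinuousAt (fun X ↦ fderiv ℝ h X (grad G h X)) 0 :=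
    (N.model.h_smooth.fderiv.clm_apply (N.model.smoothNear_grad N.model.h_smooth)).continuousAt
  have ht := hc.tendsto
  rw [N.fderiv_grad_zero.1] at ht
  have hb := mul_pos hh hh
  exact (ht.eventually_const_lt (by linarith)).and (ht.eventually_lt_const (by linarith))

lemma eventually_fderiv_grad_neg (N : NormalModel G h f F T Z ζ S) :
    ∀ᶠ X in 𝓝 0, fderiv ℝ h X (grad G h X) < 0 := by
  obtain ⟨b, hb, hev⟩ := N.eventually_fderiv_grad
  exact hev.mono fun X hX ↦ hX.2.trans (by linarith)

lemma eventually_fderiv_creaseMap (N : NormalModel G h f F T Z ζ S)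
    (hη : IsMorseChart a S e ε₀ ε₁ η) : ∀ᶠ ξ in 𝓝 0, ∀ w,
      (∀ A, fderiv ℝ (f A) (creaseMap F ζ η ξ) (fderiv ℝ (creaseMap F ζ η) ξ w) = 0) ∧
      a * fderiv ℝ h (creaseMap F ζ η ξ) (fderiv ℝ (creaseMap F ζ η) ξ w) =
        ε₀ * ξ 0 * w 0 + ε₁ * ξ 1 * w 1 := by
  have tY := N.tendsto_creaseMap hη
  filter_upwards [N.smoothNear_creaseMap hη, (N.eventually_creaseMap hη).eventually_nhds,
    tY.eventually N.model.h_smooth, tY.eventually N.eventually_isGoodPoint] with ξ hYs hev hhs good w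
  have hYd : DifferentiableAt ℝ (creaseMap F ζ η) ξ := hYs.differentiableAt (by simp)
  constructor
  · intro A
    have h1 : fderiv ℝ (fun ξ ↦ f A (creaseMap F ζ η ξ)) ξ = 0 := by
      have : (fun ξ ↦ f A (creaseMap F ζ η ξ)) =ᶠ[𝓝 ξ] fun _ ↦ 0 := hev.mono fun ξ h ↦ h.1 A
      rw [this.fderiv_eq]; simp
    have h2 := fderiv_fun_comp (g := f A) ξ (good.differentiableAt_f A) hYd
    rw [h1] at h2
    exact (DFunLike.congr_fun h2 w).symm
  · have h2 := fderiv_fun_comp (g := h) ξ (hhs.differentiableAt (by simp)) hYd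
    have hp : ∀ i : Fin 2, HasFDerivAt (fun ξ : Plane ↦ ξ i)
        (EuclideanSpace.proj i : Plane →L[ℝ] ℝ) ξ := fun i ↦
      (EuclideanSpace.proj i : Plane →L[ℝ] ℝ).hasFDerivAt
    have hq : ∀ (c : ℝ) (i : Fin 2), HasFDerivAt (fun ξ : Plane ↦ c * (ξ i * ξ i))
        (c • (ξ i • (EuclideanSpace.proj i : Plane →L[ℝ] ℝ) +
          ξ i • (EuclideanSpace.proj i : Plane →L[ℝ] ℝ))) ξ := fun c i ↦
      ((hp i).fun_mul (hp i)).const_mul c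
    have h3 := HasFDerivAt.fun_add (𝕜 := ℝ) (hq ε₀ 0) (hq ε₁ 1)
    have h4 : (fun ξ ↦ 2 * a * h (creaseMap F ζ η ξ)) =ᶠ[𝓝 ξ]
        fun ξ : Plane ↦ ε₀ * (ξ 0 * ξ 0) + ε₁ * (ξ 1 * ξ 1) :=
      hev.mono fun ξ h ↦ h.2.trans (by ring)
    have h5 := h4.fderiv_eq (𝕜 := ℝ)
    have hd : DifferentiableAt ℝ (fun ξ ↦ h (creaseMap F ζ η ξ)) ξ :=
      DifferentiableAt.comp ξ (g := h) (hhs.differentiableAt (by simp)) hYd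
    rw [fderiv_const_mul hd, h2] at h5
    have h6 := DFunLike.congr_fun (h5.trans h3.fderiv) w
    change 2 * a * fderiv ℝ h (creaseMap F ζ η ξ) (fderiv ℝ (creaseMap F ζ η) ξ w) =
      ε₀ * (ξ 0 * w 0 + ξ 0 * w 0) + ε₁ * (ξ 1 * w 1 + ξ 1 * w 1) at h6
    linarith

/-- Along the crease the sum of the normals of the sheets is comparable to the distance from the
origin. -/
lemma eventually_norm_sheetNormal (N : NormalModel G h f F T Z ζ S)
    (hη : IsMorseChart a S e ε₀ ε₁ η) (ha : 0 < a) (h₀ : ε₀ ^ 2 = 1) (h₁ : ε₁ ^ 2 = 1) :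
    ∃ c > 0, ∃ C > 0, ∀ᶠ ξ in 𝓝 0, OfOrder c C ‖ξ‖
      ‖sheetNormal G h (f 0) (creaseMap F ζ η ξ) + sheetNormal G h (f 1) (creaseMap F ζ η ξ)‖ := by
  have tY := N.tendsto_creaseMap hη
  have sY := N.smoothNear_creaseMap hη
  have Y0 := N.creaseMap_zero hη
  let Mv : E4 → E4 := fun X ↦ sheetNormal G h (f 0) X + sheetNormal G h (f 1) X
  have hM : SmoothNear (fun ξ ↦ Mv (creaseMap F ζ η ξ)) 0 :=
    SmoothNear.comp (g := Mv) (by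
      rw [Y0]; exact (N.smoothNear_sheetNormal 0).add (N.smoothNear_sheetNormal 1)) sY
  obtain ⟨CM, hCM, hMb⟩ : ∃ C > 0, ∀ᶠ ξ in 𝓝 0, ‖Mv (creaseMap F ζ η ξ)‖ ≤ C * ‖ξ‖ ^ 1 := by
    refine exists_isBigO_bound ?_
    have h1 := hM.differentiableAt.isBigO_sub
    have h2 : Mv (creaseMap F ζ η 0) = 0 := by rw [Y0]; exact N.sheetNormal_zero
    simp only [h2, sub_zero] at h1
    simpa using h1.norm_right
  have hGb := eventually_norm_sub_lt N.model.G_smooth.continuousAt one_pos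
  have hYb := eventually_norm_sub_lt sY.fderiv.continuousAt one_pos
  obtain ⟨CG, hCG0, hCG⟩ : ∃ C, 0 < C ∧ ‖G 0‖ + 1 = C := ⟨_, by positivity, rfl⟩
  obtain ⟨CY, hCY0, hCY⟩ : ∃ C, 0 < C ∧ ‖fderiv ℝ (creaseMap F ζ η) 0‖ + 1 = C :=
    ⟨_, by positivity, rfl⟩
  rw [hCG] at hGb
  rw [hCY] at hYb
  obtain ⟨c, hc, hc'⟩ : ∃ c, 0 < c ∧ c * (a * CG * CY) = 2 :=
    ⟨2 / (a * CG * CY), by positivity, by field_simp⟩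
  refine ⟨c, hc, CM, hCM, ?_⟩
  have hgrad : ∀ᶠ X in 𝓝 0, ∀ v, G X (grad G h X) v = fderiv ℝ h X v :=
    N.model.eventually_inverse_apply.mono fun X hX v ↦ DFunLike.congr_fun (hX (fderiv ℝ h X)) v
  filter_upwards [tY.eventually N.eventually_isGoodPoint, tY.eventually hgrad,
    tY.eventually hGb, hYb, hMb, N.eventually_fderiv_creaseMap hη, N.eventually_creaseMap hη,
    tY.eventually N.eventually_fderiv_grad_neg] with ξ good hg hG hYξ hMξ hd hev0 hneg
  rw [pow_one] at hMξ
  refine ⟨?_, hMξ⟩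
  change c * ‖ξ‖ ≤ ‖Mv (creaseMap F ζ η ξ)‖
  have hMv : ∀ v, _ → _ → G (creaseMap F ζ η ξ) (Mv (creaseMap F ζ η ξ)) v = _ :=
    (good.exists_angle hev0.1 hg hneg).2.1
  rcases eq_or_ne ξ 0 with rfl | hne
  · simp
  have hpos : 0 < ‖ξ‖ := norm_pos_iff.2 hne
  let w : Plane := !₂[ε₀ * ξ 0, ε₁ * ξ 1]
  have hw : ‖w‖ = ‖ξ‖ := by
    refine (pow_left_inj₀ (norm_nonneg _) (norm_nonneg _) two_ne_zero).1 ?_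
    rw [LocalPicture.norm_sq_plane, LocalPicture.norm_sq_plane]
    change (ε₀ * ξ 0) ^ 2 + (ε₁ * ξ 1) ^ 2 = _
    rw [mul_pow, mul_pow, h₀, h₁, one_mul, one_mul]
  have h1 := (hd w).2
  have h2 : ε₀ * ξ 0 * w 0 + ε₁ * ξ 1 * w 1 = ‖ξ‖ ^ 2 := by
    rw [LocalPicture.norm_sq_plane]
    change ε₀ * ξ 0 * (ε₀ * ξ 0) + ε₁ * ξ 1 * (ε₁ * ξ 1) = _
    linear_combination ξ 0 ^ 2 * h₀ + ξ 1 ^ 2 * h₁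
  rw [h2] at h1
  have h3 := hMv (fderiv ℝ (creaseMap F ζ η) ξ w) ((hd w).1 0) ((hd w).1 1)
  have h4 := (le_abs_self _).trans ((G (creaseMap F ζ η ξ)).le_opNorm₂
    (Mv (creaseMap F ζ η ξ)) (fderiv ℝ (creaseMap F ζ η) ξ w))
  have h5 := (fderiv ℝ (creaseMap F ζ η) ξ).le_opNorm w
  rw [hw] at h5
  have h6 := h5.trans (mul_le_mul_of_nonneg_right hYξ.2.le hpos.le)
  rw [h3] at h4
  have h7 := h4.trans (mul_le_mul (mul_le_mul_of_nonneg_right hG.2.le (norm_nonneg _)) h6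
    (norm_nonneg _) (by positivity))
  have h7' := mul_le_mul_of_nonneg_left h7 ha.le
  have h8 : 2 * ‖ξ‖ ≤ a * CG * CY * ‖Mv (creaseMap F ζ η ξ)‖ := by
    refine le_of_mul_le_mul_right ?_ hpos
    linarith
  rw [← hc'] at h8
  refine le_of_mul_le_mul_left ?_ (show 0 < a * CG * CY by positivity)
  linarith

/-- Along the crease the sheets meet at an angle comparable to the distance from the origin. -/
lemma eventually_angle (N : NormalModel G h f F T Z ζ S) (hη : IsMorseChart a S e ε₀ ε₁ η)
    (ha : 0 < a) (h₀ : ε₀ ^ 2 = 1) (h₁ : ε₁ ^ 2 = 1) :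
    ∃ k₁ > 0, ∃ k₂ > 0, ∀ᶠ ξ in 𝓝 0, ∃ n : Fin 2 → E4,
      (∀ A, fderiv ℝ h (creaseMap F ζ η ξ) (n A) = 0 ∧ G (creaseMap F ζ η ξ) (n A) (n A) = 1 ∧
        0 < fderiv ℝ (f A) (creaseMap F ζ η ξ) (n A) ∧
        ∀ w, fderiv ℝ h (creaseMap F ζ η ξ) w = 0 → fderiv ℝ (f A) (creaseMap F ζ η ξ) w = 0 →
          G (creaseMap F ζ η ξ) (n A) w = 0) ∧
      ∃ Ω ∈ Icc 0 Real.pi, Real.cos (Real.pi - Ω) = G (creaseMap F ζ η ξ) (n 0) (n 1) ∧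
        OfOrder k₁ k₂ ‖ξ‖ Ω := by
  have tY := N.tendsto_creaseMap hη
  obtain ⟨b, hb, hν⟩ := N.eventually_fderiv_grad
  obtain ⟨C, hC, hsp⟩ := N.eventually_spacelike_bounds
  obtain ⟨c, hc, CM, hCM, hMb⟩ := N.eventually_norm_sheetNormal hη ha h₀ h₁
  obtain ⟨k₁, hk₁, hk₁'⟩ : ∃ k, 0 < k ∧ k ^ 2 * (2 * b) = 1 / 2 * c ^ 2 :=
    ⟨√(1 / 2 * c ^ 2 / (2 * b)), Real.sqrt_pos.2 (by positivity), by
      rw [Real.sq_sqrt (by positivity)]; field_simp⟩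
  obtain ⟨k₂, hk₂, hk₂'⟩ : ∃ k, 0 < k ∧ k ^ 2 * (b / 2) = C * CM ^ 2 :=
    ⟨√(C * CM ^ 2 / (b / 2)), Real.sqrt_pos.2 (by positivity), by
      rw [Real.sq_sqrt (by positivity)]; field_simp⟩
  refine ⟨k₁, hk₁, 2 * k₂, by positivity, ?_⟩
  have hgrad : ∀ᶠ X in 𝓝 0, ∀ v, G X (grad G h X) v = fderiv ℝ h X v :=
    N.model.eventually_inverse_apply.mono fun X hX v ↦ DFunLike.congr_fun (hX (fderiv ℝ h X)) v
  filter_upwards [tY.eventually N.eventually_isGoodPoint, tY.eventually hgrad,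
    tY.eventually hν, tY.eventually hsp, hMb, N.eventually_creaseMap hη]
    with ξ good hg ⟨hν1, hν2⟩ hsp ⟨hM1, hM2⟩ hev0
  obtain ⟨hM0, -, n, hn, hΩ⟩ := good.exists_angle hev0.1 hg (by linarith)
  obtain ⟨hl, hu⟩ := hsp _ hM0
  obtain ⟨Mv, hMv⟩ : ∃ v, v = sheetNormal G h (f 0) (creaseMap F ζ η ξ) +
    sheetNormal G h (f 1) (creaseMap F ζ η ξ) := ⟨_, rfl⟩
  rw [← hMv] at hM1 hM2 hl hu hΩ
  obtain ⟨ν, hνd⟩ : ∃ ν, ν = -fderiv ℝ h (creaseMap F ζ η ξ) (grad G h (creaseMap F ζ η ξ)) :=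
    ⟨_, rfl⟩
  obtain ⟨g, hgd⟩ : ∃ g, g = G (creaseMap F ζ η ξ) Mv Mv := ⟨_, rfl⟩
  rw [← hνd, ← hgd] at hΩ
  rw [← hgd] at hl hu
  have hν0 : 0 < ν := by linarith
  have hg0 : 0 ≤ g := le_trans (by positivity) hl
  obtain ⟨Ω, hΩI, hcos, hΩ1, hΩ2⟩ := hΩ (√(g / ν)) (Real.sqrt_nonneg _) (by
    rw [Real.sq_sqrt (by positivity)]
    field_simp)
  refine ⟨n, hn, Ω, hΩI, hcos, le_trans (Real.le_sqrt_of_sq_le ?_) hΩ1, hΩ2.trans ?_⟩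
  · rw [le_div_iff₀ hν0, mul_pow]
    have h1 : (c * ‖ξ‖) ^ 2 ≤ ‖Mv‖ ^ 2 := pow_le_pow_left₀ (by positivity) hM1 2
    calc k₁ ^ 2 * ‖ξ‖ ^ 2 * ν ≤ k₁ ^ 2 * ‖ξ‖ ^ 2 * (2 * b) :=
          mul_le_mul_of_nonneg_left (by linarith) (by positivity)
      _ = 1 / 2 * (c * ‖ξ‖) ^ 2 := by rw [mul_pow]; linear_combination ‖ξ‖ ^ 2 * hk₁'
      _ ≤ 1 / 2 * ‖Mv‖ ^ 2 := by linarith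
      _ ≤ _ := hl
  · rw [mul_assoc]
    refine mul_le_mul_of_nonneg_left (Real.sqrt_le_iff.2 ⟨by positivity, ?_⟩) two_pos.le
    rw [div_le_iff₀ hν0, mul_pow]
    have h1 : ‖Mv‖ ^ 2 ≤ (CM * ‖ξ‖) ^ 2 := pow_le_pow_left₀ (norm_nonneg _) hM2 2
    calc g ≤ C * ‖Mv‖ ^ 2 := hu
      _ ≤ C * (CM * ‖ξ‖) ^ 2 := mul_le_mul_of_nonneg_left h1 hC.le
      _ = k₂ ^ 2 * ‖ξ‖ ^ 2 * (b / 2) := by rw [mul_pow]; linear_combination -‖ξ‖ ^ 2 * hk₂'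
      _ ≤ k₂ ^ 2 * ‖ξ‖ ^ 2 * ν := mul_le_mul_of_nonneg_left (by linarith) (by positivity)

end NormalModel

end

/-- Near the origin the crease is a bi-Lipschitz image of the plane, on which the height, the angle
and the metric are controlled. -/
structure CreaseBounds (𝓢 : Spacetime M) (τ : M → ℝ) (f : Fin 2 → M → ℝ)
    (ψ : OpenPartialHomeomorph M E4) (F : Fin 2 → Space → ℝ) (ζ : Plane → ℝ)
    (η : OpenPartialHomeomorph Plane Plane) (c C δ : ℝ) : Prop where
  map_zero : creaseMap F ζ η 0 = 0
  target : ∀ ξ ∈ disc δ, creaseMap F ζ η ξ ∈ ψ.target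
  smooth : ∀ ξ ∈ disc δ, ContDiffAt ℝ ∞ (creaseMap F ζ η) ξ
  lower : ∀ ξ ∈ disc δ, ∀ ξ' ∈ disc δ,
    c * ‖ξ - ξ'‖ ≤ ‖η.symm ξ - η.symm ξ'‖
  upper : ∀ ξ ∈ disc δ, ∀ ξ' ∈ disc δ,
    ‖creaseMap F ζ η ξ - creaseMap F ζ η ξ'‖ ≤ C * ‖ξ - ξ'‖
  height : ∀ ξ ∈ disc δ, |ζ (η.symm ξ)| ≤ C * ‖ξ‖ ^ 2
  angle : ∀ ξ ∈ disc δ, ∃ Ω,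
    IsCreaseAngle 𝓢 τ f (ψ.symm (creaseMap F ζ η ξ)) Ω ∧ OfOrder c C ‖ξ‖ Ω
  metric : ∀ ξ ∈ disc δ, ∀ w,
    fderiv ℝ (fun ξ ↦ τ (ψ.symm (creaseMap F ζ η ξ))) ξ w = 0 →
    c ^ 2 * ‖w‖ ^ 2 ≤ coordG 𝓢 ψ (creaseMap F ζ η ξ) (fderiv ℝ (creaseMap F ζ η) ξ w)
      (fderiv ℝ (creaseMap F ζ η) ξ w) ∧
    coordG 𝓢 ψ (creaseMap F ζ η ξ) (fderiv ℝ (creaseMap F ζ η) ξ w)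
      (fderiv ℝ (creaseMap F ζ η) ξ w) ≤ C ^ 2 * ‖w‖ ^ 2

lemma OfOrder.mono {c c' C C' ρ r : ℝ} (h : OfOrder c C ρ r) (hρ : 0 ≤ ρ) (hc : c' ≤ c)
    (hC : C ≤ C') : OfOrder c' C' ρ r :=
  ⟨(mul_le_mul_of_nonneg_right hc hρ).trans h.1, h.2.trans (mul_le_mul_of_nonneg_right hC hρ)⟩

lemma OfOrder.mul {c C m ρ r : ℝ} (h : OfOrder c C (m * ρ) r) : OfOrder (c * m) (C * m) ρ r := by
  unfold OfOrder at *
  rwa [mul_assoc, mul_assoc]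

/-- An angle in coordinates is an angle on the manifold. -/
lemma IsNormalChart.isCreaseAngle (hψ : IsNormalChart 𝓢 p ψ) {X : E4} (hX : X ∈ ψ.target)
    (hτ : MDifferentiableAt (𝓡 4) 𝓘(ℝ, ℝ) τ (ψ.symm X))
    (hf : ∀ A, MDifferentiableAt (𝓡 4) 𝓘(ℝ, ℝ) (f A) (ψ.symm X)) {n : Fin 2 → E4} {Ω : ℝ}
    (hn : ∀ A, fderiv ℝ (τ ∘ ψ.symm) X (n A) = 0 ∧ coordG 𝓢 ψ X (n A) (n A) = 1 ∧
      0 < fderiv ℝ (f A ∘ ψ.symm) X (n A) ∧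
      ∀ w, fderiv ℝ (τ ∘ ψ.symm) X w = 0 → fderiv ℝ (f A ∘ ψ.symm) X w = 0 →
        coordG 𝓢 ψ X (n A) w = 0)
    (hΩ : Ω ∈ Icc 0 Real.pi) (hcos : Real.cos (Real.pi - Ω) = coordG 𝓢 ψ X (n 0) (n 1)) :
    IsCreaseAngle 𝓢 τ f (ψ.symm X) Ω := by
  refine ⟨fun A ↦ mfderiv (𝓡 4) (𝓡 4) ψ.symm X (n A), fun A ↦ ?_, hΩ, hcos⟩
  obtain ⟨h1, h2, h3, h4⟩ := hn A
  refine ⟨?_, h2, ?_, fun w hw hw' ↦ ?_⟩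
  · rw [diff_mfderiv_symm hψ.mem_atlas hX hτ, h1]
  · rw [diff_mfderiv_symm hψ.mem_atlas hX (hf A)]
    exact h3
  · obtain ⟨v, rfl⟩ := exists_mfderiv_symm_eq hψ.mem_atlas hX w
    rw [diff_mfderiv_symm hψ.mem_atlas hX hτ] at hw
    rw [diff_mfderiv_symm hψ.mem_atlas hX (hf A)] at hw'
    exact h4 v hw hw'

lemma NormalModel.exists_creaseBounds (hψ : IsNormalChart 𝓢 p ψ)
    (N : NormalModel (coordG 𝓢 ψ) (τ ∘ ψ.symm) (fun A ↦ f A ∘ ψ.symm) F T Z ζ S)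
    (hη : IsMorseChart a S e ε₀ ε₁ η) (ha : 0 < a) (h₀ : ε₀ ^ 2 = 1) (h₁ : ε₁ ^ 2 = 1)
    (hτ : MDifferentiable (𝓡 4) 𝓘(ℝ, ℝ) τ)
    (hf : ∀ᶠ q in 𝓝 p, ∀ A, MDifferentiableAt (𝓡 4) 𝓘(ℝ, ℝ) (f A) q) :
    ∃ c > 0, ∃ C > 0, ∃ δ > 0, CreaseBounds 𝓢 τ f ψ F ζ η c C δ := by
  have tY := N.tendsto_creaseMap hη
  have sY := N.smoothNear_creaseMap hη
  obtain ⟨K, hK, δ₁, hδ₁, hlow⟩ := hη.exists_lipschitz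
  have sY1 : ContDiffAt ℝ 1 (creaseMap F ζ η) 0 := sY.contDiffAt.of_le (by norm_cast)
  obtain ⟨K', t, ht, hK'⟩ := sY1.exists_lipschitzOnWith
  obtain ⟨C₁, hC₁, hh⟩ := exists_isBigO_bound
    ((N.ζ_isBigO.comp_tendsto hη.tendsto_symm).trans (hη.isBigO_symm.norm_left.pow 2))
  obtain ⟨k₁, hk₁, k₂, hk₂, hang⟩ := N.eventually_angle hη ha h₀ h₁
  obtain ⟨C₂, hC₂, hsp⟩ := N.eventually_spacelike_bounds
  obtain ⟨c₁, hc₁, hD⟩ := hη.exists_norm_le_mul_fderiv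
  have hDu := eventually_norm_sub_lt sY.fderiv.continuousAt one_pos
  have htgt : ∀ᶠ X in 𝓝 (0 : E4), X ∈ ψ.target := ψ.open_target.mem_nhds hψ.zero_mem_target
  have hfX : ∀ᶠ X in 𝓝 (0 : E4), ∀ A, MDifferentiableAt (𝓡 4) 𝓘(ℝ, ℝ) (f A) (ψ.symm X) := by
    have := (ψ.continuousAt_symm hψ.zero_mem_target).tendsto
    rw [hψ.symm_zero] at this
    exact this.eventually hf
  obtain ⟨δ₂, hδ₂, hb⟩ := eventually_nhds_iff_ball.1 (((tY.eventually htgt).and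
    (tY.eventually hfX)).and ((sY.and ht).and (hh.and (hang.and ((tY.eventually hsp).and
      ((hD.and hDu).and (tY.eventually N.model.h_smooth)))))))
  obtain ⟨B, hB, hB'⟩ : ∃ B, 0 < B ∧ ‖fderiv ℝ (creaseMap F ζ η) 0‖ + 1 = B := ⟨_, by positivity, rfl⟩
  rw [hB'] at hb
  have hsub1 : disc (min δ₁ δ₂) ⊆ ball 0 δ₁ :=
    ball_subset_ball (min_le_left _ _)
  have hsub2 : disc (min δ₁ δ₂) ⊆ ball 0 δ₂ :=
    ball_subset_ball (min_le_right _ _)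
  refine ⟨min (min K⁻¹ k₁) (c₁ / 2), by positivity, K' + C₁ + k₂ + (C₂ + 1) * B, by positivity,
    min δ₁ δ₂, by positivity, N.creaseMap_zero hη, fun ξ hξ ↦ (hb ξ (hsub2 hξ)).1.1,
    fun ξ hξ ↦ (hb ξ (hsub2 hξ)).2.1.1, fun ξ hξ ξ' hξ' ↦ ?_, fun ξ hξ ξ' hξ' ↦ ?_, fun ξ hξ ↦ ?_,
    fun ξ hξ ↦ ?_, fun ξ hξ w hw ↦ ?_⟩
  · have h1 := hlow ξ (hsub1 hξ) ξ' (hsub1 hξ')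
    calc _ ≤ K⁻¹ * ‖ξ - ξ'‖ := mul_le_mul_of_nonneg_right
          ((min_le_left _ _).trans (min_le_left _ _)) (norm_nonneg _)
      _ ≤ _ := by rwa [inv_mul_le_iff₀ hK]
  · have h1 := hK'.dist_le_mul _ (hb ξ (hsub2 hξ)).2.1.2 _ (hb ξ' (hsub2 hξ')).2.1.2
    rw [dist_eq_norm, dist_eq_norm] at h1
    refine h1.trans (mul_le_mul_of_nonneg_right ?_ (norm_nonneg _))
    have : 0 < (C₂ + 1) * B := by positivity
    linarith
  · have h1 := (hb ξ (hsub2 hξ)).2.2.1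
    refine h1.trans (mul_le_mul_of_nonneg_right ?_ (by positivity))
    have : 0 < (C₂ + 1) * B := by positivity
    have := K'.2
    change 0 ≤ (K' : ℝ) at this
    linarith
  · obtain ⟨n, hn, Ω, hΩ, hcos, hord⟩ := (hb ξ (hsub2 hξ)).2.2.2.1
    refine ⟨Ω, hψ.isCreaseAngle (hb ξ (hsub2 hξ)).1.1 (hτ _) (hb ξ (hsub2 hξ)).1.2 hn hΩ hcos,
      hord.mono (norm_nonneg _) ((min_le_left _ _).trans (min_le_right _ _)) ?_⟩
    have : 0 < (C₂ + 1) * B := by positivity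
    have := K'.2
    change 0 ≤ (K' : ℝ) at this
    linarith
  · obtain ⟨hsp, ⟨hD, hDu⟩, hhs⟩ := (hb ξ (hsub2 hξ)).2.2.2.2
    have hYd := (hb ξ (hsub2 hξ)).2.1.1.differentiableAt (by simp)
    have h2 := fderiv_fun_comp (g := τ ∘ ψ.symm) ξ (hhs.differentiableAt (by simp)) hYd
    have h3 : fderiv ℝ (τ ∘ ψ.symm) (creaseMap F ζ η ξ) (fderiv ℝ (creaseMap F ζ η) ξ w) = 0 :=
      (DFunLike.congr_fun h2 w).symm.trans hw
    obtain ⟨hl, hu⟩ := hsp _ h3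
    constructor
    · have h4 : (c₁ * ‖w‖) ^ 2 ≤ ‖fderiv ℝ (creaseMap F ζ η) ξ w‖ ^ 2 :=
        pow_le_pow_left₀ (by positivity) (hD _ transverse_creaseMap hYd w) 2
      have h5 : min (min K⁻¹ k₁) (c₁ / 2) ^ 2 ≤ (c₁ / 2) ^ 2 :=
        pow_le_pow_left₀ (by positivity) (min_le_right _ _) 2
      nlinarith [mul_le_mul_of_nonneg_right h5 (sq_nonneg ‖w‖)]
    · have h4 := (fderiv ℝ (creaseMap F ζ η) ξ).le_opNorm w
      have h5 : ‖fderiv ℝ (creaseMap F ζ η) ξ w‖ ^ 2 ≤ (B * ‖w‖) ^ 2 :=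
        pow_le_pow_left₀ (norm_nonneg _)
          (h4.trans (mul_le_mul_of_nonneg_right hDu.2.le (norm_nonneg w))) 2
      have h6 : C₂ * B ^ 2 ≤ (K' + C₁ + k₂ + (C₂ + 1) * B) ^ 2 := by
        have h7 : ((C₂ + 1) * B) ^ 2 ≤ (K' + C₁ + k₂ + (C₂ + 1) * B) ^ 2 :=
          pow_le_pow_left₀ (by positivity) (by have := K'.2; change 0 ≤ (K' : ℝ) at this; linarith) 2
        have h8 : C₂ * B ^ 2 ≤ (C₂ + 1) ^ 2 * B ^ 2 :=
          mul_le_mul_of_nonneg_right (by nlinarith) (sq_nonneg _)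
        linarith [mul_pow (C₂ + 1) B 2]
      calc _ ≤ C₂ * ‖fderiv ℝ (creaseMap F ζ η) ξ w‖ ^ 2 := hu
        _ ≤ C₂ * (B * ‖w‖) ^ 2 := mul_le_mul_of_nonneg_left h5 hC₂.le
        _ = C₂ * B ^ 2 * ‖w‖ ^ 2 := by ring
        _ ≤ _ := mul_le_mul_of_nonneg_right h6 (sq_nonneg _)

namespace LocalPicture

lemma crease_coord (L : ℒ D τ₁)
    (hV : ∀ q ∈ V, f 0 q = 0 → ψ q 0 = F 0 (spatial (ψ q))) {s : ℝ} {q : M}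
    (hq : q ∈ 𝒞 s) :
    ∃ ξ ∈ D, S (η.symm ξ) = s ∧ η (transverse (ψ q)) = ξ ∧ ψ q = creaseMap F ζ η ξ ∧
      ψ.symm (creaseMap F ζ η ξ) = q := by
  obtain ⟨h1, h2, h3, h4⟩ := L.mem_slice_crease_iff.1 hq
  obtain ⟨-, h5, h6, -⟩ := L.coord q h1
  have h7 := hV q (L.subset h1) hq.1.2.2.1
  have h8 : ψ q = creaseMap F ζ η (η (transverse (ψ q))) := by
    rw [creaseMap, η.left_inv h5, ← h4, spt_transverse, ← h7, pt_spatial]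
  refine ⟨_, h6, by rw [η.left_inv h5, h3], rfl, h8, ?_⟩
  rw [← h8, ψ.left_inv (L.subset_source h1)]

lemma creaseMap_mem (L : ℒ D τ₁)
    (hV : ∀ q ∈ V, f 0 q = 0 → ψ q 0 = F 0 (spatial (ψ q))) {s : ℝ} (hs : |s| < τ₁) {ξ : Plane}
    (hξ : ξ ∈ D) (hξs : S (η.symm ξ) = s) :
    ψ.symm (creaseMap F ζ η ξ) ∈ 𝒞 s ∧
      ψ (ψ.symm (creaseMap F ζ η ξ)) = creaseMap F ζ η ξ := by
  have hc := L.compare s ξ hs hξ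
  have hz0 := hc.2.2.1.1 hξs
  have hz1 := hc.2.2.2.1 hξs
  obtain ⟨h1, h2, h3, -⟩ := L.point s ξ (ζ (η.symm ξ)) hs hξ hz1.le hz0.ge
  have h4 := ψ.right_inv h1
  have hmem : ψ.symm (pt (T (s, spt (η.symm ξ) (ζ (η.symm ξ)))) (spt (η.symm ξ) (ζ (η.symm ξ)))) ∈
      𝒞 s := by
    rw [L.mem_slice_crease_iff]
    refine ⟨h2, h3, ?_⟩
    rw [h4]
    simp [hξs]
  obtain ⟨ξ', -, -, h7, h8, h9⟩ := L.crease_coord hV hmem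
  have h10 : ξ' = ξ := by
    rw [← h7, h4, transverse_pt_spt, η.right_inv (L.D_subset hξ)]
  rw [h10] at h8 h9
  rw [h9]
  exact ⟨hmem, h8⟩

end LocalPicture

/-! ### Elliptical creases -/

/-- The standard parametrization of the circle of radius `ρ`. -/
def circlePoint (ρ φ : ℝ) : Plane := !₂[ρ * Real.cos φ, ρ * Real.sin φ]

lemma contDiff_circlePoint (ρ : ℝ) : ContDiff ℝ ∞ (circlePoint ρ) := by
  rw [contDiff_euclidean]
  intro i
  fin_cases i
  · exact contDiff_const.mul Real.contDiff_cos
  · exact contDiff_const.mul Real.contDiff_sin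

lemma sq_norm_circlePoint (ρ φ : ℝ) : ‖circlePoint ρ φ‖ ^ 2 = ρ ^ 2 := by
  rw [LocalPicture.norm_sq_plane]
  change (ρ * Real.cos φ) ^ 2 + (ρ * Real.sin φ) ^ 2 = _
  linear_combination ρ ^ 2 * Real.sin_sq_add_cos_sq φ

lemma hasDerivAt_circlePoint (ρ φ : ℝ) :
    HasDerivAt (circlePoint ρ) (circlePoint ρ (φ + Real.pi / 2)) φ := by
  have hd := ((contDiff_circlePoint ρ).differentiable (by simp) φ).hasDerivAt
  have hi := fun i ↦ (EuclideanSpace.proj i : Plane →L[ℝ] ℝ).hasFDerivAt.comp_hasDerivAt φ hd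
  suffices h : circlePoint ρ (φ + Real.pi / 2) = deriv (circlePoint ρ) φ by rw [h]; exact hd
  ext i
  fin_cases i
  · refine HasDerivAt.unique (f := fun φ ↦ ρ * Real.cos φ) (x := φ) ?_ (hi 0)
    change HasDerivAt _ (ρ * Real.cos (φ + Real.pi / 2)) φ
    rw [Real.cos_add_pi_div_two]
    exact (Real.hasDerivAt_cos φ).const_mul ρ
  · refine HasDerivAt.unique (f := fun φ ↦ ρ * Real.sin φ) (x := φ) ?_ (hi 1)
    change HasDerivAt _ (ρ * Real.sin (φ + Real.pi / 2)) φ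
    rw [Real.sin_add_pi_div_two]
    exact (Real.hasDerivAt_sin φ).const_mul ρ

lemma circlePoint_periodic (ρ : ℝ) : Function.Periodic (circlePoint ρ) (2 * Real.pi) := by
  intro φ
  simp only [circlePoint, Real.cos_add_two_pi, Real.sin_add_two_pi]

lemma injOn_circlePoint {ρ : ℝ} (hρ : 0 < ρ) : InjOn (circlePoint ρ) (Ico 0 (2 * Real.pi)) := by
  intro φ hφ φ' hφ' h
  have h0 : ρ * Real.cos φ = ρ * Real.cos φ' := congrArg (fun x : Plane ↦ x 0) h
  have h1 : ρ * Real.sin φ = ρ * Real.sin φ' := congrArg (fun x : Plane ↦ x 1) h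
  have h2 := Real.Angle.cos_sin_inj (mul_left_cancel₀ hρ.ne' h0) (mul_left_cancel₀ hρ.ne' h1)
  obtain ⟨k, hk⟩ := Real.Angle.angle_eq_iff_two_pi_dvd_sub.1 h2
  have hpi := Real.two_pi_pos
  have hk1 : (k : ℝ) < 1 := by nlinarith [hφ.2, hφ'.1]
  have hk2 : (-1 : ℝ) < k := by nlinarith [hφ.1, hφ'.2]
  have hk3 : k = 0 := by
    have h3 : k < 1 := by exact_mod_cast hk1
    have h4 : -1 < k := by exact_mod_cast hk2
    omega
  rw [hk3] at hk
  simp at hk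
  linarith

lemma range_circlePoint {ρ : ℝ} (hρ : 0 ≤ ρ) : range (circlePoint ρ) = {ξ | ‖ξ‖ = ρ} := by
  ext ξ
  constructor
  · rintro ⟨φ, rfl⟩
    exact (pow_left_inj₀ (norm_nonneg _) hρ two_ne_zero).1 (sq_norm_circlePoint ρ φ)
  · intro (h : ‖ξ‖ = ρ)
    have hz : ‖(⟨ξ 0, ξ 1⟩ : ℂ)‖ = ρ := by
      rw [← h]
      refine (pow_left_inj₀ (norm_nonneg _) (norm_nonneg _) two_ne_zero).1 ?_
      rw [Complex.sq_norm, Complex.normSq_mk, LocalPicture.norm_sq_plane]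
      ring
    refine ⟨Complex.arg ⟨ξ 0, ξ 1⟩, ?_⟩
    ext i
    fin_cases i
    · change ρ * Real.cos _ = ξ 0
      rw [← hz, Complex.norm_mul_cos_arg]
    · change ρ * Real.sin _ = ξ 1
      rw [← hz, Complex.norm_mul_sin_arg]

lemma contMDiffAt_symm_comp (hψ : ψ ∈ 𝒜 M) {E : Type*}
    [NormedAddCommGroup E] [NormedSpace ℝ E] {u : E → E4} {x : E} (hx : u x ∈ ψ.target)
    (hu : ContDiffAt ℝ ∞ u x) : ContMDiffAt 𝓘(ℝ, E) (𝓡 4) ∞ (fun x ↦ ψ.symm (u x)) x :=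
  ContMDiffAt.comp (g := ψ.symm) x ((contMDiffOn_symm_of_mem_maximalAtlas hψ).contMDiffAt
    (ψ.open_target.mem_nhds hx)) hu.contMDiffAt

lemma mfderiv_symm_comp (hψ : ψ ∈ 𝒜 M) {E : Type*}
    [NormedAddCommGroup E] [NormedSpace ℝ E] {u : E → E4} {x : E} (hx : u x ∈ ψ.target)
    (hu : DifferentiableAt ℝ u x) (v : E) :
    mfderiv 𝓘(ℝ, E) (𝓡 4) (fun x ↦ ψ.symm (u x)) x v =
      mfderiv (𝓡 4) (𝓡 4) ψ.symm (u x) (fderiv ℝ u x v) := by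
  have h := mfderiv_comp (I := 𝓘(ℝ, E)) (I' := 𝓡 4) (I'' := 𝓡 4) (g := ψ.symm) x
    ((mdifferentiable_of_mem_maximalAtlas hψ).mdifferentiableAt_symm hx) hu.mdifferentiableAt
  rw [mfderiv_eq_fderiv] at h
  exact DFunLike.congr_fun h v

namespace CreaseBounds

variable {c C δ : ℝ}

lemma injOn (B : CreaseBounds 𝓢 τ f ψ F ζ η c C δ) (hc : 0 < c) :
    InjOn (fun ξ ↦ ψ.symm (creaseMap F ζ η ξ)) (ball 0 δ) := by
  intro ξ hξ ξ' hξ' h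
  have h1 := ψ.symm.injOn (B.target ξ hξ) (B.target ξ' hξ') h
  have h2 := B.lower ξ hξ ξ' hξ'
  rw [← transverse_creaseMap (F := F) (ζ := ζ), ← transverse_creaseMap (F := F) (ζ := ζ) ξ', h1,
    sub_self, norm_zero] at h2
  have h3 : ‖ξ - ξ'‖ ≤ 0 := by nlinarith [norm_nonneg (ξ - ξ')]
  exact sub_eq_zero.1 (norm_le_zero_iff.1 h3)

lemma exists_length (B : CreaseBounds 𝓢 τ f ψ F ζ η c C δ)
    (hψ : ψ ∈ 𝒜 M) (hc : 0 < c) (hC : 0 < C) {ρ s : ℝ} (hρ : 0 < ρ)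
    (hρδ : ρ < δ) (hs : ∀ ξ : Plane, ‖ξ‖ = ρ → τ (ψ.symm (creaseMap F ζ η ξ)) = s)
    (hτ : MDifferentiable (𝓡 4) 𝓘(ℝ, ℝ) τ) :
    ∃ L, IsClosedCurveOfLength 𝓢 ((fun ξ ↦ ψ.symm (creaseMap F ζ η ξ)) '' {ξ | ‖ξ‖ = ρ}) L ∧
      OfOrder (2 * Real.pi * c) (2 * Real.pi * C) ρ L := by
  have hn : ∀ φ, ‖circlePoint ρ φ‖ = ρ := fun φ ↦
    (pow_left_inj₀ (norm_nonneg _) hρ.le two_ne_zero).1 (sq_norm_circlePoint ρ φ)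
  have hm : ∀ φ, circlePoint ρ φ ∈ disc δ := fun φ ↦ by
    rw [mem_ball_zero_iff, hn]; exact hρδ
  let u : ℝ → E4 := fun φ ↦ creaseMap F ζ η (circlePoint ρ φ)
  have hut : ∀ φ, u φ ∈ ψ.target := fun φ ↦ B.target _ (hm φ)
  have hus : ∀ φ, ContDiffAt ℝ ∞ u φ := fun φ ↦
    (B.smooth _ (hm φ)).comp φ (contDiff_circlePoint ρ).contDiffAt
  have hYd : ∀ φ, DifferentiableAt ℝ (creaseMap F ζ η) (circlePoint ρ φ) := fun φ ↦
    (B.smooth _ (hm φ)).differentiableAt (by simp)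
  have hud : ∀ φ, HasDerivAt u (fderiv ℝ (creaseMap F ζ η) (circlePoint ρ φ)
      (circlePoint ρ (φ + Real.pi / 2))) φ := fun φ ↦
    (hYd φ).hasFDerivAt.comp_hasDerivAt φ (hasDerivAt_circlePoint ρ φ)
  have hv φ : 𝓢.metric (ψ.symm (u φ)) (velocity (fun φ ↦ ψ.symm (u φ)) φ)
      (velocity (fun φ ↦ ψ.symm (u φ)) φ) = coordG 𝓢 ψ (u φ) (deriv u φ) (deriv u φ) := by
    have h1 := mfderiv_symm_comp hψ (hut φ) (hud φ).differentiableAt (1 : ℝ)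
    have h2 : (fderiv ℝ u φ (1 : ℝ)) = deriv u φ := fderiv_apply_one_eq_deriv
    rw [h2] at h1
    rw [coordG_apply, coordMetric, ← h1]
    rfl
  have hker φ : fderiv ℝ (fun ξ ↦ τ (ψ.symm (creaseMap F ζ η ξ))) (circlePoint ρ φ)
      (circlePoint ρ (φ + Real.pi / 2)) = 0 := by
    have hd : DifferentiableAt ℝ (fun ξ ↦ τ (ψ.symm (creaseMap F ζ η ξ))) (circlePoint ρ φ) := by
      have h1 : MDifferentiableAt 𝓘(ℝ, Plane) 𝓘(ℝ, ℝ) (fun ξ ↦ τ (ψ.symm (creaseMap F ζ η ξ)))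
          (circlePoint ρ φ) :=
        MDifferentiableAt.comp (g := τ) (I' := 𝓡 4) _ (hτ _)
          ((contMDiffAt_symm_comp hψ (B.target _ (hm φ)) (B.smooth _ (hm φ))).mdifferentiableAt (by simp))
      exact h1.differentiableAt
    have h1 := hd.hasFDerivAt.comp_hasDerivAt φ (hasDerivAt_circlePoint ρ φ)
    have h2 : ((fun ξ ↦ τ (ψ.symm (creaseMap F ζ η ξ))) ∘ circlePoint ρ) = fun _ ↦ s :=
      funext fun φ ↦ hs _ (hn φ)
    rw [h2] at h1
    exact h1.unique (hasDerivAt_const φ s)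
  have hbd φ : c * ρ ≤ √(coordG 𝓢 ψ (u φ) (deriv u φ) (deriv u φ)) ∧
      √(coordG 𝓢 ψ (u φ) (deriv u φ) (deriv u φ)) ≤ C * ρ := by
    obtain ⟨h1, h2⟩ := B.metric _ (hm φ) _ (hker φ)
    rw [hn, ← mul_pow] at h1 h2
    rw [(hud φ).deriv]
    exact ⟨Real.le_sqrt_of_sq_le h1, Real.sqrt_le_iff.2 ⟨by positivity, h2⟩⟩
  have hcont : Continuous fun φ ↦ √(coordG 𝓢 ψ (u φ) (deriv u φ) (deriv u φ)) := by
    refine Real.continuous_sqrt.comp ?_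
    have hu : ContDiff ℝ ∞ u := contDiff_iff_contDiffAt.2 hus
    have h1 : Continuous (deriv u) := hu.continuous_deriv (by simp)
    have h2 : Continuous fun φ ↦ coordG 𝓢 ψ (u φ) := by
      rw [continuous_iff_continuousAt]
      intro φ
      exact ContinuousAt.comp (g := coordG 𝓢 ψ) (((contDiffOn_coordG hψ).continuousOn).continuousAt
        (ψ.open_target.mem_nhds (hut φ))) hu.continuous.continuousAt
    exact (h2.clm_apply h1).clm_apply h1
  refine ⟨_, ⟨fun φ ↦ ψ.symm (u φ), fun φ ↦ contMDiffAt_symm_comp hψ (hut φ) (hus φ), ?_, ?_, ?_,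
    rfl⟩, ?_⟩
  · intro φ
    simp only [u, circlePoint_periodic ρ φ]
  · intro φ hφ φ' hφ' h
    exact injOn_circlePoint hρ hφ hφ' (B.injOn hc (hm φ) (hm φ') h)
  · rw [← range_circlePoint hρ.le, ← range_comp]
    rfl
  · simp only [hv]
    have hJ := hcont.intervalIntegrable (μ := volume) 0 (2 * Real.pi)
    have hconst : ∀ k : ℝ, IntervalIntegrable (fun _ : ℝ ↦ k) volume 0 (2 * Real.pi) := fun k ↦
      continuous_const.intervalIntegrable _ _
    have h1 := intervalIntegral.integral_mono_on Real.two_pi_pos.le (hconst (c * ρ)) hJ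
      fun φ _ ↦ (hbd φ).1
    have h2 := intervalIntegral.integral_mono_on Real.two_pi_pos.le hJ (hconst (C * ρ))
      fun φ _ ↦ (hbd φ).2
    rw [intervalIntegral.integral_const, smul_eq_mul, sub_zero] at h1 h2
    exact ⟨by linarith, by linarith⟩

end CreaseBounds

lemma LocalPicture.ellipticScaling {r a s c C δ k₁ k₂ : ℝ}
    (L : ℒ (ball 0 r) τ₁)
    (hV : ∀ q ∈ V, f 0 q = 0 → ψ q 0 = F 0 (spatial (ψ q)))
    (B : CreaseBounds 𝓢 τ f ψ F ζ η c C δ) (hψ : ψ ∈ 𝒜 M)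
    (hτ : MDifferentiable (𝓡 4) 𝓘(ℝ, ℝ) τ) (hc : 0 < c) (hC : 0 < C) (hrδ : r ≤ δ) (ha : 0 < a)
    (hs : |s| < τ₁) (hs0 : s ≠ 0) (hsr : 2 * a * |s| < r ^ 2) (hr : 0 < r)
    (hS : ∀ ξ ∈ disc r, S (η.symm ξ) = s ↔ ‖ξ‖ ^ 2 = 2 * a * |s|)
    (hk₁ : k₁ ≤ c * √(2 * a)) (hk₂ : 2 * Real.pi * C * √(2 * a) ≤ k₂) (hk₂' : C * (2 * a) ≤ k₂) :
    EllipticScaling 𝓢 τ f ψ k₁ k₂ s (𝒞 s) := by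
  have hpi := Real.pi_gt_three
  obtain ⟨ρ, hρ, hρ2, hρe⟩ : ∃ ρ, 0 < ρ ∧ ρ ^ 2 = 2 * a * |s| ∧ ρ = √(2 * a) * √|s| := by
    have h0 : 0 < |s| := abs_pos.2 hs0
    refine ⟨_, by positivity, ?_, rfl⟩
    rw [mul_pow, Real.sq_sqrt (by positivity), Real.sq_sqrt h0.le]
  have hρr : ρ < r := lt_of_pow_lt_pow_left₀ 2 hr.le (by rwa [hρ2])
  have hS' ξ (hξ : ξ ∈ disc r) : S (η.symm ξ) = s ↔ ‖ξ‖ = ρ := by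
    rw [hS ξ hξ, ← hρ2, pow_left_inj₀ (norm_nonneg _) hρ.le two_ne_zero]
  have hball : ∀ ξ : Plane, ‖ξ‖ = ρ → ξ ∈ disc r := fun ξ h ↦ by
    rw [mem_ball_zero_iff, h]; exact hρr
  have hsub : disc r ⊆ ball 0 δ := ball_subset_ball hrδ
  have hδ0 : (0 : Plane) ∈ disc δ := hsub (mem_ball_self hr)
  have hq q (hq : q ∈ 𝒞 s) : ∃ ξ : Plane, ‖ξ‖ = ρ ∧ ψ q = creaseMap F ζ η ξ ∧
      ψ.symm (creaseMap F ζ η ξ) = q := by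
    obtain ⟨ξ, h1, h2, -, h3, h4⟩ := L.crease_coord hV hq
    exact ⟨ξ, (hS' ξ h1).1 h2, h3, h4⟩
  have hCset : 𝒞 s =
      (fun ξ ↦ ψ.symm (creaseMap F ζ η ξ)) '' {ξ | ‖ξ‖ = ρ} := by
    ext q
    constructor
    · intro h
      obtain ⟨ξ, h1, -, h2⟩ := hq q h
      exact ⟨ξ, h1, h2⟩
    · rintro ⟨ξ, h1, rfl⟩
      exact (L.creaseMap_mem hV hs (hball ξ h1) ((hS' ξ (hball ξ h1)).2 h1)).1
  have hfac : ∀ {x y r : ℝ}, OfOrder x y ρ r → k₁ ≤ x * √(2 * a) → y * √(2 * a) ≤ k₂ →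
      OfOrder k₁ k₂ (√|s|) r := by
    intro x y r h h1 h2
    rw [hρe] at h
    exact h.mul.mono (Real.sqrt_nonneg _) h1 h2
  have hCk : C * √(2 * a) ≤ k₂ := by
    refine le_trans ?_ hk₂
    have : 0 ≤ C * √(2 * a) := by positivity
    nlinarith
  refine ⟨?_, fun q h ↦ ?_, fun q h ↦ ?_, fun q h ↦ ?_⟩
  · rw [hCset]
    obtain ⟨ℓ, h1, h2⟩ := B.exists_length hψ hc hC hρ (hρr.trans_le hrδ) (s := s) (fun ξ h ↦
      (L.creaseMap_mem hV hs (hball ξ h) ((hS' ξ (hball ξ h)).2 h)).1.2) hτ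
    refine ⟨ℓ, h1, hfac h2 (hk₁.trans ?_) hk₂⟩
    have : 0 ≤ c * √(2 * a) := by positivity
    nlinarith
  · obtain ⟨ξ, h1, h2, -⟩ := hq q h
    rw [h2, transverse_creaseMap]
    have hl := B.lower ξ (hsub (hball ξ h1)) 0 hδ0
    have hu := B.upper ξ (hsub (hball ξ h1)) 0 hδ0
    rw [L.η_zero, sub_zero, sub_zero, h1] at hl
    rw [B.map_zero, sub_zero, sub_zero, h1] at hu
    refine hfac ⟨hl, ?_⟩ hk₁ hCk
    rw [← transverse_creaseMap (F := F) (ζ := ζ)]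
    exact (norm_transverse_le _).trans hu
  · obtain ⟨ξ, h1, h2, -⟩ := hq q h
    have hh := B.height ξ (hsub (hball ξ h1))
    rw [h1, hρ2] at hh
    rw [h2]
    simp only [creaseMap, pt_three', spt_two']
    nlinarith [abs_nonneg s]
  · obtain ⟨ξ, h1, h2, h3⟩ := hq q h
    obtain ⟨Ω, h4, h5⟩ := B.angle ξ (hsub (hball ξ h1))
    rw [h3] at h4
    rw [h1] at h5
    exact ⟨Ω, h4, hfac h5 hk₁ hCk⟩

/-! ### The flying saucer -/

/-- The point of the sheet `A` in the slice at time `s` with transverse coordinates `η.symm ξ`. -/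
def sheetMap (T : ℝ × Space → ℝ) (Z : Fin 2 → ℝ × Plane → ℝ) (η : OpenPartialHomeomorph Plane Plane)
    (A : Fin 2) (s : ℝ) (ξ : Plane) : E4 :=
  pt (T (s, spt (η.symm ξ) (Z A (s, η.symm ξ)))) (spt (η.symm ξ) (Z A (s, η.symm ξ)))

section Algebra

lemma gram_bounds {G : Form} {d : Plane →L[ℝ] E4} {c C : ℝ} (hc : 0 < c)
    (hG : ∀ v w, G v w = G w v)
    (h : ∀ w, c ^ 2 * ‖w‖ ^ 2 ≤ G (d w) (d w) ∧ G (d w) (d w) ≤ C ^ 2 * ‖w‖ ^ 2) :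
    c ^ 2 ≤ √(Matrix.det (Matrix.of fun i j : Fin 2 ↦ G (d (single i 1))
      (d (single j 1)))) ∧
    √(Matrix.det (Matrix.of fun i j : Fin 2 ↦ G (d (single i 1))
      (d (single j 1)))) ≤ C ^ 2 := by
  rw [Matrix.det_fin_two]
  simp only [Matrix.of_apply]
  set v₀ := d (single 0 1)
  set v₁ := d (single 1 1)
  have h0 := h (single 0 1)
  have h1 := h (single 1 1)
  simp only [PiLp.norm_single, norm_one, one_pow, mul_one] at h0 h1
  change c ^ 2 ≤ G v₀ v₀ ∧ G v₀ v₀ ≤ C ^ 2 at h0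
  change c ^ 2 ≤ G v₁ v₁ ∧ G v₁ v₁ ≤ C ^ 2 at h1
  have hg0 : 0 < G v₀ v₀ := lt_of_lt_of_le (by positivity) h0.1
  have h2 := (h (G v₀ v₀ • single 1 1 - G v₀ v₁ • single 0 1)).1
  have h3 : ‖(G v₀ v₀ • single 1 1 - G v₀ v₁ • single 0 1 : Plane)‖ ^ 2 =
      G v₀ v₀ ^ 2 + G v₀ v₁ ^ 2 := by
    rw [LocalPicture.norm_sq_plane]
    simp
    ring
  have h4 : G (d (G v₀ v₀ • single 1 1 - G v₀ v₁ • single 0 1))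
      (d (G v₀ v₀ • single 1 1 - G v₀ v₁ • single 0 1)) =
      G v₀ v₀ * (G v₀ v₀ * G v₁ v₁ - G v₀ v₁ * G v₁ v₀) := by
    simp only [map_sub, map_smul, sub_apply, smul_apply, smul_eq_mul]
    change G v₀ v₀ * (G v₀ v₀ * G v₁ v₁ - G v₀ v₁ * G v₀ v₁) -
      G v₀ v₁ * (G v₀ v₀ * G v₁ v₀ - G v₀ v₁ * G v₀ v₀) = _
    rw [hG v₁ v₀]
    ring
  rw [h3, h4] at h2
  constructor
  · refine Real.le_sqrt_of_sq_le ?_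
    have h5 : c ^ 2 * G v₀ v₀ ≤ G v₀ v₀ * G v₁ v₁ - G v₀ v₁ * G v₁ v₀ := by
      refine le_of_mul_le_mul_left ?_ hg0
      nlinarith [mul_nonneg (sq_nonneg c) (sq_nonneg (G v₀ v₁))]
    nlinarith [sq_nonneg c]
  · refine Real.sqrt_le_iff.2 ⟨sq_nonneg _, ?_⟩
    rw [hG v₁ v₀]
    nlinarith [sq_nonneg (G v₀ v₁), sq_nonneg c, mul_le_mul h0.2 h1.2 (le_trans (sq_nonneg c) h1.1) (sq_nonneg C)]

end Algebra

/-- Near the origin the sheets in the slices are immersed images of the plane, on which the height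
and the metric are controlled. -/
structure SheetBounds (𝓢 : Spacetime M) (ψ : OpenPartialHomeomorph M E4) (T : ℝ × Space → ℝ)
    (Z : Fin 2 → ℝ × Plane → ℝ) (η : OpenPartialHomeomorph Plane Plane) (a c C δ : ℝ) : Prop where
  target : ∀ A s, |s| < δ → ∀ ξ ∈ disc δ, sheetMap T Z η A s ξ ∈ ψ.target
  smooth : ∀ A s, |s| < δ → ∀ ξ ∈ disc δ,
    ContDiffAt ℝ ∞ (sheetMap T Z η A s) ξ
  metric : ∀ A s, |s| < δ → ∀ ξ ∈ disc δ, ∀ w,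
    c ^ 2 * ‖w‖ ^ 2 ≤ coordG 𝓢 ψ (sheetMap T Z η A s ξ) (fderiv ℝ (sheetMap T Z η A s) ξ w)
      (fderiv ℝ (sheetMap T Z η A s) ξ w) ∧
    coordG 𝓢 ψ (sheetMap T Z η A s ξ) (fderiv ℝ (sheetMap T Z η A s) ξ w)
      (fderiv ℝ (sheetMap T Z η A s) ξ w) ≤ C ^ 2 * ‖w‖ ^ 2
  height : ∀ A s, |s| < δ → ∀ ξ ∈ disc δ,
    |Z A (s, η.symm ξ)| ≤ C * (|s| + ‖ξ‖ ^ 2)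
  gap : ∀ s, 0 ≤ s → s < δ → a * s ≤ Z 0 (s, 0) - Z 1 (s, 0)

lemma LocalData.Describes.exists_Z_bound {Δ : LocalData} (h : Δ.Describes 𝓢 τ f p ψ) :
    ∃ C > 0, ∀ᶠ u in 𝓝 (0 : ℝ × Plane), ∀ A, |Δ.Z A u| ≤ C * (|u.1| + ‖u.2‖ ^ 2) := by
  have t2 : Tendsto (fun u : ℝ × Plane ↦ ‖u.2‖) (𝓝 0) (𝓝 0) := by
    have : Continuous fun u : ℝ × Plane ↦ ‖u.2‖ := by fun_prop
    simpa using this.tendsto 0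
  have t1 : Tendsto (fun u : ℝ × Plane ↦ |u.1|) (𝓝 0) (𝓝 0) := by
    have : Continuous fun u : ℝ × Plane ↦ |u.1| := by fun_prop
    simpa using this.tendsto 0
  have key : ∀ (z : ℝ × Plane → ℝ) (B : Matrix (Fin 2) (Fin 2) ℝ) ,
      (fun u : ℝ × Plane ↦ Δ.a * u.1 - (z u + quad B u.2)) =O[𝓝 0]
        (fun u ↦ ‖u.2‖ ^ 3 + |u.1| * ‖u.2‖ + u.1 ^ 2) →
      ∃ C > 0, ∀ᶠ u in 𝓝 (0 : ℝ × Plane), |z u| ≤ C * (|u.1| + ‖u.2‖ ^ 2) := by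
    intro z B hz
    obtain ⟨C₁, hC₁, h1⟩ := hz.exists_pos
    have hq : (fun u : ℝ × Plane ↦ quad B u.2) =O[𝓝 0] fun u ↦ ‖u.2‖ ^ 2 :=
      isBigO_quad B (isBigO_refl _ _).norm_right
    obtain ⟨C₂, hC₂, h2⟩ := hq.exists_pos
    have ha := h.a_pos
    refine ⟨Δ.a + C₂ + 2 * C₁, by positivity, ?_⟩
    filter_upwards [h1.bound, h2.bound, t2.eventually_lt_const one_pos,
      t1.eventually_lt_const one_pos] with u b1 b2 b3 b4
    rw [Real.norm_eq_abs, Real.norm_eq_abs] at b1 b2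
    rw [abs_of_nonneg (by positivity : 0 ≤ ‖u.2‖ ^ 3 + |u.1| * ‖u.2‖ + u.1 ^ 2)] at b1
    rw [abs_of_nonneg (by positivity : 0 ≤ ‖u.2‖ ^ 2)] at b2
    have e1 : z u = Δ.a * u.1 - quad B u.2 - (Δ.a * u.1 - (z u + quad B u.2)) := by ring
    have e2 : |z u| ≤ Δ.a * |u.1| + |quad B u.2| + |Δ.a * u.1 - (z u + quad B u.2)| := by
      conv_lhs => rw [e1]
      refine (abs_sub _ _).trans (add_le_add_left ((abs_sub _ _).trans ?_) _)
      rw [abs_mul, abs_of_pos ha]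
    have n1 := norm_nonneg u.2
    have n2 := abs_nonneg u.1
    have e3 : ‖u.2‖ ^ 3 + |u.1| * ‖u.2‖ + u.1 ^ 2 ≤ 2 * (|u.1| + ‖u.2‖ ^ 2) := by
      rw [← sq_abs u.1]
      nlinarith [mul_nonneg n1 n2, sq_nonneg ‖u.2‖, mul_nonneg (sq_nonneg ‖u.2‖) (sub_nonneg.2 b3.le),
        mul_nonneg n2 (sub_nonneg.2 b4.le), mul_nonneg n2 (sub_nonneg.2 b3.le)]
    nlinarith [mul_le_mul_of_nonneg_left e3 hC₁.le, mul_nonneg hC₂.le n2,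
      mul_nonneg ha.le (sq_nonneg ‖u.2‖)]
  obtain ⟨C, hC, h0⟩ := key _ _ h.Z_zero
  obtain ⟨C', hC', h1⟩ := key _ _ h.Z_one
  refine ⟨C + C', by positivity, ?_⟩
  filter_upwards [h0, h1] with u b0 b1
  have n1 : 0 ≤ |u.1| + ‖u.2‖ ^ 2 := by positivity
  rw [abs_neg] at b1
  rw [Fin.forall_fin_two]
  exact ⟨b0.trans (mul_le_mul_of_nonneg_right (by linarith) n1),
    b1.trans (mul_le_mul_of_nonneg_right (by linarith) n1)⟩

lemma LocalData.Describes.eventually_gap {Δ : LocalData} (h : Δ.Describes 𝓢 τ f p ψ) :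
    ∀ᶠ s in 𝓝 (0 : ℝ), 0 ≤ s → Δ.a * s ≤ Δ.Z 0 (s, 0) - Δ.Z 1 (s, 0) := by
  obtain ⟨C₁, hC₁, h1⟩ := h.Z_zero.exists_pos
  obtain ⟨C₂, hC₂, h2⟩ := h.Z_one.exists_pos
  have ht : Tendsto (fun s : ℝ ↦ (s, (0 : Plane))) (𝓝 0) (𝓝 0) :=
    (Continuous.tendsto' (by fun_prop) _ _ rfl)
  have ha := h.a_pos
  filter_upwards [ht.eventually h1.bound, ht.eventually h2.bound,
    eventually_lt_nhds (show (0 : ℝ) < Δ.a / (C₁ + C₂) by positivity)] with s b1 b2 b3 hs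
  have hq : ∀ B : Matrix (Fin 2) (Fin 2) ℝ, quad B 0 = 0 := fun B ↦ by simp [quad]
  simp only [hq, norm_zero, mul_zero, add_zero, Real.norm_eq_abs] at b1 b2
  rw [zero_pow three_ne_zero, zero_add, abs_of_nonneg (sq_nonneg s)] at b1 b2
  rw [lt_div_iff₀ (by positivity)] at b3
  have := abs_le.1 b1
  have := abs_le.1 b2
  nlinarith

lemma transverse_sheetMap (A : Fin 2) (s : ℝ) (ξ : Plane) :
    transverse (sheetMap T Z η A s ξ) = η.symm ξ := by
  simp [sheetMap]

lemma NormalModel.exists_sheetBounds (hψ : IsNormalChart 𝓢 p ψ)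
    (N : NormalModel (coordG 𝓢 ψ) (τ ∘ ψ.symm) (fun A ↦ f A ∘ ψ.symm) F T Z ζ S)
    (hη : IsMorseChart a S e ε₀ ε₁ η) (ha : a = (localData (τ ∘ ψ.symm) F T Z ζ S).a) :
    ∃ c > 0, ∃ C > 0, ∃ δ > 0, SheetBounds 𝓢 ψ T Z η a c C δ := by
  have hx : Tendsto (fun u : ℝ × Plane ↦ (u.1, η.symm u.2)) (𝓝 0) (𝓝 0) := by
    have h1 : Tendsto (fun u : ℝ × Plane ↦ η.symm u.2) (𝓝 0) (𝓝 0) :=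
      hη.tendsto_symm.comp (Continuous.tendsto' (by fun_prop) _ _ rfl)
    exact (Continuous.tendsto' (by fun_prop) _ _ rfl : Tendsto (fun u : ℝ × Plane ↦ u.1) (𝓝 0) (𝓝 0)).prodMk_nhds h1
  have hsnd : SmoothNear (fun u : ℝ × Plane ↦ u.2) 0 := .of_contDiff contDiff_snd
  have hfst : SmoothNear (fun u : ℝ × Plane ↦ u.1) 0 := .of_contDiff contDiff_fst
  have sη : SmoothNear (fun u : ℝ × Plane ↦ η.symm u.2) 0 :=
    SmoothNear.comp (g := η.symm) hη.smoothNear_symm hsnd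
  have sZ : ∀ A, SmoothNear (fun u : ℝ × Plane ↦ Z A (u.1, η.symm u.2)) 0 := fun A ↦
    SmoothNear.comp (g := Z A) (f := fun u : ℝ × Plane ↦ (u.1, η.symm u.2))
      (by rw [Prod.fst_zero, Prod.snd_zero, hη.symm_zero]; exact N.crease.Z_smooth A) (hfst.prodMk sη)
  have sy : ∀ A, SmoothNear (fun u : ℝ × Plane ↦
      (u.1, spt (η.symm u.2) (Z A (u.1, η.symm u.2)))) 0 := fun A ↦
    hfst.prodMk (SmoothNear.comp (g := sptL) (.of_contDiff sptL.contDiff) (sη.prodMk (sZ A)))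
  have hy0 A : ((0 : ℝ × Plane).1, spt (η.symm (0 : ℝ × Plane).2)
      (Z A ((0 : ℝ × Plane).1, η.symm (0 : ℝ × Plane).2))) = 0 := by
    have hz : Z A (0, (0 : Plane)) = 0 := N.crease.Z_zero A
    rw [Prod.fst_zero, Prod.snd_zero, hη.symm_zero, hz, spt_zero_zero]
    rfl
  have sX : ∀ A, SmoothNear (fun u : ℝ × Plane ↦ sheetMap T Z η A u.1 u.2) 0 := fun A ↦
    SmoothNear.comp (g := ptL) smoothNear_ptL
      ((SmoothNear.comp (g := T) (by rw [hy0]; exact N.slice.smooth) (sy A)).prodMk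
        (SmoothNear.comp (g := sptL) (.of_contDiff sptL.contDiff) (sη.prodMk (sZ A))))
  have ty : ∀ A, Tendsto (fun u : ℝ × Plane ↦
      (u.1, spt (η.symm u.2) (Z A (u.1, η.symm u.2)))) (𝓝 0) (𝓝 0) := fun A ↦ by
    have := (sy A).continuousAt.tendsto
    rwa [hy0] at this
  have hX0 A : sheetMap T Z η A 0 0 = 0 := by
    have h1 := hy0 A
    rw [Prod.fst_zero, Prod.snd_zero] at h1
    have h2 : spt (η.symm 0) (Z A (0, η.symm 0)) = 0 := congrArg Prod.snd h1
    rw [sheetMap, h1, N.slice.zero, h2, pt_zero_zero]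
  have tX : ∀ A, Tendsto (fun u : ℝ × Plane ↦ sheetMap T Z η A u.1 u.2) (𝓝 0) (𝓝 0) := fun A ↦ by
    have := (sX A).continuousAt.tendsto
    rw [Prod.fst_zero, Prod.snd_zero, hX0] at this
    exact this
  obtain ⟨C₁, hC₁, hsp⟩ := N.eventually_spacelike_bounds
  obtain ⟨c, hc, hD⟩ := hη.exists_norm_le_mul_fderiv
  obtain ⟨C₂, hC₂, hZ⟩ := (N.describes hψ).exists_Z_bound
  obtain ⟨C₃, hC₃, hη2⟩ := exists_isBigO_bound (n := 1) (by simpa using hη.isBigO_symm)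
  have htgt : ∀ᶠ X in 𝓝 (0 : E4), X ∈ ψ.target := ψ.open_target.mem_nhds hψ.zero_mem_target
  have t2 : Tendsto (fun u : ℝ × Plane ↦ u.2) (𝓝 0) (𝓝 0) := Continuous.tendsto' (by fun_prop) _ _ rfl
  have hgap := (N.describes hψ).eventually_gap
  have hDu := fun A ↦ eventually_norm_sub_lt (sX A).fderiv.continuousAt one_pos
  have hall := eventually_all.2 fun A ↦ ((tX A).eventually htgt).and (((sX A).and (hDu A)).and
    (((tX A).eventually hsp).and (((tX A).eventually N.model.h_smooth).and
      ((ty A).eventually N.slice.apply_graph).eventually_nhds)))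
  obtain ⟨δ₁, hδ₁, hb⟩ := eventually_nhds_iff_ball.1 (hall.and ((t2.eventually hD).and
    ((hx.eventually hZ).and (t2.eventually hη2))))
  obtain ⟨δ₂, hδ₂, hg⟩ := eventually_nhds_iff_ball.1 hgap
  have hmem (s : ℝ) : |s| < min δ₁ δ₂ → ∀ ξ ∈ disc (min δ₁ δ₂),
      (s, ξ) ∈ ball (0 : ℝ × Plane) δ₁ := by
    intro hs ξ hξ
    rw [mem_ball_zero_iff] at hξ ⊢
    exact max_lt (hs.trans_le (min_le_left _ _)) (hξ.trans_le (min_le_left _ _))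
  obtain ⟨B, hB, hB'⟩ : ∃ B, 0 < B ∧
      ∀ A, ‖fderiv ℝ (fun u : ℝ × Plane ↦ sheetMap T Z η A u.1 u.2) 0‖ + 1 ≤ B := by
    refine ⟨‖fderiv ℝ (fun u : ℝ × Plane ↦ sheetMap T Z η 0 u.1 u.2) 0‖ +
      ‖fderiv ℝ (fun u : ℝ × Plane ↦ sheetMap T Z η 1 u.1 u.2) 0‖ + 1, by positivity, ?_⟩
    rw [Fin.forall_fin_two]
    constructor
    · linarith [norm_nonneg (fderiv ℝ (fun u : ℝ × Plane ↦ sheetMap T Z η 1 u.1 u.2) 0)]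
    · linarith [norm_nonneg (fderiv ℝ (fun u : ℝ × Plane ↦ sheetMap T Z η 0 u.1 u.2) 0)]
  have hsm A s : |s| < min δ₁ δ₂ → ∀ ξ ∈ disc (min δ₁ δ₂),
      ContDiffAt ℝ ∞ (sheetMap T Z η A s) ξ := by
    intro hs ξ hξ
    have h1 := ((hb _ (hmem s hs ξ hξ)).1 A).2.1.1
    have h2 : ContDiffAt ℝ ∞ (fun ξ : Plane ↦ (s, ξ)) ξ := contDiffAt_const.prodMk contDiffAt_id
    exact ContDiffAt.comp (g := fun u : ℝ × Plane ↦ sheetMap T Z η A u.1 u.2) ξ h1 h2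
  refine ⟨c / 2, by positivity, (C₁ + 1) * B + C₂ * (1 + C₃ ^ 2), by positivity, min δ₁ δ₂,
    by positivity, fun A s hs ξ hξ ↦ ((hb _ (hmem s hs ξ hξ)).1 A).1, hsm,
    fun A s hs ξ hξ w ↦ ?_, fun A s hs ξ hξ ↦ ?_, fun s hs0 hs ↦ ?_⟩
  · obtain ⟨-, ⟨h1, hDu⟩, hsp, hhs, hgr⟩ := (hb _ (hmem s hs ξ hξ)).1 A
    have hd := (hsm A s hs ξ hξ).differentiableAt (by simp)
    have hk : fderiv ℝ (τ ∘ ψ.symm) (sheetMap T Z η A s ξ)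
        (fderiv ℝ (sheetMap T Z η A s) ξ w) = 0 := by
      have h2 := fderiv_fun_comp (g := τ ∘ ψ.symm) ξ (hhs.differentiableAt (by simp)) hd
      have h3 : (fun ξ ↦ (τ ∘ ψ.symm) (sheetMap T Z η A s ξ)) =ᶠ[𝓝 ξ] fun _ ↦ s := by
        have h4 : Tendsto (fun ξ : Plane ↦ (s, ξ)) (𝓝 ξ) (𝓝 (s, ξ)) :=
          Continuous.tendsto' (by fun_prop) _ _ rfl
        exact (h4.eventually hgr).mono fun ξ' h ↦ h
      have h5 := h3.fderiv_eq (𝕜 := ℝ)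
      rw [h2, fderiv_const_apply] at h5
      exact DFunLike.congr_fun h5 w
    obtain ⟨hl, hu⟩ := hsp _ hk
    have h4 := (hb _ (hmem s hs ξ hξ)).2.1 _ (transverse_sheetMap A s) hd w
    have h5 : ‖fderiv ℝ (sheetMap T Z η A s) ξ w‖ ≤ B * ‖w‖ := by
      have h6 : HasFDerivAt (sheetMap T Z η A s)
          (fderiv ℝ (fun u : ℝ × Plane ↦ sheetMap T Z η A u.1 u.2) (s, ξ) ∘L .inr ℝ ℝ Plane) ξ :=
        HasFDerivAt.comp (g := fun u : ℝ × Plane ↦ sheetMap T Z η A u.1 u.2)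
          (f := fun ξ : Plane ↦ (s, ξ)) ξ (h1.differentiableAt (by simp)).hasFDerivAt
          (hasFDerivAt_prodMk_right s ξ)
      rw [h6.fderiv]
      refine ((fderiv ℝ (fun u : ℝ × Plane ↦ sheetMap T Z η A u.1 u.2) (s, ξ)).le_opNorm (0, w)).trans ?_
      have h7 : ‖((0 : ℝ), w)‖ = ‖w‖ := by simp [Prod.norm_def]
      rw [h7]
      exact mul_le_mul_of_nonneg_right (hDu.2.le.trans (hB' A)) (norm_nonneg _)
    constructor
    · have h8 : (c * ‖w‖) ^ 2 ≤ ‖fderiv ℝ (sheetMap T Z η A s) ξ w‖ ^ 2 :=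
        pow_le_pow_left₀ (by positivity) h4 2
      nlinarith
    · have h8 : ‖fderiv ℝ (sheetMap T Z η A s) ξ w‖ ^ 2 ≤ (B * ‖w‖) ^ 2 :=
        pow_le_pow_left₀ (norm_nonneg _) h5 2
      have h9 : C₁ * B ^ 2 ≤ ((C₁ + 1) * B + C₂ * (1 + C₃ ^ 2)) ^ 2 := by
        have h10 : ((C₁ + 1) * B) ^ 2 ≤ ((C₁ + 1) * B + C₂ * (1 + C₃ ^ 2)) ^ 2 :=
          pow_le_pow_left₀ (by positivity) (by linarith [show 0 < C₂ * (1 + C₃ ^ 2) by positivity]) 2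
        have h11 : C₁ * B ^ 2 ≤ (C₁ + 1) ^ 2 * B ^ 2 :=
          mul_le_mul_of_nonneg_right (by nlinarith) (sq_nonneg _)
        linarith [mul_pow (C₁ + 1) B 2]
      calc _ ≤ C₁ * ‖fderiv ℝ (sheetMap T Z η A s) ξ w‖ ^ 2 := hu
        _ ≤ C₁ * (B * ‖w‖) ^ 2 := mul_le_mul_of_nonneg_left h8 hC₁.le
        _ = C₁ * B ^ 2 * ‖w‖ ^ 2 := by ring
        _ ≤ _ := mul_le_mul_of_nonneg_right h9 (sq_nonneg _)
  · obtain ⟨-, -, h1, h2⟩ := hb _ (hmem s hs ξ hξ)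
    have h3 : |Z A (s, η.symm ξ)| ≤ C₂ * (|s| + ‖η.symm ξ‖ ^ 2) := h1 A
    rw [pow_one] at h2
    have h4 : ‖η.symm ξ‖ ^ 2 ≤ (C₃ * ‖ξ‖) ^ 2 := pow_le_pow_left₀ (norm_nonneg _) h2 2
    have h5 : |s| + ‖η.symm ξ‖ ^ 2 ≤ (1 + C₃ ^ 2) * (|s| + ‖ξ‖ ^ 2) := by
      nlinarith [abs_nonneg s, sq_nonneg ‖ξ‖, mul_nonneg (sq_nonneg C₃) (abs_nonneg s)]
    have h6 : 0 ≤ (C₁ + 1) * B * (|s| + ‖ξ‖ ^ 2) := by positivity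
    nlinarith [mul_le_mul_of_nonneg_left h5 hC₂.le]
  · rw [ha]
    refine hg s ?_ hs0
    rw [mem_ball_zero_iff, Real.norm_eq_abs, abs_of_nonneg hs0]
    exact hs.trans_le (min_le_right _ _)

lemma SheetBounds.exists_area {a c C δ r ρ s : ℝ} (B : SheetBounds 𝓢 ψ T Z η a c C δ)
    (hψ : ψ ∈ 𝒜 M) (hc : 0 < c) (hρ : 0 ≤ ρ) (hρr : ρ < r)
    (hrδ : r ≤ δ) (hrη : ball 0 r ⊆ η.target) (hs : |s| < δ) (A : Fin 2) :
    ∃ α, IsSurfaceOfArea 𝓢 ((fun ξ ↦ ψ.symm (sheetMap T Z η A s ξ)) '' closedBall 0 ρ) α ∧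
      OfOrder (Real.pi * c ^ 2) (Real.pi * C ^ 2) (ρ ^ 2) α := by
  have hsub : disc r ⊆ ball 0 δ := ball_subset_ball hrδ
  have hR : closedBall (0 : Plane) ρ ⊆ ball 0 r := closedBall_subset_ball hρr
  let u : Plane → E4 := sheetMap T Z η A s
  have hut : ∀ ξ ∈ disc r, u ξ ∈ ψ.target := fun ξ h ↦ B.target A s hs ξ (hsub h)
  have hus : ∀ ξ ∈ disc r, ContDiffAt ℝ ∞ u ξ :=
    fun ξ h ↦ B.smooth A s hs ξ (hsub h)
  have hv ξ (hξ : ξ ∈ disc r) : ∀ i j : Fin 2,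
      𝓢.metric (ψ.symm (u ξ)) (partialVelocity (fun ξ ↦ ψ.symm (u ξ)) ξ i)
        (partialVelocity (fun ξ ↦ ψ.symm (u ξ)) ξ j) =
      coordG 𝓢 ψ (u ξ) (fderiv ℝ u ξ (single i 1))
        (fderiv ℝ u ξ (single j 1)) := by
    intro i j
    have h1 := fun i : Fin 2 ↦ mfderiv_symm_comp hψ (hut ξ hξ)
      ((hus ξ hξ).differentiableAt (by simp)) (single i (1 : ℝ) : Plane)
    rw [coordG_apply, coordMetric, ← h1 i, ← h1 j]
    rfl
  have hdet ξ (hξ : ξ ∈ disc r) : √(Matrix.det (Matrix.of fun i j : Fin 2 ↦ 𝓢.metric (ψ.symm (u ξ))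
        (partialVelocity (fun ξ ↦ ψ.symm (u ξ)) ξ i)
        (partialVelocity (fun ξ ↦ ψ.symm (u ξ)) ξ j))) =
      √(Matrix.det (Matrix.of fun i j : Fin 2 ↦ coordG 𝓢 ψ (u ξ)
        (fderiv ℝ u ξ (single i 1)) (fderiv ℝ u ξ (single j 1)))) := by
    congr 2
    ext i j
    exact hv ξ hξ i j
  have hbd : ∀ ξ ∈ disc r, _ := fun ξ hξ ↦
    gram_bounds (G := coordG 𝓢 ψ (u ξ)) (d := fderiv ℝ u ξ) hc (coordMetric_symm (u ξ))
      (B.metric A s hs ξ (hsub hξ))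
  have hcont : ContinuousOn (fun ξ ↦ √(Matrix.det (Matrix.of fun i j : Fin 2 ↦ coordG 𝓢 ψ (u ξ)
      (fderiv ℝ u ξ (single i 1)) (fderiv ℝ u ξ (single j 1)))))
      (closedBall 0 ρ) := by
    intro ξ hξ
    refine ContinuousAt.continuousWithinAt ?_
    refine ContinuousAt.sqrt ?_
    have h1 : ContinuousAt (fderiv ℝ u) ξ :=
      ((hus ξ (hR hξ)).fderiv_right (m := 0) (by simp)).continuousAt
    have h2 : ContinuousAt (fun ξ ↦ coordG 𝓢 ψ (u ξ)) ξ :=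
      ContinuousAt.comp (g := coordG 𝓢 ψ) (((contDiffOn_coordG hψ).continuousOn).continuousAt
        (ψ.open_target.mem_nhds (hut ξ (hR hξ)))) (hus ξ (hR hξ)).continuousAt
    have h3 : ∀ i j : Fin 2, ContinuousAt (fun ξ ↦ coordG 𝓢 ψ (u ξ)
        (fderiv ℝ u ξ (single i 1)) (fderiv ℝ u ξ (single j 1))) ξ :=
      fun i j ↦ (h2.clm_apply (h1.clm_apply continuousAt_const)).clm_apply
        (h1.clm_apply continuousAt_const)
    simp only [Matrix.det_fin_two, Matrix.of_apply]
    exact ((h3 0 0).mul (h3 1 1)).sub ((h3 0 1).mul (h3 1 0))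
  have hcpt : IsCompact (closedBall (0 : Plane) ρ) := isCompact_closedBall _ _
  refine ⟨_, ⟨fun ξ ↦ ψ.symm (u ξ), ball 0 r, closedBall 0 ρ, isOpen_ball,
    hcpt, hR, fun ξ hξ ↦ (contMDiffAt_symm_comp hψ (hut ξ hξ) (hus ξ hξ)).contMDiffWithinAt,
    fun ξ hξ ξ' hξ' h ↦ ?_, rfl, rfl⟩, ?_⟩
  · have h1 := congrArg transverse (ψ.symm.injOn (hut ξ hξ) (hut ξ' hξ') h)
    simp only [u, transverse_sheetMap] at h1
    exact η.symm.injOn (hrη hξ) (hrη hξ') h1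
  · rw [setIntegral_congr_fun isClosed_closedBall.measurableSet fun ξ hξ ↦ hdet ξ (hR hξ)]
    have hJ := hcont.integrableOn_compact hcpt (μ := volume)
    have hvol : (volume : Measure Plane).real (closedBall 0 ρ) = Real.pi * ρ ^ 2 := by
      rw [Measure.real, EuclideanSpace.volume_closedBall_fin_two, ENNReal.toReal_mul, ENNReal.toReal_pow, ENNReal.toReal_ofReal hρ,
        mul_comm, ENNReal.toReal_ofReal Real.pi_nonneg]
    have hconst : ∀ k : ℝ, IntegrableOn (fun _ : Plane ↦ k) (closedBall 0 ρ) volume := fun k ↦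
      continuousOn_const.integrableOn_compact hcpt
    have h1 := setIntegral_mono_on (hconst (c ^ 2)) hJ
      isClosed_closedBall.measurableSet fun ξ hξ ↦ (hbd ξ (hR hξ)).1
    have h2 := setIntegral_mono_on hJ (hconst (C ^ 2))
      isClosed_closedBall.measurableSet fun ξ hξ ↦ (hbd ξ (hR hξ)).2
    rw [setIntegral_const, smul_eq_mul, hvol] at h1 h2
    exact ⟨by linarith, by linarith⟩

namespace LocalPicture

variable {s : ℝ}

lemma sheetMap_mem (L : ℒ D τ₁) (hs : |s| < τ₁) {ξ : Plane}
    (hξ : ξ ∈ D) (hξs : S (η.symm ξ) ≤ s) (A : Fin 2) :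
    ψ.symm (sheetMap T Z η A s ξ) ∈ ℋ s ∧
      f A (ψ.symm (sheetMap T Z η A s ξ)) = 0 ∧
      ψ (ψ.symm (sheetMap T Z η A s ξ)) = sheetMap T Z η A s ξ := by
  have hle := (L.le_iff hs hξ).1.1 hξs
  have hA : Z 1 (s, η.symm ξ) ≤ Z A (s, η.symm ξ) ∧ Z A (s, η.symm ξ) ≤ Z 0 (s, η.symm ξ) := by
    fin_cases A
    · exact ⟨hle, le_rfl⟩
    · exact ⟨le_rfl, hle⟩
  obtain ⟨h1, h2, h3, -⟩ := L.point s ξ _ hs hξ hA.1 hA.2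
  have h4 : ψ (ψ.symm (sheetMap T Z η A s ξ)) = sheetMap T Z η A s ξ := ψ.right_inv h1
  change ψ.symm (sheetMap T Z η A s ξ) ∈ W at h2
  change τ (ψ.symm (sheetMap T Z η A s ξ)) = s at h3
  have h5 : f A (ψ.symm (sheetMap T Z η A s ξ)) = 0 := by
    rw [L.sheet_iff _ h2, h3, h4, transverse_sheetMap]
    simp only [sheetMap, pt_three', spt_two']
  refine ⟨⟨⟨h2, (L.horizon_iff _ h2).2 ⟨?_, ?_⟩⟩, h3⟩, h5, h4⟩
  · fin_cases A
    · exact .inl h5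
    · exact .inr h5
  · rwa [h4, h3, transverse_sheetMap]

lemma exists_sheetMap (L : ℒ D τ₁) {q : M} {A : Fin 2}
    (hq : q ∈ ℋ s) (hA : f A q = 0) :
    ∃ ξ ∈ D, S (η.symm ξ) ≤ s ∧ ψ q = sheetMap T Z η A s ξ ∧
      ψ.symm (sheetMap T Z η A s ξ) = q := by
  obtain ⟨h1, h2, -, h3, h4⟩ := L.mem_slice_union (.inl hq)
  obtain ⟨-, h5, -, h6⟩ := L.coord q h1
  have h7 := (L.sheet_iff q h1 A).1 hA
  have h8 : ψ q = sheetMap T Z η A s (η (transverse (ψ q))) := by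
    rw [sheetMap, η.left_inv h5, ← h2, ← h7, spt_transverse, ← h6, pt_spatial]
  exact ⟨_, h3, h4, h8, by rw [← h8]; exact ψ.left_inv (L.subset_source h1)⟩

lemma saucerScaling {r a c C δ c' C' δ' k₁ k₂ : ℝ}
    (L : ℒ (ball 0 r) τ₁)
    (B : CreaseBounds 𝓢 τ f ψ F ζ η c C δ) (B' : SheetBounds 𝓢 ψ T Z η a c' C' δ')
    (hψ : ψ ∈ 𝒜 M) (hC : 0 < C) (hc' : 0 < c') (hC' : 0 < C')
    (hr : 0 < r) (hrδ : r ≤ δ) (hrδ' : r ≤ δ') (ha : 0 < a)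
    (hs : |s| < τ₁) (hs0 : 0 < s) (hsδ : s < δ') (hsr : 2 * a * s < r ^ 2)
    (hS : ∀ ξ ∈ disc r, S (η.symm ξ) ≤ s ↔ ‖ξ‖ ^ 2 ≤ 2 * a * s)
    (h₁ : k₁ ≤ a) (h₂ : k₁ ≤ 4 * a * Real.pi * c' ^ 2) (h₃ : C * √(2 * a) ≤ k₂)
    (h₄ : C' * (1 + 2 * a) ≤ k₂) (h₅ : 4 * a * Real.pi * C' ^ 2 ≤ k₂) :
    SaucerScaling 𝓢 f ψ k₁ k₂ s (ℋ s) := by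
  obtain ⟨ρ, hρ, hρ2, hρe⟩ : ∃ ρ, 0 < ρ ∧ ρ ^ 2 = 2 * a * s ∧ ρ = √(2 * a) * √s := by
    refine ⟨_, by positivity, ?_, rfl⟩
    rw [mul_pow, Real.sq_sqrt (by positivity), Real.sq_sqrt hs0.le]
  have hρr : ρ < r := lt_of_pow_lt_pow_left₀ 2 hr.le (by rwa [hρ2])
  have hS' ξ (hξ : ξ ∈ disc r) : S (η.symm ξ) ≤ s ↔ ‖ξ‖ ≤ ρ := by
    rw [hS ξ hξ, ← hρ2, pow_le_pow_iff_left₀ (norm_nonneg _) hρ.le two_ne_zero]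
  have hsδ' : |s| < δ' := by rwa [abs_of_pos hs0]
  have hball : ∀ ξ : Plane, ‖ξ‖ ≤ ρ → ξ ∈ disc r := fun ξ h ↦ by
    rw [mem_ball_zero_iff]; exact h.trans_lt hρr
  have hsub : disc r ⊆ ball 0 δ := ball_subset_ball hrδ
  have hsub' : disc r ⊆ ball 0 δ' := ball_subset_ball hrδ'
  have hq q (hq : q ∈ ℋ s) : ∃ A, ∃ ξ : Plane, ‖ξ‖ ≤ ρ ∧
      ψ q = sheetMap T Z η A s ξ := by
    obtain ⟨A, hA⟩ : ∃ A, f A q = 0 := by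
      rcases ((L.horizon_iff q hq.1.1).1 hq.1.2).1 with h | h
      · exact ⟨0, h⟩
      · exact ⟨1, h⟩
    obtain ⟨ξ, h1, h2, h3, -⟩ := L.exists_sheetMap hq hA
    exact ⟨A, ξ, (hS' ξ h1).1 h2, h3⟩
  refine ⟨fun q h ↦ ?_, fun q h ↦ ?_, ?_, ?_⟩
  · obtain ⟨A, ξ, h1, h2⟩ := hq q h
    have hu := B.upper ξ (hsub (hball ξ h1)) 0 (hsub (mem_ball_self hr))
    rw [B.map_zero, sub_zero, sub_zero] at hu
    rw [h2, transverse_sheetMap, ← transverse_creaseMap (F := F) (ζ := ζ)]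
    refine (norm_transverse_le _).trans (hu.trans ?_)
    calc C * ‖ξ‖ ≤ C * ρ := by gcongr
      _ = C * √(2 * a) * √s := by rw [hρe]; ring
      _ ≤ k₂ * √s := by gcongr
  · obtain ⟨A, ξ, h1, h2⟩ := hq q h
    have hh := B'.height A s hsδ' ξ (hsub' (hball ξ h1))
    rw [h2]
    simp only [sheetMap, pt_three', spt_two']
    refine hh.trans ?_
    rw [abs_of_pos hs0]
    calc C' * (s + ‖ξ‖ ^ 2) ≤ C' * (s + ρ ^ 2) := by gcongr
      _ = C' * (1 + 2 * a) * s := by rw [hρ2]; ring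
      _ ≤ k₂ * s := by gcongr
  · have h0 : (0 : Plane) ∈ disc r := mem_ball_self hr
    have hS0 : S (η.symm 0) ≤ s := (hS' 0 h0).2 (by rw [norm_zero]; exact hρ.le)
    obtain ⟨m0, -, e0⟩ := L.sheetMap_mem hs h0 hS0 0
    obtain ⟨m1, -, e1⟩ := L.sheetMap_mem hs h0 hS0 1
    refine ⟨_, m0, _, m1, ?_⟩
    rw [e0, e1]
    simp only [sheetMap, pt_three', spt_two', L.η_zero]
    exact (mul_le_mul_of_nonneg_right h₁ hs0.le).trans (B'.gap s hs0.le hsδ)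
  · have hset A : {q ∈ ℋ s | f A q = 0} =
        (fun ξ ↦ ψ.symm (sheetMap T Z η A s ξ)) '' closedBall 0 ρ := by
      ext q
      constructor
      · rintro ⟨h1, h2⟩
        obtain ⟨ξ, h3, h4, -, h5⟩ := L.exists_sheetMap h1 h2
        exact ⟨ξ, mem_closedBall_zero_iff.2 ((hS' ξ h3).1 h4), h5⟩
      · rintro ⟨ξ, h1, rfl⟩
        have h1' := mem_closedBall_zero_iff.1 h1
        obtain ⟨h2, h3, -⟩ := L.sheetMap_mem hs (hball ξ h1') ((hS' ξ (hball ξ h1')).2 h1') A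
        exact ⟨h2, h3⟩
    choose α hα hα' using B'.exists_area hψ hc' hρ.le hρr hrδ' L.D_subset hsδ'
    refine ⟨α, fun A ↦ by rw [hset]; exact hα A, ?_⟩
    rw [hρ2] at hα'
    obtain ⟨b1, b2⟩ := hα' 0
    obtain ⟨b3, b4⟩ := hα' 1
    constructor
    · nlinarith [mul_le_mul_of_nonneg_right h₂ hs0.le]
    · nlinarith [mul_le_mul_of_nonneg_right h₅ hs0.le]

end LocalPicture

/-! ### The merger -/

section Hyperbola

variable {M : Type*} [TopologicalSpace M] {D : Set Plane} {i j : Fin 2} {κ : ℝ}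

lemma abs_eq_one_of_sq {σ : ℝ} (h : σ ^ 2 = 1) : |σ| = 1 := by
  rw [← pow_left_inj₀ (abs_nonneg σ) zero_le_one two_ne_zero, sq_abs, h, one_pow]

lemma sq_norm_eq_of_ne (hij : i ≠ j) (ξ : Plane) : ‖ξ‖ ^ 2 = ξ i ^ 2 + ξ j ^ 2 := by
  rw [LocalPicture.norm_sq_plane]
  fin_cases i <;> fin_cases j <;> simp_all [add_comm]

/-- A point of a hyperbola is joined to a vertex. -/
lemma vertex_mem_connectedComponentIn {C : Set M} {Y : Plane → M} (hij : i ≠ j) (hκ : 0 < κ)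
    (hD : ∀ ξ ∈ D, ∀ ξ' : Plane, (∀ k, |ξ' k| ≤ |ξ k|) → ξ' ∈ D) (hY : ContinuousOn Y D)
    (hC : ∀ ξ ∈ D, ξ i ^ 2 = ξ j ^ 2 + κ → Y ξ ∈ C) {ξ : Plane} (hξ : ξ ∈ D)
    (h : ξ i ^ 2 = ξ j ^ 2 + κ) {σ : ℝ} (hσ : σ ^ 2 = 1) (hσξ : 0 < σ * ξ i) :
    Y (single i (σ * √κ)) ∈ connectedComponentIn C (Y ξ) := by
  let γ : ℝ → Plane := fun t ↦ single i (σ * √(t ^ 2 * ξ j ^ 2 + κ)) +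
    single j (t * ξ j)
  have hi : ∀ t, γ t i = σ * √(t ^ 2 * ξ j ^ 2 + κ) := fun t ↦ by simp [γ, hij]
  have hj : ∀ t, γ t j = t * ξ j := fun t ↦ by simp [γ, hij.symm]
  have hext (x y : Plane) : x i = y i → x j = y j → x = y := by
    intro h1 h2
    ext k
    fin_cases i <;> fin_cases j <;> fin_cases k <;> simp_all
  have hfor (P : Fin 2 → Prop) : P i → P j → ∀ k, P k := by
    intro h1 h2 k
    fin_cases i <;> fin_cases j <;> fin_cases k <;> simp_all
  have hγ : Continuous γ := by
    have h1 : ∀ (k : Fin 2) (u : ℝ → ℝ), Continuous u →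
        Continuous fun t ↦ (single k (u t) : Plane) := by
      intro k u hu
      have : (fun t ↦ (single k (u t) : Plane)) =
          fun t ↦ u t • (single k 1 : Plane) := by
        funext t
        ext l
        simp
      rw [this]
      exact hu.smul continuous_const
    exact (h1 _ _ (by fun_prop)).add (h1 _ _ (by fun_prop))
  have habs t : |γ t i| = √(t ^ 2 * ξ j ^ 2 + κ) := by
    rw [hi, abs_mul, abs_of_nonneg (Real.sqrt_nonneg _), abs_eq_one_of_sq hσ, one_mul]
  have hmem t (ht : t ∈ Icc (0 : ℝ) 1) : γ t ∈ D := by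
    refine hD ξ hξ _ (hfor _ ?_ ?_)
    · rw [habs, ← Real.sqrt_sq_eq_abs, h]
      refine Real.sqrt_le_sqrt ?_
      have : t ^ 2 ≤ 1 := pow_le_one₀ ht.1 ht.2
      nlinarith [sq_nonneg (ξ j)]
    · rw [hj, abs_mul, abs_of_nonneg ht.1]
      exact mul_le_of_le_one_left (abs_nonneg _) ht.2
  have hcon : IsPreconnected ((fun t ↦ Y (γ t)) '' Icc (0 : ℝ) 1) :=
    isPreconnected_Icc.image _ (hY.comp hγ.continuousOn hmem)
  have h1 : γ 1 = ξ := by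
    refine hext _ _ ?_ (by rw [hj, one_mul])
    rw [hi, one_pow, one_mul, ← h, Real.sqrt_sq_eq_abs]
    have h2 : |σ * ξ i| = |ξ i| := by
      rw [abs_mul, abs_eq_one_of_sq hσ, one_mul]
    rw [← h2, abs_of_pos hσξ, ← mul_assoc, ← sq, hσ, one_mul]
  have h0 : γ 0 = single i (σ * √κ) := by
    refine hext _ _ ?_ ?_
    · rw [hi]; simp
    · rw [hj]; simp [hij.symm]
  refine hcon.subset_connectedComponentIn (x := Y ξ) ⟨1, by simp, by simp only [h1]⟩ ?_
    ⟨0, by simp, by simp only [h0]⟩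
  rintro _ ⟨t, ht, rfl⟩
  refine hC _ (hmem t ht) ?_
  rw [← sq_abs, habs, Real.sq_sqrt (by positivity), hj, mul_pow]

lemma mem_connectedComponentIn_hyperbola {C : Set M} {Y : Plane → M} {g : M → Plane}
    (hij : i ≠ j) (hκ : 0 < κ)
    (hD : ∀ ξ ∈ D, ∀ ξ' : Plane, (∀ k, |ξ' k| ≤ |ξ k|) → ξ' ∈ D) (hY : ContinuousOn Y D)
    (hC : ∀ ξ ∈ D, ξ i ^ 2 = ξ j ^ 2 + κ → Y ξ ∈ C) (hg : ContinuousOn g C)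
    (hgC : ∀ q ∈ C, g q ∈ D ∧ g q i ^ 2 = g q j ^ 2 + κ ∧ Y (g q) = q) {q q' : M} (hq : q ∈ C)
    (hq' : q' ∈ C) : q' ∈ connectedComponentIn C q ↔ 0 < g q i * g q' i := by
  have hne q (hq : q ∈ C) : g q i ≠ 0 := by
    intro h
    have := (hgC q hq).2.1
    rw [h] at this
    nlinarith [sq_nonneg (g q j)]
  constructor
  · intro h
    by_contra hle
    rw [not_lt] at hle
    have hsub := connectedComponentIn_subset C q
    have hcoord : Continuous fun ξ : Plane ↦ ξ i := by fun_prop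
    have h1 : IsPreconnected ((fun q ↦ g q i) '' connectedComponentIn C q) :=
      isPreconnected_connectedComponentIn.image _ (hcoord.comp_continuousOn (hg.mono hsub))
    have h2 : uIcc (g q i) (g q' i) ⊆ (fun q ↦ g q i) '' connectedComponentIn C q :=
      h1.ordConnected.uIcc_subset ⟨q, mem_connectedComponentIn hq, rfl⟩ ⟨q', h, rfl⟩
    have h3 : (0 : ℝ) ∈ uIcc (g q i) (g q' i) := by
      rw [mem_uIcc]
      rcases mul_nonpos_iff.1 hle with h | h
      · exact .inr ⟨h.2, h.1⟩
      · exact .inl ⟨h.1, h.2⟩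
    obtain ⟨x, hx, hx0⟩ := h2 h3
    exact hne x (hsub hx) hx0
  · intro h
    obtain ⟨σ, hσ, h1, h2⟩ : ∃ σ : ℝ, σ ^ 2 = 1 ∧ 0 < σ * g q i ∧ 0 < σ * g q' i := by
      rcases mul_pos_iff.1 h with h | h
      · exact ⟨1, by norm_num, by linarith [h.1], by linarith [h.2]⟩
      · exact ⟨-1, by norm_num, by linarith [h.1], by linarith [h.2]⟩
    have key q (hq : q ∈ C) : 0 < σ * g q i →
        Y (single i (σ * √κ)) ∈ connectedComponentIn C q := by
      intro h
      obtain ⟨h3, h4, h5⟩ := hgC q hq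
      have := vertex_mem_connectedComponentIn hij hκ hD hY hC h3 h4 hσ h
      rwa [h5] at this
    rw [connectedComponentIn_eq (key q hq h1), ← connectedComponentIn_eq (key q' hq' h2)]
    exact mem_connectedComponentIn hq'

end Hyperbola

lemma CreaseBounds.lower_dist {c C δ : ℝ} (B : CreaseBounds 𝓢 τ f ψ F ζ η c C δ) {ξ ξ' : Plane}
    (hξ : ξ ∈ disc δ) (hξ' : ξ' ∈ disc δ) :
    c * ‖ξ - ξ'‖ ≤ dist (creaseMap F ζ η ξ) (creaseMap F ζ η ξ') := by
  have h1 := B.lower ξ hξ ξ' hξ'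
  have h2 := norm_transverse_le (creaseMap F ζ η ξ - creaseMap F ζ η ξ')
  rw [show transverse (creaseMap F ζ η ξ - creaseMap F ζ η ξ') = _ from map_sub transverseL _ _,
    transverseL_apply, transverseL_apply, transverse_creaseMap, transverse_creaseMap] at h2
  rw [dist_eq_norm]
  exact h1.trans h2

lemma CreaseBounds.continuousOn_symm {c C δ : ℝ} (B : CreaseBounds 𝓢 τ f ψ F ζ η c C δ) :
    ContinuousOn (fun ξ ↦ ψ.symm (creaseMap F ζ η ξ)) (ball 0 δ) := fun ξ hξ ↦
  (ContinuousAt.comp (g := ψ.symm) (f := creaseMap F ζ η) (ψ.continuousAt_symm (B.target ξ hξ))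
    (B.smooth ξ hξ).continuousAt).continuousWithinAt

lemma LocalPicture.hyperbolicScaling {a s c C δ k₁ k₂ : ℝ} {i j : Fin 2}
    (L : ℒ D τ₁)
    (hV : ∀ q ∈ V, f 0 q = 0 → ψ q 0 = F 0 (spatial (ψ q)))
    (B : CreaseBounds 𝓢 τ f ψ F ζ η c C δ) (hc : 0 < c) (hC : 0 < C) (ha : 0 < a)
    (hDδ : D ⊆ ball 0 δ) (hD : ∀ ξ ∈ D, ∀ ξ' : Plane, (∀ k, |ξ' k| ≤ |ξ k|) → ξ' ∈ D)
    (hs : |s| < τ₁) (hs0 : s ≠ 0) (hij : i ≠ j)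
    (hS : ∀ ξ ∈ D, S (η.symm ξ) = s ↔ ξ i ^ 2 = ξ j ^ 2 + 2 * a * |s|)
    (hvert : single i √(2 * a * |s|) ∈ D)
    (h₁ : k₁ ≤ c * √(2 * a)) (h₂ : 4 * C * √(2 * a) ≤ k₂)
    (h₃ : C * (6 * C / c) * √(2 * a) ≤ k₂) (h₄ : C * (6 * C / c) ^ 2 * (2 * a) ≤ k₂) :
    HyperbolicScaling 𝓢 τ f ψ k₁ k₂ s (𝒞 s) := by
  have hκ : 0 < 2 * a * |s| := by have := abs_pos.2 hs0; positivity
  obtain ⟨ρ, hρ, hρ2, hρe, hρκ⟩ : ∃ ρ, 0 < ρ ∧ ρ ^ 2 = 2 * a * |s| ∧ ρ = √(2 * a) * √|s| ∧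
      √(2 * a * |s|) = ρ :=
    ⟨_, Real.sqrt_pos.2 hκ, Real.sq_sqrt hκ.le, Real.sqrt_mul (by positivity) _, rfl⟩
  rw [hρκ] at hvert
  let g : M → Plane := fun q ↦ η (transverse (ψ q))
  have hg : ContinuousOn g (𝒞 s) := by
    intro q hq
    have h1 := hq.1.1
    refine ContinuousAt.continuousWithinAt ?_
    exact ContinuousAt.comp (g := η) (η.continuousAt (L.coord q h1).2.1)
      (ContinuousAt.comp (g := transverse) transverseL.continuous.continuousAt
        (ψ.continuousAt (L.subset_source h1)))
  have hgC q (hq : q ∈ 𝒞 s) : g q ∈ D ∧ g q i ^ 2 = g q j ^ 2 + 2 * a * |s| ∧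
      ψ.symm (creaseMap F ζ η (g q)) = q := by
    obtain ⟨ξ, h1, h2, h3, -, h4⟩ := L.crease_coord hV hq
    subst h3
    exact ⟨h1, (hS _ h1).1 h2, h4⟩
  have hψg q (hq : q ∈ 𝒞 s) : ψ q = creaseMap F ζ η (g q) := by
    obtain ⟨ξ, h1, h2, h3, h4, -⟩ := L.crease_coord hV hq
    subst h3
    exact h4
  have hYC : ∀ ξ ∈ D, ξ i ^ 2 = ξ j ^ 2 + 2 * a * |s| →
      ψ.symm (creaseMap F ζ η ξ) ∈ 𝒞 s := fun ξ h h' ↦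
    (L.creaseMap_mem hV hs h ((hS ξ h).2 h')).1
  have hcc : ∀ {q q'}, q ∈ 𝒞 s → q' ∈ 𝒞 s →
      (q' ∈ connectedComponentIn (𝒞 s) q ↔ 0 < g q i * g q' i) :=
    fun hq hq' ↦ mem_connectedComponentIn_hyperbola hij hκ hD (B.continuousOn_symm.mono hDδ) hYC hg
      hgC hq hq'
  have hlow q (hq : q ∈ 𝒞 s) : ρ ≤ |g q i| := by
    refine le_of_sq_le_sq ?_ (abs_nonneg _)
    rw [sq_abs, (hgC q hq).2.1, hρ2]
    linarith [sq_nonneg (g q j)]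
  have hsep : ∀ {q q'}, q ∈ 𝒞 s → q' ∈ 𝒞 s →
      q' ∉ connectedComponentIn (𝒞 s) q →
      2 * ρ ≤ ‖g q - g q'‖ ∧ |g q i| ≤ ‖g q - g q'‖ := by
    intro q q' hq hq' hn
    rw [hcc hq hq', not_lt] at hn
    have h1 := hlow q hq
    have h2 := hlow q' hq'
    have h3 : |g q i - g q' i| ≤ ‖g q - g q'‖ := by
      have := PiLp.norm_apply_le (g q - g q') i
      rwa [PiLp.sub_apply, Real.norm_eq_abs] at this
    have h4 : |g q i - g q' i| = |g q i| + |g q' i| := by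
      rcases mul_nonpos_iff.1 hn with h | h
      · rw [abs_of_nonneg h.1, abs_of_nonpos h.2, abs_of_nonneg (by linarith)]
        ring
      · rw [abs_of_nonpos h.1, abs_of_nonneg h.2, abs_of_nonpos (by linarith)]
        ring
    constructor <;> linarith
  have hdist : ∀ {q q'}, q ∈ 𝒞 s → q' ∈ 𝒞 s →
      c * ‖g q - g q'‖ ≤ dist (ψ q) (ψ q') := by
    intro q q' hq hq'
    rw [hψg q hq, hψg q' hq']
    exact B.lower_dist (hDδ (hgC q hq).1) (hDδ (hgC q' hq').1)
  have hver (σ : ℝ) : σ ^ 2 = 1 → (single i (σ * ρ) : Plane) ∈ D ∧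
      ψ.symm (creaseMap F ζ η (single i (σ * ρ))) ∈ 𝒞 s ∧
      ψ (ψ.symm (creaseMap F ζ η (single i (σ * ρ)))) =
        creaseMap F ζ η (single i (σ * ρ)) := by
    intro hσ
    have h1 : (single i (σ * ρ) : Plane) ∈ D := by
      refine hD _ hvert _ fun k ↦ ?_
      by_cases h : k = i
      · subst h
        simp [abs_mul, abs_eq_one_of_sq hσ]
      · simp [h]
    have h2 := L.creaseMap_mem hV hs h1 ((hS _ h1).2 ?_)
    · exact ⟨h1, h2⟩
    · simp [hij.symm, mul_pow, hσ, hρ2]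
  obtain ⟨v, hv, v', hv', hvv, hvd⟩ : ∃ v ∈ 𝒞 s,
      ∃ v' ∈ 𝒞 s, v' ∉ connectedComponentIn (𝒞 s) v ∧
        dist (ψ v) (ψ v') ≤ C * (2 * ρ) := by
    obtain ⟨m1, m2, m3⟩ := hver 1 (by norm_num)
    obtain ⟨n1, n2, n3⟩ := hver (-1) (by norm_num)
    refine ⟨_, m2, _, n2, ?_, ?_⟩
    · have hgv ξ (hξ : ξ ∈ D) : ψ (ψ.symm (creaseMap F ζ η ξ)) = creaseMap F ζ η ξ →
          g (ψ.symm (creaseMap F ζ η ξ)) = ξ := by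
        intro h
        simp only [g]
        rw [h, transverse_creaseMap]
        exact η.right_inv (L.D_subset hξ)
      rw [hcc m2 n2, hgv _ m1 m3, hgv _ n1 n3]
      simp only [PiLp.single_apply, if_true]
      nlinarith
    · rw [m3, n3, dist_eq_norm]
      refine (B.upper _ (hDδ m1) _ (hDδ n1)).trans (le_of_eq ?_)
      congr 1
      have : (single i (1 * ρ) - single i (-1 * ρ) : Plane) =
          single i (2 * ρ) := by
        ext k
        by_cases h : k = i
        · subst h
          simp
          ring
        · simp [h]
      rw [this, PiLp.norm_single, Real.norm_eq_abs, abs_of_pos (by positivity)]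
  have hmain : ∀ q q', AreClosest ψ (𝒞 s) q q' →
      (2 * c * ρ ≤ dist (ψ q) (ψ q') ∧ dist (ψ q) (ψ q') ≤ 4 * C * ρ) ∧
      ρ ≤ ‖g q‖ ∧ ‖g q‖ ≤ 6 * C / c * ρ := by
    rintro q q' ⟨hq, hq', hn, hmin⟩
    have h1 := hmin v hv v' hv' hvv
    have h2 := hdist hq hq'
    obtain ⟨h3, h4⟩ := hsep hq hq' hn
    have h5 : |g q i| ≤ 4 * C / c * ρ := by
      rw [div_mul_eq_mul_div, le_div_iff₀ hc]
      nlinarith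
    have h6 : ‖g q‖ ^ 2 = 2 * |g q i| ^ 2 - ρ ^ 2 := by
      rw [sq_norm_eq_of_ne hij, sq_abs, (hgC q hq).2.1, hρ2]
      ring
    have h7 := hlow q hq
    refine ⟨⟨by nlinarith, by linarith⟩, le_of_sq_le_sq ?_ (norm_nonneg _),
      le_of_sq_le_sq ?_ (by positivity)⟩
    · rw [h6]
      nlinarith [pow_le_pow_left₀ hρ.le h7 2]
    · rw [h6]
      have h8 := pow_le_pow_left₀ (abs_nonneg _) h5 2
      have h9 : (6 * C / c * ρ) ^ 2 = 9 / 4 * (4 * C / c * ρ) ^ 2 := by ring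
      rw [h9]
      nlinarith [sq_nonneg (4 * C / c * ρ), sq_nonneg ρ]
  have hfac : ∀ {x y r : ℝ}, OfOrder x y ρ r → k₁ ≤ x * √(2 * a) → y * √(2 * a) ≤ k₂ →
      OfOrder k₁ k₂ (√|s|) r := by
    intro x y r h h1 h2
    rw [hρe] at h
    exact h.mul.mono (Real.sqrt_nonneg _) h1 h2
  refine ⟨?_, fun q q' h ↦ ?_, fun q q' h ↦ ?_, fun q q' h ↦ ?_⟩
  · let R : Set ℝ := {d | ∃ r ∈ 𝒞 s, ∃ r' ∈ 𝒞 s,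
      r' ∉ connectedComponentIn (𝒞 s) r ∧ d = dist (ψ r) (ψ r')}
    have hR : R.Nonempty := ⟨_, v, hv, v', hv', hvv, rfl⟩
    have hlb : ∀ d ∈ R, 2 * c * ρ ≤ d := by
      rintro d ⟨r, hr, r', hr', hn, rfl⟩
      have := hdist hr hr'
      have := (hsep hr hr' hn).1
      nlinarith
    have hbdd : BddBelow R := ⟨_, hlb⟩
    have hpos : 0 < sInf R := lt_of_lt_of_le (by positivity) (le_csInf hR hlb)
    obtain ⟨d, ⟨q, hq, q', hq', hn, rfl⟩, hd⟩ := exists_lt_of_csInf_lt hR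
      (show sInf R < 2 * sInf R by linarith)
    refine ⟨q, q', hq, hq', hn, fun r hr r' hr' hn' ↦ hd.le.trans ?_⟩
    have := csInf_le hbdd (show dist (ψ r) (ψ r') ∈ R from ⟨r, hr, r', hr', hn', rfl⟩)
    linarith
  · obtain ⟨⟨h5, h6⟩, -⟩ := hmain q q' h
    refine hfac ⟨h5, h6⟩ (h₁.trans ?_) h₂
    have : 0 ≤ c * √(2 * a) := by positivity
    linarith
  · obtain ⟨-, -, h5⟩ := hmain q q' h
    have hh := B.height _ (hDδ (hgC q h.1).1)
    rw [hψg q h.1]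
    simp only [creaseMap, pt_three', spt_two']
    refine hh.trans ?_
    calc C * ‖g q‖ ^ 2 ≤ C * (6 * C / c * ρ) ^ 2 := by gcongr
      _ = C * (6 * C / c) ^ 2 * (2 * a) * |s| := by rw [mul_pow, hρ2]; ring
      _ ≤ k₂ * |s| := by gcongr
  · obtain ⟨-, h5, h6⟩ := hmain q q' h
    obtain ⟨Ω, h7, h8⟩ := B.angle _ (hDδ (hgC q h.1).1)
    rw [(hgC q h.1).2.2] at h7
    refine ⟨Ω, h7, hfac (x := c) (y := C * (6 * C / c)) ⟨?_, ?_⟩ h₁ h₃⟩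
    · exact (mul_le_mul_of_nonneg_left h5 hc.le).trans h8.1
    · rw [mul_assoc]
      exact h8.2.trans (mul_le_mul_of_nonneg_left h6 hC.le)

/-! ### The three perestroikas -/

lemma exists_time {a r u v : ℝ} (ha : 0 < a) (hr : 0 < r) (hu : 0 < u) (hv : 0 < v) :
    ∃ t : ℝ, 0 < t ∧ t ≤ u ∧ t ≤ v ∧ 2 * a * t ≤ r ^ 2 := by
  refine ⟨min (min u v) (r ^ 2 / (2 * a)), by positivity, (min_le_left _ _).trans (min_le_left _ _),
    (min_le_left _ _).trans (min_le_right _ _), ?_⟩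
  rw [mul_comm, ← le_div_iff₀ (by positivity)]
  exact min_le_right _ _

variable {ρ τ₁ c C δ c' C' δ' : ℝ}

lemma exists_perestroika (hψ : ψ ∈ 𝒜 M)
    (hτ : MDifferentiable (𝓡 4) 𝓘(ℝ, ℝ) τ) (ha : 0 < Δ.a) (hη : IsMorseChart Δ.a Δ.S e ε₀ ε₁ η)
    (hε : (ε₀ = -1 ∧ ε₁ = -1 ∧ (-Δ.Q).PosDef) ∨ (ε₀ = 1 ∧ ε₁ = 1 ∧ Δ.Q.PosDef) ∨
      (ε₀ = 1 ∧ ε₁ = -1 ∧ Δ.Q.det < 0))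
    (hV : ∀ q ∈ V, f 0 q = 0 → ψ q 0 = Δ.F 0 (spatial (ψ q)))
    (B : CreaseBounds 𝓢 τ f ψ Δ.F Δ.ζ η c C δ) (hc : 0 < c) (hC : 0 < C) (hδ : 0 < δ)
    (B' : SheetBounds 𝓢 ψ Δ.T Δ.Z η Δ.a c' C' δ') (hc' : 0 < c') (hC' : 0 < C') (hδ' : 0 < δ')
    (hρ : 0 < ρ) (hτ₁ : 0 < τ₁)
    (hL : ∀ D ⊆ disc ρ, IsOpen D → 0 ∈ D →
      ∃ W, LocalPicture 𝓢 ψ τ f p Δ.T Δ.Z Δ.ζ Δ.S η V W D τ₁) :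
    ∃ W ⊆ V, IsOpen W ∧ p ∈ W ∧ ∃ τ₀ > 0, ∃ k₁ > 0, ∃ k₂ > 0,
      Perestroika 𝓢 Δ τ f p ψ V W τ₀ k₁ k₂ := by
  obtain ⟨r, hr, hrρ, hrδ, hrδ'⟩ : ∃ r : ℝ, 0 < r ∧ 3 * r ≤ ρ ∧ 3 * r ≤ δ ∧ 3 * r ≤ δ' := by
    refine ⟨min ρ (min δ δ') / 3, by positivity, ?_⟩
    rw [mul_div_cancel₀ _ three_ne_zero]
    exact ⟨min_le_left _ _, (min_le_right _ _).trans (min_le_left _ _),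
      (min_le_right _ _).trans (min_le_right _ _)⟩
  obtain ⟨τ₀, hτ₀, h₁, h₁', h₂⟩ := exists_time ha hr hτ₁ hδ'
  have hne : 2 * Δ.a ≠ 0 := by positivity
  have hball := hL (ball 0 r) (ball_subset_ball (by linarith)) isOpen_ball
    (mem_ball_self hr)
  have hS : ∀ {W D}, LocalPicture 𝓢 ψ τ f p Δ.T Δ.Z Δ.ζ Δ.S η V W D τ₁ → ∀ ξ ∈ D,
      2 * Δ.a * Δ.S (η.symm ξ) = ε₀ * ξ 0 ^ 2 + ε₁ * ξ 1 ^ 2 := fun L ξ hξ ↦ by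
    rw [hη.eq _ (η.map_target (L.D_subset hξ)), η.right_inv (L.D_subset hξ)]
  rcases hε with ⟨rfl, rfl, hQ⟩ | ⟨rfl, rfl, hQ⟩ | ⟨rfl, rfl, hQ⟩
  · obtain ⟨W, L⟩ := hball
    replace hS : ∀ ξ ∈ disc r, 2 * Δ.a * Δ.S (η.symm ξ) = -‖ξ‖ ^ 2 :=
      fun ξ hξ ↦ by rw [hS L ξ hξ, LocalPicture.norm_sq_plane]; ring
    refine ⟨W, L.subset, L.isOpen, L.mem, τ₀, hτ₀, c * √(2 * Δ.a), by positivity,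
      2 * Real.pi * C * √(2 * Δ.a) + C * (2 * Δ.a), by positivity, L.horizon_iff, L.blackHole_iff,
      .inl ⟨hQ, L.holeCollapse hr ha hS hτ₀ h₁ h₂, fun s hs ↦ ?_⟩⟩
    have hs' : |s| < τ₀ := by rw [abs_of_neg hs.2]; linarith [hs.1]
    refine L.ellipticScaling hV B hψ hτ hc hC (by linarith) ha (hs'.trans_le h₁) hs.2.ne
      (by nlinarith) hr (fun ξ hξ ↦ ?_) le_rfl (le_add_of_nonneg_right (by positivity))
      (le_add_of_nonneg_left (by positivity))
    rw [abs_of_neg hs.2, ← mul_right_inj' hne, hS ξ hξ]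
    constructor <;> intro h <;> linarith
  · obtain ⟨W, L⟩ := hball
    replace hS : ∀ ξ ∈ disc r, 2 * Δ.a * Δ.S (η.symm ξ) = ‖ξ‖ ^ 2 :=
      fun ξ hξ ↦ by rw [hS L ξ hξ, LocalPicture.norm_sq_plane]; ring
    obtain ⟨k₁, hk₁, m1, m2, m3⟩ : ∃ k₁ : ℝ, 0 < k₁ ∧ k₁ ≤ c * √(2 * Δ.a) ∧ k₁ ≤ Δ.a ∧
        k₁ ≤ 4 * Δ.a * Real.pi * c' ^ 2 :=
      ⟨min (c * √(2 * Δ.a)) (min Δ.a (4 * Δ.a * Real.pi * c' ^ 2)), by positivity, min_le_left _ _,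
        (min_le_right _ _).trans (min_le_left _ _), (min_le_right _ _).trans (min_le_right _ _)⟩
    obtain ⟨k₂, hk₂, n1, n2, n3, n4, n5⟩ : ∃ k₂ : ℝ, 0 < k₂ ∧ 2 * Real.pi * C * √(2 * Δ.a) ≤ k₂ ∧
        C * (2 * Δ.a) ≤ k₂ ∧ C * √(2 * Δ.a) ≤ k₂ ∧ C' * (1 + 2 * Δ.a) ≤ k₂ ∧
        4 * Δ.a * Real.pi * C' ^ 2 ≤ k₂ := by
      have p1 : 0 < 2 * Real.pi * C * √(2 * Δ.a) := by positivity
      have p2 : 0 < C * (2 * Δ.a) := by positivity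
      have p3 : 0 < C * √(2 * Δ.a) := by positivity
      have p4 : 0 < C' * (1 + 2 * Δ.a) := by positivity
      have p5 : 0 < 4 * Δ.a * Real.pi * C' ^ 2 := by positivity
      refine ⟨2 * Real.pi * C * √(2 * Δ.a) + C * (2 * Δ.a) + C * √(2 * Δ.a) + C' * (1 + 2 * Δ.a) +
        4 * Δ.a * Real.pi * C' ^ 2, ?_, ?_, ?_, ?_, ?_, ?_⟩ <;> linarith
    refine ⟨W, L.subset, L.isOpen, L.mem, τ₀, hτ₀, k₁, hk₁, k₂, hk₂, L.horizon_iff,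
      L.blackHole_iff, .inr (.inl ⟨hQ, L.saucerNucleation hr ha hS hτ₀ h₁ h₂, fun s hs ↦ ?_⟩)⟩
    have hs' : |s| = s := abs_of_pos hs.1
    have hsr : 2 * Δ.a * s < r ^ 2 := by nlinarith [hs.2]
    have hsτ : |s| < τ₁ := by rw [hs']; exact hs.2.trans_le h₁
    constructor
    · refine L.ellipticScaling hV B hψ hτ hc hC (by linarith) ha hsτ hs.1.ne' (by rwa [hs']) hr
        (fun ξ hξ ↦ ?_) m1 n1 n2
      rw [hs', ← mul_right_inj' hne, hS ξ hξ]
    · refine L.saucerScaling B B' hψ hC hc' hC' hr (by linarith) (by linarith) ha hsτ hs.1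
        (hs.2.trans_le h₁') hsr (fun ξ hξ ↦ ?_) m2 m3 n3 n4 n5
      rw [← mul_le_mul_iff_right₀ (show 0 < 2 * Δ.a by positivity), hS ξ hξ]
  · obtain ⟨W, L⟩ := hL (rectangle r) (rectangle_subset_ball hr hrρ) (isOpen_rectangle r)
      (zero_mem_rectangle hr)
    replace hS : ∀ ξ ∈ rectangle r, 2 * Δ.a * Δ.S (η.symm ξ) = ξ 0 ^ 2 - ξ 1 ^ 2 :=
      fun ξ hξ ↦ by rw [hS L ξ hξ]; ring
    have hD : ∀ ξ ∈ rectangle r, ∀ ξ' : Plane, (∀ k, |ξ' k| ≤ |ξ k|) → ξ' ∈ rectangle r :=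
      fun ξ hξ ξ' h ↦ ⟨(h 0).trans_lt hξ.1, (h 1).trans_lt hξ.2⟩
    obtain ⟨k₂, hk₂, n1, n2, n3⟩ : ∃ k₂ : ℝ, 0 < k₂ ∧ 4 * C * √(2 * Δ.a) ≤ k₂ ∧
        C * (6 * C / c) * √(2 * Δ.a) ≤ k₂ ∧ C * (6 * C / c) ^ 2 * (2 * Δ.a) ≤ k₂ := by
      have p1 : 0 < 4 * C * √(2 * Δ.a) := by positivity
      have p2 : 0 < C * (6 * C / c) * √(2 * Δ.a) := by positivity
      have p3 : 0 < C * (6 * C / c) ^ 2 * (2 * Δ.a) := by positivity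
      refine ⟨4 * C * √(2 * Δ.a) + C * (6 * C / c) * √(2 * Δ.a) +
        C * (6 * C / c) ^ 2 * (2 * Δ.a), ?_, ?_, ?_, ?_⟩ <;> linarith
    refine ⟨W, L.subset, L.isOpen, L.mem, τ₀, hτ₀, c * √(2 * Δ.a), by positivity, k₂, hk₂,
      L.horizon_iff, L.blackHole_iff,
      .inr (.inr ⟨hQ, L.bridgeMerger hr ha hS hτ₀ h₁ h₂, fun s hs hs0 ↦ ?_⟩)⟩
    have hs' : |s| < τ₀ := abs_lt.2 ⟨hs.1, hs.2⟩
    have hvert (i : Fin 2) : single i √(2 * Δ.a * |s|) ∈ rectangle r := by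
      have h3 : |√(2 * Δ.a * |s|)| < r := by
        rw [abs_of_nonneg (Real.sqrt_nonneg _), Real.sqrt_lt' hr]
        nlinarith
      fin_cases i
      · exact ⟨by simpa using h3.trans (by linarith), by simpa using hr⟩
      · exact ⟨by simpa using hr, by simpa using h3⟩
    rcases lt_or_gt_of_ne hs0 with h | h
    · refine L.hyperbolicScaling (i := 1) (j := 0) hV B hc hC ha (rectangle_subset_ball hr hrδ) hD
        (hs'.trans_le h₁) hs0 (by decide) (fun ξ hξ ↦ ?_) (hvert 1) le_rfl n1 n2 n3
      rw [abs_of_neg h, ← mul_right_inj' hne, hS ξ hξ]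
      constructor <;> intro h <;> linarith
    · refine L.hyperbolicScaling (i := 0) (j := 1) hV B hc hC ha (rectangle_subset_ball hr hrδ) hD
        (hs'.trans_le h₁) hs0 (by decide) (fun ξ hξ ↦ ?_) (hvert 0) le_rfl n1 n2 n3
      rw [abs_of_pos h, ← mul_right_inj' hne, hS ξ hξ]
      constructor <;> intro h <;> linarith

lemma LocalData.Describes.Q_isSymm (h : Δ.Describes 𝓢 τ f p ψ) : Δ.Q.IsSymm :=
  (h.b_diag.isSymm.add h.b'_symm).sub (h.K_symm.submatrix _)

lemma NormalModel.perestroika {F : Fin 2 → Space → ℝ} {T : ℝ × Space → ℝ}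
    {Z : Fin 2 → ℝ × Plane → ℝ} {ζ S : Plane → ℝ} (hψ : IsNormalChart 𝓢 p ψ)
    (hτ : IsTimeFunction 𝓢 τ)
    (hf : ∀ᶠ q in 𝓝 p, ∀ A, MDifferentiableAt (𝓡 4) 𝓘(ℝ, ℝ) (f A) q)
    (N : NormalModel (coordG 𝓢 ψ) (τ ∘ ψ.symm) (fun A ↦ f A ∘ ψ.symm) F T Z ζ S)
    (hΔ : Δ = localData (τ ∘ ψ.symm) F T Z ζ S) (hdet : Δ.Q.det ≠ 0) :
    Δ.CreaseIsConic ∧ ∀ᶠ V in (𝓝 p).smallSets, V ∈ 𝓝 p →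
      ∃ W ⊆ V, IsOpen W ∧ p ∈ W ∧ ∃ τ₀ > 0, ∃ k₁ > 0, ∃ k₂ > 0,
        Perestroika 𝓢 Δ τ f p ψ V W τ₀ k₁ k₂ := by
  have hd : Δ.Describes 𝓢 τ f p ψ := hΔ ▸ N.describes hψ
  have ha := hd.a_pos
  obtain ⟨e, ε₀, ε₁, he, hε⟩ := exists_normal_form hd.Q_isSymm hdet
  have h₀ : ε₀ ^ 2 = 1 := by rcases hε with h | h | h <;> rw [h.1] <;> norm_num
  have h₁ : ε₁ ^ 2 = 1 := by rcases hε with h | h | h <;> rw [h.2.1] <;> norm_num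
  obtain ⟨η, hη⟩ := exists_isMorseChart (smoothNearZero_iff.1 hd.S_smooth) hd.S_expansion h₀ h₁ he
  refine ⟨hη.creaseIsConic he, ?_⟩
  have hτ' : MDifferentiable (𝓡 4) 𝓘(ℝ, ℝ) τ := hτ.smooth.mdifferentiable (by simp)
  obtain ⟨c, hc, C, hC, δ, hδ, B⟩ : ∃ c > 0, ∃ C > 0, ∃ δ > 0,
      CreaseBounds 𝓢 τ f ψ Δ.F Δ.ζ η c C δ := by
    subst hΔ
    exact N.exists_creaseBounds hψ hη ha h₀ h₁ hτ' hf
  obtain ⟨c', hc', C', hC', δ', hδ', B'⟩ : ∃ c > 0, ∃ C > 0, ∃ δ > 0,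
      SheetBounds 𝓢 ψ Δ.T Δ.Z η Δ.a c C δ := by
    subst hΔ
    exact N.exists_sheetBounds hψ hη rfl
  have hpic : ∀ᶠ V in (𝓝 p).smallSets, V ∈ 𝓝 p → ∃ ρ > 0, ∃ τ₁ > 0,
      ∀ D ⊆ disc ρ, IsOpen D → 0 ∈ D →
        ∃ W, LocalPicture 𝓢 ψ τ f p Δ.T Δ.Z Δ.ζ Δ.S η V W D τ₁ := by
    subst hΔ
    exact N.exists_localPicture hψ hτ hη.zero_mem hη.map_zero
  filter_upwards [hpic, (hd.sheet_iff 0).smallSets] with V hpic hV hVp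
  obtain ⟨ρ, hρ, τ₁, hτ₁, hL⟩ := hpic hVp
  have hV' : ∀ q ∈ V, f 0 q = 0 → ψ q 0 = Δ.F 0 (spatial (ψ q)) := fun q hq h ↦ (hV q hq).1 h
  exact exists_perestroika hψ.mem_atlas hτ' ha hη hε hV' B hc hC hδ B' hc' hC' hδ' hρ hτ₁ hL

end Crease

end

theorem mainTheorem7 {M : Type*} [TopologicalSpace M] [ChartedSpace Crease.E4 M]
    [IsManifold (𝓡 4) ∞ M] (𝓢 : Crease.Spacetime M) (τ : M → ℝ) (U : Set M)
    (f : Fin 2 → M → ℝ) (p : M) (hp : Crease.IsPinchPoint 𝓢 τ U f p)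
    (φ : OpenPartialHomeomorph M Crease.E4) (hφ : Crease.IsAdaptedNormalChart 𝓢 τ p φ) :
    ∃ (ψ : OpenPartialHomeomorph M Crease.E4) (D : Crease.LocalData),
      Crease.IsSpatialRotation φ ψ ∧ Crease.IsAdaptedNormalChart 𝓢 τ p ψ ∧
      D.Describes 𝓢 τ f p ψ ∧
      (D.Q.det ≠ 0 →
        D.CreaseIsConic ∧
        ∀ᶠ V in (𝓝 p).smallSets, V ∈ 𝓝 p →
          ∃ W ⊆ V, IsOpen W ∧ p ∈ W ∧ ∃ τ₀ > 0, ∃ k₁ > 0, ∃ k₂ > 0,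
            Crease.Perestroika 𝓢 D τ f p ψ V W τ₀ k₁ k₂) := by
  obtain ⟨ψ, hφψ, hψ, F, hF⟩ := hp.exists_normalized_chart hφ
  obtain ⟨T, Z, ζ, S, N⟩ := (hp.pinchModel hψ).exists_normalModel hF
  refine ⟨ψ, Crease.localData (τ ∘ ψ.symm) F T Z ζ S, hφψ, hψ, N.describes hψ.toIsNormalChart,
    N.perestroika hψ.toIsNormalChart hp.time ?_ rfl⟩
  filter_upwards [hp.isOpen.mem_nhds hp.mem] with q hq A
  exact ((hp.sheet A).smooth.contMDiffAt (hp.isOpen.mem_nhds hq)).mdifferentiableAt (by simp)
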